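/- **Setting.** Let $M$ be an open subset of $\mathbb R^\infty$ with coordinates $\mathbf v=(v_0,v_{-1},v_{-2},\dots;\hat v_0,\hat v_1,\hat v_2,\dots)$, let $C^\infty(M)$ be the algebra of smooth complex-valued functions on $M$ (locally, $C^\infty$ functions of finitely many coordinates), and let $\rho\in C^\infty(M)$ satisfy $\rho^2=\hat v_0$. Let $\mathcal A=C^\infty(M)[[\mathbf v^{(s)}\mid s\ge 1]]$, graded by $\deg \mathbf v^{(s)}=s$, so that $\mathcal A=\prod_{i\ge0}\mathcal A_i$, with the derivation $D=\sum_{s\ge0}\mathbf v^{(s+1)}\cdot\partial/\partial\mathbf v^{(s)}$, where $\mathbf v^{(0)}=\mathbf v$. Let $\mathcal D^-$ be the space of sums $\sum_{i\le N}f_iD^i$ ($N\in\mathbb Z$, $f_i\in\mathcal A$), and let $\mathcal D^+$ be the space of sums $\sum_{i\in\mathbb Z}f_iD^i$ for which there is $d\in\mathbb Z$ with $f_i\in\prod_{j\ge \max(0,d-i)}\mathcal A_j$ for all $i$. Both are algebras under $fD^i\cdot gD^j=\sum_{r\ge0}\binom ir fD^r(g)D^{i+j-r}$. For $A=\sum f_iD^i$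 put $A_+=\sum_{i\ge0}f_iD^i$, $A_-=\sum_{i<0}f_iD^i$, $\operatorname{res}A=f_{-1}$, $A^*=\sum(-D)^if_i$, and $\mathcal D^\pm_\nu=\{A\in\mathcal D^\pm\mid A^*=(-1)^\nu A\}$ for $\nu=0,1$. Let $\mathcal F=\mathcal A/(D(\mathcal A)\oplus\mathbb C)$ be the space of local functionals, let $\int f\,dx$ be the class of $f$, and put $\langle (X,\hat X),(Y,\hat Y)\rangle=\int(\operatorname{res}XY+\operatorname{res}\hat X\hat Y)\,dx$. The coset $(D,0)+\mathcal U$, with $\mathcal U=(\mathcal D^-_1)_-\times\big((\mathcal D^+_1)_+ +\{r D^{-1}r\mid r\in\mathcal A\}\big)$, has at a point $\mathbf A=(A,\hat A)$ with $\hat A_-=rD^{-1}r$ the tangent space $$T_{\mathbf A}\mathcal U=(\mathcal D^-_1)_-\times\big((\mathcal D^+_1)_+ +\{rD^{-1}f+fD^{-1}r\mid f\in\mathcal A\}\big)$$ and the cotangent space $T^*_{\mathbf A}\mathcal U=(\mathcal D^-_0)_+\times\big((\mathcal D^+_0)_-+\mathcal A\big)$. The generic point of the coset is the point $$A=D+\sum_{i\ge0}(v_{-i}D^{-2i-1}+f_{-i}D^{-2i-2}),\qquad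 \hat A=\rho D^{-1}\rho+\sum_{i\ge1}(\hat v_iD^{2i-1}+\hat f_iD^{2i-2}),$$ where $f_{-i},\hat f_i\in\mathcal A$ are determined by $(A^*,\hat A^*)=-(A,\hat A)$. The variational gradient of $F=\int f\,dx$ is $\delta F/\delta\mathbf A=(X,\hat X)$ with $$X=\tfrac12\sum_{i\ge0}\Big(\frac{\delta F}{\delta v_{-i}}D^{2i}+D^{2i}\frac{\delta F}{\delta v_{-i}}\Big),\qquad \hat X=\tfrac12\sum_{i\ge0}\Big(\frac{\delta F}{\delta \hat v_{i}}D^{-2i}+D^{-2i}\frac{\delta F}{\delta \hat v_{i}}\Big),\qquad \frac{\delta F}{\delta v}=\sum_{s\ge0}(-D)^s\frac{\partial f}{\partial v^{(s)}},$$ and $\mathcal F_0$ is the space of the $F\in\mathcal F$ with $\delta F/\delta\mathbf A\in\mathcal D^-\times\mathcal D^+$. A *Poisson tensor* on the coset is a field of linear maps $\mathcal P_{\mathbf A}:T^*_{\mathbf A}\mathcal U\to T_{\mathbf A}\mathcal U$ that is skew-symmetric, $\langle \mathbf X,\mathcal P_{\mathbf A}\mathbf Y\rangle=-\langle\mathbf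 Y,\mathcal P_{\mathbf A}\mathbf X\rangle$, and for which $\{F,G\}=\big\langle\delta F/\delta\mathbf A,\mathcal P_{\mathbf A}(\delta G/\delta\mathbf A)\big\rangle$, taken at the generic point, is a well-defined Lie bracket on $\mathcal F_0$. Two Poisson tensors are *compatible* if all their linear combinations with coefficients in $\mathbb C$ are Poisson tensors. **Lemma.** The generic point exists and is unique. For $\mathbf A=(A,\hat A)\in(D,0)+\mathcal U$ and $(X,\hat X)\in T^*_{\mathbf A}\mathcal U$ put $$\begin{aligned}\mathcal P_1(X,\hat X)=\big(&A(XD^{-1})_-+D^{-1}(XA)_--(D^{-1}X)_-A-(AX)_-D^{-1}\\&-A(D\hat X)_--D^{-1}(\hat A\hat X)_-+(\hat XD)_-A+(\hat X\hat A)_-D^{-1},\\&\hat A(\hat XD)_++D(\hat X\hat A)_+-(D\hat X)_+\hat A-(\hat A\hat X)_+D\\&-\hat A(D^{-1}X)_+-D(AX)_++(XD^{-1})_+\hat A+(XA)_+D\big),\\ \mathcal P_2(X,\hat X)=\big(&A(XA)_--(AX)_-A-A(\hat A\hat X)_-+(\hat X\hat A)_-A,\\&\hat A(\hat X\hat A)_+-(\hat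 A\hat X)_+\hat A-\hat A(AX)_++(XA)_+\hat A\big).\end{aligned}$$ Then $\mathcal P_1$ and $\mathcal P_2$ are Poisson tensors on $(D,0)+\mathcal U$, and they are compatible. Moreover, for every $s\in\mathbb C$ the shift $(A,\hat A)\mapsto(A+sD^{-1},\hat A+sD)$ maps the coset to itself, and $\mathcal P_2$ at the shifted point equals $\mathcal P_2+s\,\mathcal P_1$ at $(A,\hat A)$; there is no $s^2$ term. -/

import Mathlib

open scoped ContDiff Topology

namespace BKP

/-! ### Smooth functions on the coordinate manifold -/

/-- Labels of the coordinates: `Sum.inl i` labels `v_{-i}` and `Sum.inr i` labels `v̂_i`,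
for `i = 0, 1, 2, …`. -/
abbrev Coord := ℕ ⊕ ℕ

/-- An infinite-dimensional manifold with coordinates `(v_{-i}, v̂_i)`, i.e. an open subset of
the space `ℝ^∞` of all values of the coordinates (product topology). -/
abbrev CoordManifold := TopologicalSpace.Opens (Coord → ℝ)

/-- Smoothness of a complex function on an open subset of `ℝ^∞`: locally, it is a `C^∞` function
of finitely many coordinates. -/
def IsSmooth {M : CoordManifold} (f : M → ℂ) : Prop :=
  ∀ x : M, ∃ (S : Finset Coord) (φ : (S → ℝ) → ℂ),
    ContDiff ℝ ∞ φ ∧ ∀ᶠ y : M in 𝓝 x, f y = φ (S.restrict y.1)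

theorem IsSmooth.map₂ {M : CoordManifold} {f g : M → ℂ} (hf : IsSmooth f) (hg : IsSmooth g)
    (F : ℂ × ℂ → ℂ) (hF : ContDiff ℝ ∞ F) : IsSmooth (fun x => F (f x, g x)) := by
  intro x
  obtain ⟨S, φ, hφ, h⟩ := hf x
  obtain ⟨T, ψ, hψ, k⟩ := hg x
  refine ⟨S ∪ T, fun z => F (φ (fun i => z ⟨i.1, Finset.mem_union_left T i.2⟩),
    ψ (fun i => z ⟨i.1, Finset.mem_union_right S i.2⟩)), ?_, ?_⟩
  · refine hF.comp (ContDiff.prodMk (hφ.comp ?_) (hψ.comp ?_)) <;>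
      exact contDiff_pi.2 fun i => contDiff_apply ℝ ℝ _
  · filter_upwards [h, k] with y hy ky
    rw [hy, ky]
    rfl

theorem isSmooth_const {M : CoordManifold} (c : ℂ) : IsSmooth (fun _ : M => c) :=
  fun _ => ⟨∅, fun _ => c, contDiff_const, Filter.Eventually.of_forall fun _ => rfl⟩

theorem isSmooth_coord {M : CoordManifold} (k : Coord) :
    IsSmooth (fun x : M => (x.1 k : ℂ)) :=
  fun _ => ⟨{k}, fun z => (z ⟨k, Finset.mem_singleton_self k⟩ : ℂ),
    Complex.ofRealCLM.contDiff.comp (contDiff_apply ℝ ℝ _),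
    Filter.Eventually.of_forall fun _ => rfl⟩

/-- The algebra `C^∞(M)` of smooth complex-valued functions on `M`. -/
def Smooth (M : CoordManifold) : Subalgebra ℂ (M → ℂ) where
  carrier := {f | IsSmooth f}
  mul_mem' hf hg := hf.map₂ hg (fun z => z.1 * z.2) (contDiff_fst.mul contDiff_snd)
  add_mem' hf hg := hf.map₂ hg (fun z => z.1 + z.2) (contDiff_fst.add contDiff_snd)
  algebraMap_mem' c := isSmooth_const c

/-- The coordinate functions, as elements of `C^∞(M)`. -/
def coord {M : CoordManifold} (k : Coord) : Smooth M :=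
  ⟨fun x => (x.1 k : ℂ), isSmooth_coord k⟩

/-- The restriction of `f` to the line through `x` in the `k`-th coordinate direction
(with the value `0` outside of `M`, which does not matter near `x`). -/
noncomputable def line {M : CoordManifold} (f : M → ℂ) (k : Coord) (x : M) (t : ℝ) : ℂ :=
  Function.extend Subtype.val f 0 (Function.update x.1 k t)

theorem hasDerivAt_line {M : CoordManifold} {f : M → ℂ} (k : Coord) (x : M)
    {S : Finset Coord} {φ : (S → ℝ) → ℂ} (hφ : ContDiff ℝ ∞ φ)
    (h : ∀ᶠ y : M in 𝓝 x, f y = φ (S.restrict y.1)) :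
    HasDerivAt (line f k x)
      (fderiv ℝ φ (S.restrict x.1) (S.restrict (π := fun _ => ℝ) (Pi.single k 1))) (x.1 k) := by
  have hline : ∀ t : ℝ, S.restrict (Function.update x.1 k t) =
      S.restrict x.1 + (t - x.1 k) • S.restrict (π := fun _ => ℝ) (Pi.single k 1) := by
    intro t
    ext ⟨j, hj⟩
    by_cases hjk : j = k
    · subst hjk; simp
    · simp [hjk]
  have hd : HasDerivAt (fun t : ℝ => φ (S.restrict (Function.update x.1 k t)))
      (fderiv ℝ φ (S.restrict x.1) (S.restrict (π := fun _ => ℝ) (Pi.single k 1))) (x.1 k) := by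
    simp only [hline]
    have h1 : HasDerivAt (fun t : ℝ => S.restrict x.1 +
        (t - x.1 k) • S.restrict (π := fun _ => ℝ) (Pi.single k 1))
        (S.restrict (π := fun _ => ℝ) (Pi.single k 1)) (x.1 k) := by
      have := (((hasDerivAt_id (x.1 k)).sub_const (x.1 k)).smul_const
        (S.restrict (π := fun _ => ℝ) (Pi.single k 1))).const_add (S.restrict x.1)
      simpa using this
    refine HasFDerivAt.comp_hasDerivAt (x.1 k) (l := φ) ?_ h1
    have : S.restrict x.1 + (x.1 k - x.1 k) • S.restrict (π := fun _ => ℝ) (Pi.single k 1)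
        = S.restrict x.1 := by simp
    rw [this]
    exact (hφ.differentiable (by simp) _).hasFDerivAt
  refine hd.congr_of_eventuallyEq ?_
  have hcont : Filter.Tendsto (fun t : ℝ => Function.update x.1 k t) (𝓝 (x.1 k)) (𝓝 x.1) := by
    have : Continuous (fun t : ℝ => Function.update x.1 k t) :=
      continuous_const.update k continuous_id
    simpa using this.tendsto (x.1 k)
  rw [nhds_subtype_eq_comap, Filter.eventually_comap] at h
  filter_upwards [hcont.eventually h, hcont.eventually (M.isOpen.mem_nhds x.2)] with t ht hM
  have := ht ⟨_, hM⟩ rfl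
  rw [← this]
  exact Subtype.val_injective.extend_apply f 0 ⟨_, hM⟩

/-- The partial derivative `∂/∂v_k` on `C^∞(M)`. -/
noncomputable def pd {M : CoordManifold} (k : Coord) : Smooth M →ₗ[ℂ] Smooth M where
  toFun f := ⟨fun x => deriv (line f.1 k x) (x.1 k), by
    intro x
    obtain ⟨S, φ, hφ, h⟩ := f.2 x
    refine ⟨S, fun z => fderiv ℝ φ z (S.restrict (π := fun _ => ℝ) (Pi.single k 1)),
      (hφ.fderiv_right (m := ∞) (by simp)).clm_apply contDiff_const, ?_⟩
    filter_upwards [h.eventually_nhds] with y hy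
    exact (hasDerivAt_line k y hφ hy).deriv⟩
  map_add' f g := by
    ext x
    obtain ⟨S, φ, hφ, h⟩ := f.2 x
    obtain ⟨T, ψ, hψ, h'⟩ := g.2 x
    have hadd : line (f + g).1 k x = line f.1 k x + line g.1 k x := by
      funext t
      simp only [line, Pi.add_apply]
      by_cases ht : ∃ a : M, a.1 = Function.update x.1 k t
      · obtain ⟨a, ha⟩ := ht
        rw [← ha]
        simp only [Subtype.val_injective.extend_apply]
        rfl
      · simp [Function.extend_apply' _ _ _ ht]
    change deriv (line (f + g).1 k x) (x.1 k) =
      deriv (line f.1 k x) (x.1 k) + deriv (line g.1 k x) (x.1 k)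
    rw [hadd]
    exact ((hasDerivAt_line k x hφ h).differentiableAt.hasDerivAt.add
      (hasDerivAt_line k x hψ h').differentiableAt.hasDerivAt).deriv
  map_smul' c f := by
    ext x
    obtain ⟨S, φ, hφ, h⟩ := f.2 x
    have hsmul : line (c • f).1 k x = fun t => c * line f.1 k x t := by
      funext t
      simp only [line]
      by_cases ht : ∃ a : M, a.1 = Function.update x.1 k t
      · obtain ⟨a, ha⟩ := ht
        rw [← ha]
        simp only [Subtype.val_injective.extend_apply]
        rfl
      · simp [Function.extend_apply' _ _ _ ht]
    change deriv (line (c • f).1 k x) (x.1 k) = c * deriv (line f.1 k x) (x.1 k)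
    rw [hsmul]
    exact ((hasDerivAt_line k x hφ h).differentiableAt.hasDerivAt.const_mul c).deriv

/-! ### Differential polynomials and local functionals -/

/-- The algebra `𝒜 = C^∞(M)[[v_k^{(s)} | s ≥ 1]]` of differential polynomials on `M`.
The power series variable `(k, s)` is the jet variable `v_k^{(s+1)}`. -/
abbrev DiffPoly (M : CoordManifold) := MvPowerSeries (Coord × ℕ) (Smooth M)

/-- The degree of a monomial in the jet variables, where `deg v_k^{(s)} = s`. Elements of `𝒜_i`
are the series all of whose monomials have degree `i`. -/
noncomputable def deg (m : Coord × ℕ →₀ ℕ) : ℕ := m.sum fun p e => e * (p.2 + 1)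

/-- Build an element of `𝒜` from its coefficients, linearly. -/
def ofCoeff {M : CoordManifold} {V : Type*} [AddCommGroup V] [Module ℂ V]
    (L : (Coord × ℕ →₀ ℕ) → V →ₗ[ℂ] Smooth M) : V →ₗ[ℂ] DiffPoly M :=
  LinearMap.pi L

/-- The coefficient of a monomial in the jet variables, as a `ℂ`-linear map. -/
noncomputable def coeffL {M : CoordManifold} (m : Coord × ℕ →₀ ℕ) :
    DiffPoly M →ₗ[ℂ] Smooth M :=
  (MvPowerSeries.coeff m).restrictScalars ℂ

/-- The jet variables `v_k^{(s)}`, `s ≥ 0`, as elements of `𝒜`. -/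
noncomputable def jet {M : CoordManifold} (k : Coord) : ℕ → DiffPoly M
  | 0 => MvPowerSeries.C (coord k)
  | s + 1 => MvPowerSeries.X (k, s)

/-- The partial derivatives `∂/∂v_k^{(s)}`, `s ≥ 0`, of `𝒜`. -/
noncomputable def jetDeriv {M : CoordManifold} (k : Coord) : ℕ → DiffPoly M →ₗ[ℂ] DiffPoly M
  | 0 => ofCoeff fun m => pd k ∘ₗ coeffL m
  | s + 1 => ofCoeff fun m => (m (k, s) + 1) • coeffL (m + Finsupp.single (k, s) 1)

/-- The derivation `D = ∑_{k, s ≥ 0} v_k^{(s+1)} ∂/∂v_k^{(s)}` of `𝒜`. Only those summands whose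
factor `v_k^{(s+1)}` divides a monomial `m` contribute to the coefficient of `m`. -/
noncomputable def D {M : CoordManifold} : DiffPoly M →ₗ[ℂ] DiffPoly M :=
  ofCoeff fun m => ∑ p ∈ m.support,
    coeffL m ∘ₗ LinearMap.mulLeft ℂ (jet p.1 (p.2 + 1)) ∘ₗ jetDeriv p.1 p.2

/-- The variational derivative `δf/δv_k = ∑_{s ≥ 0} (-D)^s (∂f/∂v_k^{(s)})`. As `D` raises the
degree by one, only `s ≤ deg m` contributes to the coefficient of a monomial `m`. -/
noncomputable def varDeriv {M : CoordManifold} (k : Coord) : DiffPoly M →ₗ[ℂ] DiffPoly M :=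
  ofCoeff fun m => ∑ s ∈ Finset.range (deg m + 1), coeffL m ∘ₗ ((-D) ^ s) ∘ₗ jetDeriv k s

/-- The subspace `D(𝒜) ⊕ ℂ` of `𝒜`. -/
noncomputable def trivialDensities (M : CoordManifold) : Submodule ℂ (DiffPoly M) :=
  LinearMap.range D ⊔ Submodule.span ℂ {1}

/-- The space `ℱ = 𝒜 / (D(𝒜) ⊕ ℂ)` of local functionals. -/
abbrev LocalFunctional (M : CoordManifold) := DiffPoly M ⧸ trivialDensities M

/-- The local functional `∫ f dx` with density `f`. -/
noncomputable def integral {M : CoordManifold} : DiffPoly M →ₗ[ℂ] LocalFunctional M :=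
  (trivialDensities M).mkQ

/-! ### Pseudo-differential operators -/

/-- The space `𝒟` of all formal sums `∑_{i ∈ ℤ} a_i D^i` with `a_i ∈ 𝒜`, given by the
coefficients `a_i`. -/
abbrev Op (M : CoordManifold) := ℤ → DiffPoly M

/-- Pseudo-differential operators of the first type: `𝒟⁻`, sums `∑_{i ≤ N} a_i D^i`. -/
def Dminus (M : CoordManifold) : Submodule ℂ (Op M) where
  carrier := {a | ∃ N : ℤ, ∀ i, N < i → a i = 0}
  zero_mem' := ⟨0, fun _ _ => rfl⟩
  add_mem' := by
    rintro a b ⟨N, hN⟩ ⟨N', hN'⟩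
    refine ⟨max N N', fun i hi => ?_⟩
    simp [hN i (lt_of_le_of_lt (le_max_left _ _) hi), hN' i (lt_of_le_of_lt (le_max_right _ _) hi)]
  smul_mem' := by
    rintro c a ⟨N, hN⟩
    exact ⟨N, fun i hi => by simp [hN i hi]⟩

/-- Pseudo-differential operators of the second type: `𝒟⁺`, the union over `d ∈ ℤ` of the spaces
of sums `∑_{i ∈ ℤ} a_i D^i` such that all the monomials of each `a_i` have degree at
least `d - i`. -/
def Dplus (M : CoordManifold) : Submodule ℂ (Op M) where
  carrier := {a | ∃ d : ℤ, ∀ i m, (deg m : ℤ) < d - i → coeffL m (a i) = 0}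
  zero_mem' := ⟨0, fun _ _ _ => by simp⟩
  add_mem' := by
    rintro a b ⟨d, hd⟩ ⟨d', hd'⟩
    refine ⟨min d d', fun i m hm => ?_⟩
    simp [hd i m (by omega), hd' i m (by omega)]
  smul_mem' := by
    rintro c a ⟨d, hd⟩
    exact ⟨d, fun i m hm => by simp [hd i m hm]⟩

/-- The product of pseudo-differential operators,
`(∑ a_i D^i) (∑ b_j D^j) = ∑_{i, j} ∑_{r ≥ 0} binom(i, r) a_i D^r(b_j) D^{i + j - r}`.
If both factors are in `𝒟⁻`, or both are in `𝒟⁺`, then for every `n` and every monomial `m` only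
finitely many summands contribute to the coefficient of `m` in the coefficient of `D^n`. -/
noncomputable def mul {M : CoordManifold} (a b : Op M) : Op M := fun n m =>
  ∑ᶠ p : ℤ × ℕ, coeffL m (Ring.choose p.1 p.2 • (a p.1 * (D ^ p.2) (b (n - p.1 + p.2))))

infixl:70 " ⋆ " => mul

/-- The operator `D^j`. -/
noncomputable def Dpow {M : CoordManifold} (j : ℤ) : Op M := Pi.single j 1

/-- The operator of multiplication by `f`. -/
noncomputable def ofFun {M : CoordManifold} (f : DiffPoly M) : Op M := Pi.single 0 f

/-- The positive part `a_+ = ∑_{i ≥ 0} a_i D^i`. -/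
def pos {M : CoordManifold} (a : Op M) : Op M := fun i => if 0 ≤ i then a i else 0

/-- The negative part `a_- = ∑_{i < 0} a_i D^i`. -/
def neg {M : CoordManifold} (a : Op M) : Op M := fun i => if i < 0 then a i else 0

/-- The residue of an operator. -/
def res {M : CoordManifold} (a : Op M) : DiffPoly M := a (-1)

/-- The adjoint operator
`a^* = ∑_i (-D)^i a_i = ∑_n (∑_{r ≥ 0} (-1)^{n+r} binom(n+r, r) D^r(a_{n+r})) D^n`. As `D` raises
the degree by one, only `r ≤ deg m` contributes to the coefficient of a monomial `m`. -/
noncomputable def adj {M : CoordManifold} : Op M →ₗ[ℂ] Op M :=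
  LinearMap.pi fun n => ofCoeff fun m => ∑ r ∈ Finset.range (deg m + 1),
    ((n + r).negOnePow * Ring.choose (n + r) r : ℤ) •
      (coeffL m ∘ₗ (D ^ r) ∘ₗ LinearMap.proj (n + r))

/-- `𝒟_0`: the operators with `a^* = a`. -/
noncomputable def symmOps (M : CoordManifold) : Submodule ℂ (Op M) := LinearMap.ker (adj - 1)

/-- `𝒟_1`: the operators with `a^* = -a`. -/
noncomputable def skewOps (M : CoordManifold) : Submodule ℂ (Op M) := LinearMap.ker (adj + 1)

/-- The pairing `⟨(X, X̂), (Y, Ŷ)⟩ = ∫ res (X Y) dx + ∫ res (X̂ Ŷ) dx` on pairs of operators. -/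
noncomputable def pairing {M : CoordManifold} (X Y : Op M × Op M) : LocalFunctional M :=
  integral (res (X.1 ⋆ Y.1)) + integral (res (X.2 ⋆ Y.2))

/-! ### The coset and its tangent and cotangent spaces -/

/-- `(A, Â)` is a point of the coset `(D, 0) + 𝒰`, where
`𝒰 = (𝒟⁻_1)_- × ((𝒟⁺_1)_+ + {ρ D⁻¹ ρ | ρ ∈ 𝒜})`, with the given value of `ρ`. -/
def IsCosetPoint {M : CoordManifold} (ρ : DiffPoly M) (A : Op M × Op M) : Prop :=
  (A.1 - Dpow 1 ∈ Dminus M ⊓ skewOps M ∧ pos (A.1 - Dpow 1) = 0) ∧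
  (A.2 - ofFun ρ ⋆ Dpow (-1) ⋆ ofFun ρ ∈ Dplus M ⊓ skewOps M ∧
    neg (A.2 - ofFun ρ ⋆ Dpow (-1) ⋆ ofFun ρ) = 0)

/-- The tangent space `(𝒟⁻_1)_- × ((𝒟⁺_1)_+ + {ρ D⁻¹ f + f D⁻¹ ρ | f ∈ 𝒜})` of the coset, at the
points with the given value of `ρ`. -/
def IsTangent {M : CoordManifold} (ρ : DiffPoly M) (V : Op M × Op M) : Prop :=
  (V.1 ∈ Dminus M ⊓ skewOps M ∧ pos V.1 = 0) ∧
  ∃ f : DiffPoly M,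
    V.2 - (ofFun ρ ⋆ Dpow (-1) ⋆ ofFun f + ofFun f ⋆ Dpow (-1) ⋆ ofFun ρ) ∈
      Dplus M ⊓ skewOps M ∧
    neg (V.2 - (ofFun ρ ⋆ Dpow (-1) ⋆ ofFun f + ofFun f ⋆ Dpow (-1) ⋆ ofFun ρ)) = 0

/-- The cotangent space `(𝒟⁻_0)_+ × ((𝒟⁺_0)_- + 𝒜)` of the coset (the same at all points). -/
def IsCotangent {M : CoordManifold} (X : Op M × Op M) : Prop :=
  (X.1 ∈ Dminus M ⊓ symmOps M ∧ neg X.1 = 0) ∧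
  ∃ f : DiffPoly M, X.2 - ofFun f ∈ Dplus M ⊓ symmOps M ∧ pos (X.2 - ofFun f) = 0

/-- The generic point of the coset, at which the coefficients are the coordinates:
`A = D + ∑_{i ≥ 0} (v_{-i} D^{-2i-1} + f_{-i} D^{-2i-2})` and
`Â = ρ D⁻¹ ρ + ∑_{i ≥ 1} (v̂_i D^{2i-1} + f̂_i D^{2i-2})`, with `f_{-i}` and `f̂_i` determined by
the symmetry `(A^*, Â^*) = -(A, Â)`. The coordinate `v̂_0` is `ρ²`. -/
def IsGenericPoint {M : CoordManifold} (ρ : Smooth M) (A : Op M × Op M) : Prop :=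
  IsCosetPoint (MvPowerSeries.C ρ) A ∧
  (∀ i : ℕ, A.1 (-2 * (i : ℤ) - 1) = jet (Sum.inl i) 0) ∧
  (∀ i : ℕ, 1 ≤ i → A.2 (2 * (i : ℤ) - 1) = jet (Sum.inr i) 0)

/-! ### Variational gradients and Poisson tensors -/

/-- The formal sum `∑_{i ≥ 0} (δF/δv_{-i}) D^{2i}`. -/
noncomputable def preGrad {M : CoordManifold} : DiffPoly M →ₗ[ℂ] Op M :=
  LinearMap.pi fun n => if 0 ≤ n ∧ Even n then varDeriv (Sum.inl (n.toNat / 2)) else 0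

/-- The formal sum `∑_{i ≥ 0} (δF/δv̂_i) D^{-2i}`. -/
noncomputable def preGradHat {M : CoordManifold} : DiffPoly M →ₗ[ℂ] Op M :=
  LinearMap.pi fun n => if n ≤ 0 ∧ Even n then varDeriv (Sum.inr ((-n).toNat / 2)) else 0

/-- The variational gradient `δF/δ(A, Â) = (X, X̂)` of `F = ∫ f dx`:
`X = ½ ∑_{i ≥ 0} ((δF/δv_{-i}) D^{2i} + D^{2i} (δF/δv_{-i}))`,
`X̂ = ½ ∑_{i ≥ 0} ((δF/δv̂_i) D^{-2i} + D^{-2i} (δF/δv̂_i))`,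
where the second sums are the adjoints of the first ones. -/
noncomputable def grad {M : CoordManifold} : DiffPoly M →ₗ[ℂ] Op M × Op M :=
  LinearMap.prod ((2⁻¹ : ℂ) • (preGrad (M := M) + adj ∘ₗ preGrad))
    ((2⁻¹ : ℂ) • (preGradHat (M := M) + adj ∘ₗ preGradHat))

/-- The space `ℱ_0` of the local functionals whose variational gradient lies
in `𝒟⁻ × 𝒟⁺`. -/
noncomputable def F0 (M : CoordManifold) : Submodule ℂ (LocalFunctional M) :=
  (((Dminus M).prod (Dplus M)).comap grad).map integral

/-- The bracket `{F, G} = ⟨δF/δA, P_A(δG/δA)⟩` given by `P` at the generic point is a well-defined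
Poisson (i.e. Lie) bracket on the space `ℱ_0` of local functionals. -/
def DefinesPoissonBracket {M : CoordManifold} (ρ : Smooth M)
    (P : Op M × Op M → Op M × Op M → Op M × Op M) : Prop :=
  ∀ A, IsGenericPoint ρ A → ∃ B : F0 M →ₗ[ℂ] F0 M →ₗ[ℂ] F0 M,
    (∀ (f g : DiffPoly M) (F G : F0 M), integral f = F.1 → integral g = G.1 →
      (B F G).1 = pairing (grad f) (P A (grad g))) ∧
    (∀ F, B F F = 0) ∧
    (∀ F G H, B F (B G H) + B G (B H F) + B H (B F G) = 0)

/-- `P` is a Poisson tensor on the coset: a field of linear maps from the cotangent spaces to the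
tangent spaces, skew-symmetric with respect to the pairing, whose bracket is a Poisson bracket. -/
structure IsPoissonTensor {M : CoordManifold} (ρ : Smooth M)
    (P : Op M × Op M → Op M × Op M → Op M × Op M) : Prop where
  isTangent : ∀ r A X, IsCosetPoint r A → IsCotangent X → IsTangent r (P A X)
  map_add : ∀ r A X Y, IsCosetPoint r A → IsCotangent X → IsCotangent Y →
    P A (X + Y) = P A X + P A Y
  map_smul : ∀ r A (c : ℂ) X, IsCosetPoint r A → IsCotangent X → P A (c • X) = c • P A X
  skew : ∀ r A X Y, IsCosetPoint r A → IsCotangent X → IsCotangent Y →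
    pairing X (P A Y) = -pairing Y (P A X)
  bracket : DefinesPoissonBracket ρ P

/-- Two Poisson tensors are compatible if all their linear combinations are Poisson tensors. -/
def Compatible {M : CoordManifold} (ρ : Smooth M)
    (P Q : Op M × Op M → Op M × Op M → Op M × Op M) : Prop :=
  ∀ a b : ℂ, IsPoissonTensor ρ (a • P + b • Q)

/-- The linear tensor `𝒫_1`. -/
noncomputable def P1 {M : CoordManifold} : Op M × Op M → Op M × Op M → Op M × Op M :=
  fun (A, Ah) (X, Xh) =>
    (A ⋆ neg (X ⋆ Dpow (-1)) + Dpow (-1) ⋆ neg (X ⋆ A)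
        - neg (Dpow (-1) ⋆ X) ⋆ A - neg (A ⋆ X) ⋆ Dpow (-1)
        - A ⋆ neg (Dpow 1 ⋆ Xh) - Dpow (-1) ⋆ neg (Ah ⋆ Xh)
        + neg (Xh ⋆ Dpow 1) ⋆ A + neg (Xh ⋆ Ah) ⋆ Dpow (-1),
      Ah ⋆ pos (Xh ⋆ Dpow 1) + Dpow 1 ⋆ pos (Xh ⋆ Ah)
        - pos (Dpow 1 ⋆ Xh) ⋆ Ah - pos (Ah ⋆ Xh) ⋆ Dpow 1
        - Ah ⋆ pos (Dpow (-1) ⋆ X) - Dpow 1 ⋆ pos (A ⋆ X)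
        + pos (X ⋆ Dpow (-1)) ⋆ Ah + pos (X ⋆ A) ⋆ Dpow 1)

/-- The quadratic tensor `𝒫_2`. -/
noncomputable def P2 {M : CoordManifold} : Op M × Op M → Op M × Op M → Op M × Op M :=
  fun (A, Ah) (X, Xh) =>
    (A ⋆ neg (X ⋆ A) - neg (A ⋆ X) ⋆ A - A ⋆ neg (Ah ⋆ Xh) + neg (Xh ⋆ Ah) ⋆ A,
      Ah ⋆ pos (Xh ⋆ Ah) - pos (Ah ⋆ Xh) ⋆ Ah - Ah ⋆ pos (A ⋆ X) + pos (X ⋆ A) ⋆ Ah)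

end BKP

/-!
The proof separates the calculus of pseudo-differential operators, an algebraic identity for the
quadratic tensor, and a variational argument which derives the Jacobi identity from it.

**Operators.** Both `𝒟⁻` and `𝒟⁺` lie in algebras `Reg M b` of formal series in `D`, infinite on
both sides, whose coefficients tend to zero in one of the directions. Writing an operator as its
symbol `∑ a_n ξ^n`, the product becomes `a ⋆ b = ∑_r (1 / r!) (∂_ξ ^ r a) (D ^ r b)`, the star
product of two commuting derivations, and the adjoint becomes `exp (∂_ξ D)` composed with `ξ ↦ -ξ`.
Associativity (`StarData.star_assoc`) and the anti-automorphism property of the adjoint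
(`StarData.lap_star`) are identities between exponentials of commuting operators; the trace
property of `∫ res dx` (`StarData.trace_star`) is integration by parts. A skew operator is
determined by its odd coefficients, which are arbitrary (`eq_zero_of_skew`, `exists_skew`); this
gives the generic point.

**The quadratic tensor.** For a covector `(X, X̂)` put `k = (XA - ÂX̂)_-` and `h = (XA - ÂX̂)_+`.
For skew `A`, `Â` and symmetric `X`, `X̂` one finds `P2 (X, X̂) = (A k + k^* A, h Â + Â h^*)`
(`P2_eq`), and `⟨X, P2 Y⟩ = 2 ∫ res (X A k_Y + Â X̂ h_Y) dx` (`pairing_P2`). The right side is skew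
in `X` and `Y` because `k_X` and `h_X` come from complementary projections (`omega_add_omega`) and
the trace of `XAYA` vanishes. The tensor is quadratic in the point, and it vanishes at `(D⁻¹, D)`;
so it is affine along the shifts by `s (D⁻¹, D)`, and its slope is `P1` (`P2_shift`). Hence
`x P1 + y P2` is a combination of the values of `P2` at two points of the coset, and all the claims
reduce to statements about `P2` at the shifted points (`combination_eq_shiftedPoint`).

**The Jacobi identity.** A coordinate may occur in infinitely many coefficients of the generic
point, and a functional in `ℱ_0` may depend on infinitely many coordinates. What makes derivatives
along vector fields meaningful is that every coordinate beyond finitely many enters a density only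
through terms of high degree (`depGE`, `Adm`). For gradients of functionals in `ℱ_0` this follows
from the self-adjointness of the second variation (`adj_frechet_varDeriv`), and it is inherited by
the density of the bracket, which therefore is again in `ℱ_0` (`IsGenericPoint.density_mem`). The
derivative of `F` along the evolutionary vector field of a tangent vector `V` is `⟨δF/δA, V⟩`
(`integral_evol`), and the generic point itself evolves by `V` (`IsGenericPoint.evol_fst`,
`IsGenericPoint.evol_snd`). So the cyclic sum in the Jacobi identity is obtained by differentiating
`⟨X, P2 Y⟩`; the second derivatives of the functionals cancel by their symmetry (`hessian_symm`),
and the remaining terms cancel by the identity satisfied by the two projections (`tri_kk_hh`,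
`cyclic_variation`). This applies at each of the shifted points, since the shift is constant. The
Jacobi expression is quadratic in the bracket, so the identity at three points of the affine line
of shifts gives it for all linear combinations of `P1` and `P2` (`jacobi_combination`).
-/

open Finset.HasAntidiagonal (antidiagonal mem_antidiagonal)

namespace BKP

/-! ### Sums in filtered modules -/

/-- `x` is the sum of the family `t` with respect to the filtration `W`: for every `K`, the finite
partial sums eventually agree with `x` modulo `W K`. -/
def HasFSum {ι E : Type*} [AddCommGroup E] [Module ℂ E] (W : ℤ → Submodule ℂ E)
    (t : ι → E) (x : E) : Prop :=
  ∀ K, ∀ᶠ T : Finset ι in Filter.atTop, x - ∑ j ∈ T, t j ∈ W K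

/-- The family `t` tends to zero along the cofinite filter, for the filtration `W`. -/
def TendsZero {ι E : Type*} [AddCommGroup E] [Module ℂ E] (W : ℤ → Submodule ℂ E)
    (t : ι → E) : Prop :=
  ∀ K, {j | t j ∉ W K}.Finite

section FSum

variable {ι κ E E' : Type*} [AddCommGroup E] [Module ℂ E] [AddCommGroup E'] [Module ℂ E']
  {W : ℤ → Submodule ℂ E} {W' : ℤ → Submodule ℂ E'}

theorem HasFSum.unique (hW : ∀ x, (∀ K, x ∈ W K) → x = 0) {t : ι → E} {x y : E}
    (hx : HasFSum W t x) (hy : HasFSum W t y) : x = y := by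
  refine sub_eq_zero.1 (hW _ fun K => ?_)
  obtain ⟨T, h1, h2⟩ := ((hx K).and (hy K)).exists
  have := (W K).sub_mem h1 h2
  simpa using this

theorem HasFSum.add {t u : ι → E} {x y : E} (hx : HasFSum W t x) (hy : HasFSum W u y) :
    HasFSum W (fun j => t j + u j) (x + y) := by
  intro K
  filter_upwards [hx K, hy K] with T h1 h2
  have := (W K).add_mem h1 h2
  rwa [Finset.sum_add_distrib, add_sub_add_comm]

theorem HasFSum.map {t : ι → E} {x : E} (hx : HasFSum W t x) (L : E →ₗ[ℂ] E')
    (hL : ∀ K, ∃ K', ∀ y ∈ W K', L y ∈ W' K) : HasFSum W' (fun j => L (t j)) (L x) := by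
  intro K
  obtain ⟨K', h⟩ := hL K
  filter_upwards [hx K'] with T h1
  have := h _ h1
  rwa [map_sub, map_sum] at this

theorem HasFSum.smul {t : ι → E} {x : E} (hx : HasFSum W t x) (c : ℂ) :
    HasFSum W (fun j => c • t j) (c • x) :=
  hx.map (LinearMap.lsmul ℂ E c) fun K => ⟨K, fun _ hy => (W K).smul_mem c hy⟩

theorem HasFSum.neg {t : ι → E} {x : E} (hx : HasFSum W t x) :
    HasFSum W (fun j => -t j) (-x) := by
  simpa using hx.smul (-1)

theorem HasFSum.sub {t u : ι → E} {x y : E} (hx : HasFSum W t x) (hy : HasFSum W u y) :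
    HasFSum W (fun j => t j - u j) (x - y) := by
  simpa [sub_eq_add_neg] using hx.add hy.neg

theorem hasFSum_of_subset (t : ι → E) (S : Finset ι) (h : ∀ j, j ∉ S → t j = 0) :
    HasFSum W t (∑ j ∈ S, t j) := by
  intro K
  filter_upwards [Filter.eventually_ge_atTop S] with T hT
  rw [← Finset.sum_subset hT fun j _ hj => h j hj, sub_self]
  exact (W K).zero_mem

theorem hasFSum_single (t : ι → E) (i : ι) (h : ∀ j, j ≠ i → t j = 0) :
    HasFSum W t (t i) := by
  simpa using hasFSum_of_subset (W := W) t {i} (by simpa using h)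

theorem hasFSum_zero : HasFSum W (fun _ : ι => (0 : E)) 0 := by
  simpa using hasFSum_of_subset (W := W) (fun _ : ι => (0 : E)) ∅ (by simp)

theorem hasFSum_finset_sum {t : κ → ι → E} {x : κ → E} (s : Finset κ)
    (h : ∀ k ∈ s, HasFSum W (t k) (x k)) :
    HasFSum W (fun j => ∑ k ∈ s, t k j) (∑ k ∈ s, x k) := by
  classical
  induction s using Finset.induction_on with
  | empty => simpa using hasFSum_zero
  | insert a s ha ih =>
    simp only [Finset.sum_insert ha]
    exact (h a (by simp)).add (ih fun k hk => h k (by simp [hk]))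

theorem HasFSum.comp_injective {t : ι → E} {x : E} (hx : HasFSum W t x) (e : κ → ι)
    (he : Function.Injective e) (h : ∀ j, j ∉ Set.range e → t j = 0) :
    HasFSum W (fun j => t (e j)) x := by
  classical
  intro K
  obtain ⟨S, hS⟩ := Filter.eventually_atTop.1 (hx K)
  filter_upwards [Filter.eventually_ge_atTop (S.preimage e he.injOn)] with T hT
  have key : ∑ j ∈ S ∪ T.image e, t j = ∑ j ∈ T, t (e j) := by
    rw [← Finset.sum_image (f := t) (g := e) he.injOn]
    refine (Finset.sum_subset Finset.subset_union_right fun j hj hj' => ?_).symm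
    by_cases hr : j ∈ Set.range e
    · obtain ⟨i, rfl⟩ := hr
      refine absurd ?_ hj'
      rcases Finset.mem_union.1 hj with h1 | h1
      · exact Finset.mem_image_of_mem _ (hT (Finset.mem_preimage.2 h1))
      · exact h1
    · exact h j hr
  rw [← key]
  exact hS _ Finset.subset_union_left

theorem HasFSum.equiv {t : ι → E} {x : E} (hx : HasFSum W t x) (e : κ ≃ ι) :
    HasFSum W (fun j => t (e j)) x :=
  hx.comp_injective e e.injective fun j hj => absurd (e.surjective j) hj

/-- Open submodules are closed under sums. -/
theorem HasFSum.mem {t : ι → E} {x : E} (hx : HasFSum W t x) {N : Submodule ℂ E} {K : ℤ}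
    (hN : W K ≤ N) (h : ∀ j, t j ∈ N) : x ∈ N := by
  obtain ⟨T, hT⟩ := (hx K).exists
  have := N.add_mem (hN hT) (N.sum_mem (t := T) fun j _ => h j)
  simpa using this

theorem HasFSum.tendsZero {t : ι → E} {x : E} (hx : HasFSum W t x) : TendsZero W t := by
  classical
  intro K
  obtain ⟨S, hS⟩ := Filter.eventually_atTop.1 (hx K)
  refine S.finite_toSet.subset fun j hj => ?_
  by_contra hjS
  refine hj ?_
  have h1 := hS S le_rfl
  have h2 := hS (insert j S) (Finset.subset_insert j S)
  rw [Finset.sum_insert hjS] at h2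
  have := (W K).sub_mem h1 h2
  simpa using this

/-- Sums over a product may be computed by summing over the fibres first. -/
theorem HasFSum.prod {t : ι × κ → E} {x : E} (hx : HasFSum W t x) {y : ι → E}
    (hy : ∀ i, HasFSum W (fun j => t (i, j)) (y i)) : HasFSum W y x := by
  classical
  intro K
  obtain ⟨S, hS⟩ := Filter.eventually_atTop.1 (hx K)
  filter_upwards [Filter.eventually_ge_atTop (S.image Prod.fst)] with T hT
  have h1 : ∀ᶠ F : Finset κ in Filter.atTop,
      ∀ i ∈ T, y i - ∑ j ∈ F, t (i, j) ∈ W K :=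
    (Filter.eventually_all_finset T).2 fun i _ => hy i K
  obtain ⟨F, hF, hF'⟩ := (h1.and (Filter.eventually_ge_atTop (S.image Prod.snd))).exists
  have h2 := hS (T ×ˢ F) fun p hp => Finset.mem_product.2
    ⟨hT (Finset.mem_image_of_mem _ hp), hF' (Finset.mem_image_of_mem _ hp)⟩
  have h3 := (W K).sum_mem (t := T) fun i hi => hF i hi
  rw [Finset.sum_product] at h2
  rw [Finset.sum_sub_distrib] at h3
  have := (W K).sub_mem h2 h3
  simpa using this

theorem HasFSum.prod_swap {t : ι × κ → E} {x : E} (hx : HasFSum W t x) {y : κ → E}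
    (hy : ∀ j, HasFSum W (fun i => t (i, j)) (y j)) : HasFSum W y x :=
  (hx.equiv (Equiv.prodComm κ ι)).prod hy

/-- Summation over the (finite) fibres of a map `g` first. -/
theorem HasFSum.fiber {t : ι → E} {x : E} (hx : HasFSum W t x) (g : ι → κ) (fib : κ → Finset ι)
    (h : ∀ j k, j ∈ fib k ↔ g j = k) : HasFSum W (fun k => ∑ j ∈ fib k, t j) x := by
  classical
  intro K
  obtain ⟨S, hS⟩ := Filter.eventually_atTop.1 (hx K)
  filter_upwards [Filter.eventually_ge_atTop (S.image g)] with T hT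
  have := hS (T.biUnion fib) fun p hp => by
    simp only [Finset.mem_biUnion, h, exists_eq_right']
    exact hT (Finset.mem_image_of_mem g hp)
  rwa [Finset.sum_biUnion] at this
  intro a _ b _ hab
  refine Finset.disjoint_left.2 fun p h1 h2 => hab ?_
  rw [h] at h1 h2
  exact h1.symm.trans h2

theorem HasFSum.sum_diag {t : ℕ × ℕ → E} {x : E} (hx : HasFSum W t x) :
    HasFSum W (fun n => ∑ p ∈ antidiagonal n, t p) x :=
  hx.fiber (fun p => p.1 + p.2) _ fun _ _ => mem_antidiagonal

/-- A sum over a disjoint union of two index types. -/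
theorem HasFSum.sum_type {t : ι ⊕ κ → E} {x y : E} (hx : HasFSum W (fun i => t (Sum.inl i)) x)
    (hy : HasFSum W (fun i => t (Sum.inr i)) y) : HasFSum W t (x + y) := by
  classical
  intro K
  obtain ⟨S, hS⟩ := Filter.eventually_atTop.1 (hx K)
  obtain ⟨S', hS'⟩ := Filter.eventually_atTop.1 (hy K)
  filter_upwards [Filter.eventually_ge_atTop (S.disjSum S')] with T hT
  have h1 := hS T.toLeft fun i hi => by
    simpa using hT (Finset.inl_mem_disjSum.2 hi)
  have h2 := hS' T.toRight fun i hi => by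
    simpa using hT (Finset.inr_mem_disjSum.2 hi)
  have := (W K).add_mem h1 h2
  rw [← Finset.toLeft_disjSum_toRight (u := T), Finset.sum_disjSum, add_sub_add_comm]
  exact this

theorem TendsZero.comp_injective {t : ι → E} (ht : TendsZero W t) (e : κ → ι)
    (he : Function.Injective e) : TendsZero W (fun j => t (e j)) := fun K =>
  (ht K).preimage he.injOn

theorem tendsZero_nat (hW : Antitone W) {t : ℕ → E} (h : ∀ n : ℕ, t n ∈ W n) :
    TendsZero W t := fun K =>
  (Finset.range K.toNat).finite_toSet.subset fun n hn => by
    rw [Finset.coe_range, Set.mem_Iio]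
    by_contra hlt
    exact hn (hW (by omega : K ≤ (n : ℤ)) (h n))

theorem tendsZero_nat₂ (hW : Antitone W) {t : ℕ × ℕ → E}
    (h : ∀ p : ℕ × ℕ, t p ∈ W (p.1 + p.2 : ℕ)) :
    TendsZero W t := fun K =>
  (Finset.range K.toNat ×ˢ Finset.range K.toNat).finite_toSet.subset fun p hp => by
    rw [Finset.mem_coe, Finset.mem_product, Finset.mem_range, Finset.mem_range]
    by_contra hlt
    exact hp (hW (by omega : K ≤ ((p.1 + p.2 : ℕ) : ℤ)) (h p))

theorem tendsZero_nat₃ (hW : Antitone W) {t : ℕ × (ℕ × ℕ) → E}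
    (h : ∀ p : ℕ × (ℕ × ℕ), t p ∈ W (p.1 + p.2.1 + p.2.2 : ℕ)) : TendsZero W t := fun K =>
  (Finset.range K.toNat ×ˢ (Finset.range K.toNat ×ˢ Finset.range K.toNat)).finite_toSet.subset
    fun p hp => by
      simp only [Finset.mem_coe, Finset.mem_product, Finset.mem_range]
      by_contra hlt
      exact hp (hW (by omega : K ≤ ((p.1 + p.2.1 + p.2.2 : ℕ) : ℤ)) (h p))

end FSum

/-! ### The grading of differential polynomials -/

section Degree

variable {M : CoordManifold}

theorem deg_add (m n : Coord × ℕ →₀ ℕ) : deg (m + n) = deg m + deg n :=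
  Finsupp.sum_add_index' (by simp) (by intros; ring)

theorem deg_single (p : Coord × ℕ) (e : ℕ) : deg (Finsupp.single p e) = e * (p.2 + 1) :=
  Finsupp.sum_single_index (by simp)

/-- The differential polynomials all of whose monomials have degree at least `K`. -/
def degGE (M : CoordManifold) (K : ℤ) : Submodule ℂ (DiffPoly M) where
  carrier := {f | ∀ m, (deg m : ℤ) < K → coeffL m f = 0}
  zero_mem' := fun _ _ => map_zero _
  add_mem' := fun ha hb m hm => by rw [map_add, ha m hm, hb m hm, add_zero]
  smul_mem' := fun c a ha m hm => by rw [map_smul, ha m hm, smul_zero]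

theorem degGE_antitone : Antitone (degGE M) := fun _ _ h _ hf m hm => hf m (by omega)

theorem mem_degGE_of_nonpos {K : ℤ} (hK : K ≤ 0) (f : DiffPoly M) : f ∈ degGE M K :=
  fun m hm => by omega

theorem degGE_le {K L : ℤ} (h : K ≤ L) {f : DiffPoly M} (hf : f ∈ degGE M L) : f ∈ degGE M K :=
  degGE_antitone h hf

theorem ext_coeffL {f g : DiffPoly M} (h : ∀ m, coeffL m f = coeffL m g) : f = g :=
  MvPowerSeries.ext h

theorem eq_zero_of_mem_degGE (f : DiffPoly M) (h : ∀ K, f ∈ degGE M K) : f = 0 :=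
  ext_coeffL fun m => by rw [map_zero]; exact h (deg m + 1) m (by omega)

theorem coeffL_mul [DecidableEq (Coord × ℕ)] (m : Coord × ℕ →₀ ℕ) (f g : DiffPoly M) :
    coeffL m (f * g) = ∑ p ∈ antidiagonal m, coeffL p.1 f * coeffL p.2 g :=
  MvPowerSeries.coeff_mul _ _ _

theorem mul_mem_degGE {K L : ℤ} {f g : DiffPoly M} (hf : f ∈ degGE M K) (hg : g ∈ degGE M L) :
    f * g ∈ degGE M (K + L) := by
  classical
  intro m hm
  rw [coeffL_mul]
  refine Finset.sum_eq_zero fun p hp => ?_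
  rw [mem_antidiagonal] at hp
  rw [← hp, deg_add] at hm
  push_cast at hm
  by_cases h : (deg p.1 : ℤ) < K
  · rw [hf _ h, zero_mul]
  · rw [hg _ (by omega), mul_zero]

theorem mul_mem_degGE_left {K : ℤ} {f : DiffPoly M} (hf : f ∈ degGE M K) (g : DiffPoly M) :
    f * g ∈ degGE M K := by
  simpa using mul_mem_degGE hf (mem_degGE_of_nonpos le_rfl g)

theorem mul_mem_degGE_right {K : ℤ} {g : DiffPoly M} (hg : g ∈ degGE M K) (f : DiffPoly M) :
    f * g ∈ degGE M K := by
  simpa using mul_mem_degGE (mem_degGE_of_nonpos le_rfl f) hg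

/-- The sum of a family of differential polynomials, computed coefficientwise. -/
noncomputable def fsum {ι : Type*} (t : ι → DiffPoly M) : DiffPoly M :=
  fun m => ∑ᶠ j, coeffL m (t j)

theorem coeffL_fsum {ι : Type*} (t : ι → DiffPoly M) (m : Coord × ℕ →₀ ℕ) :
    coeffL m (fsum t) = ∑ᶠ j, coeffL m (t j) := rfl

theorem hasFSum_fsum {ι : Type*} {t : ι → DiffPoly M} (ht : TendsZero (degGE M) t) :
    HasFSum (degGE M) t (fsum t) := by
  intro K
  filter_upwards [Filter.eventually_ge_atTop (ht K).toFinset] with T hT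
  intro m hm
  have hsub : Function.support (fun j => coeffL m (t j)) ⊆ T := fun j hj => hT (by
    rw [Set.Finite.mem_toFinset]
    exact fun hmem => hj (hmem m hm))
  rw [map_sub, map_sum, coeffL_fsum, finsum_eq_sum_of_support_subset _ hsub, sub_self]

theorem TendsZero.exists_hasFSum {ι : Type*} {t : ι → DiffPoly M}
    (ht : TendsZero (degGE M) t) : ∃ x, HasFSum (degGE M) t x :=
  ⟨_, hasFSum_fsum ht⟩

theorem HasFSum.eq {ι : Type*} {t : ι → DiffPoly M} {x y : DiffPoly M}
    (hx : HasFSum (degGE M) t x) (hy : HasFSum (degGE M) t y) : x = y :=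
  hx.unique eq_zero_of_mem_degGE hy

theorem HasFSum.eq_fsum {ι : Type*} {t : ι → DiffPoly M} {x : DiffPoly M}
    (hx : HasFSum (degGE M) t x) : x = fsum t :=
  hx.eq (hasFSum_fsum hx.tendsZero)

theorem HasFSum.mul_left {ι : Type*} {t : ι → DiffPoly M} {x : DiffPoly M}
    (hx : HasFSum (degGE M) t x) (g : DiffPoly M) :
    HasFSum (degGE M) (fun j => g * t j) (g * x) :=
  hx.map (LinearMap.mulLeft ℂ g) fun K => ⟨K, fun _ hy => mul_mem_degGE_right hy g⟩

theorem HasFSum.mul_right {ι : Type*} {t : ι → DiffPoly M} {x : DiffPoly M}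
    (hx : HasFSum (degGE M) t x) (g : DiffPoly M) :
    HasFSum (degGE M) (fun j => t j * g) (x * g) := by
  simpa only [mul_comm] using hx.mul_left g

end Degree

/-! ### Partial derivatives of smooth functions -/

section PartialDerivatives

variable {M : CoordManifold}

theorem pd_apply (k : Coord) (f : Smooth M) (x : M) {S : Finset Coord} {φ : (S → ℝ) → ℂ}
    (hφ : ContDiff ℝ ∞ φ) (h : ∀ᶠ y : M in 𝓝 x, f.1 y = φ (S.restrict y.1)) :
    (pd k f).1 x = fderiv ℝ φ (S.restrict x.1) (S.restrict (π := fun _ => ℝ) (Pi.single k 1)) :=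
  (hasDerivAt_line k x hφ h).deriv

theorem hasDerivAt_pd (k : Coord) (f : Smooth M) (x : M) :
    HasDerivAt (line f.1 k x) ((pd k f).1 x) (x.1 k) := by
  obtain ⟨S, φ, hφ, h⟩ := f.2 x
  rw [pd_apply k f x hφ h]
  exact hasDerivAt_line k x hφ h

theorem line_self (f : M → ℂ) (k : Coord) (x : M) : line f k x (x.1 k) = f x := by
  rw [line, Function.update_eq_self]
  exact Subtype.val_injective.extend_apply f 0 x

theorem line_mul (f g : M → ℂ) (k : Coord) (x : M) :
    line (f * g) k x = line f k x * line g k x := by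
  funext t
  simp only [line, Pi.mul_apply]
  by_cases ht : ∃ a : M, a.1 = Function.update x.1 k t
  · obtain ⟨a, ha⟩ := ht
    rw [← ha]
    simp only [Subtype.val_injective.extend_apply]
    rfl
  · simp [Function.extend_apply' _ _ _ ht]

theorem pd_mul (k : Coord) (f g : Smooth M) : pd k (f * g) = pd k f * g + f * pd k g := by
  ext x
  have h := (hasDerivAt_pd k f x).mul (hasDerivAt_pd k g x)
  rw [line_self, line_self, ← line_mul] at h
  exact (hasDerivAt_pd k (f * g) x).unique h

/-- Partial derivatives of smooth functions commute. -/
theorem pd_comm (k l : Coord) (f : Smooth M) : pd k (pd l f) = pd l (pd k f) := by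
  ext x
  obtain ⟨S, φ, hφ, h⟩ := f.2 x
  have key : ∀ i j : Coord, (pd i (pd j f)).1 x =
      fderiv ℝ (fderiv ℝ φ) (S.restrict x.1) (S.restrict (π := fun _ => ℝ) (Pi.single i 1))
        (S.restrict (π := fun _ => ℝ) (Pi.single j 1)) := by
    intro i j
    have hd : ContDiff ℝ ∞ (fderiv ℝ φ) := hφ.fderiv_right (m := ∞) (by simp)
    have h2 : ∀ᶠ y : M in 𝓝 x, (pd j f).1 y =
        (fun z => fderiv ℝ φ z (S.restrict (π := fun _ => ℝ) (Pi.single j 1)))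
          (S.restrict y.1) := by
      filter_upwards [h.eventually_nhds] with y hy
      exact pd_apply j f y hφ hy
    rw [pd_apply i (pd j f) x (hd.clm_apply contDiff_const) h2]
    have h3 := ((hd.differentiable (by simp) (S.restrict x.1)).hasFDerivAt.clm_apply
      (hasFDerivAt_const (S.restrict (π := fun _ => ℝ) (Pi.single j (1 : ℝ)))
        (S.restrict x.1))).fderiv
    rw [h3]
    simp
  have hs : IsSymmSndFDerivAt ℝ φ (S.restrict x.1) :=
    hφ.contDiffAt.isSymmSndFDerivAt (by
      simpa using (WithTop.coe_le_coe.2 le_top : ((2 : ℕ∞) : WithTop ℕ∞) ≤ ∞))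
  change (pd k (pd l f)).1 x = (pd l (pd k f)).1 x
  rw [key, key]
  exact hs _ _

theorem pd_one (k : Coord) : pd k (1 : Smooth M) = 0 := by
  have := pd_mul k (1 : Smooth M) 1
  rw [mul_one, mul_one, one_mul] at this
  simpa using this

theorem pd_coord (k l : Coord) : pd k (coord l : Smooth M) = if k = l then 1 else 0 := by
  ext x
  have h := hasDerivAt_pd k (coord l : Smooth M) x
  have key : (line (coord l : Smooth M).1 k x) =ᶠ[𝓝 (x.1 k)]
      fun t : ℝ => ((Function.update x.1 k t l : ℝ) : ℂ) := by
    have hcont : Filter.Tendsto (fun t : ℝ => Function.update x.1 k t) (𝓝 (x.1 k)) (𝓝 x.1) := by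
      have : Continuous (fun t : ℝ => Function.update x.1 k t) :=
        continuous_const.update k continuous_id
      simpa using this.tendsto (x.1 k)
    filter_upwards [hcont.eventually (M.isOpen.mem_nhds x.2)] with t hM
    exact Subtype.val_injective.extend_apply (coord l : Smooth M).1 0 ⟨_, hM⟩
  have h2 := h.congr_of_eventuallyEq key.symm
  by_cases hkl : k = l
  · subst hkl
    simp only [Function.update_self] at h2
    rw [if_pos rfl]
    exact h2.unique Complex.ofRealCLM.hasDerivAt
  · rw [if_neg hkl]
    simp only [Function.update_of_ne (Ne.symm hkl)] at h2
    exact h2.unique (hasDerivAt_const _ _)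

end PartialDerivatives

/-! ### Derivations of the algebra of differential polynomials -/

section JetCalculus

variable {M : CoordManifold}

theorem coeffL_jetDeriv_zero (k : Coord) (f : DiffPoly M) (m : Coord × ℕ →₀ ℕ) :
    coeffL m (jetDeriv k 0 f) = pd k (coeffL m f) := rfl

theorem coeffL_jetDeriv_succ (k : Coord) (s : ℕ) (f : DiffPoly M) (m : Coord × ℕ →₀ ℕ) :
    coeffL m (jetDeriv k (s + 1) f) =
      (m (k, s) + 1) • coeffL (m + Finsupp.single (k, s) 1) f := rfl

theorem coeffL_D (f : DiffPoly M) (m : Coord × ℕ →₀ ℕ) :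
    coeffL m (D f) =
      ∑ p ∈ m.support, coeffL m (MvPowerSeries.X p * jetDeriv p.1 p.2 f) := by
  change (∑ p ∈ m.support, coeffL m ∘ₗ LinearMap.mulLeft ℂ (jet p.1 (p.2 + 1)) ∘ₗ
    jetDeriv p.1 p.2 : DiffPoly M →ₗ[ℂ] Smooth M) f = _
  rw [LinearMap.sum_apply]
  rfl

theorem coeffL_add_X_mul (p : Coord × ℕ) (f : DiffPoly M) (m : Coord × ℕ →₀ ℕ) :
    coeffL (m + Finsupp.single p 1) (MvPowerSeries.X p * f) = coeffL m f := by
  rw [add_comm m, MvPowerSeries.X]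
  exact (MvPowerSeries.coeff_add_monomial_mul _ _ _ _).trans (one_mul _)

theorem coeffL_X_mul_of_notMem (p : Coord × ℕ) (f : DiffPoly M) (m : Coord × ℕ →₀ ℕ)
    (h : p ∉ m.support) : coeffL m (MvPowerSeries.X p * f) = 0 := by
  classical
  change MvPowerSeries.coeff m _ = _
  rw [MvPowerSeries.X, MvPowerSeries.coeff_monomial_mul, if_neg]
  intro hle
  refine h (Finsupp.mem_support_iff.2 ?_)
  have := hle p
  simp only [Finsupp.single_eq_same] at this
  omega

theorem exists_eq_add_single {p : Coord × ℕ} {m : Coord × ℕ →₀ ℕ} (h : p ∈ m.support) :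
    ∃ m', m = m' + Finsupp.single p 1 := by
  refine ⟨m - Finsupp.single p 1, (tsub_add_cancel_of_le ?_).symm⟩
  rw [Finsupp.single_le_iff]
  exact Nat.one_le_iff_ne_zero.2 (Finsupp.mem_support_iff.1 h)

theorem X_mul_cancel {p : Coord × ℕ} {f g : DiffPoly M}
    (h : MvPowerSeries.X p * f = MvPowerSeries.X p * g) : f = g :=
  ext_coeffL fun m => by
    have := congrArg (coeffL (m + Finsupp.single p 1)) h
    rwa [coeffL_add_X_mul, coeffL_add_X_mul] at this

theorem coeffL_D_of_subset (f : DiffPoly M) {m : Coord × ℕ →₀ ℕ} {S : Finset (Coord × ℕ)}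
    (hS : m.support ⊆ S) :
    coeffL m (D f) = ∑ p ∈ S, coeffL m (MvPowerSeries.X p * jetDeriv p.1 p.2 f) := by
  rw [coeffL_D]
  exact Finset.sum_subset hS fun p _ hp => coeffL_X_mul_of_notMem _ _ _ hp

theorem coeffL_X_mul_jetDeriv (p : Coord × ℕ) (f : DiffPoly M) (m : Coord × ℕ →₀ ℕ) :
    coeffL m (MvPowerSeries.X p * jetDeriv p.1 (p.2 + 1) f) = m p • coeffL m f := by
  by_cases h : p ∈ m.support
  · obtain ⟨m', rfl⟩ := exists_eq_add_single h
    rw [coeffL_add_X_mul, coeffL_jetDeriv_succ]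
    simp
  · rw [coeffL_X_mul_of_notMem _ _ _ h, Finsupp.notMem_support_iff.1 h, zero_smul]

theorem jetDeriv_mul (k : Coord) (s : ℕ) (f g : DiffPoly M) :
    jetDeriv k s (f * g) = jetDeriv k s f * g + f * jetDeriv k s g := by
  classical
  cases s with
  | zero =>
    refine ext_coeffL fun m => ?_
    rw [coeffL_jetDeriv_zero, map_add, coeffL_mul, coeffL_mul, coeffL_mul, map_sum,
      ← Finset.sum_add_distrib]
    exact Finset.sum_congr rfl fun p _ => pd_mul _ _ _
  | succ s =>
    refine X_mul_cancel (p := (k, s)) (ext_coeffL fun m => ?_)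
    have e : MvPowerSeries.X (k, s) * (jetDeriv k (s + 1) f * g + f * jetDeriv k (s + 1) g) =
        (MvPowerSeries.X (k, s) * jetDeriv k (s + 1) f) * g +
          f * (MvPowerSeries.X (k, s) * jetDeriv k (s + 1) g) := by ring
    rw [e, coeffL_X_mul_jetDeriv (k, s), map_add, coeffL_mul, coeffL_mul, coeffL_mul,
      ← Finset.sum_add_distrib, Finset.smul_sum]
    refine Finset.sum_congr rfl fun p hp => ?_
    rw [coeffL_X_mul_jetDeriv (k, s), coeffL_X_mul_jetDeriv (k, s), smul_mul_assoc, mul_smul_comm,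
      ← add_smul, ← mem_antidiagonal.1 hp, Finsupp.add_apply]

theorem jetDeriv_X_mul (k : Coord) (s : ℕ) (p : Coord × ℕ) (f : DiffPoly M) :
    jetDeriv k s (MvPowerSeries.X p * f) =
      (if s = p.2 + 1 ∧ k = p.1 then f else 0) + MvPowerSeries.X p * jetDeriv k s f := by
  classical
  have hX : jetDeriv k s (MvPowerSeries.X p : DiffPoly M) =
      if s = p.2 + 1 ∧ k = p.1 then 1 else 0 := by
    refine ext_coeffL fun m => ?_
    cases s with
    | zero =>
      rw [if_neg (by omega), map_zero, coeffL_jetDeriv_zero]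
      change pd k (MvPowerSeries.coeff m (MvPowerSeries.X p)) = 0
      rw [MvPowerSeries.coeff_X]
      split_ifs
      · exact pd_one k
      · exact map_zero _
    | succ s =>
      rw [coeffL_jetDeriv_succ]
      change _ • MvPowerSeries.coeff _ (MvPowerSeries.X p) = _
      rw [MvPowerSeries.coeff_X]
      by_cases hp : (k, s) = p
      · subst hp
        rw [if_pos (c := s + 1 = (k, s).2 + 1 ∧ k = (k, s).1) ⟨rfl, rfl⟩]
        change _ = MvPowerSeries.coeff m 1
        rw [MvPowerSeries.coeff_one]
        simp only [add_eq_right]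
        by_cases hm : m = 0
        · subst hm; simp
        · rw [if_neg hm, smul_zero]
      · rw [if_neg, if_neg, map_zero, smul_zero]
        · rintro ⟨h1, h2⟩
          exact hp (Prod.ext h2 (by simpa using h1))
        · intro h
          have := DFunLike.congr_fun h (k, s)
          simp [Ne.symm hp] at this
  rw [jetDeriv_mul, hX]
  split_ifs <;> simp

theorem jetDeriv_comm (k l : Coord) (s t : ℕ) (f : DiffPoly M) :
    jetDeriv k s (jetDeriv l t f) = jetDeriv l t (jetDeriv k s f) := by
  have h0 : ∀ (k l : Coord) (t : ℕ), jetDeriv k 0 (jetDeriv l (t + 1) f) =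
      jetDeriv l (t + 1) (jetDeriv k 0 f) := fun k l t => ext_coeffL fun m => by
    rw [coeffL_jetDeriv_zero, coeffL_jetDeriv_succ, coeffL_jetDeriv_succ, map_nsmul,
      coeffL_jetDeriv_zero]
  cases s with
  | zero =>
    cases t with
    | zero => exact ext_coeffL fun m => pd_comm _ _ _
    | succ t => exact h0 k l t
  | succ s =>
    cases t with
    | zero => exact (h0 l k s).symm
    | succ t =>
      refine ext_coeffL fun m => ?_
      simp only [coeffL_jetDeriv_succ, smul_smul]
      rw [add_right_comm]
      congr 1
      simp only [Finsupp.add_apply, Finsupp.single_apply]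
      by_cases h : (k, s) = (l, t)
      · rw [h]
      · rw [if_neg h, if_neg (Ne.symm h)]
        ring

theorem D_mul (f g : DiffPoly M) : D (f * g) = D f * g + f * D g := by
  classical
  refine ext_coeffL fun m => ?_
  have e : ∀ p : Coord × ℕ, MvPowerSeries.X p * jetDeriv p.1 p.2 (f * g) =
      MvPowerSeries.X p * jetDeriv p.1 p.2 f * g + f * (MvPowerSeries.X p * jetDeriv p.1 p.2 g) :=
    fun p => by rw [jetDeriv_mul]; ring
  rw [coeffL_D, map_add, coeffL_mul, coeffL_mul]
  simp only [e, map_add, coeffL_mul m]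
  rw [Finset.sum_add_distrib, Finset.sum_comm, Finset.sum_comm (s := m.support)]
  have hsub : ∀ q ∈ antidiagonal m, q.1.support ⊆ m.support ∧ q.2.support ⊆ m.support := by
    intro q hq
    rw [← mem_antidiagonal.1 hq]
    exact ⟨Finsupp.support_mono (self_le_add_right _ _),
      Finsupp.support_mono (self_le_add_left _ _)⟩
  congr 1
  · refine Finset.sum_congr rfl fun q hq => ?_
    rw [← Finset.sum_mul, coeffL_D_of_subset f (hsub q hq).1]
  · refine Finset.sum_congr rfl fun q hq => ?_
    rw [← Finset.mul_sum, coeffL_D_of_subset g (hsub q hq).2]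

theorem jetDeriv_zero_D (k : Coord) (f : DiffPoly M) :
    jetDeriv k 0 (D f) = D (jetDeriv k 0 f) := by
  refine ext_coeffL fun m => ?_
  rw [coeffL_jetDeriv_zero, coeffL_D, coeffL_D, map_sum]
  refine Finset.sum_congr rfl fun p _ => ?_
  rw [← coeffL_jetDeriv_zero, jetDeriv_X_mul, if_neg (by omega), zero_add, jetDeriv_comm]

theorem jetDeriv_succ_D (k : Coord) (s : ℕ) (f : DiffPoly M) :
    jetDeriv k (s + 1) (D f) = D (jetDeriv k (s + 1) f) + jetDeriv k s f := by
  classical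
  refine ext_coeffL fun m => ?_
  have h1 : (m + Finsupp.single (k, s) 1).support ⊆ insert (k, s) m.support := by
    refine Finsupp.support_add.trans ?_
    rw [Finset.insert_eq, Finset.union_comm]
    exact Finset.union_subset_union_left Finsupp.support_single_subset
  rw [coeffL_jetDeriv_succ, coeffL_D_of_subset f h1, map_add,
    coeffL_D_of_subset _ (Finset.subset_insert (k, s) m.support), Finset.smul_sum]
  simp only [← coeffL_jetDeriv_succ, jetDeriv_X_mul, map_add, jetDeriv_comm k _ (s + 1)]
  rw [Finset.sum_add_distrib, add_comm]
  congr 1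
  rw [Finset.sum_eq_single (k, s)]
  · simp
  · rintro ⟨l, t⟩ _ hne
    rw [if_neg, map_zero]
    rintro ⟨h1, h2⟩
    exact hne (Prod.ext h2.symm (by simp only at h1 ⊢; omega))
  · intro h
    exact absurd (Finset.mem_insert_self _ _) h

theorem jetDeriv_mem_degGE {K : ℤ} {f : DiffPoly M} (hf : f ∈ degGE M K) (k : Coord) (s : ℕ) :
    jetDeriv k s f ∈ degGE M (K - s) := by
  intro m hm
  cases s with
  | zero => rw [coeffL_jetDeriv_zero, hf m (by simpa using hm), map_zero]
  | succ s =>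
    rw [coeffL_jetDeriv_succ, hf, smul_zero]
    rw [deg_add, deg_single]
    push_cast at hm ⊢
    linarith

/-- `D` is homogeneous of degree one. -/
theorem coeffL_D_eq_zero {f : DiffPoly M} {m : Coord × ℕ →₀ ℕ}
    (h : ∀ m', deg m' + 1 = deg m → coeffL m' f = 0) : coeffL m (D f) = 0 := by
  rw [coeffL_D]
  refine Finset.sum_eq_zero fun p hp => ?_
  obtain ⟨m', rfl⟩ := exists_eq_add_single hp
  rw [coeffL_add_X_mul]
  obtain ⟨k, s⟩ := p
  cases s with
  | zero =>
    rw [coeffL_jetDeriv_zero, h, map_zero]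
    rw [deg_add, deg_single]
    ring
  | succ s =>
    rw [coeffL_jetDeriv_succ, h, smul_zero]
    simp only [deg_add, deg_single]
    ring

theorem D_mem_degGE {K : ℤ} {f : DiffPoly M} (hf : f ∈ degGE M K) : D f ∈ degGE M (K + 1) :=
  fun m hm => coeffL_D_eq_zero fun m' hm' => hf m' (by omega)

theorem D_pow_mem_degGE {K : ℤ} {f : DiffPoly M} (hf : f ∈ degGE M K) (r : ℕ) :
    (D ^ r) f ∈ degGE M (K + r) := by
  induction r with
  | zero => simpa using hf
  | succ r ih =>
    rw [pow_succ', Module.End.mul_apply]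
    have := D_mem_degGE ih
    push_cast
    rwa [← add_assoc]

theorem D_pow_mem_degGE' (f : DiffPoly M) (r : ℕ) : (D ^ r) f ∈ degGE M r := by
  simpa using D_pow_mem_degGE (mem_degGE_of_nonpos le_rfl f) r

theorem HasFSum.D_pow {ι : Type*} {t : ι → DiffPoly M} {x : DiffPoly M}
    (hx : HasFSum (degGE M) t x) (r : ℕ) :
    HasFSum (degGE M) (fun j => (D ^ r) (t j)) ((D ^ r) x) :=
  hx.map (D ^ r) fun K => ⟨K, fun _ hy => degGE_le (by omega) (D_pow_mem_degGE hy r)⟩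

theorem HasFSum.jetDeriv {ι : Type*} {t : ι → DiffPoly M} {x : DiffPoly M}
    (hx : HasFSum (degGE M) t x) (k : Coord) (s : ℕ) :
    HasFSum (degGE M) (fun j => BKP.jetDeriv k s (t j)) (BKP.jetDeriv k s x) :=
  hx.map (BKP.jetDeriv k s) fun K => ⟨K + s, fun _ hy => degGE_le (by omega)
    (jetDeriv_mem_degGE hy k s)⟩

theorem D_one : D (1 : DiffPoly M) = 0 := by
  have := D_mul (1 : DiffPoly M) 1
  rw [mul_one, mul_one, one_mul] at this
  simpa using this

/-- An element of `D(𝒜)` of degree at least `K` has a primitive of degree at least `K - 1`. -/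
theorem exists_primitive {K : ℤ} {f : DiffPoly M} (hf : f ∈ LinearMap.range (D (M := M)))
    (hK : f ∈ degGE M K) : ∃ g ∈ degGE M (K - 1), D g = f := by
  obtain ⟨h, rfl⟩ := hf
  let g : DiffPoly M := fun m => if (deg m : ℤ) < K - 1 then 0 else h m
  refine ⟨g, fun m hm => if_pos hm, ?_⟩
  refine ext_coeffL fun m => ?_
  by_cases hm : (deg m : ℤ) < K
  · rw [hK m hm]
    exact coeffL_D_eq_zero fun m' hm' => if_pos (by omega)
  · rw [← sub_eq_zero, ← map_sub, ← map_sub]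
    refine coeffL_D_eq_zero fun m' hm' => ?_
    rw [map_sub]
    change (if (deg m' : ℤ) < K - 1 then 0 else h m') - h m' = 0
    rw [if_neg (by omega), sub_self]

/-- Infinite sums of total derivatives are total derivatives. -/
theorem HasFSum.mem_range_D {ι : Type*} {t : ι → DiffPoly M} {x : DiffPoly M}
    (hx : HasFSum (degGE M) t x) (h : ∀ j, t j ∈ LinearMap.range (D (M := M))) :
    x ∈ LinearMap.range (D (M := M)) := by
  classical
  -- A primitive of every summand, of the largest possible degree.
  have hex : ∀ j, ∃ g, D g = t j ∧ ∀ K : ℤ, t j ∈ degGE M K → g ∈ degGE M (K - 1) := by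
    intro j
    by_cases h0 : t j = 0
    · exact ⟨0, by rw [map_zero, h0], fun _ _ => Submodule.zero_mem _⟩
    · have hfin : ∃ N : ℕ, t j ∉ degGE M N := by
        by_contra hcon
        push Not at hcon
        exact h0 (eq_zero_of_mem_degGE _ fun K => degGE_le (Int.self_le_toNat K) (hcon _))
      have hN := Nat.find_spec hfin
      obtain ⟨g, hg, hD⟩ := exists_primitive (K := (Nat.find hfin : ℤ) - 1) (h j) (by
        by_cases h1 : Nat.find hfin = 0
        · exact mem_degGE_of_nonpos (by omega) _
        · have := Nat.find_min hfin (m := Nat.find hfin - 1) (by omega)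
          rw [not_not] at this
          rwa [Nat.cast_sub (by omega)] at this)
      refine ⟨g, hD, fun K hK => degGE_le ?_ hg⟩
      have : K < (Nat.find hfin : ℤ) := by
        by_contra hcon
        exact hN (degGE_le (by omega) hK)
      omega
  choose g hg hgK using hex
  have hz : TendsZero (degGE M) g := fun K =>
    (hx.tendsZero (K + 1)).subset fun j hj hmem => hj (by simpa using hgK j _ hmem)
  obtain ⟨y, hy⟩ := hz.exists_hasFSum
  refine ⟨y, (hx.eq ?_).symm⟩
  simpa only [pow_one, hg] using hy.D_pow 1

end JetCalculus

/-! ### Star products on filtered commutative algebras -/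

/-- The divided power `T ^ n / n!` of an endomorphism. -/
noncomputable def dp {E : Type*} [AddCommGroup E] [Module ℂ E] (n : ℕ) (T : Module.End ℂ E) :
    Module.End ℂ E :=
  ((n.factorial : ℂ)⁻¹) • T ^ n

section DividedPowers

variable {E : Type*} [AddCommGroup E] [Module ℂ E]

theorem dp_zero (T : Module.End ℂ E) : dp 0 T = 1 := by simp [dp]

theorem dp_of_zero {n : ℕ} (hn : n ≠ 0) : dp n (0 : Module.End ℂ E) = 0 := by simp [dp, hn]

theorem dp_choose (T : Module.End ℂ E) (i j : ℕ) :
    ((i + j).choose i : ℂ) • dp (i + j) T = dp i T * dp j T := by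
  simp only [dp, smul_mul_smul_comm, ← pow_add, smul_smul]
  congr 1
  have h1 : ((i + j).choose i : ℂ) * i.factorial * j.factorial = (i + j).factorial := by
    rw [Nat.choose_symm_add]; exact_mod_cast Nat.add_choose_mul_factorial_mul_factorial i j
  have hi : (i.factorial : ℂ) ≠ 0 := by exact_mod_cast i.factorial_ne_zero
  have hj : (j.factorial : ℂ) ≠ 0 := by exact_mod_cast j.factorial_ne_zero
  have hij : ((i + j).factorial : ℂ) ≠ 0 := by exact_mod_cast (i + j).factorial_ne_zero
  field_simp
  linear_combination h1

/-- The binomial theorem for divided powers. -/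
theorem dp_add {S T : Module.End ℂ E} (h : Commute S T) (n : ℕ) :
    dp n (S + T) = ∑ p ∈ antidiagonal n, dp p.1 S * dp p.2 T := by
  rw [dp, h.add_pow', Finset.smul_sum]
  refine Finset.sum_congr rfl fun p hp => ?_
  rw [← mem_antidiagonal.1 hp]
  simp only [dp, smul_mul_smul_comm]
  rw [← Nat.cast_smul_eq_nsmul ℂ, smul_smul]
  congr 1
  have h1 : ((p.1 + p.2).choose p.1 : ℂ) * p.1.factorial * p.2.factorial =
      (p.1 + p.2).factorial := by
    rw [Nat.choose_symm_add]; exact_mod_cast Nat.add_choose_mul_factorial_mul_factorial p.1 p.2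
  have hi : (p.1.factorial : ℂ) ≠ 0 := by exact_mod_cast p.1.factorial_ne_zero
  have hj : (p.2.factorial : ℂ) ≠ 0 := by exact_mod_cast p.2.factorial_ne_zero
  have hij : ((p.1 + p.2).factorial : ℂ) ≠ 0 := by exact_mod_cast (p.1 + p.2).factorial_ne_zero
  field_simp
  linear_combination h1

theorem dp_comp {E' : Type*} [AddCommGroup E'] [Module ℂ E'] {S : Module.End ℂ E}
    {T : Module.End ℂ E'} {f : E →ₗ[ℂ] E'} (h : ∀ x, f (S x) = T (f x)) (n : ℕ) (x : E) :
    f (dp n S x) = dp n T (f x) := by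
  have hp : ∀ n x, f ((S ^ n) x) = (T ^ n) (f x) := by
    intro n
    induction n with
    | zero => simp
    | succ n ih => intro x; rw [pow_succ, pow_succ, Module.End.mul_apply, ih, h,
        Module.End.mul_apply]
  simp [dp, hp]

theorem dp_mem {W : ℤ → Submodule ℂ E} {T : Module.End ℂ E} {d : ℤ}
    (h : ∀ K x, x ∈ W K → T x ∈ W (K + d)) (n : ℕ) {K : ℤ} {x : E} (hx : x ∈ W K) :
    dp n T x ∈ W (K + n * d) := by
  refine Submodule.smul_mem _ _ ?_
  induction n with
  | zero => simpa using hx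
  | succ n ih =>
    rw [pow_succ', Module.End.mul_apply]
    have := h _ _ ih
    rwa [show K + ((n + 1 : ℕ) : ℤ) * d = K + n * d + d by push_cast; ring]

end DividedPowers

/-- A commutative algebra with a complete and separated filtration by ideals, and two commuting
derivations `dxi`, `dx` of which the second one raises the filtration. -/
structure StarData (R : Type*) [CommRing R] [Algebra ℂ R] where
  W : ℤ → Submodule ℂ R
  anti : Antitone W
  mem_zero : ∀ x, x ∈ W 0
  eq_zero : ∀ x, (∀ K, x ∈ W K) → x = 0
  complete : ∀ {ι : Type} (t : ι → R), TendsZero W t → ∃ x, HasFSum W t x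
  mul_mem' : ∀ {K L x y}, x ∈ W K → y ∈ W L → x * y ∈ W (K + L)
  dxi : Module.End ℂ R
  dx : Module.End ℂ R
  dxi_mul : ∀ x y, dxi (x * y) = dxi x * y + x * dxi y
  dx_mul : ∀ x y, dx (x * y) = dx x * y + x * dx y
  comm : Commute dxi dx
  dxi_mem : ∀ {K x}, x ∈ W K → dxi x ∈ W K
  dx_mem : ∀ {K x}, x ∈ W K → dx x ∈ W (K + 1)

namespace StarData

open TensorProduct

variable {R : Type*} [CommRing R] [Algebra ℂ R] (A : StarData R)

theorem mul_mem {K : ℤ} {x : R} (hx : x ∈ A.W K) (y : R) : y * x ∈ A.W K := by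
  simpa using A.mul_mem' (A.mem_zero y) hx

theorem dx_pow_mem {K : ℤ} {x : R} (hx : x ∈ A.W K) (n : ℕ) : (A.dx ^ n) x ∈ A.W (K + n) := by
  induction n with
  | zero => simpa using hx
  | succ n ih =>
    rw [pow_succ', Module.End.mul_apply]
    have := A.dx_mem ih
    push_cast
    rwa [← add_assoc]

theorem dx_pow_mem' (x : R) (n : ℕ) : (A.dx ^ n) x ∈ A.W n := by
  simpa using A.dx_pow_mem (A.mem_zero x) n

theorem dp_dxi_mem (n : ℕ) {K : ℤ} {x : R} (hx : x ∈ A.W K) : dp n A.dxi x ∈ A.W K := by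
  simpa using dp_mem (W := A.W) (T := A.dxi) (d := 0)
    (fun K x hx => by simpa using A.dxi_mem hx) n hx

theorem dp_lap_mem (n : ℕ) {K : ℤ} {x : R} (hx : x ∈ A.W K) :
    dp n (A.dxi * A.dx) x ∈ A.W (K + n) := by
  simpa using dp_mem (W := A.W) (T := A.dxi * A.dx) (d := 1)
    (fun K x hx => A.dxi_mem (A.dx_mem hx)) n hx

theorem dp_neg_lap_mem (n : ℕ) {K : ℤ} {x : R} (hx : x ∈ A.W K) :
    dp n (-(A.dxi * A.dx)) x ∈ A.W (K + n) := by
  simpa using dp_mem (W := A.W) (T := -(A.dxi * A.dx)) (d := 1)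
    (fun K x hx => Submodule.neg_mem _ (A.dxi_mem (A.dx_mem hx))) n hx

theorem hasFSum_map {ι : Type*} {t : ι → R} {x : R} (hx : HasFSum A.W t x) (L : R →ₗ[ℂ] R)
    (hL : ∀ {K y}, y ∈ A.W K → L y ∈ A.W K) : HasFSum A.W (fun j => L (t j)) (L x) :=
  hx.map L fun K => ⟨K, fun _ hy => hL hy⟩

theorem hasFSum_mul_left {ι : Type*} {t : ι → R} {x : R} (hx : HasFSum A.W t x) (y : R) :
    HasFSum A.W (fun j => y * t j) (y * x) :=
  A.hasFSum_map hx (LinearMap.mulLeft ℂ y) fun h => A.mul_mem h y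

theorem hasFSum_mul_right {ι : Type*} {t : ι → R} {x : R} (hx : HasFSum A.W t x) (y : R) :
    HasFSum A.W (fun j => t j * y) (x * y) := by
  simpa only [mul_comm] using A.hasFSum_mul_left hx y

theorem star_summable (x y : R) :
    TendsZero A.W fun r : ℕ => dp r A.dxi x * (A.dx ^ r) y :=
  tendsZero_nat A.anti fun n => A.mul_mem (A.dx_pow_mem' y n) _

/-- The product `∑_r (1 / r!) dxi ^ r x * dx ^ r y`. -/
noncomputable def star (x y : R) : R := (A.complete _ (A.star_summable x y)).choose

theorem hasFSum_star (x y : R) :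
    HasFSum A.W (fun r : ℕ => dp r A.dxi x * (A.dx ^ r) y) (A.star x y) :=
  (A.complete _ (A.star_summable x y)).choose_spec

theorem eq_star {x y z : R} (h : HasFSum A.W (fun r : ℕ => dp r A.dxi x * (A.dx ^ r) y) z) :
    z = A.star x y :=
  h.unique A.eq_zero (A.hasFSum_star x y)

/-- The operator `T ⊗ 1` on `R ⊗ R`. -/
noncomputable def onLeft (T : Module.End ℂ R) : Module.End ℂ (R ⊗[ℂ] R) := T.rTensor R

/-- The operator `1 ⊗ T` on `R ⊗ R`. -/
noncomputable def onRight (T : Module.End ℂ R) : Module.End ℂ (R ⊗[ℂ] R) := T.lTensor R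

theorem onLeft_tmul (T : Module.End ℂ R) (x y : R) : onLeft T (x ⊗ₜ y) = T x ⊗ₜ y := rfl

theorem onRight_tmul (T : Module.End ℂ R) (x y : R) : onRight T (x ⊗ₜ y) = x ⊗ₜ T y := rfl

theorem onLeft_mul (S T : Module.End ℂ R) : onLeft (S * T) = onLeft S * onLeft T :=
  LinearMap.rTensor_mul _ _ _

theorem onRight_mul (S T : Module.End ℂ R) : onRight (S * T) = onRight S * onRight T :=
  LinearMap.lTensor_mul _ _ _

theorem commute_left_right (S T : Module.End ℂ R) : Commute (onLeft S) (onRight T) :=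
  TensorProduct.ext' fun _ _ => rfl

theorem commute_left_left {S T : Module.End ℂ R} (h : Commute S T) :
    Commute (onLeft S) (onLeft T) := by
  rw [commute_iff_eq, ← onLeft_mul, h.eq, onLeft_mul]

theorem commute_right_right {S T : Module.End ℂ R} (h : Commute S T) :
    Commute (onRight S) (onRight T) := by
  rw [commute_iff_eq, ← onRight_mul, h.eq, onRight_mul]

theorem dp_onLeft (n : ℕ) (T : Module.End ℂ R) (x y : R) :
    dp n (onLeft T) (x ⊗ₜ y) = dp n T x ⊗ₜ y :=
  (dp_comp (f := (TensorProduct.mk ℂ R R).flip y) (S := T) (T := onLeft T) (fun _ => rfl) n x).symm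

theorem dp_onRight (n : ℕ) (T : Module.End ℂ R) (x y : R) :
    dp n (onRight T) (x ⊗ₜ y) = x ⊗ₜ dp n T y :=
  (dp_comp (f := TensorProduct.mk ℂ R R x) (S := T) (T := onRight T) (fun _ => rfl) n y).symm

theorem mul'_derivation {T : Module.End ℂ R} (hT : ∀ x y, T (x * y) = T x * y + x * T y)
    (z : R ⊗[ℂ] R) :
    LinearMap.mul' ℂ R ((onLeft T + onRight T) z) = T (LinearMap.mul' ℂ R z) := by
  induction z with
  | zero => simp
  | add z w hz hw => rw [map_add, map_add, hz, hw, map_add, map_add]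
  | tmul x y =>
    rw [LinearMap.add_apply, onLeft_tmul, onRight_tmul, map_add]
    simp only [LinearMap.mul'_apply]
    exact (hT x y).symm

/-- The Leibniz rule for divided powers of a derivation. -/
theorem dp_leibniz {T : Module.End ℂ R} (hT : ∀ x y, T (x * y) = T x * y + x * T y) (n : ℕ)
    (x y : R) : dp n T (x * y) = ∑ p ∈ antidiagonal n, dp p.1 T x * dp p.2 T y := by
  have h := dp_comp (f := LinearMap.mul' ℂ R) (mul'_derivation hT) n (x ⊗ₜ y)
  rw [LinearMap.mul'_apply] at h
  rw [← h, dp_add (commute_left_right T T), LinearMap.sum_apply, map_sum]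
  refine Finset.sum_congr rfl fun p _ => ?_
  rw [Module.End.mul_apply, dp_onRight, dp_onLeft, LinearMap.mul'_apply]

theorem pow_eq_dp {E : Type*} [AddCommGroup E] [Module ℂ E] (T : Module.End ℂ E) (n : ℕ) :
    T ^ n = (n.factorial : ℂ) • dp n T := by
  rw [dp, smul_smul, mul_inv_cancel₀ (by exact_mod_cast n.factorial_ne_zero), one_smul]

/-- The summands in the expansion of a triple star product. -/
noncomputable def triple (a b c : R) (p : ℕ × (ℕ × ℕ)) : R :=
  dp p.2.1 A.dxi (dp p.1 A.dxi a) * dp p.2.2 A.dxi ((A.dx ^ p.1) b) *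
    (A.dx ^ (p.2.1 + p.2.2)) c

theorem triple_summable (a b c : R) : TendsZero A.W (A.triple a b c) :=
  tendsZero_nat₃ A.anti fun p => by
    have h := A.mul_mem' (A.mul_mem (A.dp_dxi_mem p.2.2 (A.dx_pow_mem' b p.1))
      (dp p.2.1 A.dxi (dp p.1 A.dxi a))) (A.dx_pow_mem' c (p.2.1 + p.2.2))
    exact A.anti (by push_cast; omega) h

theorem exists_fibers {ι κ : Type} {t : ι × κ → R} (ht : TendsZero A.W t) :
    ∃ y : ι → R, ∀ i, HasFSum A.W (fun j => t (i, j)) (y i) :=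
  ⟨fun _ => _, fun i => (A.complete _ (ht.comp_injective (fun j : κ => (i, j))
    fun _ _ h => (Prod.ext_iff.1 h).2)).choose_spec⟩

/-- Both bracketings of a triple star product are sums of the family `triple`; here summation over
`p.1` gives the inner product `star a b`, after the Leibniz rule. -/
theorem triple_left (a b c : R) {X : R} (hX : HasFSum A.W (A.triple a b c) X) :
    X = A.star (A.star a b) c := by
  refine A.eq_star ?_
  have hX' : HasFSum A.W (fun q : (ℕ × ℕ) × ℕ => A.triple a b c (q.2, q.1)) X :=
    hX.equiv (Equiv.prodComm (ℕ × ℕ) ℕ)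
  obtain ⟨y, hy⟩ := A.exists_fibers hX'.tendsZero
  have h1 := (hX'.prod hy).sum_diag
  have e : (fun n => ∑ p ∈ antidiagonal n, y p) =
      fun n : ℕ => dp n A.dxi (A.star a b) * (A.dx ^ n) c := by
    funext n
    have h2 := A.hasFSum_mul_right (A.hasFSum_map (A.hasFSum_star a b) (dp n A.dxi)
      fun h => A.dp_dxi_mem n h) ((A.dx ^ n) c)
    have h3 := hasFSum_finset_sum (antidiagonal n) fun q _ => hy q
    refine h3.unique A.eq_zero ?_
    have e2 : (fun r => ∑ q ∈ antidiagonal n, A.triple a b c (r, q)) =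
        fun r => dp n A.dxi (dp r A.dxi a * (A.dx ^ r) b) * (A.dx ^ n) c := by
      funext r
      rw [dp_leibniz A.dxi_mul, Finset.sum_mul]
      refine Finset.sum_congr rfl fun q hq => ?_
      rw [triple, mem_antidiagonal.1 hq]
    rw [e2]
    exact h2
  rw [e] at h1
  exact h1

/-- The Leibniz rule for `dx ^ n` in the expansion of `star a (star b c)`. -/
theorem triple_term (a b c : R) (n r : ℕ) :
    dp n A.dxi a * (A.dx ^ n) (dp r A.dxi b * (A.dx ^ r) c) =
      ∑ q ∈ antidiagonal n, A.triple a b c (q.1, (q.2, r)) := by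
  rw [pow_eq_dp, LinearMap.smul_apply, dp_leibniz A.dx_mul, Finset.smul_sum, Finset.mul_sum]
  refine Finset.sum_congr rfl fun q hq => ?_
  rw [← mem_antidiagonal.1 hq, triple]
  have h3 := LinearMap.congr_fun (dp_choose A.dxi q.2 q.1) a
  rw [LinearMap.smul_apply, Module.End.mul_apply] at h3
  have h4 : dp r A.dxi ((A.dx ^ q.1) b) = (A.dx ^ q.1) (dp r A.dxi b) :=
    (dp_comp (f := A.dx ^ q.1) (S := A.dxi) (T := A.dxi)
      (fun x => LinearMap.congr_fun (A.comm.symm.pow_left q.1).eq x) r b).symm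
  have h1 : ((q.2 + q.1).choose q.2 : ℂ) * q.1.factorial * q.2.factorial =
      (q.1 + q.2).factorial := by
    rw [add_comm q.2]
    exact_mod_cast Nat.add_choose_mul_factorial_mul_factorial q.1 q.2
  dsimp only
  rw [← h3, h4, pow_add, Module.End.mul_apply, pow_eq_dp A.dx q.1, pow_eq_dp A.dx q.2,
    add_comm q.2 q.1]
  rw [add_comm q.2 q.1] at h1
  simp only [LinearMap.smul_apply, smul_mul_assoc, mul_smul_comm, smul_smul, mul_assoc, ← h1]
  congr 1
  ring

/-- The family `triple`, summed over `p.2.2` first, gives the inner product `star b c`; compare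
`triple_left`. -/
theorem triple_right (a b c : R) {X : R} (hX : HasFSum A.W (A.triple a b c) X) :
    X = A.star a (A.star b c) := by
  refine A.eq_star ?_
  have hX' : HasFSum A.W (fun q : (ℕ × ℕ) × ℕ => A.triple a b c (q.1.1, (q.1.2, q.2))) X :=
    hX.equiv (Equiv.prodAssoc ℕ ℕ ℕ)
  obtain ⟨y, hy⟩ := A.exists_fibers hX'.tendsZero
  have h1 := (hX'.prod hy).sum_diag
  have e : (fun n => ∑ p ∈ antidiagonal n, y p) =
      fun n : ℕ => dp n A.dxi a * (A.dx ^ n) (A.star b c) := by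
    funext n
    have h2 := A.hasFSum_mul_left (A.hasFSum_map (A.hasFSum_star b c) (A.dx ^ n)
      fun h => A.anti (by omega) (A.dx_pow_mem h n)) (dp n A.dxi a)
    have h3 := hasFSum_finset_sum (antidiagonal n) fun q _ => hy q
    refine h3.unique A.eq_zero ?_
    simp only [← A.triple_term]
    exact h2
  rw [e] at h1
  exact h1

theorem star_assoc (a b c : R) : A.star (A.star a b) c = A.star a (A.star b c) := by
  obtain ⟨X, hX⟩ := A.complete _ (A.triple_summable a b c)
  rw [← A.triple_left a b c hX, ← A.triple_right a b c hX]

theorem star_add_left (a b c : R) : A.star (a + b) c = A.star a c + A.star b c := by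
  refine (A.eq_star ?_).symm
  simpa only [map_add, add_mul] using (A.hasFSum_star a c).add (A.hasFSum_star b c)

theorem star_add_right (a b c : R) : A.star a (b + c) = A.star a b + A.star a c := by
  refine (A.eq_star ?_).symm
  simpa only [map_add, mul_add] using (A.hasFSum_star a b).add (A.hasFSum_star a c)

theorem star_smul_left (z : ℂ) (a c : R) : A.star (z • a) c = z • A.star a c := by
  refine (A.eq_star ?_).symm
  simpa only [map_smul, smul_mul_assoc] using (A.hasFSum_star a c).smul z

theorem star_smul_right (z : ℂ) (a c : R) : A.star a (z • c) = z • A.star a c := by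
  refine (A.eq_star ?_).symm
  simpa only [map_smul, mul_smul_comm] using (A.hasFSum_star a c).smul z

theorem one_star (a : R) : A.star 1 a = a := by
  have h1 : A.dxi 1 = 0 := by simpa using A.dxi_mul 1 1
  have h := hasFSum_single (W := A.W) (fun r : ℕ => dp r A.dxi 1 * (A.dx ^ r) a) 0 fun r hr => by
    obtain ⟨r, rfl⟩ := Nat.exists_eq_succ_of_ne_zero hr
    simp [dp, pow_succ, h1]
  rw [← A.eq_star h]
  simp [dp_zero]

theorem star_one (a : R) : A.star a 1 = a := by
  have h1 : A.dx 1 = 0 := by simpa using A.dx_mul 1 1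
  have h := hasFSum_single (W := A.W) (fun r : ℕ => dp r A.dxi a * (A.dx ^ r) 1) 0 fun r hr => by
    obtain ⟨r, rfl⟩ := Nat.exists_eq_succ_of_ne_zero hr
    simp [pow_succ, h1]
  rw [← A.eq_star h]
  simp [dp_zero]

/-- A functional that is compatible with sums and vanishes on derivatives is a trace for the
star product. -/
theorem trace_star {V : Type*} [AddCommGroup V] [Module ℂ V] (τ : R →ₗ[ℂ] V)
    (hτ : ∀ {t : ℕ → R} {x : R}, HasFSum A.W t x → (∀ j, τ (t j) = 0) → τ x = 0)
    (h1 : ∀ x, τ (A.dxi x) = 0) (h2 : ∀ x, τ (A.dx x) = 0) (a b : R) :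
    τ (A.star a b) = τ (A.star b a) := by
  have hparts : ∀ T : Module.End ℂ R, (∀ x y, T (x * y) = T x * y + x * T y) →
      (∀ x, τ (T x) = 0) → ∀ n x y, τ ((T ^ n) x * y) = (-1 : ℂ) ^ n • τ (x * (T ^ n) y) := by
    intro T hT h n
    induction n with
    | zero => simp
    | succ n ih =>
      intro x y
      have h3 := h ((T ^ n) x * y)
      rw [hT, map_add] at h3
      rw [pow_succ', Module.End.mul_apply, eq_neg_of_add_eq_zero_left h3, ih,
        ← Module.End.mul_apply, ← pow_succ, pow_succ' (-1 : ℂ), neg_one_mul, neg_smul, pow_succ']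
  have h := (A.hasFSum_star a b).sub (A.hasFSum_star b a)
  rw [← sub_eq_zero, ← map_sub]
  refine hτ h fun r => ?_
  rw [map_sub, sub_eq_zero, mul_comm (dp r A.dxi b)]
  simp only [dp, LinearMap.smul_apply, smul_mul_assoc, mul_smul_comm, map_smul]
  rw [hparts A.dxi A.dxi_mul h1, hparts A.dx A.dx_mul h2, ← Module.End.mul_apply,
    ← Module.End.mul_apply, ((A.comm.pow_pow r r)).eq]

/-- The summands of `exp (dxi dx) x`. -/
theorem lap_summable (x : R) : TendsZero A.W fun r : ℕ => dp r (A.dxi * A.dx) x :=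
  tendsZero_nat A.anti fun n => by simpa using A.dp_lap_mem n (A.mem_zero x)

/-- The operator `exp (dxi dx)`. -/
noncomputable def lap (x : R) : R := (A.complete _ (A.lap_summable x)).choose

theorem hasFSum_lap (x : R) : HasFSum A.W (fun r : ℕ => dp r (A.dxi * A.dx) x) (A.lap x) :=
  (A.complete _ (A.lap_summable x)).choose_spec

theorem eq_lap {x y : R} (h : HasFSum A.W (fun r : ℕ => dp r (A.dxi * A.dx) x) y) : y = A.lap x :=
  h.unique A.eq_zero (A.hasFSum_lap x)

theorem lap_mem {K : ℤ} {x : R} (hx : x ∈ A.W K) : A.lap x ∈ A.W K :=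
  (A.hasFSum_lap x).mem le_rfl fun r => A.anti (by omega) (A.dp_lap_mem r hx)

theorem lap_add (x y : R) : A.lap (x + y) = A.lap x + A.lap y := by
  refine (A.eq_lap ?_).symm
  simpa only [map_add] using (A.hasFSum_lap x).add (A.hasFSum_lap y)

theorem lap_smul (z : ℂ) (x : R) : A.lap (z • x) = z • A.lap x := by
  refine (A.eq_lap ?_).symm
  simpa only [map_smul] using (A.hasFSum_lap x).smul z

/-- `lap` as a linear map. -/
noncomputable def lapL : R →ₗ[ℂ] R where
  toFun := A.lap
  map_add' := A.lap_add
  map_smul' := A.lap_smul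

theorem hasFSum_lap_map {ι : Type*} {t : ι → R} {x : R} (hx : HasFSum A.W t x) :
    HasFSum A.W (fun j => A.lap (t j)) (A.lap x) :=
  A.hasFSum_map hx A.lapL fun h => A.lap_mem h

/-- The series `exp (-dxi dx)` inverts `exp (dxi dx)`. -/
theorem lap_neg {x y : R} (h : HasFSum A.W (fun r : ℕ => dp r (-(A.dxi * A.dx)) x) y) :
    A.lap y = x := by
  have hz : TendsZero A.W fun p : ℕ × ℕ =>
      dp p.1 (A.dxi * A.dx) (dp p.2 (-(A.dxi * A.dx)) x) := tendsZero_nat₂ A.anti fun p => by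
    have := A.dp_lap_mem p.1 (A.dp_neg_lap_mem p.2 (A.mem_zero x))
    convert this using 2
    push_cast
    ring
  obtain ⟨X, hX⟩ := A.complete _ hz
  have h0 : HasFSum A.W (fun j => A.lap (dp j (-(A.dxi * A.dx)) x)) X :=
    hX.prod_swap fun j => A.hasFSum_lap (dp j (-(A.dxi * A.dx)) x)
  rw [← h0.unique A.eq_zero (A.hasFSum_lap_map h)]
  refine hX.sum_diag.unique A.eq_zero ?_
  have h2 : ∀ n, ∑ p ∈ antidiagonal n, dp p.1 (A.dxi * A.dx) (dp p.2 (-(A.dxi * A.dx)) x) =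
      dp n (0 : Module.End ℂ R) x := by
    intro n
    have h3 := LinearMap.congr_fun (dp_add ((Commute.refl (A.dxi * A.dx)).neg_right) n) x
    rw [add_neg_cancel, LinearMap.sum_apply] at h3
    exact h3.symm
  simp only [h2]
  have h4 := hasFSum_single (W := A.W) (fun n : ℕ => dp n (0 : Module.End ℂ R) x) 0 fun r hr => by
    simp [dp_of_zero hr]
  simpa [dp_zero] using h4

theorem commute_mul_mul {E : Type*} [Ring E] {a b c d : E} (h1 : Commute a c) (h2 : Commute a d)
    (h3 : Commute b c) (h4 : Commute b d) : Commute (a * b) (c * d) :=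
  (h1.mul_right h2).mul_left (h3.mul_right h4)

theorem pow_mul_tmul (S T : Module.End ℂ R) (n : ℕ) (x y : R) :
    ((onLeft S * onRight T) ^ n) (x ⊗ₜ[ℂ] y) = (S ^ n) x ⊗ₜ[ℂ] (T ^ n) y := by
  induction n with
  | zero => rfl
  | succ n ih =>
    rw [pow_succ', Module.End.mul_apply, ih, pow_succ', pow_succ', Module.End.mul_apply,
      onRight_tmul, onLeft_tmul, Module.End.mul_apply, Module.End.mul_apply]

/-- The operator `1 ⊗ dxi dx + dxi dx ⊗ 1 + dx ⊗ dxi` on `R ⊗ R`. -/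
noncomputable def biLap : Module.End ℂ (R ⊗[ℂ] R) :=
  onLeft A.dx * onRight A.dxi + (onLeft (A.dxi * A.dx) + onRight (A.dxi * A.dx))

/-- The multiplication map applied to `exp (biLap)`, after writing `biLap` as
`(dxi ⊗ 1 + 1 ⊗ dxi) (dx ⊗ 1 + 1 ⊗ dx) - dxi ⊗ dx`. -/
theorem dp_biLap_left (n : ℕ) (x y : R) :
    LinearMap.mul' ℂ R (dp n A.biLap (x ⊗ₜ[ℂ] y)) = ∑ p ∈ antidiagonal n,
      dp p.1 (A.dxi * A.dx) (dp p.2 (-A.dxi) x * (A.dx ^ p.2) y) := by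
  have hΘ : ∀ z, LinearMap.mul' ℂ R (((onLeft A.dxi + onRight A.dxi) *
      (onLeft A.dx + onRight A.dx)) z) = (A.dxi * A.dx) (LinearMap.mul' ℂ R z) := fun z => by
    rw [Module.End.mul_apply, mul'_derivation A.dxi_mul, mul'_derivation A.dx_mul,
      Module.End.mul_apply]
  have h2 : A.biLap = (onLeft A.dxi + onRight A.dxi) * (onLeft A.dx + onRight A.dx) +
      onLeft (-A.dxi) * onRight A.dx := by
    rw [biLap, add_mul, mul_add, mul_add, onLeft_mul, onRight_mul,
      (commute_left_right A.dx A.dxi).eq, show onLeft (-A.dxi) * onRight A.dx =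
        -(onLeft A.dxi * onRight A.dx) from
        TensorProduct.ext' fun x y => TensorProduct.neg_tmul (A.dxi x) (A.dx y)]
    abel
  have h3 : Commute ((onLeft A.dxi + onRight A.dxi) * (onLeft A.dx + onRight A.dx))
      (onLeft (-A.dxi) * onRight A.dx) := by
    have c1 : Commute A.dxi (-A.dxi) := LinearMap.ext fun x => by simp
    have c2 : Commute A.dx (-A.dxi) := LinearMap.ext fun x => by
      simpa using (LinearMap.congr_fun A.comm.eq x).symm
    refine commute_mul_mul ?_ ?_ ?_ ?_
    · exact (commute_left_left c1).add_left (commute_left_right _ _).symm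
    · exact (commute_left_right _ _).add_left (commute_right_right A.comm)
    · exact (commute_left_left c2).add_left (commute_left_right _ _).symm
    · exact (commute_left_right _ _).add_left (Commute.refl _)
  rw [h2, dp_add h3, LinearMap.sum_apply, map_sum]
  refine Finset.sum_congr rfl fun p _ => ?_
  rw [Module.End.mul_apply, dp_comp hΘ, dp, dp, dp, LinearMap.smul_apply, LinearMap.smul_apply,
    LinearMap.smul_apply, LinearMap.smul_apply, pow_mul_tmul, map_smul, LinearMap.mul'_apply,
    smul_mul_assoc]

/-- The multiplication map applied to `exp (biLap)`, expanded as a product of the exponentials of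
the three summands. -/
theorem dp_biLap_right (n : ℕ) (x y : R) :
    LinearMap.mul' ℂ R (dp n A.biLap (x ⊗ₜ[ℂ] y)) = ∑ q ∈ antidiagonal n, ∑ p ∈ antidiagonal q.2,
      dp q.1 A.dxi (dp p.2 (A.dxi * A.dx) y) * (A.dx ^ q.1) (dp p.1 (A.dxi * A.dx) x) := by
  have c1 : Commute A.dx (A.dxi * A.dx) := A.comm.symm.mul_right (Commute.refl _)
  have c2 : Commute A.dxi (A.dxi * A.dx) := (Commute.refl _).mul_right A.comm
  have h2 : Commute (onLeft A.dx * onRight A.dxi)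
      (onLeft (A.dxi * A.dx) + onRight (A.dxi * A.dx)) :=
    ((commute_left_left c1).mul_left (commute_left_right _ _).symm).add_right
      ((commute_left_right _ _).mul_left (commute_right_right c2))
  rw [biLap, dp_add h2, LinearMap.sum_apply, map_sum]
  refine Finset.sum_congr rfl fun q _ => ?_
  rw [dp_add (commute_left_right _ _), Finset.mul_sum, LinearMap.sum_apply, map_sum]
  refine Finset.sum_congr rfl fun p _ => ?_
  rw [Module.End.mul_apply, Module.End.mul_apply, dp_onRight, dp_onLeft, dp, LinearMap.smul_apply,
    pow_mul_tmul, ← TensorProduct.tmul_smul, LinearMap.mul'_apply, mul_comm]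
  rfl

/-- The first of the two evaluations of `exp (biLap)`: it is `exp (dxi dx)` of a star product in
which `dxi` is replaced with `-dxi`. -/
theorem hasFSum_biLap_left (x y z : R)
    (h : HasFSum A.W (fun r : ℕ => dp r (-A.dxi) x * (A.dx ^ r) y) z) :
    HasFSum A.W (fun n => LinearMap.mul' ℂ R (dp n A.biLap (x ⊗ₜ[ℂ] y))) (A.lap z) := by
  simp only [dp_biLap_left]
  have hz : TendsZero A.W fun p : ℕ × ℕ =>
      dp p.1 (A.dxi * A.dx) (dp p.2 (-A.dxi) x * (A.dx ^ p.2) y) :=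
    tendsZero_nat₂ A.anti fun p => by
      have := A.dp_lap_mem p.1 (A.mul_mem (A.dx_pow_mem' y p.2) (dp p.2 (-A.dxi) x))
      exact A.anti (by push_cast; omega) this
  obtain ⟨X, hX⟩ := A.complete _ hz
  have h0 : HasFSum A.W (fun j => A.lap (dp j (-A.dxi) x * (A.dx ^ j) y)) X :=
    hX.prod_swap fun j => A.hasFSum_lap (dp j (-A.dxi) x * (A.dx ^ j) y)
  rw [← h0.unique A.eq_zero (A.hasFSum_lap_map h)]
  exact hX.sum_diag

/-- The second of the two evaluations of `exp (biLap)`: a star product in the opposite order. -/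
theorem hasFSum_biLap_right (x y : R) :
    HasFSum A.W (fun n => LinearMap.mul' ℂ R (dp n A.biLap (x ⊗ₜ[ℂ] y)))
      (A.star (A.lap y) (A.lap x)) := by
  simp only [dp_biLap_right]
  have hz : TendsZero A.W fun p : ℕ × (ℕ × ℕ) => dp p.1 A.dxi (dp p.2.2 (A.dxi * A.dx) y) *
      (A.dx ^ p.1) (dp p.2.1 (A.dxi * A.dx) x) := tendsZero_nat₃ A.anti fun p => by
    have := A.mul_mem' (A.dp_dxi_mem p.1 (A.dp_lap_mem p.2.2 (A.mem_zero y)))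
      (A.dx_pow_mem (A.dp_lap_mem p.2.1 (A.mem_zero x)) p.1)
    exact A.anti (by push_cast; omega) this
  obtain ⟨X, hX⟩ := A.complete _ hz
  have hX1 : X = A.star (A.lap y) (A.lap x) := by
    refine A.eq_star (hX.prod fun q => ?_)
    obtain ⟨Y, hY⟩ := A.complete _ (hz.comp_injective (fun p : ℕ × ℕ => (q, p))
      fun _ _ h => (Prod.ext_iff.1 h).2)
    have h1 := hY.prod fun e => A.hasFSum_mul_right (A.hasFSum_map (A.hasFSum_lap y)
      (dp q A.dxi) fun h => A.dp_dxi_mem q h) ((A.dx ^ q) (dp e (A.dxi * A.dx) x))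
    have h2 := A.hasFSum_mul_left (A.hasFSum_map (A.hasFSum_lap x) (A.dx ^ q)
      fun h => A.anti (by omega) (A.dx_pow_mem h q)) (dp q A.dxi (A.lap y))
    rw [h2.unique A.eq_zero h1]
    exact hY
  rw [← hX1]
  have h1 := hX.fiber (fun p => (p.1, p.2.1 + p.2.2))
    (fun k => (antidiagonal k.2).map (Function.Embedding.sectR k.1 (ℕ × ℕ)))
    (fun j k => by
      simp only [Finset.mem_map, mem_antidiagonal, Function.Embedding.sectR_apply]
      constructor
      · rintro ⟨p, hp, rfl⟩
        exact Prod.ext rfl hp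
      · rintro rfl
        exact ⟨j.2, rfl, rfl⟩)
  simp only [Finset.sum_map, Function.Embedding.sectR_apply] at h1
  exact h1.sum_diag

/-- If `T` is an automorphism with `T dxi = -dxi T` and `T dx = dx T`, then `exp (dxi dx) T`
is an anti-automorphism for the star product: on `R ⊗ R` this is the identity
`exp ((u + u') (v + v')) exp (-u v') = exp (v u') exp (u v) exp (u' v')` for the commuting
operators `u = dxi ⊗ 1`, `u' = 1 ⊗ dxi`, `v = dx ⊗ 1`, `v' = 1 ⊗ dx`. -/
theorem lap_star (T : R →ₗ[ℂ] R) (hT : ∀ x y, T (x * y) = T x * T y)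
    (hTW : ∀ {K x}, x ∈ A.W K → T x ∈ A.W K) (hT1 : ∀ x, T (A.dxi x) = (-A.dxi) (T x))
    (hT2 : ∀ x, T (A.dx x) = A.dx (T x)) (a b : R) :
    A.lap (T (A.star a b)) = A.star (A.lap (T b)) (A.lap (T a)) := by
  refine (A.hasFSum_biLap_left (T a) (T b) _ ?_).unique A.eq_zero (A.hasFSum_biLap_right _ _)
  have h1 := A.hasFSum_map (A.hasFSum_star a b) T hTW
  have h2 : ∀ r, T ((A.dx ^ r) b) = (A.dx ^ r) (T b) := fun r => by
    rw [pow_eq_dp, LinearMap.smul_apply, map_smul, dp_comp (f := T) hT2]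
    rfl
  simpa only [hT, dp_comp (f := T) hT1, h2] using h1

end StarData

/-! ### The symbol algebras -/

/-- The index `i` for `b = true` and `-i` for `b = false`. -/
def orient (b : Bool) (i : ℤ) : ℤ := if b then i else -i

theorem orient_true (i : ℤ) : orient true i = i := rfl

theorem orient_false (i : ℤ) : orient false i = -i := rfl

/-- The operators whose coefficients `a i` tend to zero for the degree filtration as `i → ∞`
(for `b = true`) or as `i → -∞` (for `b = false`). These spaces contain `𝒟⁻` and `𝒟⁺`,
and the product of operators is defined on each of them. -/
def Reg (M : CoordManifold) (b : Bool) : Submodule ℂ (Op M) where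
  carrier := {a | ∀ K : ℤ, ∃ N : ℤ, ∀ i, N < orient b i → a i ∈ degGE M K}
  zero_mem' := fun _ => ⟨0, fun _ _ => Submodule.zero_mem _⟩
  add_mem' := by
    intro a c ha hc K
    obtain ⟨N, hN⟩ := ha K
    obtain ⟨N', hN'⟩ := hc K
    exact ⟨max N N', fun i hi => Submodule.add_mem _
      (hN i (lt_of_le_of_lt (le_max_left _ _) hi)) (hN' i (lt_of_le_of_lt (le_max_right _ _) hi))⟩
  smul_mem' := by
    intro z a ha K
    obtain ⟨N, hN⟩ := ha K
    exact ⟨N, fun i hi => Submodule.smul_mem _ z (hN i hi)⟩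

section Symbols

variable {M : CoordManifold} {b : Bool}

theorem tendsZero_conv {a c : Op M} (ha : a ∈ Reg M b) (hc : c ∈ Reg M b) (n : ℤ) :
    TendsZero (degGE M) fun i : ℤ => a i * c (n - i) := by
  intro K
  obtain ⟨N, hN⟩ := ha K
  obtain ⟨N', hN'⟩ := hc K
  have key : ∀ i, a i * c (n - i) ∉ degGE M K → orient b i ≤ N ∧ orient b (n - i) ≤ N' := by
    intro i hi
    refine ⟨?_, ?_⟩ <;> by_contra hcon <;> refine hi ?_
    · exact mul_mem_degGE_left (hN i (not_le.1 hcon)) _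
    · exact mul_mem_degGE_right (hN' _ (not_le.1 hcon)) _
  cases b
  · refine (Finset.Icc (-N) (N' + n)).finite_toSet.subset fun i hi => ?_
    have := key i hi
    simp only [orient_false] at this
    rw [Finset.mem_coe, Finset.mem_Icc]
    omega
  · refine (Finset.Icc (n - N') N).finite_toSet.subset fun i hi => ?_
    have := key i hi
    simp only [orient_true] at this
    rw [Finset.mem_coe, Finset.mem_Icc]
    omega

/-- The convolution product of two sequences of coefficients. -/
noncomputable def conv (a c : Op M) : Op M := fun n => fsum fun i : ℤ => a i * c (n - i)

theorem hasFSum_conv {a c : Op M} (ha : a ∈ Reg M b) (hc : c ∈ Reg M b) (n : ℤ) :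
    HasFSum (degGE M) (fun i : ℤ => a i * c (n - i)) (conv a c n) :=
  hasFSum_fsum (tendsZero_conv ha hc n)

theorem conv_eq {a c : Op M} {n : ℤ} {x : DiffPoly M}
    (h : HasFSum (degGE M) (fun i : ℤ => a i * c (n - i)) x) : conv a c n = x :=
  h.eq_fsum.symm

theorem conv_mem_degGE {a c : Op M} (ha : a ∈ Reg M b) (hc : c ∈ Reg M b) (n K L : ℤ)
    (h : ∀ i, a i ∈ degGE M K) (h' : ∀ i, c i ∈ degGE M L) : conv a c n ∈ degGE M (K + L) :=
  (hasFSum_conv ha hc n).mem le_rfl fun i => mul_mem_degGE (h i) (h' _)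

theorem conv_mem {a c : Op M} (ha : a ∈ Reg M b) (hc : c ∈ Reg M b) : conv a c ∈ Reg M b := by
  intro K
  obtain ⟨N, hN⟩ := ha K
  obtain ⟨N', hN'⟩ := hc K
  refine ⟨N + N', fun n hn => (hasFSum_conv ha hc n).mem le_rfl fun i => ?_⟩
  by_cases h : N < orient b i
  · exact mul_mem_degGE_left (hN i h) _
  · refine mul_mem_degGE_right (hN' _ ?_) _
    cases b <;> simp only [orient_false, orient_true] at * <;> omega

theorem conv_comm {a c : Op M} (ha : a ∈ Reg M b) (hc : c ∈ Reg M b) : conv a c = conv c a := by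
  funext n
  refine conv_eq ?_
  simpa [mul_comm] using (hasFSum_conv hc ha n).equiv (Equiv.subLeft n)

theorem conv_add {a c d : Op M} (ha : a ∈ Reg M b) (hc : c ∈ Reg M b) (hd : d ∈ Reg M b) :
    conv a (c + d) = conv a c + conv a d := by
  funext n
  refine conv_eq ?_
  simpa [mul_add] using (hasFSum_conv ha hc n).add (hasFSum_conv ha hd n)

theorem smul_conv {a c : Op M} (ha : a ∈ Reg M b) (hc : c ∈ Reg M b) (z : ℂ) :
    conv (z • a) c = z • conv a c := by
  funext n
  refine conv_eq ?_
  simpa using (hasFSum_conv ha hc n).smul z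

theorem single_mem_Reg (j : ℤ) (f : DiffPoly M) : (Pi.single j f : Op M) ∈ Reg M b := by
  refine fun K => ⟨|j|, fun i hi => ?_⟩
  have hij : i ≠ j := by
    rintro rfl
    have h1 := le_abs_self i
    have h2 := neg_le_abs i
    cases b <;> simp only [orient_false, orient_true] at hi <;> omega
  rw [Pi.single_eq_of_ne hij]
  exact Submodule.zero_mem _

theorem one_conv (a : Op M) : conv (Pi.single 0 1) a = a := by
  funext n
  refine conv_eq ?_
  have h := hasFSum_single (W := degGE M)
    (fun i : ℤ => (Pi.single 0 1 : Op M) i * a (n - i)) 0 fun i hi => by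
      rw [Pi.single_eq_of_ne hi, zero_mul]
  simpa using h

/-- Both bracketings are sums of the same family over `ℤ × ℤ`. -/
theorem conv_assoc {a c d : Op M} (ha : a ∈ Reg M b) (hc : c ∈ Reg M b) (hd : d ∈ Reg M b) :
    conv (conv a c) d = conv a (conv c d) := by
  funext n
  have hz : TendsZero (degGE M) fun p : ℤ × ℤ => a p.1 * c p.2 * d (n - p.1 - p.2) := by
    intro K
    obtain ⟨N, hN⟩ := ha K
    obtain ⟨N', hN'⟩ := hc K
    obtain ⟨N'', hN''⟩ := hd K
    have key : ∀ p : ℤ × ℤ, a p.1 * c p.2 * d (n - p.1 - p.2) ∉ degGE M K →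
        orient b p.1 ≤ N ∧ orient b p.2 ≤ N' ∧ orient b (n - p.1 - p.2) ≤ N'' := by
      intro p hp
      refine ⟨?_, ?_, ?_⟩ <;> by_contra hcon <;> refine hp ?_
      · exact mul_mem_degGE_left (mul_mem_degGE_left (hN _ (not_le.1 hcon)) _) _
      · exact mul_mem_degGE_left (mul_mem_degGE_right (hN' _ (not_le.1 hcon)) _) _
      · exact mul_mem_degGE_right (hN'' _ (not_le.1 hcon)) _
    cases b
    · refine (Finset.Icc (-N) (N' + N'' + n) ×ˢ
        Finset.Icc (-N') (N + N'' + n)).finite_toSet.subset fun p hp => ?_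
      have := key p hp
      simp only [orient_false] at this
      rw [Finset.mem_coe, Finset.mem_product, Finset.mem_Icc, Finset.mem_Icc]
      omega
    · refine (Finset.Icc (n - N' - N'') N ×ˢ
        Finset.Icc (n - N - N'') N').finite_toSet.subset fun p hp => ?_
      have := key p hp
      simp only [orient_true] at this
      rw [Finset.mem_coe, Finset.mem_product, Finset.mem_Icc, Finset.mem_Icc]
      omega
  obtain ⟨X, hX⟩ := hz.exists_hasFSum
  have h1 : HasFSum (degGE M) (fun i => a i * conv c d (n - i)) X :=
    hX.prod fun i => by simpa only [mul_assoc] using (hasFSum_conv hc hd (n - i)).mul_left (a i)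
  have hX' : HasFSum (degGE M) (fun p : ℤ × ℤ => a p.2 * c (p.1 - p.2) * d (n - p.1)) X := by
    let e : ℤ × ℤ ≃ ℤ × ℤ :=
      { toFun := fun p => (p.2, p.1 - p.2)
        invFun := fun p => (p.1 + p.2, p.1)
        left_inv := fun p => by simp
        right_inv := fun p => by simp }
    have := hX.equiv e
    refine cast (congrArg₂ _ (funext fun p => ?_) rfl) this
    simp [e]
  have h2 : HasFSum (degGE M) (fun i => conv a c i * d (n - i)) X :=
    hX'.prod fun i => (hasFSum_conv ha hc i).mul_right (d (n - i))
  rw [conv_eq h1, conv_eq h2]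

/-- The commutative algebra of symbols: the space `Reg M b` with the convolution product. -/
def Symb (M : CoordManifold) (b : Bool) : Type := Reg M b

noncomputable instance : AddCommGroup (Symb M b) := inferInstanceAs (AddCommGroup (Reg M b))

noncomputable instance : Module ℂ (Symb M b) := inferInstanceAs (Module ℂ (Reg M b))

/-- The coefficients of a symbol. -/
def Symb.coeffs : Symb M b →ₗ[ℂ] Op M := (Reg M b).subtype

theorem Symb.mem (x : Symb M b) : x.coeffs ∈ Reg M b := x.2

theorem Symb.ext {x y : Symb M b} (h : x.coeffs = y.coeffs) : x = y := Subtype.ext h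

/-- The symbol with the given coefficients. -/
def Symb.mk (a : Op M) (ha : a ∈ Reg M b) : Symb M b := ⟨a, ha⟩

theorem Symb.coeffs_mk (a : Op M) (ha : a ∈ Reg M b) : (Symb.mk a ha).coeffs = a := rfl

noncomputable instance : Mul (Symb M b) := ⟨fun x y => Symb.mk _ (conv_mem x.mem y.mem)⟩

noncomputable instance : One (Symb M b) := ⟨Symb.mk (Pi.single 0 1) (single_mem_Reg 0 1)⟩

theorem Symb.coeffs_mul (x y : Symb M b) : (x * y).coeffs = conv x.coeffs y.coeffs := rfl

theorem Symb.mul_comm' (x y : Symb M b) : x * y = y * x := Symb.ext (conv_comm x.mem y.mem)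

theorem Symb.mul_add' (x y z : Symb M b) : x * (y + z) = x * y + x * z :=
  Symb.ext (by
    rw [map_add, Symb.coeffs_mul, Symb.coeffs_mul, Symb.coeffs_mul, map_add,
      conv_add x.mem y.mem z.mem])

theorem Symb.one_mul' (x : Symb M b) : 1 * x = x := Symb.ext (one_conv x.coeffs)

noncomputable instance : CommRing (Symb M b) :=
  { (inferInstance : AddCommGroup (Symb M b)) with
    mul_comm := Symb.mul_comm'
    mul_assoc := fun x y z => Symb.ext (conv_assoc x.mem y.mem z.mem)
    left_distrib := Symb.mul_add'
    right_distrib := fun x y z => by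
      rw [Symb.mul_comm', Symb.mul_add', Symb.mul_comm' z, Symb.mul_comm' z]
    one_mul := Symb.one_mul'
    mul_one := fun x => by rw [Symb.mul_comm', Symb.one_mul']
    zero_mul := fun x => by
      rw [Symb.mul_comm']
      have := Symb.mul_add' x 0 0
      rw [add_zero] at this
      simpa using this
    mul_zero := fun x => by
      have := Symb.mul_add' x 0 0
      rw [add_zero] at this
      simpa using this }

theorem Symb.smul_mul' (z : ℂ) (x y : Symb M b) : (z • x) * y = z • (x * y) :=
  Symb.ext (smul_conv x.mem y.mem z)

noncomputable instance : Algebra ℂ (Symb M b) :=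
  Algebra.ofModule Symb.smul_mul' fun z x y => by
    rw [mul_comm, Symb.smul_mul', mul_comm]

/-- The symbols all of whose coefficients have degree at least `K`. -/
noncomputable def symbGE (M : CoordManifold) (b : Bool) (K : ℤ) : Submodule ℂ (Symb M b) where
  carrier := {x | ∀ i, x.coeffs i ∈ degGE M K}
  zero_mem' := fun _ => Submodule.zero_mem _
  add_mem' := fun ha hb i => Submodule.add_mem _ (ha i) (hb i)
  smul_mem' := fun z _ ha i => Submodule.smul_mem _ z (ha i)

theorem mem_symbGE {K : ℤ} {x : Symb M b} :
    x ∈ symbGE M b K ↔ ∀ i, x.coeffs i ∈ degGE M K := Iff.rfl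

theorem hasFSum_coeffs {ι : Type*} {t : ι → Symb M b} {x : Symb M b}
    (h : HasFSum (symbGE M b) t x) (n : ℤ) :
    HasFSum (degGE M) (fun j => (t j).coeffs n) (x.coeffs n) := by
  intro K
  filter_upwards [h K] with T hT
  have := mem_symbGE.1 hT n
  rwa [map_sub, map_sum, Pi.sub_apply, Finset.sum_apply] at this

/-- The filtration by the degree of all the coefficients is complete: the sums exist
coefficientwise, and the limit still satisfies the condition at infinity. -/
theorem Symb.complete {ι : Type} (t : ι → Symb M b) (ht : TendsZero (symbGE M b) t) :
    ∃ x, HasFSum (symbGE M b) t x := by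
  have h1 : ∀ n, HasFSum (degGE M) (fun j => (t j).coeffs n) (fsum fun j => (t j).coeffs n) :=
    fun n => hasFSum_fsum fun K => (ht K).subset fun j hj hmem => hj (hmem n)
  -- Modulo terms of degree `K`, the sum equals a finite partial sum, in all coefficients at once.
  have h2 : ∀ K : ℤ, ∀ T : Finset ι, (ht K).toFinset ⊆ T → ∀ n,
      (fsum fun j => (t j).coeffs n) - ∑ j ∈ T, (t j).coeffs n ∈ degGE M K := by
    intro K T hT n
    classical
    obtain ⟨T', h3, h4⟩ := ((h1 n K).and (Filter.eventually_ge_atTop T)).exists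
    have h5 : ∑ j ∈ T' \ T, (t j).coeffs n ∈ degGE M K :=
      Submodule.sum_mem _ fun j hj => by
        by_contra hcon
        refine (Finset.mem_sdiff.1 hj).2 (hT ?_)
        rw [Set.Finite.mem_toFinset]
        exact fun hmem => hcon (hmem n)
    have h6 := Submodule.add_mem _ h3 h5
    have h7 := Finset.sum_sdiff h4 (f := fun j => (t j).coeffs n)
    rwa [← h7, sub_add_eq_sub_sub, sub_add_eq_add_sub, sub_add_cancel] at h6
  have hmem : (fun n => fsum fun j => (t j).coeffs n) ∈ Reg M b := by
    intro K
    have h3 : ∑ j ∈ (ht K).toFinset, (t j).coeffs ∈ Reg M b :=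
      Submodule.sum_mem _ fun j _ => (t j).mem
    obtain ⟨N, hN⟩ := h3 K
    refine ⟨N, fun i hi => ?_⟩
    have h4 := Submodule.add_mem _ (h2 K _ le_rfl i) (hN i hi)
    rwa [Finset.sum_apply, sub_add_cancel] at h4
  refine ⟨Symb.mk _ hmem, fun K => ?_⟩
  filter_upwards [Filter.eventually_ge_atTop (ht K).toFinset] with T hT
  refine mem_symbGE.2 fun n => ?_
  rw [map_sub, map_sum, Pi.sub_apply, Finset.sum_apply, Symb.coeffs_mk]
  exact h2 K T hT n

/-- The derivation `∂/∂ξ` on sequences of coefficients. -/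
noncomputable def dxiOp : Op M →ₗ[ℂ] Op M :=
  LinearMap.pi fun n => ((n + 1 : ℤ) : ℂ) • LinearMap.proj (n + 1)

/-- The derivation `D` applied to the coefficients. -/
noncomputable def dxOp : Op M →ₗ[ℂ] Op M := LinearMap.pi fun n => D ∘ₗ LinearMap.proj n

theorem dxiOp_mem {a : Op M} (ha : a ∈ Reg M b) : dxiOp a ∈ Reg M b := by
  intro K
  obtain ⟨N, hN⟩ := ha K
  refine ⟨N + 1, fun i hi => Submodule.smul_mem _ _ (hN _ ?_)⟩
  cases b <;> simp only [orient_false, orient_true] at * <;> omega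

theorem dxOp_mem {a : Op M} (ha : a ∈ Reg M b) : dxOp a ∈ Reg M b := by
  intro K
  obtain ⟨N, hN⟩ := ha K
  exact ⟨N, fun i hi => degGE_le (by omega) (D_mem_degGE (hN i hi))⟩

/-- `∂/∂ξ` on symbols. -/
noncomputable def Symb.dxi : Module.End ℂ (Symb M b) :=
  (dxiOp (M := M)).restrict (p := Reg M b) (q := Reg M b) fun _ ha => dxiOp_mem ha

/-- `D` on symbols. -/
noncomputable def Symb.dx : Module.End ℂ (Symb M b) :=
  (dxOp (M := M)).restrict (p := Reg M b) (q := Reg M b) fun _ ha => dxOp_mem ha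

theorem Symb.coeffs_dxi (x : Symb M b) (n : ℤ) :
    (Symb.dxi x).coeffs n = ((n + 1 : ℤ) : ℂ) • x.coeffs (n + 1) := rfl

theorem Symb.coeffs_dx (x : Symb M b) (n : ℤ) : (Symb.dx x).coeffs n = D (x.coeffs n) := rfl

theorem Symb.dxi_mul (x y : Symb M b) :
    Symb.dxi (x * y) = Symb.dxi x * y + x * Symb.dxi y := by
  refine Symb.ext (funext fun n => ?_)
  rw [Symb.coeffs_dxi, map_add, Pi.add_apply, Symb.coeffs_mul, Symb.coeffs_mul, Symb.coeffs_mul]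
  have h1 := (hasFSum_conv x.mem y.mem (n + 1)).smul ((n + 1 : ℤ) : ℂ)
  have h2 := (hasFSum_conv (Symb.dxi x).mem y.mem n).equiv (Equiv.subRight (1 : ℤ))
  have h3 := hasFSum_conv x.mem (Symb.dxi y).mem n
  refine h1.eq ?_
  refine cast (congrArg₂ _ (funext fun i => ?_) rfl) (h2.add h3)
  rw [Equiv.subRight_apply, Symb.coeffs_dxi, Symb.coeffs_dxi, sub_add_cancel, smul_mul_assoc,
    mul_smul_comm, show n - (i - 1) = n + 1 - i by ring, show n - i + 1 = n + 1 - i by ring,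
    ← add_smul]
  congr 1
  push_cast
  ring

theorem Symb.dx_mul (x y : Symb M b) : Symb.dx (x * y) = Symb.dx x * y + x * Symb.dx y := by
  refine Symb.ext (funext fun n => ?_)
  rw [Symb.coeffs_dx, map_add, Pi.add_apply, Symb.coeffs_mul, Symb.coeffs_mul, Symb.coeffs_mul]
  have h1 := (hasFSum_conv x.mem y.mem n).D_pow 1
  simp only [pow_one] at h1
  refine h1.eq ?_
  refine cast (congrArg₂ _ (funext fun i => ?_) rfl)
    ((hasFSum_conv (Symb.dx x).mem y.mem n).add (hasFSum_conv x.mem (Symb.dx y).mem n))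
  rw [D_mul, Symb.coeffs_dx, Symb.coeffs_dx]

theorem Symb.dxi_comm : Commute (Symb.dxi : Module.End ℂ (Symb M b)) Symb.dx := by
  refine LinearMap.ext fun x => Symb.ext (funext fun n => ?_)
  rw [Module.End.mul_apply, Module.End.mul_apply, Symb.coeffs_dxi, Symb.coeffs_dx,
    Symb.coeffs_dx, Symb.coeffs_dxi, map_smul]

/-- The filtered algebra of symbols, with the derivations `∂/∂ξ` and `D`. -/
noncomputable def symbData (M : CoordManifold) (b : Bool) : StarData (Symb M b) where
  W := symbGE M b
  anti := fun _ _ h _ hx i => degGE_le h (hx i)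
  mem_zero := fun _ _ => mem_degGE_of_nonpos le_rfl _
  eq_zero := fun _ h => Symb.ext (funext fun n => eq_zero_of_mem_degGE _ fun K => h K n)
  complete := Symb.complete
  mul_mem' := fun {K L x y} hx hy n => conv_mem_degGE x.mem y.mem n K L hx hy
  dxi := Symb.dxi
  dx := Symb.dx
  dxi_mul := Symb.dxi_mul
  dx_mul := Symb.dx_mul
  comm := Symb.dxi_comm
  dxi_mem := fun hx i => Submodule.smul_mem _ _ (hx (i + 1))
  dx_mem := fun hx i => D_mem_degGE (hx i)

theorem succ_mul_choose (x : ℤ) (r : ℕ) :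
    ((r + 1 : ℕ) : ℤ) * Ring.choose (x + 1) (r + 1) = (x + 1) * Ring.choose x r := by
  have h := Ring.choose_smul_choose (x + 1) (n := r + 1) (k := 1) (by omega)
  simpa using h

theorem Symb.coeffs_dp_dxi (x : Symb M b) (r : ℕ) (n : ℤ) :
    (dp r Symb.dxi x).coeffs n = Ring.choose (n + r) r • x.coeffs (n + r) := by
  have h : ∀ r : ℕ, ∀ x : Symb M b, ((Symb.dxi ^ r) x).coeffs n =
      ((r.factorial * Ring.choose (n + r) r : ℤ) : ℂ) • x.coeffs (n + r) := by
    intro r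
    induction r with
    | zero => intro x; simp
    | succ r ih =>
      intro x
      rw [pow_succ, Module.End.mul_apply, ih, Symb.coeffs_dxi, smul_smul, ← Int.cast_mul,
        Nat.factorial_succ]
      have h1 := succ_mul_choose (n + r) r
      push_cast at h1 ⊢
      rw [← add_assoc]
      congr 1
      have h2 : (((r : ℤ) + 1) * Ring.choose (n + r + 1) (r + 1) : ℂ) =
        ((n + r + 1) * Ring.choose (n + (r : ℤ)) r : ℂ) := by exact_mod_cast h1
      push_cast at h2
      linear_combination (-(r.factorial : ℂ)) * h2
  rw [dp, LinearMap.smul_apply, map_smul, Pi.smul_apply, h, smul_smul]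
  push_cast
  rw [inv_mul_cancel_left₀ (by exact_mod_cast r.factorial_ne_zero), Int.cast_smul_eq_zsmul]

theorem Symb.coeffs_dx_pow (x : Symb M b) (r : ℕ) (n : ℤ) :
    ((Symb.dx ^ r) x).coeffs n = (D ^ r) (x.coeffs n) := by
  induction r generalizing x with
  | zero => rfl
  | succ r ih => rw [pow_succ, pow_succ, Module.End.mul_apply, Module.End.mul_apply, ih,
      Symb.coeffs_dx]

/-! ### The product of operators -/

theorem tendsZero_mul {a c : Op M} (ha : a ∈ Reg M b) (hc : c ∈ Reg M b) (n : ℤ) :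
    TendsZero (degGE M) fun p : ℤ × ℕ =>
      Ring.choose p.1 p.2 • (a p.1 * (D ^ p.2) (c (n - p.1 + p.2))) := by
  intro K
  obtain ⟨N, hN⟩ := ha K
  obtain ⟨N', hN'⟩ := hc K
  have key : ∀ p : ℤ × ℕ, Ring.choose p.1 p.2 • (a p.1 * (D ^ p.2) (c (n - p.1 + p.2))) ∉
      degGE M K → orient b p.1 ≤ N ∧ orient b (n - p.1 + p.2) ≤ N' ∧ (p.2 : ℤ) < K := by
    intro p hp
    refine ⟨?_, ?_, ?_⟩ <;> by_contra hcon <;> refine hp (zsmul_mem ?_ _)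
    · exact mul_mem_degGE_left (hN _ (not_le.1 hcon)) _
    · exact mul_mem_degGE_right (degGE_le (by omega)
        (D_pow_mem_degGE (hN' _ (not_le.1 hcon)) p.2)) _
    · exact mul_mem_degGE_right (degGE_le (not_lt.1 hcon) (D_pow_mem_degGE' _ _)) _
  cases b
  · refine (Finset.Icc (-N) (N' + n + K) ×ˢ
      Finset.range K.toNat).finite_toSet.subset fun p hp => ?_
    have := key p hp
    simp only [orient_false] at this
    rw [Finset.mem_coe, Finset.mem_product, Finset.mem_Icc, Finset.mem_range]
    omega
  · refine (Finset.Icc (n - N') N ×ˢ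
      Finset.range K.toNat).finite_toSet.subset fun p hp => ?_
    have := key p hp
    simp only [orient_true] at this
    rw [Finset.mem_coe, Finset.mem_product, Finset.mem_Icc, Finset.mem_range]
    omega

theorem hasFSum_mul {a c : Op M} (ha : a ∈ Reg M b) (hc : c ∈ Reg M b) (n : ℤ) :
    HasFSum (degGE M) (fun p : ℤ × ℕ =>
      Ring.choose p.1 p.2 • (a p.1 * (D ^ p.2) (c (n - p.1 + p.2)))) ((a ⋆ c) n) :=
  hasFSum_fsum (tendsZero_mul ha hc n)

/-- The product of operators is the star product of their symbols. -/
theorem coeffs_star (x y : Symb M b) :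
    ((symbData M b).star x y).coeffs = x.coeffs ⋆ y.coeffs := by
  funext n
  have h1 := hasFSum_coeffs ((symbData M b).hasFSum_star x y) n
  refine h1.eq ((hasFSum_mul x.mem y.mem n).prod_swap fun r => ?_)
  have h2 := (hasFSum_conv (dp r Symb.dxi x).mem ((Symb.dx ^ r) y).mem n).equiv
    (Equiv.subRight (r : ℤ))
  refine cast (congrArg₂ _ (funext fun i => ?_) rfl) h2
  rw [Equiv.subRight_apply, Symb.coeffs_dp_dxi, Symb.coeffs_dx_pow, sub_add_cancel,
    smul_mul_assoc, show n - (i - r) = n - i + r by ring]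

end Symbols

/-! ### The algebras of pseudo-differential operators -/

section Operators

variable {M : CoordManifold} {b : Bool}

theorem mul_mem_Reg {a c : Op M} (ha : a ∈ Reg M b) (hc : c ∈ Reg M b) : a ⋆ c ∈ Reg M b := by
  have := coeffs_star (Symb.mk a ha) (Symb.mk c hc)
  rw [Symb.coeffs_mk, Symb.coeffs_mk] at this
  rw [← this]
  exact Symb.mem _

/-- The ring of pseudo-differential operators with underlying space `Reg M b`. -/
def Psd (M : CoordManifold) (b : Bool) : Type := Reg M b

noncomputable instance : AddCommGroup (Psd M b) := inferInstanceAs (AddCommGroup (Reg M b))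

noncomputable instance : Module ℂ (Psd M b) := inferInstanceAs (Module ℂ (Reg M b))

/-- The coefficients of an operator. -/
def Psd.op : Psd M b →ₗ[ℂ] Op M := (Reg M b).subtype

theorem Psd.mem (x : Psd M b) : x.op ∈ Reg M b := x.2

theorem Psd.ext {x y : Psd M b} (h : x.op = y.op) : x = y := Subtype.ext h

/-- The operator with the given coefficients. -/
def Psd.mk (a : Op M) (ha : a ∈ Reg M b) : Psd M b := ⟨a, ha⟩

/-- The symbol of an operator. -/
noncomputable def Psd.symb : Psd M b →ₗ[ℂ] Symb M b := LinearMap.id (M := Reg M b)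

theorem Psd.coeffs_symb (x : Psd M b) : x.symb.coeffs = x.op := rfl

theorem Psd.symb_injective {x y : Psd M b} (h : x.symb = y.symb) : x = y := h

noncomputable instance : Mul (Psd M b) :=
  ⟨fun x y => Psd.mk (x.op ⋆ y.op) (mul_mem_Reg x.mem y.mem)⟩

noncomputable instance : One (Psd M b) := ⟨Psd.mk (Dpow 0) (single_mem_Reg 0 1)⟩

theorem Psd.op_mul (x y : Psd M b) : (x * y).op = x.op ⋆ y.op := rfl

theorem Psd.symb_mul (x y : Psd M b) : (x * y).symb = (symbData M b).star x.symb y.symb :=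
  Symb.ext (by rw [coeffs_star, Psd.coeffs_symb, Psd.op_mul, Psd.coeffs_symb, Psd.coeffs_symb])

theorem Psd.symb_one : (1 : Psd M b).symb = 1 := rfl

noncomputable instance : Ring (Psd M b) :=
  { (inferInstance : AddCommGroup (Psd M b)) with
    mul_assoc := fun x y z => Psd.symb_injective (by
      simp only [Psd.symb_mul, StarData.star_assoc])
    left_distrib := fun x y z => Psd.symb_injective (by
      simp only [Psd.symb_mul, map_add, StarData.star_add_right])
    right_distrib := fun x y z => Psd.symb_injective (by
      simp only [Psd.symb_mul, map_add, StarData.star_add_left])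
    one_mul := fun x => Psd.symb_injective (by
      rw [Psd.symb_mul, Psd.symb_one, StarData.one_star])
    mul_one := fun x => Psd.symb_injective (by
      rw [Psd.symb_mul, Psd.symb_one, StarData.star_one])
    zero_mul := fun x => Psd.symb_injective (by
      rw [Psd.symb_mul, map_zero]
      simpa using (symbData M b).star_add_left 0 0 x.symb)
    mul_zero := fun x => Psd.symb_injective (by
      rw [Psd.symb_mul, map_zero]
      simpa using (symbData M b).star_add_right x.symb 0 0) }

noncomputable instance : Algebra ℂ (Psd M b) :=
  Algebra.ofModule (fun z x y => Psd.symb_injective (by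
    simp only [Psd.symb_mul, map_smul, StarData.star_smul_left])) fun z x y =>
      Psd.symb_injective (by simp only [Psd.symb_mul, map_smul, StarData.star_smul_right])

theorem mul_assoc_Reg {a c d : Op M} (ha : a ∈ Reg M b) (hc : c ∈ Reg M b) (hd : d ∈ Reg M b) :
    a ⋆ c ⋆ d = a ⋆ (c ⋆ d) :=
  congrArg Psd.op (mul_assoc (Psd.mk a ha) (Psd.mk c hc) (Psd.mk d hd))

theorem add_mul_Reg {a c d : Op M} (ha : a ∈ Reg M b) (hc : c ∈ Reg M b) (hd : d ∈ Reg M b) :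
    (a + c) ⋆ d = a ⋆ d + c ⋆ d :=
  congrArg Psd.op (add_mul (Psd.mk a ha) (Psd.mk c hc) (Psd.mk d hd))

theorem mul_add_Reg {a c d : Op M} (ha : a ∈ Reg M b) (hc : c ∈ Reg M b) (hd : d ∈ Reg M b) :
    a ⋆ (c + d) = a ⋆ c + a ⋆ d :=
  congrArg Psd.op (mul_add (Psd.mk a ha) (Psd.mk c hc) (Psd.mk d hd))

theorem smul_mul_Reg {a c : Op M} (ha : a ∈ Reg M b) (hc : c ∈ Reg M b) (z : ℂ) :
    (z • a) ⋆ c = z • (a ⋆ c) :=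
  congrArg Psd.op (smul_mul_assoc z (Psd.mk a ha) (Psd.mk c hc))

theorem mul_smul_Reg {a c : Op M} (ha : a ∈ Reg M b) (hc : c ∈ Reg M b) (z : ℂ) :
    a ⋆ (z • c) = z • (a ⋆ c) :=
  congrArg Psd.op (mul_smul_comm z (Psd.mk a ha) (Psd.mk c hc))

theorem neg_mul_Reg {a c : Op M} (ha : a ∈ Reg M b) (hc : c ∈ Reg M b) :
    (-a) ⋆ c = -(a ⋆ c) :=
  congrArg Psd.op (neg_mul (Psd.mk a ha) (Psd.mk c hc))

theorem mul_neg_Reg {a c : Op M} (ha : a ∈ Reg M b) (hc : c ∈ Reg M b) :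
    a ⋆ (-c) = -(a ⋆ c) :=
  congrArg Psd.op (mul_neg (Psd.mk a ha) (Psd.mk c hc))

/-! ### The adjoint -/

theorem ofCoeff_apply {V : Type*} [AddCommGroup V] [Module ℂ V]
    (L : (Coord × ℕ →₀ ℕ) → V →ₗ[ℂ] Smooth M) (x : V) (m : Coord × ℕ →₀ ℕ) :
    ofCoeff L x m = L m x := rfl

theorem hasFSum_adj (a : Op M) (n : ℤ) : HasFSum (degGE M) (fun r : ℕ =>
    ((n + r).negOnePow * Ring.choose (n + r) r : ℤ) • (D ^ r) (a (n + r))) (adj a n) := by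
  have hz : TendsZero (degGE M) (fun r : ℕ =>
      ((n + r).negOnePow * Ring.choose (n + r) r : ℤ) • (D ^ r) (a (n + r))) :=
    tendsZero_nat degGE_antitone fun r => zsmul_mem (D_pow_mem_degGE' _ _) _
  convert hasFSum_fsum hz using 1
  refine ext_coeffL fun m => ?_
  have e : coeffL m (adj a n) = ∑ r ∈ Finset.range (deg m + 1),
      coeffL m (((n + r).negOnePow * Ring.choose (n + r) r : ℤ) • (D ^ r) (a (n + r))) := by
    have h1 : coeffL m (adj a n) = (ofCoeff (fun m => ∑ r ∈ Finset.range (deg m + 1),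
        ((n + r).negOnePow * Ring.choose (n + r) r : ℤ) •
          (coeffL m ∘ₗ (D ^ r) ∘ₗ LinearMap.proj (n + r))) : Op M →ₗ[ℂ] DiffPoly M) a m := by
      rw [adj, LinearMap.pi_apply]
      rfl
    rw [h1, ofCoeff_apply, LinearMap.sum_apply]
    refine Finset.sum_congr rfl fun r _ => ?_
    rw [LinearMap.smul_apply, map_zsmul]
    rfl
  rw [coeffL_fsum, e]
  refine (finsum_eq_sum_of_support_subset _ fun r hr => ?_).symm
  rw [Finset.coe_range, Set.mem_Iio]
  by_contra hcon
  exact hr (zsmul_mem (D_pow_mem_degGE' (a (n + r)) r) _ m (by omega))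

theorem adj_eq {a : Op M} {n : ℤ} {x : DiffPoly M} (h : HasFSum (degGE M) (fun r : ℕ =>
    ((n + r).negOnePow * Ring.choose (n + r) r : ℤ) • (D ^ r) (a (n + r))) x) : adj a n = x :=
  (hasFSum_adj a n).eq h

theorem negOnePow_smul (n : ℤ) (f : DiffPoly M) :
    ((n.negOnePow : ℤ) : ℂ) • f = (n.negOnePow : ℤ) • f := Int.cast_smul_eq_zsmul ..

/-- The substitution `ξ ↦ -ξ` on symbols. -/
noncomputable def Symb.flip : Symb M b →ₗ[ℂ] Symb M b :=
  (LinearMap.pi fun n => ((n.negOnePow : ℤ) : ℂ) • LinearMap.proj n :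
    Op M →ₗ[ℂ] Op M).restrict (p := Reg M b) (q := Reg M b) fun a ha K => by
      obtain ⟨N, hN⟩ := ha K
      exact ⟨N, fun i hi => Submodule.smul_mem _ _ (hN i hi)⟩

theorem Symb.coeffs_flip (x : Symb M b) (n : ℤ) :
    (Symb.flip x).coeffs n = (n.negOnePow : ℤ) • x.coeffs n :=
  negOnePow_smul n (x.coeffs n)

theorem negOnePow_mul_self (n : ℤ) : (n.negOnePow : ℤ) * (n.negOnePow : ℤ) = 1 := by
  rcases Int.even_or_odd n with h | h
  · simp [Int.negOnePow_even n h]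
  · simp [Int.negOnePow_odd n h]

theorem Symb.flip_flip (x : Symb M b) : Symb.flip (Symb.flip x) = x :=
  Symb.ext (funext fun n => by
    rw [Symb.coeffs_flip, Symb.coeffs_flip, smul_smul, negOnePow_mul_self, one_smul])

theorem Symb.flip_mul (x y : Symb M b) : Symb.flip (x * y) = Symb.flip x * Symb.flip y := by
  refine Symb.ext (funext fun n => ?_)
  rw [Symb.coeffs_flip, Symb.coeffs_mul, Symb.coeffs_mul]
  refine HasFSum.eq ?_ (hasFSum_conv (Symb.flip x).mem (Symb.flip y).mem n)
  have h := (hasFSum_conv x.mem y.mem n).smul (n.negOnePow : ℤ)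
  rw [negOnePow_smul] at h
  refine cast (congrArg₂ _ (funext fun i => ?_) rfl) h
  rw [negOnePow_smul, Symb.coeffs_flip, Symb.coeffs_flip, smul_mul_assoc, mul_smul_comm, smul_smul]
  congr 1
  rw [← Units.val_mul, ← Int.negOnePow_add]
  congr 2
  ring

theorem Symb.coeffs_dp_lap (x : Symb M b) (r : ℕ) (n : ℤ) :
    (dp r (Symb.dxi * Symb.dx) x).coeffs n =
      Ring.choose (n + r) r • (D ^ r) (x.coeffs (n + r)) := by
  have h : dp r (Symb.dxi * Symb.dx : Module.End ℂ (Symb M b)) = dp r Symb.dxi * Symb.dx ^ r := by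
    rw [dp, dp, Symb.dxi_comm.mul_pow, smul_mul_assoc]
  rw [h, Module.End.mul_apply, Symb.coeffs_dp_dxi, Symb.coeffs_dx_pow]

theorem coeffs_lap_flip (x : Symb M b) :
    ((symbData M b).lap (Symb.flip x)).coeffs = adj x.coeffs := by
  funext n
  refine (adj_eq ?_).symm
  refine cast (congrArg₂ _ (funext fun r => ?_) rfl)
    (hasFSum_coeffs ((symbData M b).hasFSum_lap (Symb.flip x)) n)
  change (dp r (Symb.dxi * Symb.dx) (Symb.flip x)).coeffs n = _
  rw [Symb.coeffs_dp_lap, Symb.coeffs_flip, map_zsmul, smul_smul, mul_comm]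

theorem adj_mem_Reg {a : Op M} (ha : a ∈ Reg M b) : adj a ∈ Reg M b := by
  have := coeffs_lap_flip (Symb.mk a ha)
  rw [Symb.coeffs_mk] at this
  rw [← this]
  exact Symb.mem _

/-- The adjoint on `Psd M b`. -/
noncomputable def Psd.adj : Psd M b →ₗ[ℂ] Psd M b :=
  (BKP.adj (M := M)).restrict (p := Reg M b) (q := Reg M b) fun _ ha => adj_mem_Reg ha

theorem Psd.op_adj (x : Psd M b) : x.adj.op = BKP.adj x.op := rfl

theorem Psd.symb_adj (x : Psd M b) : x.adj.symb = (symbData M b).lap (Symb.flip x.symb) :=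
  Symb.ext (by rw [coeffs_lap_flip, Psd.coeffs_symb, Psd.op_adj, Psd.coeffs_symb])

theorem Symb.flip_dxi (x : Symb M b) : Symb.flip (Symb.dxi x) = (-Symb.dxi) (Symb.flip x) := by
  refine Symb.ext (funext fun n => ?_)
  rw [LinearMap.neg_apply, map_neg, Pi.neg_apply, Symb.coeffs_dxi, Symb.coeffs_flip,
    Symb.coeffs_dxi, Symb.coeffs_flip, Int.negOnePow_succ, Units.val_neg, neg_smul, smul_neg,
    neg_neg, smul_comm]

theorem Symb.flip_dx (x : Symb M b) : Symb.flip (Symb.dx x) = Symb.dx (Symb.flip x) :=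
  Symb.ext (funext fun n => by
    rw [Symb.coeffs_flip, Symb.coeffs_dx, Symb.coeffs_dx, Symb.coeffs_flip, map_zsmul])

theorem Symb.flip_mem {K : ℤ} {x : Symb M b} (hx : x ∈ symbGE M b K) :
    Symb.flip x ∈ symbGE M b K := fun i => by
  rw [Symb.coeffs_flip]
  exact zsmul_mem (hx i) _

/-- The adjoint reverses products. -/
theorem Psd.adj_mul (x y : Psd M b) : (x * y).adj = y.adj * x.adj :=
  Psd.symb_injective (by
    rw [Psd.symb_adj, Psd.symb_mul, Psd.symb_mul, Psd.symb_adj, Psd.symb_adj]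
    exact (symbData M b).lap_star Symb.flip Symb.flip_mul Symb.flip_mem Symb.flip_dxi
      Symb.flip_dx _ _)

theorem Psd.adj_adj (x : Psd M b) : x.adj.adj = x :=
  Psd.symb_injective (by
    rw [Psd.symb_adj, Psd.symb_adj]
    refine (symbData M b).lap_neg ?_
    have h := (symbData M b).hasFSum_map ((symbData M b).hasFSum_lap (Symb.flip x.symb))
      Symb.flip Symb.flip_mem
    have h1 : ∀ y : Symb M b, Symb.flip (((symbData M b).dxi * (symbData M b).dx) y) =
        (-((symbData M b).dxi * (symbData M b).dx)) (Symb.flip y) := fun y => by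
      rw [LinearMap.neg_apply, Module.End.mul_apply, Module.End.mul_apply]
      exact (Symb.flip_dxi _).trans (by
        rw [show Symb.flip ((symbData M b).dx y) = (symbData M b).dx (Symb.flip y) from
          Symb.flip_dx y]
        rfl)
    refine cast (congrArg₂ _ (funext fun r => ?_) rfl) h
    rw [dp_comp (f := Symb.flip) h1, Symb.flip_flip])

theorem adj_mul_Reg {a c : Op M} (ha : a ∈ Reg M b) (hc : c ∈ Reg M b) :
    adj (a ⋆ c) = adj c ⋆ adj a :=
  congrArg Psd.op (Psd.adj_mul (Psd.mk a ha) (Psd.mk c hc))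

theorem adj_adj_Reg {a : Op M} (ha : a ∈ Reg M b) : adj (adj a) = a :=
  congrArg Psd.op (Psd.adj_adj (Psd.mk a ha))

/-! ### The trace -/

/-- The residue of a commutator is a total derivative. -/
theorem res_mul_comm {a c : Op M} (ha : a ∈ Reg M b) (hc : c ∈ Reg M b) :
    res (a ⋆ c) - res (c ⋆ a) ∈ LinearMap.range (D (M := M)) := by
  let τ : Symb M b →ₗ[ℂ] DiffPoly M ⧸ LinearMap.range (D (M := M)) :=
    (LinearMap.range (D (M := M))).mkQ ∘ₗ LinearMap.proj (-1) ∘ₗ Symb.coeffs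
  have hτ : ∀ x : Symb M b, τ x = 0 ↔ x.coeffs (-1) ∈ LinearMap.range (D (M := M)) := fun x =>
    Submodule.Quotient.mk_eq_zero _
  have h := (symbData M b).trace_star τ
    (fun {t x} hx h => (hτ x).2 ((hasFSum_coeffs hx (-1)).mem_range_D fun j => (hτ _).1 (h j)))
    (fun x => (hτ _).2 (by
      change (Symb.dxi x).coeffs (-1) ∈ _
      rw [Symb.coeffs_dxi]
      simp))
    (fun x => (hτ _).2 ⟨x.coeffs (-1), rfl⟩) (Symb.mk a ha) (Symb.mk c hc)
  rw [← sub_eq_zero, ← map_sub, hτ, map_sub, coeffs_star, coeffs_star] at h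
  exact h

theorem integral_eq_zero_iff {f : DiffPoly M} :
    integral f = 0 ↔ f ∈ trivialDensities M := by
  rw [← LinearMap.mem_ker, integral, Submodule.ker_mkQ]

theorem integral_eq_of_sub_mem {f g : DiffPoly M} (h : f - g ∈ LinearMap.range (D (M := M))) :
    integral (M := M) f = integral (M := M) g :=
  (Submodule.Quotient.eq (trivialDensities M)).2 (Submodule.mem_sup_left h)

/-- The trace `∫ res a dx`. -/
noncomputable def Psd.tr (x : Psd M b) : LocalFunctional M := integral (M := M) (res x.op)

theorem Psd.tr_add (x y : Psd M b) : (x + y).tr = x.tr + y.tr :=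
  (integral (M := M)).map_add (res x.op) (res y.op)

theorem Psd.tr_sub (x y : Psd M b) : (x - y).tr = x.tr - y.tr :=
  (integral (M := M)).map_sub (res x.op) (res y.op)

theorem Psd.tr_neg (x : Psd M b) : (-x).tr = -x.tr :=
  (integral (M := M)).map_neg (res x.op)

theorem Psd.tr_smul (z : ℂ) (x : Psd M b) : (z • x).tr = z • x.tr :=
  (integral (M := M)).map_smul z (res x.op)

theorem Psd.tr_mul_comm (x y : Psd M b) : (x * y).tr = (y * x).tr :=
  integral_eq_of_sub_mem (res_mul_comm x.mem y.mem)

theorem res_adj (a : Op M) : res (adj a) = -res a := by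
  refine adj_eq ?_
  have h := hasFSum_single (W := degGE M) (fun r : ℕ =>
    ((-1 + (r : ℤ)).negOnePow * Ring.choose (-1 + (r : ℤ)) r : ℤ) • (D ^ r) (a (-1 + r))) 0
    fun r hr => by
      have : Ring.choose (-1 + (r : ℤ)) r = 0 := by
        obtain ⟨r, rfl⟩ := Nat.exists_eq_succ_of_ne_zero hr
        rw [show (-1 + ((r.succ : ℕ) : ℤ)) = (r : ℤ) by push_cast; ring, Ring.choose_natCast]
        simp
      rw [this, mul_zero, zero_zsmul]
  simpa [res] using h

theorem Psd.tr_adj (x : Psd M b) : x.adj.tr = -x.tr := by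
  rw [Psd.tr, Psd.op_adj, res_adj, (integral (M := M)).map_neg, Psd.tr]

/-! ### Positive and negative parts -/

theorem fsum_mem_degGE {ι : Type*} {t : ι → DiffPoly M} {K : ℤ} (h : ∀ j, t j ∈ degGE M K) :
    fsum t ∈ degGE M K := fun m hm => by
  rw [coeffL_fsum, finsum_congr fun j => h j m hm, finsum_zero]

theorem fsum_eq_zero {ι : Type*} {t : ι → DiffPoly M} (h : ∀ j, t j = 0) : fsum t = 0 :=
  eq_zero_of_mem_degGE _ fun K => fsum_mem_degGE fun j => by rw [h j]; exact Submodule.zero_mem _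

theorem pos_add_neg (a : Op M) : pos a + neg a = a := by
  funext i
  by_cases h : 0 ≤ i
  · simp [pos, neg, h, not_lt.2 h]
  · simp [pos, neg, h, not_le.1 h]

/-- The projection to the positive part, as a linear map. -/
def posL : Op M →ₗ[ℂ] Op M where
  toFun := pos
  map_add' a c := by funext i; by_cases h : 0 ≤ i <;> simp [pos, h]
  map_smul' z a := by funext i; by_cases h : 0 ≤ i <;> simp [pos, h]

/-- The projection to the negative part, as a linear map. -/
def negL : Op M →ₗ[ℂ] Op M where
  toFun := neg
  map_add' a c := by funext i; by_cases h : i < 0 <;> simp [neg, h]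
  map_smul' z a := by funext i; by_cases h : i < 0 <;> simp [neg, h]

theorem pos_eq (a : Op M) : pos a = posL a := rfl

theorem neg_eq (a : Op M) : neg a = negL a := rfl

theorem pos_apply {a : Op M} {i : ℤ} (h : 0 ≤ i) : pos a i = a i := if_pos h

theorem pos_apply_of_neg {a : Op M} {i : ℤ} (h : i < 0) : pos a i = 0 := if_neg (not_le.2 h)

theorem neg_apply {a : Op M} {i : ℤ} (h : i < 0) : neg a i = a i := if_pos h

theorem neg_apply_of_nonneg {a : Op M} {i : ℤ} (h : 0 ≤ i) : neg a i = 0 := if_neg (not_lt.2 h)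

theorem neg_eq_zero_iff {a : Op M} : neg a = 0 ↔ ∀ i < 0, a i = 0 := by
  refine ⟨fun h i hi => by rw [← neg_apply (a := a) hi, h]; rfl, fun h => funext fun i => ?_⟩
  by_cases hi : i < 0
  · rw [neg_apply hi, h i hi]; rfl
  · exact if_neg hi

theorem pos_eq_zero_iff {a : Op M} : pos a = 0 ↔ ∀ i, 0 ≤ i → a i = 0 := by
  refine ⟨fun h i hi => by rw [← pos_apply (a := a) hi, h]; rfl, fun h => funext fun i => ?_⟩
  by_cases hi : 0 ≤ i
  · rw [pos_apply hi, h i hi]; rfl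
  · exact if_neg hi

theorem neg_pos (a : Op M) : neg (pos a) = 0 := neg_eq_zero_iff.2 fun _ h => pos_apply_of_neg h

theorem pos_neg (a : Op M) : pos (neg a) = 0 := pos_eq_zero_iff.2 fun _ h => neg_apply_of_nonneg h

theorem pos_of_neg_eq_zero {a : Op M} (h : neg a = 0) : pos a = a := by
  conv_rhs => rw [← pos_add_neg a, h, add_zero]

theorem neg_of_pos_eq_zero {a : Op M} (h : pos a = 0) : neg a = a := by
  conv_rhs => rw [← pos_add_neg a, h, zero_add]

theorem mem_Reg_of_pos {a : Op M} (h : pos a = 0) : a ∈ Reg M true := fun K =>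
  ⟨0, fun i hi => by
    rw [pos_eq_zero_iff.1 h i (le_of_lt hi)]
    exact Submodule.zero_mem _⟩

theorem mem_Reg_of_neg {a : Op M} (h : neg a = 0) : a ∈ Reg M false := fun K =>
  ⟨0, fun i hi => by
    rw [orient_false] at hi
    rw [neg_eq_zero_iff.1 h i (by omega)]
    exact Submodule.zero_mem _⟩

theorem pos_mem_Reg {a : Op M} (ha : a ∈ Reg M b) : pos a ∈ Reg M b := fun K => by
  obtain ⟨N, hN⟩ := ha K
  refine ⟨N, fun i hi => ?_⟩
  by_cases h : 0 ≤ i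
  · rw [pos_apply h]; exact hN i hi
  · rw [pos_apply_of_neg (not_le.1 h)]; exact Submodule.zero_mem _

theorem neg_mem_Reg {a : Op M} (ha : a ∈ Reg M b) : neg a ∈ Reg M b := fun K => by
  obtain ⟨N, hN⟩ := ha K
  refine ⟨N, fun i hi => ?_⟩
  by_cases h : i < 0
  · rw [neg_apply h]; exact hN i hi
  · rw [neg_apply_of_nonneg (not_lt.1 h)]; exact Submodule.zero_mem _

theorem choose_eq_zero {i : ℤ} {r : ℕ} (h0 : 0 ≤ i) (h : i < r) : Ring.choose i r = 0 := by
  lift i to ℕ using h0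
  rw [Ring.choose_natCast, Nat.choose_eq_zero_of_lt (by exact_mod_cast h)]
  rfl

/-- Differential operators form a subalgebra. -/
theorem neg_mul_eq_zero {a c : Op M} (ha : neg a = 0) (hc : neg c = 0) : neg (a ⋆ c) = 0 := by
  rw [neg_eq_zero_iff] at *
  refine fun n hn => fsum_eq_zero fun p => ?_
  by_cases h1 : p.1 < 0
  · rw [ha _ h1, zero_mul, zsmul_zero]
  by_cases h2 : n - p.1 + p.2 < 0
  · rw [hc _ h2, map_zero, mul_zero, zsmul_zero]
  · rw [choose_eq_zero (by omega) (by omega), zero_zsmul]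

/-- Operators of negative order form a subalgebra. -/
theorem pos_mul_eq_zero {a c : Op M} (ha : pos a = 0) (hc : pos c = 0) : pos (a ⋆ c) = 0 := by
  rw [pos_eq_zero_iff] at *
  refine fun n hn => fsum_eq_zero fun p => ?_
  by_cases h1 : 0 ≤ p.1
  · rw [ha _ h1, zero_mul, zsmul_zero]
  · rw [hc _ (by omega), map_zero, mul_zero, zsmul_zero]

theorem res_mul_of_neg {a c : Op M} (ha : neg a = 0) (hc : neg c = 0) : res (a ⋆ c) = 0 :=
  neg_eq_zero_iff.1 (neg_mul_eq_zero ha hc) _ (by norm_num)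

theorem res_mul_of_pos {a c : Op M} (ha : pos a = 0) (hc : pos c = 0) : res (a ⋆ c) = 0 := by
  rw [pos_eq_zero_iff] at *
  refine fsum_eq_zero fun p => ?_
  by_cases h1 : 0 ≤ p.1
  · rw [ha _ h1, zero_mul, zsmul_zero]
  · rw [hc _ (by omega), map_zero, mul_zero, zsmul_zero]

theorem neg_adj_eq_zero {a : Op M} (ha : neg a = 0) : neg (adj a) = 0 := by
  rw [neg_eq_zero_iff] at *
  refine fun n hn => adj_eq ?_
  refine cast (congrArg₂ _ (funext fun r => ?_) rfl) (hasFSum_zero (ι := ℕ))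
  by_cases h : n + r < 0
  · rw [ha _ h, map_zero, zsmul_zero]
  · rw [choose_eq_zero (by omega) (by omega), mul_zero, zero_zsmul]

theorem pos_adj_eq_zero {a : Op M} (ha : pos a = 0) : pos (adj a) = 0 := by
  rw [pos_eq_zero_iff] at *
  refine fun n hn => adj_eq ?_
  refine cast (congrArg₂ _ (funext fun r => ?_) rfl) (hasFSum_zero (ι := ℕ))
  rw [ha _ (by omega), map_zero, zsmul_zero]

theorem adj_pos (a : Op M) : adj (pos a) = pos (adj a) := by
  have h : adj a = adj (pos a) + adj (neg a) := by rw [← map_add, pos_add_neg]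
  rw [h, pos_eq (_ + _), map_add, ← pos_eq, ← pos_eq,
    pos_of_neg_eq_zero (neg_adj_eq_zero (neg_pos a)), pos_adj_eq_zero (pos_neg a), add_zero]

theorem adj_neg (a : Op M) : adj (neg a) = neg (adj a) := by
  have h : adj a = adj (pos a) + adj (neg a) := by rw [← map_add, pos_add_neg]
  rw [h, neg_eq (_ + _), map_add, ← neg_eq, ← neg_eq,
    neg_of_pos_eq_zero (pos_adj_eq_zero (pos_neg a)), neg_adj_eq_zero (neg_pos a), zero_add]

/-! ### Operators of the first and of the second type -/

theorem mem_Dplus {a : Op M} : a ∈ Dplus M ↔ ∃ d : ℤ, ∀ i, a i ∈ degGE M (d - i) := Iff.rfl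

theorem Dminus_le : Dminus M ≤ Reg M true := fun a ⟨N, hN⟩ _ => ⟨N, fun i hi => by
  rw [hN i hi]
  exact Submodule.zero_mem _⟩

theorem Dplus_le : Dplus M ≤ Reg M false := fun a ha K => by
  obtain ⟨d, hd⟩ := mem_Dplus.1 ha
  exact ⟨K - d, fun i hi => degGE_le (by rw [orient_false] at hi; omega) (hd i)⟩

theorem mul_apply_eq_zero {a c : Op M} {N N' : ℤ} (ha : ∀ i, N < i → a i = 0)
    (hc : ∀ i, N' < i → c i = 0) {n : ℤ} (hn : N + N' < n) : (a ⋆ c) n = 0 :=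
  fsum_eq_zero fun p => by
    by_cases h1 : N < p.1
    · rw [ha _ h1, zero_mul, zsmul_zero]
    · rw [hc _ (by omega), map_zero, mul_zero, zsmul_zero]

theorem mul_mem_Dminus {a c : Op M} (ha : a ∈ Dminus M) (hc : c ∈ Dminus M) :
    a ⋆ c ∈ Dminus M := by
  obtain ⟨N, hN⟩ := ha
  obtain ⟨N', hN'⟩ := hc
  exact ⟨N + N', fun n hn => mul_apply_eq_zero hN hN' hn⟩

theorem mul_apply_mem_degGE {a c : Op M} {d d' : ℤ} (ha : ∀ i, a i ∈ degGE M (d - i))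
    (hc : ∀ i, c i ∈ degGE M (d' - i)) (n : ℤ) : (a ⋆ c) n ∈ degGE M (d + d' - n) :=
  fsum_mem_degGE fun p => zsmul_mem (degGE_le (by omega)
    (mul_mem_degGE (ha p.1) (D_pow_mem_degGE (hc (n - p.1 + p.2)) p.2))) _

theorem mul_mem_Dplus {a c : Op M} (ha : a ∈ Dplus M) (hc : c ∈ Dplus M) :
    a ⋆ c ∈ Dplus M := by
  obtain ⟨d, hd⟩ := mem_Dplus.1 ha
  obtain ⟨d', hd'⟩ := mem_Dplus.1 hc
  exact mem_Dplus.2 ⟨d + d', mul_apply_mem_degGE hd hd'⟩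

theorem adj_mem_Dminus {a : Op M} (ha : a ∈ Dminus M) : adj a ∈ Dminus M := by
  obtain ⟨N, hN⟩ := ha
  refine ⟨N, fun n hn => adj_eq ?_⟩
  refine cast (congrArg₂ _ (funext fun r => ?_) rfl) (hasFSum_zero (ι := ℕ))
  rw [hN _ (by omega), map_zero, zsmul_zero]

theorem adj_mem_Dplus {a : Op M} (ha : a ∈ Dplus M) : adj a ∈ Dplus M := by
  obtain ⟨d, hd⟩ := mem_Dplus.1 ha
  exact mem_Dplus.2 ⟨d, fun n => (hasFSum_adj a n).mem le_rfl fun r => zsmul_mem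
    (degGE_le (by omega) (D_pow_mem_degGE (hd (n + r)) r)) _⟩

theorem neg_mem_Dminus (a : Op M) : neg a ∈ Dminus M :=
  ⟨0, fun _ hn => neg_apply_of_nonneg hn.le⟩

theorem pos_mem_Dplus (a : Op M) : pos a ∈ Dplus M :=
  mem_Dplus.2 ⟨0, fun n => by
    by_cases h : 0 ≤ n
    · exact mem_degGE_of_nonpos (by omega) _
    · rw [pos_apply_of_neg (not_le.1 h)]; exact Submodule.zero_mem _⟩

theorem single_mem_Dminus (j : ℤ) (f : DiffPoly M) : (Pi.single j f : Op M) ∈ Dminus M :=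
  ⟨j, fun _ hi => Pi.single_eq_of_ne (ne_of_gt hi) _⟩

theorem single_mem_Dplus (j : ℤ) (f : DiffPoly M) : (Pi.single j f : Op M) ∈ Dplus M :=
  mem_Dplus.2 ⟨j, fun i => by
    by_cases h : i = j
    · exact mem_degGE_of_nonpos (by omega) _
    · rw [Pi.single_eq_of_ne h]; exact Submodule.zero_mem _⟩

theorem mem_symmOps {a : Op M} : a ∈ symmOps M ↔ adj a = a := by
  rw [symmOps, LinearMap.mem_ker, LinearMap.sub_apply, Module.End.one_apply, sub_eq_zero]

theorem mem_skewOps {a : Op M} : a ∈ skewOps M ↔ adj a = -a := by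
  rw [skewOps, LinearMap.mem_ker, LinearMap.add_apply, Module.End.one_apply,
    add_eq_zero_iff_eq_neg]

end Operators

/-! ### Operators with a symmetry are determined by every other coefficient -/

section Parity

variable {M : CoordManifold} {b : Bool}

/-- The leading term of the coefficients of the adjoint. -/
theorem adj_sub_mem {a : Op M} {N : ℤ → Submodule ℂ (DiffPoly M)} {K : ℤ}
    (hD : ∀ n f, f ∈ N (n + 1) → D f ∈ N n) (ha : ∀ n, a n ∈ N n ⊔ degGE M K) (n : ℤ) :
    adj a n - (n.negOnePow : ℤ) • a n ∈ N n ⊔ degGE M (K + 1) := by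
  have hDr : ∀ (r : ℕ) (n : ℤ) (f : DiffPoly M), f ∈ N (n + r) ⊔ degGE M K →
      (D ^ r) f ∈ N n ⊔ degGE M (K + r) := by
    intro r n f hf
    obtain ⟨f₁, h1, f₂, h2, rfl⟩ := Submodule.mem_sup.1 hf
    rw [map_add]
    refine Submodule.add_mem_sup ?_ (D_pow_mem_degGE h2 r)
    clear hf h2
    induction r generalizing f₁ with
    | zero => simpa using h1
    | succ r ih =>
      rw [pow_succ, Module.End.mul_apply]
      refine ih _ (hD _ _ ?_)
      rwa [show n + (r : ℤ) + 1 = n + ((r + 1 : ℕ) : ℤ) by push_cast; ring]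
  have h1 := (hasFSum_adj a n).sub (hasFSum_single (W := degGE M) (fun r : ℕ => if r = 0 then
    ((n + r).negOnePow * Ring.choose (n + r) r : ℤ) • (D ^ r) (a (n + r)) else 0) 0
    fun j hj => if_neg hj)
  rw [if_pos rfl] at h1
  have e : ((n + (0 : ℕ)).negOnePow * Ring.choose (n + (0 : ℕ)) 0 : ℤ) •
      (D ^ 0) (a (n + (0 : ℕ))) = (n.negOnePow : ℤ) • a n := by simp
  rw [e] at h1
  refine h1.mem (K := K + 1) le_sup_right fun r => ?_
  by_cases hr : r = 0
  · rw [if_pos hr, sub_self]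
    exact Submodule.zero_mem _
  · rw [if_neg hr, sub_zero]
    refine zsmul_mem ?_ _
    refine (sup_le_sup_left (degGE_antitone ?_) _) (hDr r n _ (ha (n + r)))
    omega

/-- If every coefficient of an operator `a` lies in a given subspace, or can be recovered from
`a + a^*` modulo that subspace and coefficients of higher order, then all the coefficients lie in
the given subspaces, up to terms of arbitrarily high degree. -/
theorem mem_of_parity {a : Op M} {N : ℤ → Submodule ℂ (DiffPoly M)}
    (hD : ∀ n f, f ∈ N (n + 1) → D f ∈ N n)
    (h : ∀ n, a n ∈ N n ∨ a n + (n.negOnePow : ℤ) • adj a n ∈ N n) (n K : ℤ) :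
    a n ∈ N n ⊔ degGE M K := by
  have key : ∀ k : ℕ, ∀ n, a n ∈ N n ⊔ degGE M k := by
    intro k
    induction k with
    | zero => exact fun n => Submodule.mem_sup_right (mem_degGE_of_nonpos (by norm_num) _)
    | succ k ih =>
      intro n
      rcases h n with h | h
      · exact Submodule.mem_sup_left h
      have h1 := zsmul_mem (adj_sub_mem hD ih n) (n.negOnePow : ℤ)
      rw [zsmul_sub, ← mul_zsmul, negOnePow_mul_self, one_zsmul] at h1
      have h2 := Submodule.smul_mem _ (2⁻¹ : ℂ) (Submodule.sub_mem _ (Submodule.mem_sup_left h) h1)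
      have e : (2⁻¹ : ℂ) • (a n + (n.negOnePow : ℤ) • adj a n -
          ((n.negOnePow : ℤ) • adj a n - a n)) = a n := by
        rw [show a n + (n.negOnePow : ℤ) • adj a n - ((n.negOnePow : ℤ) • adj a n - a n) =
          (2 : ℂ) • a n by rw [two_smul]; abel, smul_smul]
        norm_num
      rw [e] at h2
      exact_mod_cast h2
  exact sup_le_sup_left (degGE_antitone (Int.self_le_toNat K)) _ (key K.toNat n)

/-- A skew operator whose odd coefficients lie in open subspaces compatible with `D` has all
its coefficients there. -/
theorem mem_of_skew {a : Op M} (ha : adj a = -a) {N : ℤ → Submodule ℂ (DiffPoly M)}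
    (hD : ∀ n f, f ∈ N (n + 1) → D f ∈ N n) (hN : ∀ n, ∃ K, degGE M K ≤ N n)
    (h : ∀ n, Odd n → a n ∈ N n) (n : ℤ) : a n ∈ N n := by
  obtain ⟨K, hK⟩ := hN n
  have := mem_of_parity (a := a) hD (fun n => by
    rcases Int.even_or_odd n with hn | hn
    · right
      rw [ha, Int.negOnePow_even n hn, Pi.neg_apply, Units.val_one, one_zsmul, add_neg_cancel]
      exact Submodule.zero_mem _
    · exact Or.inl (h n hn)) n K
  rwa [sup_eq_left.2 hK] at this

theorem eq_zero_of_parity {a : Op M}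
    (h : ∀ n, a n = 0 ∨ a n + (n.negOnePow : ℤ) • adj a n = 0) : a = 0 :=
  funext fun n => eq_zero_of_mem_degGE _ fun K => by
    simpa using mem_of_parity (a := a) (N := fun _ => ⊥)
      (fun _ f hf => by rw [(Submodule.mem_bot ℂ).1 hf, map_zero]; exact Submodule.zero_mem _)
      (fun n => by simpa only [Submodule.mem_bot] using h n) n K

theorem eq_zero_of_skew {a : Op M} (ha : adj a = -a) (h : ∀ n, Odd n → a n = 0) : a = 0 :=
  eq_zero_of_parity fun n => by
    rcases Int.even_or_odd n with hn | hn
    · right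
      rw [ha, Int.negOnePow_even n hn, Pi.neg_apply, Units.val_one, one_zsmul, add_neg_cancel]
    · exact Or.inl (h n hn)

theorem eq_zero_of_symm {a : Op M} (ha : adj a = a) (h : ∀ n, Even n → a n = 0) : a = 0 :=
  eq_zero_of_parity fun n => by
    rcases Int.even_or_odd n with hn | hn
    · exact Or.inl (h n hn)
    · right
      rw [ha, Int.negOnePow_odd n hn, Units.val_neg, Units.val_one, neg_one_zsmul, add_neg_cancel]

/-- The correction of the even coefficients in the construction of a skew operator with
prescribed odd coefficients. -/
noncomputable def skewStep : Op M →ₗ[ℂ] Op M :=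
  LinearMap.pi fun n => if Even n then
    (-(2⁻¹ : ℂ)) • (LinearMap.proj n ∘ₗ (adj - 1 : Op M →ₗ[ℂ] Op M)) else 0

theorem skewStep_even {n : ℤ} (hn : Even n) (a : Op M) :
    skewStep a n = -(2⁻¹ : ℂ) • (adj a n - a n) := by
  rw [skewStep, LinearMap.pi_apply, if_pos hn]
  rfl

theorem skewStep_odd {n : ℤ} (hn : Odd n) (a : Op M) : skewStep a n = 0 := by
  rw [skewStep, LinearMap.pi_apply, if_neg (Int.not_even_iff_odd.2 hn)]
  rfl

theorem skewStep_mem {a : Op M} {K : ℤ} (ha : ∀ n, a n ∈ degGE M K) (n : ℤ) :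
    skewStep a n ∈ degGE M (K + 1) := by
  rcases Int.even_or_odd n with hn | hn
  · rw [skewStep_even hn]
    have := adj_sub_mem (a := a) (N := fun _ => ⊥) (K := K)
      (fun _ f hf => by rw [(Submodule.mem_bot ℂ).1 hf, map_zero]; exact Submodule.zero_mem _)
      (fun n => by rw [bot_sup_eq]; exact ha n) n
    rw [bot_sup_eq, Int.negOnePow_even n hn, Units.val_one, one_zsmul] at this
    exact Submodule.smul_mem _ _ this
  · rw [skewStep_odd hn]
    exact Submodule.zero_mem _

/-- There is a skew operator with prescribed odd coefficients `c`. The set `Z` is a set of indices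
such that the operators with vanishing coefficients there are stable under the adjoint. -/
theorem exists_skew {c : Op M} {Z : Set ℤ} (hodd : ∀ n, Even n → c n = 0)
    (hZ : ∀ a : Op M, (∀ n ∈ Z, a n = 0) → a ∈ Reg M b ∧ ∀ n ∈ Z, adj a n = 0)
    (hc : ∀ n ∈ Z, c n = 0) :
    ∃ a : Op M, adj a = -a ∧ (∀ n, Odd n → a n = c n) ∧ ∀ n ∈ Z, a n = 0 := by
  have hpow : ∀ k : ℕ, ∀ n, (skewStep ^ k) c n ∈ degGE M k := by
    intro k
    induction k with
    | zero => exact fun n => mem_degGE_of_nonpos (by norm_num) _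
    | succ k ih =>
      intro n
      rw [pow_succ', Module.End.mul_apply]
      exact_mod_cast skewStep_mem ih n
  have hpowZ : ∀ k : ℕ, ∀ n ∈ Z, (skewStep ^ k) c n = 0 := by
    intro k
    induction k with
    | zero => exact hc
    | succ k ih =>
      intro n hn
      rw [pow_succ', Module.End.mul_apply]
      rcases Int.even_or_odd n with h | h
      · rw [skewStep_even h, ih n hn, (hZ _ ih).2 n hn, sub_zero, smul_zero]
      · exact skewStep_odd h _
  -- The solution of `a = c + skewStep a`, as a Neumann series.
  let a : Op M := fun n => fsum fun k => (skewStep ^ k) c n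
  have haZ : ∀ n ∈ Z, a n = 0 := fun n hn => fsum_eq_zero fun k => hpowZ k n hn
  have hrem : ∀ K : ℕ, ∀ n, (a - ∑ k ∈ Finset.range K, (skewStep ^ k) c) n ∈ degGE M K := by
    intro K n
    have h1 : HasFSum (degGE M) (fun k => (skewStep ^ k) c n) (a n) :=
      hasFSum_fsum (tendsZero_nat degGE_antitone fun k => hpow k n)
    have h2 := h1.sub (hasFSum_of_subset (W := degGE M)
      (fun k => if k < K then (skewStep ^ k) c n else 0) (Finset.range K) fun j hj =>
        if_neg fun h => hj (Finset.mem_range.2 h))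
    have e : ∑ k ∈ Finset.range K, (if k < K then (skewStep ^ k) c n else 0) =
        (∑ k ∈ Finset.range K, (skewStep ^ k) c) n := by
      rw [Finset.sum_apply]
      exact Finset.sum_congr rfl fun k hk => if_pos (Finset.mem_range.1 hk)
    rw [e] at h2
    refine h2.mem (K := K) le_rfl fun k => ?_
    by_cases hk : k < K
    · rw [if_pos hk, sub_self]; exact Submodule.zero_mem _
    · rw [if_neg hk, sub_zero]; exact degGE_le (by omega) (hpow k n)
  have hfix : a = c + skewStep a := by
    refine sub_eq_zero.1 (funext fun n => eq_zero_of_mem_degGE _ fun K => ?_)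
    refine degGE_le (Int.self_le_toNat K) ?_
    set k := K.toNat
    set R := a - ∑ k ∈ Finset.range k, (skewStep ^ k) c
    have e : a - (c + skewStep a) = R - (skewStep ^ k) c - skewStep R := by
      have e1 : a = ∑ k ∈ Finset.range k, (skewStep ^ k) c + R := by simp [R]
      have e2 : skewStep (∑ k ∈ Finset.range k, (skewStep ^ k) c) + c =
          ∑ k ∈ Finset.range k, (skewStep ^ k) c + (skewStep ^ k) c := by
        rw [map_sum, ← Finset.sum_range_succ, Finset.sum_range_succ']
        congr 1
        refine Finset.sum_congr rfl fun j _ => ?_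
        rw [pow_succ', Module.End.mul_apply]
      have e3 : skewStep a = skewStep (∑ k ∈ Finset.range k, (skewStep ^ k) c) + skewStep R := by
        rw [← map_add, ← e1]
      rw [e3]
      nth_rewrite 1 [e1]
      rw [show c + (skewStep (∑ k ∈ Finset.range k, (skewStep ^ k) c) + skewStep R) =
        skewStep (∑ k ∈ Finset.range k, (skewStep ^ k) c) + c + skewStep R by abel, e2]
      abel
    rw [e]
    exact Submodule.sub_mem _ (Submodule.sub_mem _ (hrem k n) (hpow k n))
      (degGE_le (by omega) (skewStep_mem (hrem k) n))
  refine ⟨a, ?_, fun n hn => ?_, haZ⟩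
  · have hs : a + adj a = 0 := by
      refine eq_zero_of_symm ?_ fun n hn => ?_
      · rw [map_add, adj_adj_Reg (hZ a haZ).1, add_comm]
      · have h1 := congrFun hfix n
        rw [Pi.add_apply, hodd n hn, zero_add, skewStep_even hn] at h1
        have h2 := congrArg (fun x => (2 : ℂ) • x) h1
        simp only [smul_smul] at h2
        rw [show (2 : ℂ) * -2⁻¹ = -1 by norm_num, two_smul, neg_one_smul, neg_sub] at h2
        rw [Pi.add_apply]
        have h3 : a n + adj a n = a n + a n - (a n - adj a n) := by abel
        rw [h3, h2, sub_self]
    rw [eq_neg_iff_add_eq_zero, add_comm]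
    exact hs
  · rw [hfix, Pi.add_apply, skewStep_odd hn, add_zero]

end Parity

/-! ### Products with monomials -/

section Monomials

variable {M : CoordManifold} {b : Bool}

theorem mul_apply_eq {a c : Op M} {n : ℤ} {x : DiffPoly M}
    (h : HasFSum (degGE M) (fun p : ℤ × ℕ =>
      Ring.choose p.1 p.2 • (a p.1 * (D ^ p.2) (c (n - p.1 + p.2)))) x) : (a ⋆ c) n = x :=
  h.eq_fsum.symm

/-- If there is only one nonzero summand, the product can be read off. -/
theorem mul_apply_single {a c : Op M} {n : ℤ} (p : ℤ × ℕ) (h : ∀ q : ℤ × ℕ, q ≠ p →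
      Ring.choose q.1 q.2 • (a q.1 * (D ^ q.2) (c (n - q.1 + q.2))) = 0) :
    (a ⋆ c) n = Ring.choose p.1 p.2 • (a p.1 * (D ^ p.2) (c (n - p.1 + p.2))) :=
  mul_apply_eq (hasFSum_single _ p h)

theorem ofFun_mul_apply (f : DiffPoly M) (a : Op M) (n : ℤ) : (ofFun f ⋆ a) n = f * a n := by
  rw [mul_apply_single (0, 0)]
  · simp [ofFun]
  · rintro ⟨i, r⟩ h
    by_cases hi : i = 0
    · subst hi
      have hr : r ≠ 0 := fun hr => h (by rw [hr])
      rw [choose_eq_zero le_rfl (by omega), zero_zsmul]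
    · rw [ofFun, Pi.single_eq_of_ne hi, zero_mul, zsmul_zero]

theorem mul_Dpow_apply (a : Op M) (j n : ℤ) : (a ⋆ Dpow j) n = a (n - j) := by
  rw [mul_apply_single (n - j, 0)]
  · simp [Dpow]
  · rintro ⟨i, r⟩ h
    by_cases hi : n - i + r = j
    · have hr : r ≠ 0 := fun hr => h (by subst hr; congr; omega)
      obtain ⟨r, rfl⟩ := Nat.exists_eq_succ_of_ne_zero hr
      rw [hi, Dpow, Pi.single_eq_same, pow_succ, Module.End.mul_apply, D_one, map_zero, mul_zero,
        zsmul_zero]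
    · rw [Dpow, Pi.single_eq_of_ne hi, map_zero, mul_zero, zsmul_zero]

/-- The top coefficient of a product. -/
theorem mul_apply_top {a c : Op M} {N N' : ℤ} (ha : ∀ i, N < i → a i = 0)
    (hc : ∀ i, N' < i → c i = 0) : (a ⋆ c) (N + N') = a N * c N' := by
  rw [mul_apply_single (N, 0)]
  · simp
  · rintro ⟨i, r⟩ h
    by_cases hi : N < i
    · rw [ha _ hi, zero_mul, zsmul_zero]
    · rw [hc _ ?_, map_zero, mul_zero, zsmul_zero]
      by_contra hcon
      exact h (by rw [Prod.mk.injEq]; omega)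

theorem ofFun_mem_Reg (f : DiffPoly M) : ofFun f ∈ Reg M b := single_mem_Reg 0 f

theorem Dpow_mem_Reg (j : ℤ) : (Dpow j : Op M) ∈ Reg M b := single_mem_Reg j 1

theorem adj_Dpow (j : ℤ) : adj (Dpow j : Op M) = (j.negOnePow : ℤ) • Dpow j := by
  funext n
  refine adj_eq ?_
  by_cases hn : n = j
  · subst hn
    have h := hasFSum_single (W := degGE M) (fun r : ℕ =>
      ((n + (r : ℤ)).negOnePow * Ring.choose (n + (r : ℤ)) r : ℤ) •
        (D ^ r) ((Dpow n : Op M) (n + r))) 0 fun r hr => by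
          rw [Dpow, Pi.single_eq_of_ne (by omega), map_zero, zsmul_zero]
    simpa [Dpow] using h
  · refine cast (congrArg₂ _ (funext fun r => ?_) ?_) (hasFSum_zero (ι := ℕ))
    · by_cases h : n + r = j
      · have hr : r ≠ 0 := by omega
        obtain ⟨r, rfl⟩ := Nat.exists_eq_succ_of_ne_zero hr
        rw [h, Dpow, Pi.single_eq_same, pow_succ, Module.End.mul_apply, D_one, map_zero,
          zsmul_zero]
      · rw [Dpow, Pi.single_eq_of_ne h, map_zero, zsmul_zero]
    · rw [Pi.smul_apply, Dpow, Pi.single_eq_of_ne hn, zsmul_zero]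

theorem adj_ofFun (f : DiffPoly M) : adj (ofFun f) = ofFun f := by
  funext n
  refine adj_eq ?_
  by_cases hn : n = 0
  · subst hn
    have h := hasFSum_single (W := degGE M) (fun r : ℕ =>
      ((0 + (r : ℤ)).negOnePow * Ring.choose (0 + (r : ℤ)) r : ℤ) •
        (D ^ r) ((ofFun f : Op M) (0 + r))) 0 fun r hr => by
          rw [ofFun, Pi.single_eq_of_ne (by omega), map_zero, zsmul_zero]
    simpa [ofFun] using h
  · refine cast (congrArg₂ _ (funext fun r => ?_) ?_) (hasFSum_zero (ι := ℕ))
    · by_cases h : n + r = 0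
      · rw [h, choose_eq_zero le_rfl (by omega), mul_zero, zero_zsmul]
      · rw [ofFun, Pi.single_eq_of_ne h, map_zero, zsmul_zero]
    · rw [ofFun, Pi.single_eq_of_ne hn]

theorem adj_Dpow_one : adj (Dpow 1 : Op M) = -Dpow 1 := by
  rw [adj_Dpow, Int.negOnePow_one, Units.val_neg, Units.val_one, neg_one_zsmul]

theorem adj_Dpow_neg_one : adj (Dpow (-1) : Op M) = -Dpow (-1) := by
  rw [adj_Dpow, Int.negOnePow_neg, Int.negOnePow_one, Units.val_neg, Units.val_one, neg_one_zsmul]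

theorem fDg_apply (f g : DiffPoly M) {n : ℤ} (hn : 0 ≤ n) :
    (ofFun f ⋆ Dpow (-1) ⋆ ofFun g) n = 0 :=
  mul_apply_eq_zero (N := -1) (N' := 0)
    (fun i hi => by rw [ofFun_mul_apply, Dpow, Pi.single_eq_of_ne (by omega), mul_zero])
    (fun i hi => by rw [ofFun, Pi.single_eq_of_ne (by omega)]) (by omega)

theorem fDg_apply_neg_one (f g : DiffPoly M) : (ofFun f ⋆ Dpow (-1) ⋆ ofFun g) (-1) = f * g := by
  have := mul_apply_top (a := ofFun f ⋆ Dpow (-1)) (c := ofFun g) (N := -1) (N' := 0)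
    (fun i hi => by rw [ofFun_mul_apply, Dpow, Pi.single_eq_of_ne (by omega), mul_zero])
    (fun i hi => by rw [ofFun, Pi.single_eq_of_ne (by omega)])
  rw [add_zero, ofFun_mul_apply] at this
  simpa [Dpow, ofFun] using this

theorem pos_fDg (f g : DiffPoly M) : pos (ofFun f ⋆ Dpow (-1) ⋆ ofFun g) = 0 :=
  pos_eq_zero_iff.2 fun _ hi => fDg_apply f g hi

theorem adj_fDg (f g : DiffPoly M) :
    adj (ofFun f ⋆ Dpow (-1) ⋆ ofFun g) = -(ofFun g ⋆ Dpow (-1) ⋆ ofFun f) := by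
  have h : ∀ {f : DiffPoly M}, ofFun f ∈ Reg M true := fun {f} => ofFun_mem_Reg f
  have hD : (Dpow (-1) : Op M) ∈ Reg M true := Dpow_mem_Reg _
  rw [adj_mul_Reg (mul_mem_Reg h hD) h, adj_mul_Reg h hD, adj_ofFun, adj_ofFun, adj_Dpow_neg_one,
    neg_mul_Reg hD h, mul_neg_Reg h (mul_mem_Reg hD h), mul_assoc_Reg h hD h]

theorem fDg_mem_Dplus (f g : DiffPoly M) : ofFun f ⋆ Dpow (-1) ⋆ ofFun g ∈ Dplus M :=
  mul_mem_Dplus (mul_mem_Dplus (single_mem_Dplus _ _) (single_mem_Dplus _ _))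
    (single_mem_Dplus _ _)

end Monomials

/-! ### The generic point -/

section Generic

variable {M : CoordManifold}

theorem two_mul_rho_mul_pd {ρ : Smooth M} (hρ : ρ * ρ = coord (Sum.inr 0)) (k : Coord) :
    2 * ρ * pd k ρ = if k = Sum.inr 0 then 1 else 0 := by
  rw [← pd_coord, ← hρ, pd_mul]
  ring

theorem pd_rho {ρ : Smooth M} (hρ : ρ * ρ = coord (Sum.inr 0)) {k : Coord}
    (hk : k ≠ Sum.inr 0) : pd k ρ = 0 := by
  have h1 := two_mul_rho_mul_pd hρ (Sum.inr 0)
  have h2 := two_mul_rho_mul_pd hρ k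
  rw [if_pos rfl] at h1
  rw [if_neg hk] at h2
  calc pd k ρ = (2 * ρ * pd (Sum.inr 0) ρ) * pd k ρ := by rw [h1, one_mul]
    _ = pd (Sum.inr 0) ρ * (2 * ρ * pd k ρ) := by ring
    _ = 0 := by rw [h2, mul_zero]

theorem IsCosetPoint.skew_fst {r : DiffPoly M} {A : Op M × Op M} (h : IsCosetPoint r A) :
    adj A.1 = -A.1 := by
  have := mem_skewOps.1 h.1.1.2
  rw [map_sub, adj_Dpow_one, neg_sub, sub_neg_eq_add] at this
  have h2 := congrArg (fun x => x - Dpow 1) this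
  simpa [sub_eq_add_neg] using h2

theorem IsCosetPoint.skew_snd {r : DiffPoly M} {A : Op M × Op M} (h : IsCosetPoint r A) :
    adj A.2 = -A.2 := by
  have := mem_skewOps.1 h.2.1.2
  rw [map_sub, adj_fDg, neg_sub, sub_neg_eq_add] at this
  have h2 := congrArg (fun x => x - ofFun r ⋆ Dpow (-1) ⋆ ofFun r) this
  simpa [sub_eq_add_neg] using h2

theorem IsCosetPoint.fst_mem {r : DiffPoly M} {A : Op M × Op M} (h : IsCosetPoint r A) :
    A.1 ∈ Dminus M := by
  have := Submodule.add_mem _ h.1.1.1 (single_mem_Dminus (M := M) 1 1)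
  rwa [← Dpow, sub_add_cancel] at this

theorem IsCosetPoint.snd_mem {r : DiffPoly M} {A : Op M × Op M} (h : IsCosetPoint r A) :
    A.2 ∈ Dplus M := by
  have := Submodule.add_mem _ h.2.1.1 (fDg_mem_Dplus r r)
  rwa [sub_add_cancel] at this

theorem IsCosetPoint.fst_apply {r : DiffPoly M} {A : Op M × Op M} (h : IsCosetPoint r A)
    {n : ℤ} (hn : 0 ≤ n) : A.1 n = (Dpow 1 : Op M) n :=
  sub_eq_zero.1 (pos_eq_zero_iff.1 h.1.2 n hn)

theorem IsCosetPoint.snd_apply {r : DiffPoly M} {A : Op M × Op M} (h : IsCosetPoint r A)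
    {n : ℤ} (hn : n < 0) : A.2 n = (ofFun r ⋆ Dpow (-1) ⋆ ofFun r) n :=
  sub_eq_zero.1 (neg_eq_zero_iff.1 h.2.2 n hn)

/-- Uniqueness of the generic point. -/
theorem IsGenericPoint.eq {ρ : Smooth M} {A B : Op M × Op M} (hA : IsGenericPoint ρ A)
    (hB : IsGenericPoint ρ B) : A = B := by
  refine Prod.ext (sub_eq_zero.1 (eq_zero_of_skew ?_ fun n hn => ?_))
    (sub_eq_zero.1 (eq_zero_of_skew ?_ fun n hn => ?_))
  · rw [map_sub, hA.1.skew_fst, hB.1.skew_fst, neg_sub_neg, neg_sub]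
  · rw [Pi.sub_apply, sub_eq_zero]
    rcases lt_or_ge n 0 with h | h
    · obtain ⟨k, rfl⟩ := hn
      obtain ⟨i, rfl⟩ : ∃ i : ℕ, k = -(i : ℤ) - 1 := ⟨(-k - 1).toNat, by omega⟩
      rw [show 2 * (-(i : ℤ) - 1) + 1 = -2 * i - 1 by ring, hA.2.1, hB.2.1]
    · rw [hA.1.fst_apply h, hB.1.fst_apply h]
  · rw [map_sub, hA.1.skew_snd, hB.1.skew_snd, neg_sub_neg, neg_sub]
  · rw [Pi.sub_apply, sub_eq_zero]
    rcases lt_or_ge n 0 with h | h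
    · rw [hA.1.snd_apply h, hB.1.snd_apply h]
    · obtain ⟨k, rfl⟩ := hn
      obtain ⟨i, rfl⟩ : ∃ i : ℕ, k = (i : ℤ) - 1 := ⟨(k + 1).toNat, by omega⟩
      rw [show 2 * ((i : ℤ) - 1) + 1 = 2 * i - 1 by ring, hA.2.2 i (by omega),
        hB.2.2 i (by omega)]

theorem existsUnique_isGenericPoint (ρ : Smooth M) : ∃! A, IsGenericPoint ρ A := by
  obtain ⟨a, ha, ha', haZ⟩ := exists_skew (M := M) (b := true) (Z := {n | 0 ≤ n})
    (c := fun n => if n < 0 ∧ Odd n then jet (Sum.inl ((-n - 1) / 2).toNat) 0 else 0)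
    (fun n hn => if_neg fun h => Int.not_even_iff_odd.2 h.2 hn)
    (fun a ha => ⟨mem_Reg_of_pos (pos_eq_zero_iff.2 ha),
      pos_eq_zero_iff.1 (pos_adj_eq_zero (pos_eq_zero_iff.2 ha))⟩)
    (fun n hn => if_neg fun h => absurd h.1 (not_lt.2 hn))
  obtain ⟨c, hc, hc', hcZ⟩ := exists_skew (M := M) (b := false) (Z := {n | n < 0})
    (c := fun n => if 0 ≤ n ∧ Odd n then jet (Sum.inr ((n + 1) / 2).toNat) 0 else 0)
    (fun n hn => if_neg fun h => Int.not_even_iff_odd.2 h.2 hn)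
    (fun a ha => ⟨mem_Reg_of_neg (neg_eq_zero_iff.2 ha),
      neg_eq_zero_iff.1 (neg_adj_eq_zero (neg_eq_zero_iff.2 ha))⟩)
    (fun n hn => if_neg fun h => absurd h.1 (not_le.2 hn))
  have hodd : ∀ i : ℕ, Odd (-2 * (i : ℤ) - 1) := fun i => ⟨-(i : ℤ) - 1, by ring⟩
  have hodd' : ∀ i : ℕ, Odd (2 * (i : ℤ) - 1) := fun i => ⟨(i : ℤ) - 1, by ring⟩
  refine existsUnique_of_exists_of_unique
    ⟨(Dpow 1 + a, ofFun (MvPowerSeries.C ρ) ⋆ Dpow (-1) ⋆ ofFun (MvPowerSeries.C ρ) + c),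
      ⟨⟨⟨?_, ?_⟩, ?_⟩, ⟨?_, ?_⟩, ?_⟩, fun i => ?_, fun i hi => ?_⟩ fun _ _ h h' => h.eq h'
  · rw [add_sub_cancel_left]
    exact ⟨0, fun n hn => haZ n (le_of_lt hn)⟩
  · rw [add_sub_cancel_left]
    exact mem_skewOps.2 ha
  · rw [add_sub_cancel_left]
    exact pos_eq_zero_iff.2 haZ
  · rw [add_sub_cancel_left, ← pos_of_neg_eq_zero (neg_eq_zero_iff.2 hcZ)]
    exact pos_mem_Dplus c
  · rw [add_sub_cancel_left]
    exact mem_skewOps.2 hc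
  · rw [add_sub_cancel_left]
    exact neg_eq_zero_iff.2 hcZ
  · change (Dpow 1 + a : Op M) _ = _
    rw [Pi.add_apply, Dpow, Pi.single_eq_of_ne (by omega), zero_add, ha' _ (hodd i),
      if_pos ⟨by omega, hodd i⟩]
    congr 2
    omega
  · change (ofFun (MvPowerSeries.C ρ) ⋆ Dpow (-1) ⋆ ofFun (MvPowerSeries.C ρ) + c : Op M) _ = _
    rw [Pi.add_apply, fDg_apply _ _ (by omega), zero_add, hc' _ (hodd' i),
      if_pos ⟨by omega, hodd' i⟩]
    congr 2
    omega

end Generic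

/-! ### Variational derivatives -/

section Variational

variable {M : CoordManifold} {b : Bool}

theorem HasFSum.exists_range {E : Type*} [AddCommGroup E] [Module ℂ E] {W : ℤ → Submodule ℂ E}
    {t : ℕ → E} {x : E} (hx : HasFSum W t x) (K : ℤ) :
    ∃ n₀ : ℕ, ∀ n, n₀ ≤ n → x - ∑ j ∈ Finset.range n, t j ∈ W K := by
  obtain ⟨S, hS⟩ := Filter.eventually_atTop.1 (hx K)
  refine ⟨S.sup id + 1, fun n hn => hS _ fun j hj => Finset.mem_range.2 ?_⟩
  have := Finset.le_sup (f := id) hj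
  simp only [id] at this
  omega

theorem neg_D_pow_succ (s : ℕ) (f : DiffPoly M) :
    ((-D (M := M)) ^ (s + 1)) f = -((-D (M := M)) ^ s) (D f) := by
  rw [pow_succ, Module.End.mul_apply, LinearMap.neg_apply, map_neg]

theorem neg_D_pow_succ' (s : ℕ) (f : DiffPoly M) :
    ((-D (M := M)) ^ (s + 1)) f = -D (((-D (M := M)) ^ s) f) := by
  rw [pow_succ', Module.End.mul_apply, LinearMap.neg_apply]

theorem zsmul_mem_degGE {K : ℤ} {f : DiffPoly M} (hf : f ∈ degGE M K) (z : ℤ) :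
    z • f ∈ degGE M K :=
  (degGE M K).toAddSubgroup.zsmul_mem hf z

theorem neg_D_pow_apply (s : ℕ) (f : DiffPoly M) :
    ((-D (M := M)) ^ s) f = ((-1 : ℤ) ^ s) • (D ^ s) f := by
  induction s generalizing f with
  | zero => simp
  | succ s ih =>
    rw [neg_D_pow_succ, ih, pow_succ, pow_succ, Module.End.mul_apply, mul_neg_one, neg_zsmul]

theorem neg_D_pow_mem {K : ℤ} {f : DiffPoly M} (hf : f ∈ degGE M K) (s : ℕ) :
    ((-D (M := M)) ^ s) f ∈ degGE M (K + s) := by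
  rw [neg_D_pow_apply]
  exact zsmul_mem_degGE (D_pow_mem_degGE hf s) _

theorem neg_D_pow_mem' (f : DiffPoly M) (s : ℕ) : ((-D (M := M)) ^ s) f ∈ degGE M s := by
  simpa using neg_D_pow_mem (mem_degGE_of_nonpos le_rfl f) s

theorem hasFSum_varDeriv (k : Coord) (f : DiffPoly M) :
    HasFSum (degGE M) (fun s : ℕ => ((-D (M := M)) ^ s) (jetDeriv k s f)) (varDeriv k f) := by
  have hz : TendsZero (degGE M) (fun s : ℕ => ((-D (M := M)) ^ s) (jetDeriv k s f)) :=
    tendsZero_nat degGE_antitone fun s => neg_D_pow_mem' _ _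
  convert hasFSum_fsum hz using 1
  refine ext_coeffL fun m => ?_
  have e : coeffL m (varDeriv k f) =
      ∑ s ∈ Finset.range (deg m + 1), coeffL m (((-D (M := M)) ^ s) (jetDeriv k s f)) := by
    change varDeriv k f m = _
    rw [varDeriv, ofCoeff_apply, LinearMap.sum_apply]
    rfl
  rw [coeffL_fsum, e]
  refine (finsum_eq_sum_of_support_subset _ fun s hs => ?_).symm
  rw [Finset.coe_range, Set.mem_Iio]
  by_contra hcon
  exact hs (neg_D_pow_mem' (jetDeriv k s f) s m (by omega))

theorem varDeriv_D (k : Coord) (f : DiffPoly M) : varDeriv k (D f) = 0 := by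
  have hsum : ∀ n : ℕ, ∑ s ∈ Finset.range (n + 1), ((-D (M := M)) ^ s) (jetDeriv k s (D f)) =
      ((-D (M := M)) ^ n) (D (jetDeriv k n f)) := by
    intro n
    induction n with
    | zero => simp [jetDeriv_zero_D]
    | succ n ih =>
      rw [Finset.sum_range_succ, ih, jetDeriv_succ_D, map_add, neg_D_pow_succ,
        neg_D_pow_succ]
      abel
  refine eq_zero_of_mem_degGE _ fun K => ?_
  obtain ⟨n₀, h⟩ := (hasFSum_varDeriv k (D f)).exists_range K
  have h1 := h (max n₀ K.toNat + 1) (by omega)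
  rw [hsum] at h1
  have h2 := Submodule.add_mem _ h1 (degGE_le (show K ≤ ((max n₀ K.toNat : ℕ) : ℤ) by omega)
    (neg_D_pow_mem' (D (jetDeriv k (max n₀ K.toNat) f)) (max n₀ K.toNat)))
  rwa [sub_add_cancel] at h2

theorem jetDeriv_one (k : Coord) (s : ℕ) : jetDeriv k s (1 : DiffPoly M) = 0 := by
  have := jetDeriv_mul k s (1 : DiffPoly M) 1
  rw [mul_one, mul_one, one_mul] at this
  exact left_eq_add.1 this

theorem varDeriv_one (k : Coord) : varDeriv k (1 : DiffPoly M) = 0 :=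
  (hasFSum_varDeriv k 1).eq (cast (congrArg₂ _ (funext fun s => by rw [jetDeriv_one, map_zero]) rfl)
    (hasFSum_zero (W := degGE M) (ι := ℕ)))

/-- Variational derivatives only depend on the local functional. -/
theorem varDeriv_eq_zero {f : DiffPoly M} (hf : integral f = 0) (k : Coord) :
    varDeriv k f = 0 := by
  obtain ⟨g, ⟨h, rfl⟩, c, hc, rfl⟩ := Submodule.mem_sup.1 (integral_eq_zero_iff.1 hf)
  obtain ⟨z, rfl⟩ := Submodule.mem_span_singleton.1 hc
  rw [map_add, varDeriv_D, map_smul, varDeriv_one, smul_zero, add_zero]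

/-- Integration by parts. -/
theorem D_pow_mul_sub_mem (s : ℕ) (f g : DiffPoly M) :
    (D ^ s) f * g - f * ((-D (M := M)) ^ s) g ∈ LinearMap.range (D (M := M)) := by
  induction s generalizing g with
  | zero => simp
  | succ s ih =>
    have h1 := Submodule.sub_mem _ (LinearMap.mem_range_self D ((D ^ s) f * g)) (ih (D g))
    rw [D_mul] at h1
    convert h1 using 1
    rw [pow_succ', Module.End.mul_apply, neg_D_pow_succ]
    ring

/-! ### Fréchet derivatives -/

/-- The Fréchet derivative `∑_{s ≥ 0} (∂g/∂v_k^{(s)}) D^s` in the direction of `v_k`. -/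
noncomputable def frechet (k : Coord) : DiffPoly M →ₗ[ℂ] Op M :=
  LinearMap.pi fun n => if 0 ≤ n then jetDeriv k n.toNat else 0

theorem frechet_apply (k : Coord) (g : DiffPoly M) (n : ℕ) :
    frechet k g n = jetDeriv k n g := by
  rw [frechet, LinearMap.pi_apply, if_pos (by omega)]
  rfl

theorem frechet_apply_of_neg (k : Coord) (g : DiffPoly M) {n : ℤ} (hn : n < 0) :
    frechet k g n = 0 := by
  rw [frechet, LinearMap.pi_apply, if_neg (by omega)]
  rfl

theorem neg_frechet (k : Coord) (g : DiffPoly M) : neg (frechet k g) = 0 :=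
  neg_eq_zero_iff.2 fun _ h => frechet_apply_of_neg k g h

theorem frechet_mem_Reg (k : Coord) (g : DiffPoly M) : frechet k g ∈ Reg M false :=
  mem_Reg_of_neg (neg_frechet k g)

theorem frechet_mem_degGE {K : ℤ} {g : DiffPoly M} (hg : g ∈ degGE M K) (k : Coord) (n : ℤ) :
    frechet k g n ∈ degGE M (K - n) := by
  rcases lt_or_ge n 0 with h | h
  · rw [frechet_apply_of_neg k g h]; exact Submodule.zero_mem _
  · lift n to ℕ using h
    rw [frechet_apply]
    exact jetDeriv_mem_degGE hg k n

theorem adj_mem_degGE {d : ℤ} {a : Op M} (ha : ∀ n, a n ∈ degGE M (d - n)) (n : ℤ) :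
    adj a n ∈ degGE M (d - n) :=
  (hasFSum_adj a n).mem le_rfl fun r => zsmul_mem
    (degGE_le (by omega) (D_pow_mem_degGE (ha (n + r)) r)) _

theorem Dpow_one_mul_apply (a : Op M) (n : ℤ) : (Dpow 1 ⋆ a) n = D (a n) + a (n - 1) := by
  classical
  refine mul_apply_eq ?_
  have h := hasFSum_of_subset (W := degGE M) (fun p : ℤ × ℕ =>
    Ring.choose p.1 p.2 • ((Dpow 1 : Op M) p.1 * (D ^ p.2) (a (n - p.1 + p.2))))
    {(1, 1), (1, 0)} (by
      rintro ⟨i, r⟩ h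
      by_cases hi : i = 1
      · subst hi
        have hr : (1 : ℤ) < r := by
          by_contra hcon
          refine h ?_
          have : r = 0 ∨ r = 1 := by omega
          rcases this with rfl | rfl <;> simp
        rw [choose_eq_zero (by norm_num) hr, zero_zsmul]
      · rw [Dpow, Pi.single_eq_of_ne hi, zero_mul, zsmul_zero])
  rw [Finset.sum_pair (by simp)] at h
  convert h using 2 <;> simp [Dpow]

theorem frechet_D (k : Coord) (g : DiffPoly M) : frechet k (D g) = Dpow 1 ⋆ frechet k g := by
  funext n
  rw [Dpow_one_mul_apply]
  rcases lt_or_ge n 0 with h | h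
  · rw [frechet_apply_of_neg _ _ h, frechet_apply_of_neg _ _ h, frechet_apply_of_neg _ _ (by omega),
      map_zero, add_zero]
  · lift n to ℕ using h
    cases n with
    | zero =>
      rw [frechet_apply, frechet_apply, frechet_apply_of_neg _ _ (by norm_num), add_zero,
        jetDeriv_zero_D]
    | succ n =>
      rw [frechet_apply, frechet_apply, show ((n + 1 : ℕ) : ℤ) - 1 = n by push_cast; ring,
        frechet_apply, jetDeriv_succ_D]

/-- As `frechet k (-D g) = -D ⋆ frechet k g`, its adjoint is `adj (frechet k g) ⋆ D`. -/
theorem adj_frechet_neg_D_pow (k : Coord) (s : ℕ) (g : DiffPoly M) (n : ℤ) :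
    adj (frechet k (((-D (M := M)) ^ s) g)) n = adj (frechet k g) (n - s) := by
  induction s generalizing n with
  | zero => simp
  | succ s ih =>
    rw [neg_D_pow_succ', map_neg, frechet_D, map_neg,
      adj_mul_Reg (b := false) (Dpow_mem_Reg 1) (frechet_mem_Reg _ _), adj_Dpow_one,
      mul_neg_Reg (b := false) (adj_mem_Reg (frechet_mem_Reg _ _)) (Dpow_mem_Reg 1), neg_neg,
      mul_Dpow_apply, ih, show n - 1 - (s : ℤ) = n - ((s + 1 : ℕ) : ℤ) by push_cast; ring]

/-- The coefficient of `D^m` in `(-D)^q g`. -/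
noncomputable def negDCoeff (q : ℕ) (m : ℤ) : DiffPoly M →ₗ[ℂ] DiffPoly M :=
  if m ≤ q then ((-1) ^ q * (q.choose (q - m).toNat : ℤ) : ℤ) •
    (D ^ (q - m).toNat : DiffPoly M →ₗ[ℂ] DiffPoly M) else 0

theorem negDCoeff_of_lt {q : ℕ} {m : ℤ} (h : q < m) : negDCoeff (M := M) q m = 0 :=
  if_neg (by omega)

theorem negDCoeff_of_neg {q : ℕ} {m : ℤ} (h : m < 0) : negDCoeff (M := M) q m = 0 := by
  rw [negDCoeff, if_pos (by omega), Nat.choose_eq_zero_of_lt (by omega)]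
  simp

theorem negDCoeff_add (m : ℤ) (r q : ℕ) (h : (q : ℤ) = m + r) (g : DiffPoly M) :
    negDCoeff q m g = ((-1) ^ q * (q.choose r : ℤ) : ℤ) • (D ^ r) g := by
  rw [negDCoeff, if_pos (by omega), show (q - m).toNat = r by omega]
  rfl

theorem negDCoeff_zero (m : ℤ) (g : DiffPoly M) :
    negDCoeff 0 m g = if m = 0 then g else 0 := by
  split_ifs with h
  · subst h
    rw [negDCoeff_add 0 0 0 rfl]
    simp
  · rcases lt_or_gt_of_ne h with h | h
    · rw [negDCoeff_of_neg h]; rfl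
    · rw [negDCoeff_of_lt (by exact_mod_cast h)]; rfl

theorem negDCoeff_succ (q : ℕ) (m : ℤ) (g : DiffPoly M) :
    negDCoeff (q + 1) m g = -(D (negDCoeff q m g) + negDCoeff q (m - 1) g) := by
  rcases lt_or_ge ((q : ℤ) + 1) m with h | h
  · rw [negDCoeff_of_lt (by push_cast; omega), negDCoeff_of_lt (q := q) (m := m) (by omega),
      negDCoeff_of_lt (q := q) (m := m - 1) (by omega)]
    simp
  · obtain ⟨r, hr⟩ : ∃ r : ℕ, (q : ℤ) + 1 = m + r := ⟨(q + 1 - m).toNat, by omega⟩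
    rw [negDCoeff_add m r (q + 1) (by push_cast; omega), negDCoeff_add (m - 1) r q (by omega)]
    cases r with
    | zero =>
      rw [negDCoeff_of_lt (q := q) (m := m) (by omega), Nat.choose_zero_right,
        Nat.choose_zero_right, LinearMap.zero_apply, map_zero, zero_add, pow_succ, ← neg_zsmul]
      congr 1
      ring
    | succ r =>
      rw [negDCoeff_add m r q (by push_cast at hr; omega), map_zsmul, Nat.choose_succ_succ,
        pow_succ' D r, Module.End.mul_apply, ← add_zsmul, ← neg_zsmul]
      congr 1
      push_cast
      ring

/-- The commutation of `∂/∂v^(n)` with powers of `D`, obtained by iterating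
`∂/∂v^(n) D = D ∂/∂v^(n) + ∂/∂v^(n-1)`. The bound `T` only has to be large enough, as the summands
with `s > n` vanish. -/
theorem jetDeriv_neg_D_pow (k : Coord) (q : ℕ) (g : DiffPoly M) (n T : ℕ) (hT : n < T) :
    jetDeriv k n (((-D (M := M)) ^ q) g) =
      ∑ s ∈ Finset.range T, negDCoeff q ((n : ℤ) - s) (jetDeriv k s g) := by
  induction q generalizing n with
  | zero =>
    simp only [negDCoeff_zero, sub_eq_zero, Nat.cast_inj]
    rw [Finset.sum_ite_eq, if_pos (Finset.mem_range.2 hT), pow_zero]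
    rfl
  | succ q ih =>
    simp only [negDCoeff_succ, Finset.sum_neg_distrib, Finset.sum_add_distrib]
    rw [← map_sum, ← ih n hT, neg_D_pow_succ', map_neg]
    congr 1
    cases n with
    | zero =>
      rw [jetDeriv_zero_D, Finset.sum_eq_zero, add_zero]
      intro s _
      rw [negDCoeff_of_neg (by omega)]
      rfl
    | succ n =>
      rw [jetDeriv_succ_D, ih n (by omega)]
      congr 1
      refine Finset.sum_congr rfl fun s _ => ?_
      congr 2
      push_cast
      ring

/-- The adjoint `∑_q (-D)^q ∂g/∂v^(q)` of the Fréchet derivative, by coefficients. -/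
theorem hasFSum_adj_frechet (k : Coord) (g : DiffPoly M) (m : ℤ) :
    HasFSum (degGE M) (fun q : ℕ => negDCoeff q m (jetDeriv k q g)) (adj (frechet k g) m) := by
  rcases lt_or_ge m 0 with h | h
  · rw [neg_eq_zero_iff.1 (neg_adj_eq_zero (neg_frechet k g)) m h]
    refine cast (congrArg₂ _ (funext fun q => ?_) rfl) (hasFSum_zero (ι := ℕ))
    rw [negDCoeff_of_neg h]
    rfl
  · lift m to ℕ using h
    have hz : TendsZero (degGE M) (fun q : ℕ => negDCoeff q (m : ℤ) (jetDeriv k q g)) := by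
      intro K
      refine (Finset.range (m + K.toNat)).finite_toSet.subset fun q hq => ?_
      rw [Finset.coe_range, Set.mem_Iio]
      by_contra hcon
      refine hq ?_
      change negDCoeff q (m : ℤ) _ ∈ _
      rw [negDCoeff_add (m : ℤ) (q - m) q (by omega)]
      exact zsmul_mem_degGE (degGE_le (by omega) (D_pow_mem_degGE' _ _)) _
    obtain ⟨x, hx⟩ := hz.exists_hasFSum
    have h1 := hx.comp_injective (fun r : ℕ => m + r) (add_right_injective m) fun q hq => by
      rw [negDCoeff_of_lt]
      · rfl
      · by_contra hcon
        exact hq ⟨q - m, by simp only; omega⟩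
    have h2 : adj (frechet k g) m = x := by
      refine adj_eq (cast (congrArg₂ _ (funext fun r => ?_) rfl) h1)
      rw [negDCoeff_add (m : ℤ) r (m + r) (by push_cast; ring),
        show (m : ℤ) + r = ((m + r : ℕ) : ℤ) by push_cast; ring, frechet_apply,
        Ring.choose_natCast]
      rcases Nat.even_or_odd (m + r) with h | h
      · rw [h.neg_one_pow, Int.negOnePow_even _ (by exact_mod_cast h)]; rfl
      · rw [h.neg_one_pow, Int.negOnePow_odd _ (by exact_mod_cast h)]; rfl
    rw [h2]
    exact hx

/-- The Fréchet derivatives of variational derivatives are symmetric (Helmholtz). -/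
theorem adj_frechet_varDeriv (k l : Coord) (f : DiffPoly M) :
    adj (frechet l (varDeriv k f)) = frechet k (varDeriv l f) := by
  funext n
  rcases lt_or_ge n 0 with h | h
  · rw [frechet_apply_of_neg _ _ h,
      neg_eq_zero_iff.1 (neg_adj_eq_zero (neg_frechet l _)) n h]
  lift n to ℕ using h
  rw [frechet_apply]
  -- Both sides are the double sum of the coefficients of `D^n` in
  -- `(-D)^q (∂²f/∂v_l^{(q)}∂v_k^{(s)}) D^s`.
  have hz : TendsZero (degGE M) (fun p : ℕ × ℕ =>
      negDCoeff p.1 ((n : ℤ) - p.2) (jetDeriv l p.1 (jetDeriv k p.2 f))) := by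
    intro K
    refine (Finset.range (n + K.toNat) ×ˢ Finset.range (n + 1)).finite_toSet.subset fun p hp => ?_
    by_contra hcon
    refine hp ?_
    change negDCoeff p.1 ((n : ℤ) - p.2) _ ∈ _
    rcases lt_or_ge ((n : ℤ) - p.2) 0 with h | h
    · rw [negDCoeff_of_neg h]; exact Submodule.zero_mem _
    rcases lt_or_ge (p.1 : ℤ) ((n : ℤ) - p.2) with h' | h'
    · rw [negDCoeff_of_lt h']; exact Submodule.zero_mem _
    have hp1 : n + K.toNat ≤ p.1 := by
      by_contra h1
      exact hcon (Finset.mem_coe.2 (Finset.mem_product.2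
        ⟨Finset.mem_range.2 (by omega), Finset.mem_range.2 (by omega)⟩))
    rw [negDCoeff_add _ (p.1 + p.2 - n) p.1 (by omega)]
    exact zsmul_mem_degGE (degGE_le (by omega) (D_pow_mem_degGE' _ _)) _
  have h1 : HasFSum (degGE M) (fun s : ℕ => adj (frechet l (jetDeriv k s f)) ((n : ℤ) - s))
      (adj (frechet l (varDeriv k f)) n) := by
    have := (hasFSum_varDeriv k f).map (LinearMap.proj (n : ℤ) ∘ₗ adj ∘ₗ frechet l)
      (W' := degGE M) fun K => ⟨K + n, fun g hg => degGE_le (by omega)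
        (adj_mem_degGE (fun i => frechet_mem_degGE hg l i) (n : ℤ))⟩
    refine cast (congrArg₂ _ (funext fun s => ?_) rfl) this
    exact (adj_frechet_neg_D_pow l s _ n)
  have h2 := (hasFSum_varDeriv l f).jetDeriv k n
  refine HasFSum.eq (hx := h1) ?_
  obtain ⟨x, hx⟩ := hz.exists_hasFSum
  have h3 := hx.prod_swap fun s => hasFSum_adj_frechet l (jetDeriv k s f) ((n : ℤ) - s)
  have h4 : HasFSum (degGE M)
      (fun q : ℕ => jetDeriv k n (((-D (M := M)) ^ q) (jetDeriv l q f))) x :=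
    hx.prod fun q => by
      rw [jetDeriv_neg_D_pow k q _ n (n + 1) (by omega)]
      have := hasFSum_of_subset (W := degGE M) (fun s : ℕ =>
        negDCoeff q ((n : ℤ) - s) (jetDeriv k s (jetDeriv l q f))) (Finset.range (n + 1))
        fun s hs => by
          rw [negDCoeff_of_neg (by rw [Finset.mem_range] at hs; omega)]
          rfl
      refine cast (congrArg₂ _ (funext fun s => ?_) rfl) this
      rw [jetDeriv_comm]
  rw [h2.eq h4]
  exact h3

end Variational

/-! ### The algebra behind the quadratic bracket -/

section Trilinear

/-- The identity between trilinear forms which the Jacobi identity reduces to. The elements `p` are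
differential operators of the first kind and `q` is the remaining part of operators of the first
kind; `p'` and `q'` are the corresponding parts of operators of the second kind; `P` is `p`
regarded as an operator of the second kind, and `Q` is `q'` regarded as an operator of
the first kind. -/
theorem trilinear_identity {R R' F : Type*} [AddCommGroup R] [AddCommGroup R'] [AddCommGroup F]
    (T : R →+ R →+ R →+ F) (T' : R' →+ R' →+ R' →+ F) (N : AddSubgroup R) (N' : AddSubgroup R')
    (hN : ∀ x ∈ N, ∀ y ∈ N, ∀ z ∈ N, T x y z = 0)
    (hN' : ∀ x ∈ N', ∀ y ∈ N', ∀ z ∈ N', T' x y z = 0)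
    {p₁ p₂ p₃ q₁ q₂ q₃ Q₁ Q₂ Q₃ : R} {p₁' p₂' p₃' q₁' q₂' q₃' P₁ P₂ P₃ : R'}
    (hq₁ : q₁ ∈ N) (hq₂ : q₂ ∈ N) (hq₃ : q₃ ∈ N) (hQ₁ : Q₁ ∈ N) (hQ₂ : Q₂ ∈ N) (hQ₃ : Q₃ ∈ N)
    (hp₁ : p₁' ∈ N') (hp₂ : p₂' ∈ N') (hp₃ : p₃' ∈ N') (hP₁ : P₁ ∈ N') (hP₂ : P₂ ∈ N')
    (hP₃ : P₃ ∈ N') (hp : T p₁ p₂ p₃ = 0) (hq : T' q₁' q₂' q₃' = 0)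
    (h₁ : T p₁ p₂ Q₃ = T' P₁ P₂ q₃') (h₂ : T p₁ Q₂ p₃ = T' P₁ q₂' P₃)
    (h₃ : T Q₁ p₂ p₃ = T' q₁' P₂ P₃) (h₄ : T p₁ Q₂ Q₃ = T' P₁ q₂' q₃')
    (h₅ : T Q₁ p₂ Q₃ = T' q₁' P₂ q₃') (h₆ : T Q₁ Q₂ p₃ = T' q₁' q₂' P₃) :
    -(T (p₁ + q₁) (q₂ - Q₂) (q₃ - Q₃) + T (q₁ - Q₁) (p₂ + q₂) (q₃ - Q₃) +
        T (q₁ - Q₁) (q₂ - Q₂) (p₃ + q₃)) +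
      (T (p₁ + q₁) (p₂ + q₂) (q₃ - Q₃) + T (q₁ - Q₁) (p₂ + q₂) (p₃ + q₃) +
        T (p₁ + q₁) (q₂ - Q₂) (p₃ + q₃)) +
      (T' (p₁' + q₁') (P₂ - p₂') (P₃ - p₃') + T' (P₁ - p₁') (p₂' + q₂') (P₃ - p₃') +
        T' (P₁ - p₁') (P₂ - p₂') (p₃' + q₃')) +
      (T' (p₁' + q₁') (p₂' + q₂') (P₃ - p₃') + T' (P₁ - p₁') (p₂' + q₂') (p₃' + q₃') +
        T' (p₁' + q₁') (P₂ - p₂') (p₃' + q₃')) =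
      T (p₁ + q₁) (p₂ + q₂) (p₃ + q₃) - T' (p₁' + q₁') (p₂' + q₂') (p₃' + q₃') := by
  simp only [map_add, map_sub, AddMonoidHom.add_apply, AddMonoidHom.sub_apply, hN _ hq₁ _ hq₂ _ hq₃,
    hN _ hq₁ _ hq₂ _ hQ₃, hN _ hq₁ _ hQ₂ _ hq₃, hN _ hq₁ _ hQ₂ _ hQ₃, hN _ hQ₁ _ hq₂ _ hq₃,
    hN _ hQ₁ _ hq₂ _ hQ₃, hN _ hQ₁ _ hQ₂ _ hq₃, hN' _ hp₁ _ hp₂ _ hp₃,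
    hN' _ hp₁ _ hp₂ _ hP₃, hN' _ hp₁ _ hP₂ _ hp₃, hN' _ hp₁ _ hP₂ _ hP₃, hN' _ hP₁ _ hp₂ _ hp₃,
    hN' _ hP₁ _ hp₂ _ hP₃, hN' _ hP₁ _ hP₂ _ hp₃, hp, hq, h₁, h₂, h₃, h₄,
    h₅, h₆]
  abel

end Trilinear

section Algebra

variable {M : CoordManifold} {b : Bool}

/-- The part of negative order, as an operator of the first kind. -/
noncomputable def Psd.negTrue : Psd M b →ₗ[ℂ] Psd M true :=
  (negL (M := M)).restrict (p := Reg M b) (q := Reg M true) fun a _ => mem_Reg_of_pos (pos_neg a)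

/-- The differential part, as an operator of the second kind. -/
noncomputable def Psd.posFalse : Psd M b →ₗ[ℂ] Psd M false :=
  (posL (M := M)).restrict (p := Reg M b) (q := Reg M false) fun a _ =>
    mem_Reg_of_neg (neg_pos a)

/-- The differential part. -/
noncomputable def Psd.posPart (x : Psd M b) : Psd M b := Psd.mk (pos x.op) (pos_mem_Reg x.mem)

/-- The part of negative order. -/
noncomputable def Psd.negPart (x : Psd M b) : Psd M b := Psd.mk (neg x.op) (neg_mem_Reg x.mem)

theorem Psd.posPart_add_negTrue (x : Psd M true) : x.posPart + x.negTrue = x :=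
  Psd.ext (pos_add_neg x.op)

theorem Psd.posFalse_add_negPart (x : Psd M false) : x.posFalse + x.negPart = x :=
  Psd.ext (pos_add_neg x.op)

/-- Operators of negative order. -/
noncomputable def Psd.negs (M : CoordManifold) (b : Bool) : AddSubgroup (Psd M b) where
  carrier := {x | pos x.op = 0}
  zero_mem' := by
    change posL (Psd.op (0 : Psd M b)) = 0
    rw [map_zero, map_zero]
  add_mem' {x y} hx hy := by
    change posL (Psd.op (x + y)) = 0
    rw [map_add, map_add, ← pos_eq, ← pos_eq]
    exact (congrArg₂ _ hx hy).trans (add_zero 0)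
  neg_mem' {x} hx := by
    change posL (Psd.op (-x)) = 0
    rw [map_neg, map_neg, ← pos_eq]
    exact (congrArg _ hx).trans neg_zero

/-- Differential operators. -/
noncomputable def Psd.poss (M : CoordManifold) (b : Bool) : AddSubgroup (Psd M b) where
  carrier := {x | neg x.op = 0}
  zero_mem' := by
    change negL (Psd.op (0 : Psd M b)) = 0
    rw [map_zero, map_zero]
  add_mem' {x y} hx hy := by
    change negL (Psd.op (x + y)) = 0
    rw [map_add, map_add, ← neg_eq, ← neg_eq]
    exact (congrArg₂ _ hx hy).trans (add_zero 0)
  neg_mem' {x} hx := by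
    change negL (Psd.op (-x)) = 0
    rw [map_neg, map_neg, ← neg_eq]
    exact (congrArg _ hx).trans neg_zero

theorem Psd.mul_mem_negs {x y : Psd M b} (hx : x ∈ Psd.negs M b) (hy : y ∈ Psd.negs M b) :
    x * y ∈ Psd.negs M b := pos_mul_eq_zero (a := x.op) (c := y.op) hx hy

theorem Psd.mul_mem_poss {x y : Psd M b} (hx : x ∈ Psd.poss M b) (hy : y ∈ Psd.poss M b) :
    x * y ∈ Psd.poss M b := neg_mul_eq_zero (a := x.op) (c := y.op) hx hy

theorem Psd.tr_negs_mul {x y : Psd M b} (hx : x ∈ Psd.negs M b) (hy : y ∈ Psd.negs M b) :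
    (x * y).tr = 0 := by
  have h : res (x * y).op = 0 := res_mul_of_pos (a := x.op) (c := y.op) hx hy
  rw [Psd.tr, h]
  exact (integral (M := M)).map_zero

theorem Psd.tr_poss_mul {x y : Psd M b} (hx : x ∈ Psd.poss M b) (hy : y ∈ Psd.poss M b) :
    (x * y).tr = 0 := by
  have h : res (x * y).op = 0 := res_mul_of_neg (a := x.op) (c := y.op) hx hy
  rw [Psd.tr, h]
  exact (integral (M := M)).map_zero

theorem Psd.negTrue_mem (x : Psd M b) : x.negTrue ∈ Psd.negs M true := pos_neg x.op

theorem Psd.posFalse_mem (x : Psd M b) : x.posFalse ∈ Psd.poss M false := neg_pos x.op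

theorem Psd.negPart_mem (x : Psd M b) : x.negPart ∈ Psd.negs M b := pos_neg x.op

theorem Psd.posPart_mem (x : Psd M b) : x.posPart ∈ Psd.poss M b := neg_pos x.op

/-- The alternating form `tr x[y, z]`. -/
noncomputable def Psd.tri (x y z : Psd M b) : LocalFunctional M := (x * (y * z - z * y)).tr

/-- The form `tr x[y, z]`, as a trilinear map. -/
noncomputable def Psd.triHom : Psd M b →+ Psd M b →+ Psd M b →+ LocalFunctional M :=
  AddMonoidHom.mk' (fun x => AddMonoidHom.mk' (fun y => AddMonoidHom.mk'
    (fun z => Psd.tri x y z)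
    (fun z z' => by rw [Psd.tri, Psd.tri, Psd.tri, ← Psd.tr_add]; congr 1; noncomm_ring))
    (fun y y' => AddMonoidHom.ext fun z => by
      change Psd.tri x (y + y') z = Psd.tri x y z + Psd.tri x y' z
      rw [Psd.tri, Psd.tri, Psd.tri, ← Psd.tr_add]; congr 1; noncomm_ring))
    (fun x x' => AddMonoidHom.ext fun y => AddMonoidHom.ext fun z => by
      change Psd.tri (x + x') y z = Psd.tri x y z + Psd.tri x' y z
      rw [Psd.tri, Psd.tri, Psd.tri, ← Psd.tr_add]; congr 1; noncomm_ring)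

theorem Psd.tri_apply (x y z : Psd M b) :
    Psd.tri x y z = (x * y * z).tr - (x * z * y).tr := by
  rw [Psd.tri, mul_sub, Psd.tr_sub, mul_assoc, mul_assoc]

theorem Psd.tri_negs (x : Psd M b) (hx : x ∈ Psd.negs M b) (y : Psd M b) (hy : y ∈ Psd.negs M b)
    (z : Psd M b) (hz : z ∈ Psd.negs M b) : Psd.tri x y z = 0 := by
  rw [Psd.tri_apply, Psd.tr_negs_mul (Psd.mul_mem_negs hx hy) hz,
    Psd.tr_negs_mul (Psd.mul_mem_negs hx hz) hy, sub_zero]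

theorem Psd.tri_poss (x : Psd M b) (hx : x ∈ Psd.poss M b) (y : Psd M b) (hy : y ∈ Psd.poss M b)
    (z : Psd M b) (hz : z ∈ Psd.poss M b) : Psd.tri x y z = 0 := by
  rw [Psd.tri_apply, Psd.tr_poss_mul (Psd.mul_mem_poss hx hy) hz,
    Psd.tr_poss_mul (Psd.mul_mem_poss hx hz) hy, sub_zero]

/-- The projection `(a - c)_-` for operators `a`, `c` of the first and of the second kind. -/
noncomputable def kk (a : Psd M true) (c : Psd M false) : Psd M true := a.negTrue - c.negTrue

/-- The projection `(a - c)_+` for operators `a`, `c` of the first and of the second kind. -/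
noncomputable def hh (a : Psd M true) (c : Psd M false) : Psd M false := a.posFalse - c.posFalse

/-- The algebraic source of the Jacobi identity, a form of the modified Yang-Baxter equation for
the projections `kk` and `hh`. It holds because the operators of negative order and the
differential operators are subalgebras on which the trace vanishes. -/
theorem tri_kk_hh (a₁ a₂ a₃ : Psd M true) (c₁ c₂ c₃ : Psd M false) :
    -(Psd.tri a₁ (kk a₂ c₂) (kk a₃ c₃) + Psd.tri (kk a₁ c₁) a₂ (kk a₃ c₃) +
        Psd.tri (kk a₁ c₁) (kk a₂ c₂) a₃) +
      (Psd.tri a₁ a₂ (kk a₃ c₃) + Psd.tri (kk a₁ c₁) a₂ a₃ + Psd.tri a₁ (kk a₂ c₂) a₃) +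
      (Psd.tri c₁ (hh a₂ c₂) (hh a₃ c₃) + Psd.tri (hh a₁ c₁) c₂ (hh a₃ c₃) +
        Psd.tri (hh a₁ c₁) (hh a₂ c₂) c₃) +
      (Psd.tri c₁ c₂ (hh a₃ c₃) + Psd.tri (hh a₁ c₁) c₂ c₃ + Psd.tri c₁ (hh a₂ c₂) c₃) =
      Psd.tri a₁ a₂ a₃ - Psd.tri c₁ c₂ c₃ := by
  have T : ∀ (x y z : Psd M true) (x' y' z' : Psd M false), x.op = x'.op → y.op = y'.op →
      z.op = z'.op → Psd.tri x y z = Psd.tri x' y' z' := fun x y z x' y' z' hx hy hz => by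
    simp only [Psd.tri_apply, Psd.tr, Psd.op_mul, hx, hy, hz]
  have := trilinear_identity (Psd.triHom (M := M)) (Psd.triHom (M := M)) (Psd.negs M true)
    (Psd.poss M false) (fun x hx y hy z hz => Psd.tri_negs x hx y hy z hz)
    (fun x hx y hy z hz => Psd.tri_poss x hx y hy z hz) (Psd.negTrue_mem a₁) (Psd.negTrue_mem a₂)
    (Psd.negTrue_mem a₃) (Psd.negTrue_mem c₁) (Psd.negTrue_mem c₂) (Psd.negTrue_mem c₃)
    (Psd.posFalse_mem c₁) (Psd.posFalse_mem c₂) (Psd.posFalse_mem c₃) (Psd.posFalse_mem a₁)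
    (Psd.posFalse_mem a₂) (Psd.posFalse_mem a₃)
    (Psd.tri_poss _ (Psd.posPart_mem a₁) _ (Psd.posPart_mem a₂) _ (Psd.posPart_mem a₃))
    (Psd.tri_negs _ (Psd.negPart_mem c₁) _ (Psd.negPart_mem c₂) _ (Psd.negPart_mem c₃))
    (T _ _ _ _ _ _ rfl rfl rfl) (T _ _ _ _ _ _ rfl rfl rfl) (T _ _ _ _ _ _ rfl rfl rfl)
    (T _ _ _ _ _ _ rfl rfl rfl) (T _ _ _ _ _ _ rfl rfl rfl) (T _ _ _ _ _ _ rfl rfl rfl)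
  simp only [Psd.posPart_add_negTrue, Psd.posFalse_add_negPart] at this
  exact this

/-- The bilinear form `tr (a (a' - c')_-) + tr (c (a' - c')_+)`. With `a = XA` and `c = A'X'`
it is half of the pairing given by the quadratic tensor, see `pairing_P2`. -/
noncomputable def omega (a : Psd M true) (c : Psd M false) (a' : Psd M true) (c' : Psd M false) :
    LocalFunctional M := (a * kk a' c').tr + (c * hh a' c').tr

/-- The symmetric part of `omega` does not involve the projections; it vanishes on the operators
which the quadratic tensor is made of, see `tr_skew_word`. -/
theorem omega_add_omega (a : Psd M true) (c : Psd M false) (a' : Psd M true) (c' : Psd M false) :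
    omega a c a' c' + omega a' c' a c = (a * a').tr - (c * c').tr := by
  have h1 : ∀ {b' : Bool} (x : Psd M true) (y : Psd M b'),
      (x * y.negTrue).tr = (x.posPart * y.negTrue).tr := fun x y => by
    conv_lhs => rw [← Psd.posPart_add_negTrue x]
    rw [add_mul, Psd.tr_add, Psd.tr_negs_mul (Psd.negTrue_mem x) (Psd.negTrue_mem y), add_zero]
  have h2 : ∀ {b' : Bool} (x : Psd M false) (y : Psd M b'),
      (x * y.posFalse).tr = (x.negPart * y.posFalse).tr := fun x y => by
    conv_lhs => rw [← Psd.posFalse_add_negPart x]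
    rw [add_mul, Psd.tr_add, Psd.tr_poss_mul (Psd.posFalse_mem x) (Psd.posFalse_mem y), zero_add]
  have h3 : ∀ (x : Psd M true) (y : Psd M false),
      (x * y.negTrue).tr = (y * x.posFalse).tr := fun x y => by
    rw [h1, h2, Psd.tr_mul_comm y.negPart]
    rfl
  have h4 : ∀ x y : Psd M true, (x * y).tr = (x * y.negTrue).tr + (y * x.negTrue).tr :=
      fun x y => by
    conv_lhs => rw [← Psd.posPart_add_negTrue y]
    rw [mul_add, Psd.tr_add, Psd.tr_mul_comm x y.posPart, h1 y x]
    conv_lhs => rw [← Psd.posPart_add_negTrue x]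
    rw [mul_add, Psd.tr_add, Psd.tr_poss_mul (Psd.posPart_mem y) (Psd.posPart_mem x), zero_add,
      Psd.posPart_add_negTrue, add_comm]
  have h5 : ∀ x y : Psd M false, (x * y).tr = (x * y.posFalse).tr + (y * x.posFalse).tr :=
    fun x y => by
      conv_lhs => rw [← Psd.posFalse_add_negPart y]
      rw [mul_add, Psd.tr_add, Psd.tr_mul_comm x y.negPart, h2 y x]
      conv_lhs => rw [← Psd.posFalse_add_negPart x]
      rw [mul_add, Psd.tr_add, Psd.tr_negs_mul (Psd.negPart_mem y) (Psd.negPart_mem x), add_zero,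
        Psd.posFalse_add_negPart]
  rw [omega, omega, kk, kk, hh, hh]
  simp only [mul_sub, Psd.tr_sub]
  rw [h4 a a', h5 c c', h3 a c', h3 a' c]
  abel

/-! ### Traces of symmetric words -/

/-- The trace of the reversed word. -/
theorem Psd.tr_eq_neg_tr_adj (x : Psd M b) : x.tr = -x.adj.tr := by
  rw [Psd.tr_adj, neg_neg]

theorem Psd.tr_symm_mul_symm {x y : Psd M b} (hx : x.adj = x) (hy : y.adj = y) :
    (x * y).tr = 0 := by
  have h := Psd.tr_eq_neg_tr_adj (x * y)
  rw [Psd.adj_mul, hx, hy, Psd.tr_mul_comm y x, eq_neg_iff_add_eq_zero, ← two_smul ℂ] at h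
  exact (smul_eq_zero.1 h).resolve_left two_ne_zero

theorem Psd.tr_symm_mul_adj {x y : Psd M b} (hx : x.adj = x) :
    (x * y.adj).tr = -(x * y).tr := by
  rw [Psd.tr_eq_neg_tr_adj (x * y), Psd.adj_mul, hx, neg_neg, Psd.tr_mul_comm]

theorem Psd.tr_cycle (x y z : Psd M b) : (x * y * z).tr = (y * z * x).tr := by
  rw [mul_assoc, Psd.tr_mul_comm]

end Algebra

/-! ### The algebraic part of the Jacobi identity -/

section Variation

variable {M : CoordManifold} {b : Bool}

/-- The first component of the quadratic tensor, for `k = (XA - A'X')_-`; see `P2_eq`. -/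
noncomputable def vecK (A k : Psd M true) : Psd M true := A * k + k.adj * A

/-- The second component of the quadratic tensor, for `h = (XA - A'X')_+`; see `P2_eq`. -/
noncomputable def vecH (A' h : Psd M false) : Psd M false := h * A' + A' * h.adj

theorem tr_mul_vecK {A k x : Psd M true} (hA : A.adj = -A) (hx : x.adj = x) :
    (x * vecK A k).tr = (2 : ℂ) • (x * A * k).tr := by
  have h : k.adj * A = -(A * k).adj := by rw [Psd.adj_mul, hA, mul_neg, neg_neg]
  rw [vecK, h, mul_add, mul_neg, Psd.tr_add, Psd.tr_neg, Psd.tr_symm_mul_adj hx, neg_neg, two_smul,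
    mul_assoc]

theorem tr_mul_vecH {A' h x : Psd M false} (hA : A'.adj = -A') (hx : x.adj = x) :
    (x * vecH A' h).tr = (2 : ℂ) • (A' * x * h).tr := by
  have h' : A' * h.adj = -(h * A').adj := by rw [Psd.adj_mul, hA, neg_mul, neg_neg]
  rw [vecH, h', mul_add, mul_neg, Psd.tr_add, Psd.tr_neg, Psd.tr_symm_mul_adj hx, neg_neg, two_smul,
    ← mul_assoc, Psd.tr_mul_comm (x * h), ← mul_assoc]

/-- For a skew operator `A` and symmetric operators `x`, `y`, one has `tr (xAyA) = 0`. -/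
theorem tr_skew_word {A x y : Psd M b} (hA : A.adj = -A) (hx : x.adj = x) (hy : y.adj = y) :
    (x * A * (y * A)).tr = 0 := by
  rw [mul_assoc]
  refine Psd.tr_symm_mul_symm hx ?_
  rw [Psd.adj_mul, Psd.adj_mul, hA, hy]
  noncomm_ring

theorem tr_skew_word' {A x y : Psd M b} (hA : A.adj = -A) (hx : x.adj = x) (hy : y.adj = y) :
    (A * x * (A * y)).tr = 0 := by
  rw [mul_assoc A, Psd.tr_mul_comm, ← tr_skew_word hA hx hy]
  exact congrArg Psd.tr (by noncomm_ring)

/-- By taking adjoints, the form `tr (x k^* A l)` is symmetric in `k` and `l`. -/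
theorem tr_word_symm {A x k l : Psd M b} (hA : A.adj = -A) (hx : x.adj = x) :
    (x * k.adj * A * l).tr = (x * l.adj * A * k).tr := by
  rw [Psd.tr_eq_neg_tr_adj]
  simp only [Psd.adj_mul, Psd.adj_adj, hA, hx]
  rw [← Psd.tr_neg, show x * l.adj * A * k = x * (l.adj * A * k) by noncomm_ring,
    Psd.tr_mul_comm x]
  exact congrArg Psd.tr (by noncomm_ring)

theorem tr_word_symm' {A x h l : Psd M b} (hA : A.adj = -A) (hx : x.adj = x) :
    (A * h.adj * x * l).tr = (A * l.adj * x * h).tr := by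
  rw [Psd.tr_eq_neg_tr_adj]
  simp only [Psd.adj_mul, Psd.adj_adj, hA, hx]
  rw [← Psd.tr_neg, show A * l.adj * x * h = A * (l.adj * x * h) by noncomm_ring,
    Psd.tr_mul_comm A]
  exact congrArg Psd.tr (by noncomm_ring)

/-- The trace of `xA` against the variation `zA + y δA` of `yA`, when `δA` is the vector field
given by `k`. The second derivative `z` of the Hamiltonian drops out. -/
theorem tr_mul_variation {A x y z k : Psd M true} (hA : A.adj = -A) (hx : x.adj = x)
    (hy : y.adj = y) (hz : z.adj = z) :
    (x * A * (z * A + y * vecK A k)).tr = (x * A * (y * A) * k).tr - (y * A * (x * A) * k).tr := by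
  have e : x * A * (z * A + y * vecK A k) =
      x * A * (z * A) + x * A * (y * A) * k + x * (A * y * (k.adj * A)) := by
    rw [vecK]
    noncomm_ring
  have e' : (x * (A * y * (k.adj * A))).tr = -(y * A * (x * A) * k).tr := by
    rw [Psd.tr_eq_neg_tr_adj]
    simp only [Psd.adj_mul, Psd.adj_adj, hA, hx, hy]
    rw [show y * A * (x * A) * k = y * (A * x * A * k) by noncomm_ring,
      Psd.tr_mul_comm y, show -A * k * (y * -A) * x = (A * k * y) * (A * x) by
        noncomm_ring, Psd.tr_mul_comm]
    exact congrArg Neg.neg (congrArg Psd.tr (by noncomm_ring))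
  rw [e, Psd.tr_add, Psd.tr_add, tr_skew_word hA hx hz, zero_add, e', sub_eq_add_neg]

/-- The analogue of `tr_mul_variation` for operators of the second kind. -/
theorem tr_mul_variation' {A x y z h : Psd M false} (hA : A.adj = -A) (hx : x.adj = x)
    (hy : y.adj = y) (hz : z.adj = z) :
    (A * x * (vecH A h * y + A * z)).tr = (A * y * (A * x) * h).tr - (A * x * (A * y) * h).tr := by
  have e : A * x * (vecH A h * y + A * z) =
      A * x * (A * z) + A * x * h * (A * y) + A * x * (A * h.adj * y) := by
    rw [vecH]
    noncomm_ring
  have e' : (A * x * (A * h.adj * y)).tr = -(A * x * (A * y) * h).tr := by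
    rw [Psd.tr_eq_neg_tr_adj]
    simp only [Psd.adj_mul, Psd.adj_adj, hA, hx, hy]
    rw [show y * (h * -A) * (x * -A) = (y * h) * (A * x * A) by noncomm_ring, Psd.tr_mul_comm]
    exact congrArg Neg.neg (congrArg Psd.tr (by noncomm_ring))
  rw [e, Psd.tr_add, Psd.tr_add, tr_skew_word' hA hx hz, zero_add, e', ← sub_eq_add_neg,
    Psd.tr_mul_comm (A * x * h) (A * y), mul_assoc (A * y)]

theorem tr_variation_mul (A k x y k₂ : Psd M true) (A' h x' y' h₂ : Psd M false) :
    ((y * A + x * vecK A k) * k₂).tr + ((vecH A' h * x' + A' * y') * h₂).tr =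
      (y * A * k₂).tr + (A' * y' * h₂).tr + ((x * k.adj * A * k₂).tr + (A' * h.adj * x' * h₂).tr) +
        (x * A * k * k₂).tr + (A' * x' * h₂ * h).tr := by
  have e1 : (y * A + x * vecK A k) * k₂ = y * A * k₂ + x * k.adj * A * k₂ + x * A * k * k₂ := by
    rw [vecK]
    noncomm_ring
  have e2 : (vecH A' h * x' + A' * y') * h₂ =
      A' * y' * h₂ + A' * h.adj * x' * h₂ + h * (A' * x' * h₂) := by
    rw [vecH]
    noncomm_ring
  rw [e1, e2, Psd.tr_add, Psd.tr_add, Psd.tr_add, Psd.tr_add, Psd.tr_mul_comm h]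
  abel

/-- The bookkeeping of the cyclic sums in the Jacobi identity: the terms `H` and `S` are symmetric
and cancel. -/
theorem cyclic_sum_eq_zero {F ι : Type*} [AddCommGroup F] {d H S U U' V V' : ι → ι → ι → F}
    (hH : ∀ i j l, H i j l = H i l j) (hS : ∀ i j l, S i j l = S i l j)
    (hd : ∀ i j l, d i j l = H i l j + S i l j + U i l j + U' i j l +
      (V i j l - V j i l - (V' j i l - V' i j l) - (H j l i + S j l i + U j l i + U' j i l)))
    (i j l : ι)
    (h : -(U i j l - U i l j + (U j l i - U j i l) + (U l i j - U l j i)) +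
      (V i j l - V j i l + (V j l i - V l j i) + (V l i j - V i l j)) +
      (U' i j l - U' i l j + (U' j l i - U' j i l) + (U' l i j - U' l j i)) +
      (V' i j l - V' j i l + (V' j l i - V' l j i) + (V' l i j - V' i l j)) = 0) :
    d i j l + d j l i + d l i j = 0 := by
  rw [hd, hd, hd, hH i l j, hH j i l, hH l j i, hS i l j, hS j i l, hS l j i]
  refine Eq.trans ?_ h
  abel

variable {ι : Type*} (A : Psd M true) (A' : Psd M false) (X : ι → Psd M true)
  (X' : ι → Psd M false)

/-- The right side of `tri_kk_hh` vanishes on the operators `XA` with `X` symmetric and `A` skew.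
-/
theorem tri_skew {A : Psd M b} {X : ι → Psd M b} (hA : A.adj = -A) (hX : ∀ i, (X i).adj = X i)
    (i j l : ι) : Psd.tri (X i * A) (X j * A) (X l * A) = 0 := by
  rw [Psd.tri_apply, sub_eq_zero, Psd.tr_eq_neg_tr_adj]
  simp only [Psd.adj_mul, hA, hX]
  rw [← Psd.tr_neg, show X i * A * (X l * A) * (X j * A) = X i * (A * X l * A * X j * A) by
    noncomm_ring, Psd.tr_mul_comm (X i)]
  exact congrArg Psd.tr (by noncomm_ring)

theorem tri_skew' {A : Psd M b} {X : ι → Psd M b} (hA : A.adj = -A) (hX : ∀ i, (X i).adj = X i)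
    (i j l : ι) : Psd.tri (A * X i) (A * X j) (A * X l) = 0 := by
  rw [Psd.tri_apply, sub_eq_zero, Psd.tr_eq_neg_tr_adj]
  simp only [Psd.adj_mul, hA, hX]
  rw [← Psd.tr_neg, show A * X i * (A * X l) * (A * X j) = (A * X i * A * X l * A) * X j by
    noncomm_ring, Psd.tr_mul_comm _ (X j)]
  rw [show -(X l * -A * (X j * -A * (X i * -A))) = X l * (A * X j * A * X i * A) by noncomm_ring,
    Psd.tr_mul_comm (X l)]
  rw [show A * X j * A * X i * A * X l = (A * X j) * (A * X i * A * X l) by noncomm_ring,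
    Psd.tr_mul_comm, show A * X i * A * X l * (A * X j) = (A * X i * A * X l * A) * X j by
    noncomm_ring, Psd.tr_mul_comm _ (X j)]

/-- The operator `(XA - A'X')_-`. -/
noncomputable def kOp (i : ι) : Psd M true := kk (X i * A) (A' * X' i)

/-- The operator `(XA - A'X')_+`. -/
noncomputable def hOp (i : ι) : Psd M false := hh (X i * A) (A' * X' i)

variable {A A' X X'}

/-- Let the operators vary along the Hamiltonian vector fields of each other, and let the second
derivatives `Y i j` of the Hamiltonians be symmetric. Then the cyclic sum of the derivatives of
the form `omegaAt` vanishes. -/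
theorem cyclic_variation (hA : A.adj = -A) (hA' : A'.adj = -A') (hX : ∀ i, (X i).adj = X i)
    (hX' : ∀ i, (X' i).adj = X' i) {Y : ι → ι → Psd M true} {Y' : ι → ι → Psd M false}
    (hY : ∀ i j, (Y i j).adj = Y i j) (hY' : ∀ i j, (Y' i j).adj = Y' i j)
    (hess : ∀ i j l,
      (Y i j * vecK A (kOp A A' X X' l)).tr + (Y' i j * vecH A' (hOp A A' X X' l)).tr =
      (Y i l * vecK A (kOp A A' X X' j)).tr + (Y' i l * vecH A' (hOp A A' X X' j)).tr)
    {da : ι → ι → Psd M true} {dc : ι → ι → Psd M false}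
    (hda : ∀ i j, da i j = Y i j * A + X i * vecK A (kOp A A' X X' j))
    (hdc : ∀ i j, dc i j = vecH A' (hOp A A' X X' j) * X' i + A' * Y' i j)
    {dO : ι → ι → ι → LocalFunctional M}
    (hdO : ∀ i j l, dO i j l = omega (da i l) (dc i l) (X j * A) (A' * X' j) +
      omega (X i * A) (A' * X' i) (da j l) (dc j l)) (i j l : ι) :
    dO i j l + dO j l i + dO l i j = 0 := by
  set k := kOp A A' X X'
  set h := hOp A A' X X'
  have hH : ∀ i j l, (Y i j * A * k l).tr + (A' * Y' i j * h l).tr =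
      (Y i l * A * k j).tr + (A' * Y' i l * h j).tr := fun i j l => by
    have := hess i j l
    rw [tr_mul_vecK hA (hY _ _), tr_mul_vecK hA (hY _ _), tr_mul_vecH hA' (hY' _ _),
      tr_mul_vecH hA' (hY' _ _), ← smul_add, ← smul_add] at this
    exact smul_right_injective _ (two_ne_zero (α := ℂ)) this
  have hS : ∀ i j l, (X i * (k j).adj * A * k l).tr + (A' * (h j).adj * X' i * h l).tr =
      (X i * (k l).adj * A * k j).tr + (A' * (h l).adj * X' i * h j).tr := fun i j l => by
    rw [tr_word_symm hA (hX i) (k := k j), tr_word_symm' hA' (hX' i) (h := h j)]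
  have h1 : ∀ i j l, omega (da i j) (dc i j) (X l * A) (A' * X' l) = _ := fun i j l =>
    (congrArg₂ (fun (x : Psd M true) (y : Psd M false) =>
      (x * k l).tr + (y * h l).tr) (hda i j) (hdc i j)).trans (tr_variation_mul ..)
  have h2 : ∀ i j l, dO i j l = omega (da i l) (dc i l) (X j * A) (A' * X' j) +
      ((X i * A * da j l).tr - (A' * X' i * dc j l).tr -
        omega (da j l) (dc j l) (X i * A) (A' * X' i)) := fun i j l => by
    rw [hdO, ← omega_add_omega (X i * A) (A' * X' i) (da j l) (dc j l), add_sub_cancel_right]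
  refine cyclic_sum_eq_zero hH hS (U := fun i j l => (X i * A * k j * k l).tr)
    (U' := fun i j l => (A' * X' i * h j * h l).tr)
    (V := fun i j l => (X i * A * (X j * A) * k l).tr)
    (V' := fun i j l => (A' * X' i * (A' * X' j) * h l).tr) (fun i j l => ?_) i j l ?_
  · rw [h2, h1, h1, hda, hdc, tr_mul_variation hA (hX i) (hX j) (hY j l),
      tr_mul_variation' hA' (hX' i) (hX' j) (hY' j l)]
  · have key := tri_kk_hh (X i * A) (X j * A) (X l * A) (A' * X' i) (A' * X' j) (A' * X' l)
    rw [tri_skew hA hX, tri_skew' hA' hX', sub_zero] at key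
    change -(Psd.tri (X i * A) (k j) (k l) + Psd.tri (k i) (X j * A) (k l) +
        Psd.tri (k i) (k j) (X l * A)) +
      (Psd.tri (X i * A) (X j * A) (k l) + Psd.tri (k i) (X j * A) (X l * A) +
        Psd.tri (X i * A) (k j) (X l * A)) +
      (Psd.tri (A' * X' i) (h j) (h l) + Psd.tri (h i) (A' * X' j) (h l) +
        Psd.tri (h i) (h j) (A' * X' l)) +
      (Psd.tri (A' * X' i) (A' * X' j) (h l) + Psd.tri (h i) (A' * X' j) (A' * X' l) +
        Psd.tri (A' * X' i) (h j) (A' * X' l)) = 0 at key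
    simp only [Psd.tri_apply] at key
    -- Bring all the words into the same cyclic order.
    rwa [Psd.tr_cycle (k i) (X j * A) (k l), ← Psd.tr_cycle (X j * A) (k i) (k l),
      ← Psd.tr_cycle (X l * A) (k i) (k j), Psd.tr_cycle (k i) (X l * A) (k j),
      Psd.tr_cycle (k i) (X j * A) (X l * A), Psd.tr_cycle (k i) (X l * A) (X j * A),
      ← Psd.tr_cycle (X l * A) (X i * A) (k j), ← Psd.tr_cycle (X j * A) (X i * A) (k l),
      Psd.tr_cycle (h i) (A' * X' j) (h l), ← Psd.tr_cycle (A' * X' j) (h i) (h l),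
      ← Psd.tr_cycle (A' * X' l) (h i) (h j), Psd.tr_cycle (h i) (A' * X' l) (h j),
      Psd.tr_cycle (h i) (A' * X' j) (A' * X' l), Psd.tr_cycle (h i) (A' * X' l) (A' * X' j),
      ← Psd.tr_cycle (A' * X' l) (A' * X' i) (h j),
      ← Psd.tr_cycle (A' * X' j) (A' * X' i) (h l)] at key

end Variation

/-! ### The quadratic tensor and its shifts -/

section Tensor

variable {M : CoordManifold} {b : Bool}

theorem Psd.adj_negTrue (x : Psd M b) : x.negTrue.adj = x.adj.negTrue := Psd.ext (adj_neg x.op)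

theorem Psd.adj_posFalse (x : Psd M b) : x.posFalse.adj = x.adj.posFalse :=
  Psd.ext (adj_pos x.op)

theorem P2_op (A X : Psd M true) (A' X' : Psd M false) :
    P2 (A.op, A'.op) (X.op, X'.op) =
      ((A * (X * A).negTrue - (A * X).negTrue * A - A * (A' * X').negTrue +
          (X' * A').negTrue * A).op,
        (A' * (X' * A').posFalse - (A' * X').posFalse * A' - A' * (A * X).posFalse +
          (X * A).posFalse * A').op) := rfl

theorem kk_adj {A X : Psd M true} {A' X' : Psd M false} (hA : A.adj = -A) (hA' : A'.adj = -A')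
    (hX : X.adj = X) (hX' : X'.adj = X') :
    (kk (X * A) (A' * X')).adj = (X' * A').negTrue - (A * X).negTrue := by
  rw [kk, map_sub, Psd.adj_negTrue, Psd.adj_negTrue, Psd.adj_mul, Psd.adj_mul, hA, hA', hX, hX',
    neg_mul, mul_neg, map_neg, map_neg]
  abel

theorem hh_adj {A X : Psd M true} {A' X' : Psd M false} (hA : A.adj = -A) (hA' : A'.adj = -A')
    (hX : X.adj = X) (hX' : X'.adj = X') :
    (hh (X * A) (A' * X')).adj = (X' * A').posFalse - (A * X).posFalse := by
  rw [hh, map_sub, Psd.adj_posFalse, Psd.adj_posFalse, Psd.adj_mul, Psd.adj_mul, hA, hA', hX, hX',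
    neg_mul, mul_neg, map_neg, map_neg]
  abel

/-- The quadratic tensor in terms of the projections of `XA - A'X'`. -/
theorem P2_eq {A X : Psd M true} {A' X' : Psd M false} (hA : A.adj = -A) (hA' : A'.adj = -A')
    (hX : X.adj = X) (hX' : X'.adj = X') :
    P2 (A.op, A'.op) (X.op, X'.op) = ((vecK A (kk (X * A) (A' * X'))).op,
      (vecH A' (hh (X * A) (A' * X'))).op) := by
  rw [P2_op, vecK, vecH, kk_adj hA hA' hX hX', hh_adj hA hA' hX hX', kk, hh]
  refine Prod.ext (congrArg Psd.op ?_) (congrArg Psd.op ?_)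
  · noncomm_ring
  · noncomm_ring

theorem vecK_adj {A k : Psd M true} (hA : A.adj = -A) : (vecK A k).adj = -vecK A k := by
  rw [vecK, map_add, Psd.adj_mul, Psd.adj_mul, Psd.adj_adj, hA]
  noncomm_ring

theorem vecH_adj {A' h : Psd M false} (hA : A'.adj = -A') : (vecH A' h).adj = -vecH A' h := by
  rw [vecH, map_add, Psd.adj_mul, Psd.adj_mul, Psd.adj_adj, hA]
  noncomm_ring

/-- The pairing with the Hamiltonian vector field is twice the form `omega`. -/
theorem pairing_P2 {A X Y : Psd M true} {A' X' Y' : Psd M false} (hA : A.adj = -A)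
    (hA' : A'.adj = -A') (hX : X.adj = X) (hX' : X'.adj = X') (hY : Y.adj = Y)
    (hY' : Y'.adj = Y') :
    pairing (X.op, X'.op) (P2 (A.op, A'.op) (Y.op, Y'.op)) =
      (2 : ℂ) • omega (X * A) (A' * X') (Y * A) (A' * Y') := by
  rw [P2_eq hA hA' hY hY']
  change (X * vecK A _).tr + (X' * vecH A' _).tr = _
  rw [tr_mul_vecK hA hX, tr_mul_vecH hA' hX', ← smul_add]
  rfl

end Tensor

/-! ### Points, tangent and cotangent vectors -/

section Coset

variable {M : CoordManifold} {r : DiffPoly M} {A X Y V W : Op M × Op M}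

theorem ofFun_mem_Dplus (f : DiffPoly M) : ofFun f ∈ Dplus M := single_mem_Dplus 0 f

theorem IsCotangent.fst_mem (h : IsCotangent X) : X.1 ∈ Dminus M := h.1.1.1

theorem IsCotangent.snd_mem (h : IsCotangent X) : X.2 ∈ Dplus M := by
  obtain ⟨f, h1, -⟩ := h.2
  have := Submodule.add_mem _ h1.1 (ofFun_mem_Dplus f)
  rwa [sub_add_cancel] at this

theorem IsCotangent.symm_fst (h : IsCotangent X) : adj X.1 = X.1 := mem_symmOps.1 h.1.1.2

theorem IsCotangent.symm_snd (h : IsCotangent X) : adj X.2 = X.2 := by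
  obtain ⟨f, h1, -⟩ := h.2
  have := mem_symmOps.1 h1.2
  rw [map_sub, adj_ofFun] at this
  exact sub_left_inj.1 this

theorem IsCotangent.snd_apply (h : IsCotangent X) {n : ℤ} (hn : 0 < n) : X.2 n = 0 := by
  obtain ⟨f, -, h2⟩ := h.2
  have := pos_eq_zero_iff.1 h2 n hn.le
  rwa [Pi.sub_apply, ofFun, Pi.single_eq_of_ne hn.ne', sub_zero] at this

/-- A symmetric operator has no residue. -/
theorem res_eq_zero_of_symm {a : Op M} (h : adj a = a) : a (-1) = 0 := by
  have h1 := res_adj a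
  rw [h, res, eq_neg_iff_add_eq_zero, ← two_smul ℂ] at h1
  exact (smul_eq_zero.1 h1).resolve_left two_ne_zero

/-- Cotangent vectors in terms of coefficients: the summand `𝒜` of the second component is its
coefficient of order zero, since symmetric operators have no residue. -/
theorem isCotangent_iff : IsCotangent X ↔ (X.1 ∈ Dminus M ∧ adj X.1 = X.1 ∧ neg X.1 = 0) ∧
    X.2 ∈ Dplus M ∧ adj X.2 = X.2 ∧ ∀ n > 0, X.2 n = 0 := by
  refine ⟨fun h => ⟨⟨h.fst_mem, h.symm_fst, h.1.2⟩, h.snd_mem, h.symm_snd, fun n => h.snd_apply⟩,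
    fun ⟨⟨h1, h2, h3⟩, h4, h5, h6⟩ => ⟨⟨⟨h1, mem_symmOps.2 h2⟩, h3⟩, X.2 0, ⟨?_, ?_⟩, ?_⟩⟩
  · exact Submodule.sub_mem _ h4 (ofFun_mem_Dplus _)
  · exact mem_symmOps.2 (by rw [map_sub, h5, adj_ofFun])
  · refine pos_eq_zero_iff.2 fun n hn => ?_
    rcases hn.eq_or_lt with rfl | hn
    · rw [Pi.sub_apply, ofFun, Pi.single_eq_same, sub_self]
    · rw [Pi.sub_apply, ofFun, Pi.single_eq_of_ne hn.ne', sub_zero, h6 n hn]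

/-- Tangent vectors in terms of coefficients: only the negative part of the second component is
restricted, and there it has to be `ρ D⁻¹ f + f D⁻¹ ρ`. -/
theorem isTangent_iff : IsTangent r V ↔ (V.1 ∈ Dminus M ∧ adj V.1 = -V.1 ∧ pos V.1 = 0) ∧
    V.2 ∈ Dplus M ∧ adj V.2 = -V.2 ∧ ∃ f, ∀ n < 0, V.2 n =
      (ofFun r ⋆ Dpow (-1) ⋆ ofFun f + ofFun f ⋆ Dpow (-1) ⋆ ofFun r : Op M) n := by
  have hm : ∀ f, (ofFun r ⋆ Dpow (-1) ⋆ ofFun f + ofFun f ⋆ Dpow (-1) ⋆ ofFun r : Op M) ∈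
      Dplus M := fun f => Submodule.add_mem _ (fDg_mem_Dplus _ _) (fDg_mem_Dplus _ _)
  have hs : ∀ f, adj (ofFun r ⋆ Dpow (-1) ⋆ ofFun f + ofFun f ⋆ Dpow (-1) ⋆ ofFun r : Op M) =
      -(ofFun r ⋆ Dpow (-1) ⋆ ofFun f + ofFun f ⋆ Dpow (-1) ⋆ ofFun r : Op M) := fun f => by
    rw [map_add, adj_fDg, adj_fDg, neg_add_rev]
  constructor
  · rintro ⟨⟨⟨h1, h2⟩, h3⟩, f, ⟨h4, h5⟩, h6⟩
    refine ⟨⟨h1, mem_skewOps.1 h2, h3⟩, ?_, ?_, f, fun n hn =>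
      sub_eq_zero.1 (neg_eq_zero_iff.1 h6 n hn)⟩
    · have := Submodule.add_mem _ h4 (hm f)
      rwa [sub_add_cancel] at this
    · have := mem_skewOps.1 h5
      rw [map_sub, hs, sub_neg_eq_add, neg_sub', sub_neg_eq_add] at this
      exact add_right_cancel this
  · rintro ⟨⟨h1, h2, h3⟩, h4, h5, f, h6⟩
    refine ⟨⟨⟨h1, mem_skewOps.2 h2⟩, h3⟩, f, ⟨Submodule.sub_mem _ h4 (hm f), mem_skewOps.2 ?_⟩,
      neg_eq_zero_iff.2 fun n hn => sub_eq_zero.2 (h6 n hn)⟩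
    rw [map_sub, h5, hs, neg_sub_neg, neg_sub]

theorem IsTangent.add (hV : IsTangent r V) (hW : IsTangent r W) : IsTangent r (V + W) := by
  rw [isTangent_iff] at *
  obtain ⟨⟨h1, h2, h3⟩, h4, h5, f, h6⟩ := hV
  obtain ⟨⟨k1, k2, k3⟩, k4, k5, g, k6⟩ := hW
  have hf : ∀ f : DiffPoly M, ofFun f ∈ Reg M true := fun f => ofFun_mem_Reg f
  have hD : (Dpow (-1) : Op M) ∈ Reg M true := Dpow_mem_Reg _
  refine ⟨⟨Submodule.add_mem _ h1 k1, ?_, ?_⟩, Submodule.add_mem _ h4 k4, ?_, f + g,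
    fun n hn => ?_⟩
  · change adj (V.1 + W.1) = -(V.1 + W.1)
    rw [map_add, h2, k2, neg_add]
  · change pos (V.1 + W.1) = 0
    rw [pos_eq, map_add, ← pos_eq, ← pos_eq, h3, k3, add_zero]
  · change adj (V.2 + W.2) = -(V.2 + W.2)
    rw [map_add, h5, k5, neg_add]
  · change (V.2 + W.2) n = _
    have e : (ofFun (f + g) : Op M) = ofFun f + ofFun g := Pi.single_add _ _ _
    rw [Pi.add_apply, h6 n hn, k6 n hn, e, add_mul_Reg (hf f) (hf g) hD,
      add_mul_Reg (mul_mem_Reg (hf f) hD) (mul_mem_Reg (hf g) hD) (hf r),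
      mul_add_Reg (mul_mem_Reg (hf r) hD) (hf f) (hf g)]
    simp only [Pi.add_apply]
    exact add_add_add_comm _ _ _ _

theorem IsTangent.smul (hV : IsTangent r V) (z : ℂ) : IsTangent r (z • V) := by
  rw [isTangent_iff] at *
  obtain ⟨⟨h1, h2, h3⟩, h4, h5, f, h6⟩ := hV
  have hf : ∀ f : DiffPoly M, ofFun f ∈ Reg M true := fun f => ofFun_mem_Reg f
  have hD : (Dpow (-1) : Op M) ∈ Reg M true := Dpow_mem_Reg _
  refine ⟨⟨Submodule.smul_mem _ z h1, ?_, ?_⟩, Submodule.smul_mem _ z h4, ?_, z • f,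
    fun n hn => ?_⟩
  · change adj (z • V.1) = -(z • V.1)
    rw [map_smul, h2, smul_neg]
  · change pos (z • V.1) = 0
    rw [pos_eq, map_smul, ← pos_eq, h3, smul_zero]
  · change adj (z • V.2) = -(z • V.2)
    rw [map_smul, h5, smul_neg]
  · change z • V.2 n = _
    have e : (ofFun (z • f) : Op M) = z • ofFun f := Pi.single_smul' _ _ _
    rw [h6 n hn, e, smul_mul_Reg (hf f) hD, smul_mul_Reg (mul_mem_Reg (hf f) hD) (hf r),
      mul_smul_Reg (mul_mem_Reg (hf r) hD) (hf f), ← smul_add]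
    rfl

theorem IsCotangent.add (hX : IsCotangent X) (hY : IsCotangent Y) : IsCotangent (X + Y) := by
  rw [isCotangent_iff] at *
  obtain ⟨⟨h1, h2, h3⟩, h4, h5, h6⟩ := hX
  obtain ⟨⟨k1, k2, k3⟩, k4, k5, k6⟩ := hY
  refine ⟨⟨Submodule.add_mem _ h1 k1, ?_, ?_⟩, Submodule.add_mem _ h4 k4, ?_, fun n hn => ?_⟩
  · change adj (X.1 + Y.1) = X.1 + Y.1
    rw [map_add, h2, k2]
  · change neg (X.1 + Y.1) = 0
    rw [neg_eq, map_add, ← neg_eq, ← neg_eq, h3, k3, add_zero]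
  · change adj (X.2 + Y.2) = X.2 + Y.2
    rw [map_add, h5, k5]
  · change X.2 n + Y.2 n = 0
    rw [h6 n hn, k6 n hn, add_zero]

theorem IsCotangent.smul (hX : IsCotangent X) (z : ℂ) : IsCotangent (z • X) := by
  rw [isCotangent_iff] at *
  obtain ⟨⟨h1, h2, h3⟩, h4, h5, h6⟩ := hX
  refine ⟨⟨Submodule.smul_mem _ z h1, ?_, ?_⟩, Submodule.smul_mem _ z h4, ?_, fun n hn => ?_⟩
  · change adj (z • X.1) = z • X.1
    rw [map_smul, h2]
  · change neg (z • X.1) = 0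
    rw [neg_eq, map_smul, ← neg_eq, h3, smul_zero]
  · change adj (z • X.2) = z • X.2
    rw [map_smul, h5]
  · change z • X.2 n = 0
    rw [h6 n hn, smul_zero]

/-- The shift of the coset. -/
theorem IsCosetPoint.shift (hA : IsCosetPoint r A) (s : ℂ) :
    IsCosetPoint r (A + s • (Dpow (-1), Dpow 1)) := by
  obtain ⟨⟨⟨h1, h2⟩, h3⟩, ⟨h4, h5⟩, h6⟩ := hA
  have e1 : (A + s • ((Dpow (-1), Dpow 1) : Op M × Op M)).1 - Dpow 1 =
      A.1 - Dpow 1 + s • (Dpow (-1) : Op M) := by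
    change A.1 + s • (Dpow (-1) : Op M) - Dpow 1 = _
    abel
  have e2 : (A + s • ((Dpow (-1), Dpow 1) : Op M × Op M)).2 - ofFun r ⋆ Dpow (-1) ⋆ ofFun r =
      A.2 - ofFun r ⋆ Dpow (-1) ⋆ ofFun r + s • (Dpow 1 : Op M) := by
    change A.2 + s • (Dpow 1 : Op M) - ofFun r ⋆ Dpow (-1) ⋆ ofFun r = _
    abel
  rw [IsCosetPoint, e1, e2]
  refine ⟨⟨⟨Submodule.add_mem _ h1 (Submodule.smul_mem _ s (single_mem_Dminus _ _)),
    Submodule.add_mem _ h2 (Submodule.smul_mem _ s (mem_skewOps.2 adj_Dpow_neg_one))⟩, ?_⟩,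
    ⟨Submodule.add_mem _ h4 (Submodule.smul_mem _ s (single_mem_Dplus _ _)),
    Submodule.add_mem _ h5 (Submodule.smul_mem _ s (mem_skewOps.2 adj_Dpow_one))⟩, ?_⟩
  · have : pos (Dpow (-1) : Op M) = 0 := pos_eq_zero_iff.2 fun n hn => by
      rw [Dpow, Pi.single_eq_of_ne (by omega)]
    rw [pos_eq, map_add, map_smul, ← pos_eq, ← pos_eq, h3, this, smul_zero, add_zero]
  · have : neg (Dpow 1 : Op M) = 0 := neg_eq_zero_iff.2 fun n hn => by
      rw [Dpow, Pi.single_eq_of_ne (by omega)]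
    rw [neg_eq, map_add, map_smul, ← neg_eq, ← neg_eq, h6, this, smul_zero, add_zero]

end Coset

section Tangency

variable {M : CoordManifold} {b : Bool} {r : DiffPoly M} {A X Y : Op M × Op M}

/-- The first component of a point, in the algebra of operators of the first kind. -/
def IsCosetPoint.fst (hA : IsCosetPoint r A) : Psd M true := Psd.mk A.1 (Dminus_le hA.fst_mem)

/-- The second component of a point, in the algebra of operators of the second kind. -/
def IsCosetPoint.snd (hA : IsCosetPoint r A) : Psd M false := Psd.mk A.2 (Dplus_le hA.snd_mem)

/-- The first component of a covector, in the algebra of operators of the first kind. -/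
def IsCotangent.fst (hX : IsCotangent X) : Psd M true := Psd.mk X.1 (Dminus_le hX.fst_mem)

/-- The second component of a covector, in the algebra of operators of the second kind. -/
def IsCotangent.snd (hX : IsCotangent X) : Psd M false := Psd.mk X.2 (Dplus_le hX.snd_mem)

theorem IsCosetPoint.adj_fst (hA : IsCosetPoint r A) : hA.fst.adj = -hA.fst :=
  Psd.ext hA.skew_fst

theorem IsCosetPoint.adj_snd (hA : IsCosetPoint r A) : hA.snd.adj = -hA.snd :=
  Psd.ext hA.skew_snd

theorem IsCotangent.adj_fst (hX : IsCotangent X) : hX.fst.adj = hX.fst := Psd.ext hX.symm_fst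

theorem IsCotangent.adj_snd (hX : IsCotangent X) : hX.snd.adj = hX.snd := Psd.ext hX.symm_snd

/-! ### The quadratic tensor is tangent to the coset -/

theorem neg_mul_Dpow_neg_one {a : Op M} (ha : neg a = 0) :
    neg (a ⋆ Dpow (-1)) = ofFun (a 0) ⋆ Dpow (-1) := by
  funext n
  rw [ofFun_mul_apply, Dpow]
  by_cases hn : n < 0
  · rw [neg_apply hn, ← Dpow, mul_Dpow_apply]
    by_cases h : n = -1
    · subst h
      simp [Dpow]
    · rw [neg_eq_zero_iff.1 ha _ (by omega), Dpow, Pi.single_eq_of_ne h, mul_zero]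
  · rw [neg_apply_of_nonneg (by omega), Pi.single_eq_of_ne (by omega), mul_zero]

theorem neg_ofFun (f : DiffPoly M) : neg (ofFun f : Op M) = 0 :=
  neg_eq_zero_iff.2 fun n hn => by rw [ofFun, Pi.single_eq_of_ne (by omega)]

theorem neg_mul_of_neg_eq_zero {a c : Op M} (ha : a ∈ Reg M false) (hc : neg c = 0) :
    neg (a ⋆ c) = neg (neg a ⋆ c) := by
  conv_lhs => rw [← pos_add_neg a,
    add_mul_Reg (pos_mem_Reg ha) (neg_mem_Reg ha) (mem_Reg_of_neg hc),
    neg_eq, map_add, ← neg_eq, ← neg_eq, neg_mul_eq_zero (neg_pos a) hc, zero_add]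

theorem neg_mul_of_neg_eq_zero' {a c : Op M} (ha : a ∈ Reg M false) (hc : neg c = 0) :
    neg (c ⋆ a) = neg (c ⋆ neg a) := by
  conv_lhs => rw [← pos_add_neg a,
    mul_add_Reg (mem_Reg_of_neg hc) (pos_mem_Reg ha) (neg_mem_Reg ha),
    neg_eq, map_add, ← neg_eq, ← neg_eq, neg_mul_eq_zero hc (neg_pos a), zero_add]

/-- A differential operator `h` acts on the functions: `(h r D⁻¹ g)_- = h(r) D⁻¹ g`. -/
theorem neg_mul_fDg {h : Op M} (hh : neg h = 0) (f g : DiffPoly M) :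
    neg (h ⋆ (ofFun f ⋆ Dpow (-1) ⋆ ofFun g)) = ofFun ((h ⋆ ofFun f) 0) ⋆ Dpow (-1) ⋆ ofFun g := by
  have hR : h ∈ Reg M false := mem_Reg_of_neg hh
  have hf : ∀ {f : DiffPoly M}, ofFun f ∈ Reg M false := fun {f} => ofFun_mem_Reg f
  have hD : (Dpow (-1) : Op M) ∈ Reg M false := Dpow_mem_Reg _
  have hhf : neg (h ⋆ ofFun f) = 0 := neg_mul_eq_zero hh (neg_ofFun f)
  rw [← mul_assoc_Reg hR (mul_mem_Reg hf hD) hf, ← mul_assoc_Reg hR hf hD,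
    neg_mul_of_neg_eq_zero (mul_mem_Reg (mul_mem_Reg hR hf) hD) (neg_ofFun g),
    neg_mul_Dpow_neg_one hhf]
  exact neg_of_pos_eq_zero (pos_fDg _ _)

theorem IsCosetPoint.neg_snd (hA : IsCosetPoint r A) :
    neg A.2 = ofFun r ⋆ Dpow (-1) ⋆ ofFun r := by
  funext n
  by_cases hn : n < 0
  · rw [neg_apply hn, hA.snd_apply hn]
  · rw [neg_apply_of_nonneg (by omega), fDg_apply _ _ (by omega)]

/-- The leading term of `A k + k^* A` is `D k + k^* D`. It has order at most zero, and its
coefficient of order zero is the sum of the residues of `k` and of `k^*`, which vanishes. -/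
theorem vecK_tangent (hA : IsCosetPoint r A) {k : Psd M true} (hk : pos k.op = 0) :
    pos (vecK hA.fst k).op = 0 := by
  have h1 : ∀ n, 1 < n → A.1 n = 0 := fun n hn => by
    rw [hA.fst_apply (by omega), Dpow, Pi.single_eq_of_ne hn.ne']
  have h2 : A.1 1 = 1 := by rw [hA.fst_apply (by norm_num), Dpow, Pi.single_eq_same]
  have hk' : ∀ n, -1 < n → k.op n = 0 := fun n hn => pos_eq_zero_iff.1 hk n (by omega)
  have hk'' : ∀ n, -1 < n → adj k.op n = 0 := fun n hn =>
    pos_eq_zero_iff.1 (pos_adj_eq_zero hk) n (by omega)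
  have e : (vecK hA.fst k).op = A.1 ⋆ k.op + adj k.op ⋆ A.1 := rfl
  rw [e, pos_eq_zero_iff]
  intro n hn
  rw [Pi.add_apply]
  rcases hn.eq_or_lt with rfl | hn
  · have e1 := mul_apply_top h1 hk'
    have e2 := mul_apply_top hk'' h1
    rw [add_neg_cancel] at e1
    rw [neg_add_cancel] at e2
    rw [e1, e2, h2, one_mul, mul_one]
    exact (congrArg _ (res_adj k.op)).trans (add_neg_cancel _)
  · rw [mul_apply_eq_zero h1 hk' (by omega), mul_apply_eq_zero hk'' h1 (by omega), add_zero]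

/-- The negative part of `h Â` is `h(ρ) D⁻¹ ρ`, as `h` is a differential operator; here the
function `h(ρ)` is the coefficient of order zero of `h ⋆ ρ`. -/
theorem vecH_tangent (hA : IsCosetPoint r A) {h : Psd M false} (hh : neg h.op = 0) :
    neg (vecH hA.snd h).op = ofFun r ⋆ Dpow (-1) ⋆ ofFun ((h.op ⋆ ofFun r) 0) +
      ofFun ((h.op ⋆ ofFun r) 0) ⋆ Dpow (-1) ⋆ ofFun r := by
  have e : vecH hA.snd h = h * hA.snd - (h * hA.snd).adj := by
    rw [vecH, Psd.adj_mul, hA.adj_snd, neg_mul, sub_neg_eq_add]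
  have e1 : neg (h * hA.snd).op = ofFun ((h.op ⋆ ofFun r) 0) ⋆ Dpow (-1) ⋆ ofFun r := by
    change neg (h.op ⋆ A.2) = _
    rw [neg_mul_of_neg_eq_zero' (Dplus_le hA.snd_mem) hh, hA.neg_snd, neg_mul_fDg hh]
  rw [e, map_sub, neg_eq, map_sub, ← neg_eq, ← neg_eq, Psd.op_adj, ← adj_neg, e1, adj_fDg,
    sub_neg_eq_add, add_comm]

theorem P2_eq' (hA : IsCosetPoint r A) (hX : IsCotangent X) :
    P2 A X = ((vecK hA.fst (kk (hX.fst * hA.fst) (hA.snd * hX.snd))).op,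
      (vecH hA.snd (hh (hX.fst * hA.fst) (hA.snd * hX.snd))).op) := by
  have h := P2_eq hA.adj_fst hA.adj_snd hX.adj_fst hX.adj_snd
  exact h

theorem kk_mem (a : Psd M true) (c : Psd M false) : pos (kk a c).op = 0 :=
  AddSubgroup.sub_mem (Psd.negs M true) a.negTrue_mem c.negTrue_mem

theorem hh_mem (a : Psd M true) (c : Psd M false) : neg (hh a c).op = 0 :=
  AddSubgroup.sub_mem (Psd.poss M false) a.posFalse_mem c.posFalse_mem

theorem mem_Dplus_of_neg {a : Op M} (h : neg a = 0) : a ∈ Dplus M := by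
  rw [← pos_of_neg_eq_zero h]
  exact pos_mem_Dplus a

theorem mem_Dminus_of_pos {a : Op M} (h : pos a = 0) : a ∈ Dminus M := by
  rw [← neg_of_pos_eq_zero h]
  exact neg_mem_Dminus a

theorem P2_isTangent (hA : IsCosetPoint r A) (hX : IsCotangent X) : IsTangent r (P2 A X) := by
  rw [P2_eq' hA hX, isTangent_iff]
  set k := kk (hX.fst * hA.fst) (hA.snd * hX.snd)
  set h := hh (hX.fst * hA.fst) (hA.snd * hX.snd)
  have hk : k.op ∈ Dminus M := mem_Dminus_of_pos (kk_mem _ _)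
  have hh : h.op ∈ Dplus M := mem_Dplus_of_neg (hh_mem _ _)
  refine ⟨⟨?_, ?_, vecK_tangent hA (kk_mem _ _)⟩, ?_, ?_, (h.op ⋆ ofFun r) 0, fun n hn => ?_⟩
  · exact Submodule.add_mem _ (mul_mem_Dminus hA.fst_mem hk)
      (mul_mem_Dminus (adj_mem_Dminus hk) hA.fst_mem)
  · exact congrArg Psd.op (vecK_adj hA.adj_fst)
  · exact Submodule.add_mem _ (mul_mem_Dplus hh hA.snd_mem)
      (mul_mem_Dplus hA.snd_mem (adj_mem_Dplus hh))
  · exact congrArg Psd.op (vecH_adj hA.adj_snd)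
  · change (vecH hA.snd h).op n = _
    rw [← neg_apply (a := (vecH hA.snd h).op) hn, vecH_tangent hA (hh_mem _ _)]

theorem P2_add (hA : IsCosetPoint r A) (hX : IsCotangent X) (hY : IsCotangent Y) :
    P2 A (X + Y) = P2 A X + P2 A Y := by
  refine (P2_op hA.fst (hX.fst + hY.fst) hA.snd (hX.snd + hY.snd)).trans (Eq.trans ?_
    (congrArg₂ HAdd.hAdd (P2_op hA.fst hX.fst hA.snd hX.snd)
      (P2_op hA.fst hY.fst hA.snd hY.snd)).symm)
  rw [Prod.mk_add_mk, ← map_add, ← map_add]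
  refine Prod.ext (congrArg Psd.op ?_) (congrArg Psd.op ?_)
  · simp only [mul_add, add_mul, map_add]
    abel
  · simp only [mul_add, add_mul, map_add]
    abel

theorem P2_smul (hA : IsCosetPoint r A) (hX : IsCotangent X) (z : ℂ) :
    P2 A (z • X) = z • P2 A X := by
  have h := P2_op hA.fst (z • hX.fst) hA.snd (z • hX.snd)
  refine h.trans (Eq.trans ?_ (congrArg _ (P2_op hA.fst hX.fst hA.snd hX.snd)).symm)
  simp only [mul_smul_comm, smul_mul_assoc, map_smul, ← smul_sub, ← smul_add]
  rfl

theorem P2_skew (hA : IsCosetPoint r A) (hX : IsCotangent X) (hY : IsCotangent Y) :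
    pairing X (P2 A Y) = -pairing Y (P2 A X) := by
  have h1 := pairing_P2 hA.adj_fst hA.adj_snd hX.adj_fst hX.adj_snd hY.adj_fst hY.adj_snd
  have h2 := pairing_P2 hA.adj_fst hA.adj_snd hY.adj_fst hY.adj_snd hX.adj_fst hX.adj_snd
  refine h1.trans (Eq.trans ?_ (congrArg Neg.neg h2).symm)
  have := omega_add_omega (hX.fst * hA.fst) (hA.snd * hX.snd) (hY.fst * hA.fst)
    (hA.snd * hY.snd)
  rw [tr_skew_word hA.adj_fst hX.adj_fst hY.adj_fst,
    tr_skew_word' hA.adj_snd hX.adj_snd hY.adj_snd, sub_zero] at this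
  rw [← smul_neg, eq_neg_of_add_eq_zero_left this]

end Tangency

/-! ### The shift of the quadratic tensor -/

section Shift

variable {M : CoordManifold} {b : Bool} {r : DiffPoly M} {A X Y : Op M × Op M}

/-- The operator `D^j` in the algebras of operators. -/
noncomputable def Psd.dpow (M : CoordManifold) (b : Bool) (j : ℤ) : Psd M b :=
  Psd.mk (Dpow j) (Dpow_mem_Reg j)

/-- The operator of multiplication by `f` in the algebras of operators. -/
noncomputable def Psd.fn (b : Bool) (f : DiffPoly M) : Psd M b :=
  Psd.mk (ofFun f) (ofFun_mem_Reg f)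

theorem Psd.adj_fn (f : DiffPoly M) : (Psd.fn b f).adj = Psd.fn b f := Psd.ext (adj_ofFun f)

theorem Psd.adj_dpow_one : (Psd.dpow M b 1).adj = -Psd.dpow M b 1 := Psd.ext adj_Dpow_one

theorem Psd.adj_dpow_neg_one : (Psd.dpow M b (-1)).adj = -Psd.dpow M b (-1) :=
  Psd.ext adj_Dpow_neg_one

theorem Psd.negTrue_mul_dpow {x : Psd M true} (h : neg x.op = 0) :
    (x * Psd.dpow M true (-1)).negTrue = Psd.fn true (x.op 0) * Psd.dpow M true (-1) :=
  Psd.ext (neg_mul_Dpow_neg_one h)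

theorem Psd.posFalse_mul_dpow {x : Psd M false} (h : ∀ n > 0, x.op n = 0) (h1 : x.op (-1) = 0) :
    (x * Psd.dpow M false 1).posFalse = Psd.fn false (x.op 0) * Psd.dpow M false 1 := by
  refine Psd.ext (funext fun n => ?_)
  change pos (x.op ⋆ Dpow 1) n = (ofFun (x.op 0) ⋆ Dpow 1) n
  rw [ofFun_mul_apply, Dpow]
  by_cases hn : 0 ≤ n
  · rw [pos_apply hn, ← Dpow, mul_Dpow_apply]
    by_cases h' : n = 1
    · subst h'
      simp [Dpow]
    · rw [Dpow, Pi.single_eq_of_ne h', mul_zero]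
      rcases hn.eq_or_lt with rfl | hn
      · exact h1
      · exact h _ (by omega)
  · rw [pos_apply_of_neg (by omega), Pi.single_eq_of_ne (by omega), mul_zero]

/-- Multiplication by `D` commutes with the negative part up to the residue, which is assumed to
vanish. -/
theorem Psd.negTrue_mul_dpow_mul_dpow {x : Psd M false} (h1 : x.op (-1) = 0) :
    (x * Psd.dpow M false 1).negTrue * Psd.dpow M true (-1) = x.negTrue := by
  refine Psd.ext (funext fun n => ?_)
  change (neg (x.op ⋆ Dpow 1) ⋆ Dpow (-1)) n = neg x.op n
  rw [mul_Dpow_apply]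
  rcases lt_trichotomy n (-1) with hn | rfl | hn
  · rw [neg_apply (by omega), neg_apply (by omega), mul_Dpow_apply, sub_neg_eq_add,
      add_sub_cancel_right]
  · rw [neg_apply_of_nonneg (by omega), neg_apply (by omega), h1]
  · rw [neg_apply_of_nonneg (by omega), neg_apply_of_nonneg (by omega)]

/-- Multiplication by `D⁻¹` commutes with the differential part up to the coefficient of order
zero. -/
theorem Psd.posFalse_mul_dpow_mul_dpow (x : Psd M true) :
    (x * Psd.dpow M true (-1)).posFalse * Psd.dpow M false 1 =
      x.posFalse - Psd.fn false (x.op 0) := by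
  refine Psd.ext (funext fun n => ?_)
  change (pos (x.op ⋆ Dpow (-1)) ⋆ Dpow 1) n = pos x.op n - ofFun (x.op 0) n
  rw [mul_Dpow_apply, ofFun]
  rcases lt_trichotomy n 0 with hn | rfl | hn
  · rw [pos_apply_of_neg (by omega), pos_apply_of_neg (by omega), Pi.single_eq_of_ne (by omega),
      sub_zero]
  · rw [pos_apply_of_neg (by omega), pos_apply (by omega), Pi.single_eq_same, sub_self]
  · rw [pos_apply (by omega), pos_apply (by omega), Pi.single_eq_of_ne (by omega), mul_Dpow_apply,
      sub_zero]
    exact congrArg x.op (by ring)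

/-- The vanishing of the first component of the quadratic tensor at `(D⁻¹, D)`. -/
theorem P2_dpow_fst {X : Psd M true} {X' : Psd M false} (hX : X.adj = X) (hX' : X'.adj = X')
    (h : neg X.op = 0) :
    Psd.dpow M true (-1) * (X * Psd.dpow M true (-1)).negTrue -
      (Psd.dpow M true (-1) * X).negTrue * Psd.dpow M true (-1) -
      Psd.dpow M true (-1) * (Psd.dpow M false 1 * X').negTrue +
      (X' * Psd.dpow M false 1).negTrue * Psd.dpow M true (-1) = 0 := by
  have e1 := Psd.negTrue_mul_dpow h
  have e2 := congrArg Psd.adj e1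
  have e3 := Psd.negTrue_mul_dpow_mul_dpow (x := X') (res_eq_zero_of_symm (congrArg Psd.op hX'))
  have e4 := congrArg Psd.adj e3
  simp only [Psd.adj_negTrue, Psd.adj_mul, hX, hX', Psd.adj_dpow_one, Psd.adj_dpow_neg_one,
    Psd.adj_fn, neg_mul, map_neg, neg_inj, mul_neg, neg_neg] at e2 e4
  rw [e1, e2, e3, e4]
  noncomm_ring

/-- The vanishing of the second component of the quadratic tensor at `(D⁻¹, D)`. -/
theorem P2_dpow_snd {X : Psd M true} {X' : Psd M false} (hX : X.adj = X) (hX' : X'.adj = X')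
    (h' : ∀ n > 0, X'.op n = 0) :
    Psd.dpow M false 1 * (X' * Psd.dpow M false 1).posFalse -
      (Psd.dpow M false 1 * X').posFalse * Psd.dpow M false 1 -
      Psd.dpow M false 1 * (Psd.dpow M true (-1) * X).posFalse +
      (X * Psd.dpow M true (-1)).posFalse * Psd.dpow M false 1 = 0 := by
  have e1 := Psd.posFalse_mul_dpow h' (res_eq_zero_of_symm (congrArg Psd.op hX'))
  have e2 := congrArg Psd.adj e1
  have e3 := Psd.posFalse_mul_dpow_mul_dpow X
  have e4 := congrArg Psd.adj e3
  simp only [Psd.adj_posFalse, Psd.adj_mul, hX, hX', Psd.adj_dpow_one, Psd.adj_dpow_neg_one,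
    Psd.adj_fn, neg_mul, map_neg, map_sub, neg_inj, mul_neg, neg_neg] at e2 e4
  rw [e1, e2, e3, e4]
  noncomm_ring

theorem P1_op (A X : Psd M true) (A' X' : Psd M false) :
    P1 (A.op, A'.op) (X.op, X'.op) =
      ((A * (X * Psd.dpow M true (-1)).negTrue + Psd.dpow M true (-1) * (X * A).negTrue -
          (Psd.dpow M true (-1) * X).negTrue * A - (A * X).negTrue * Psd.dpow M true (-1) -
          A * (Psd.dpow M false 1 * X').negTrue - Psd.dpow M true (-1) * (A' * X').negTrue +
          (X' * Psd.dpow M false 1).negTrue * A +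
          (X' * A').negTrue * Psd.dpow M true (-1)).op,
        (A' * (X' * Psd.dpow M false 1).posFalse + Psd.dpow M false 1 * (X' * A').posFalse -
          (Psd.dpow M false 1 * X').posFalse * A' - (A' * X').posFalse * Psd.dpow M false 1 -
          A' * (Psd.dpow M true (-1) * X).posFalse - Psd.dpow M false 1 * (A * X).posFalse +
          (X * Psd.dpow M true (-1)).posFalse * A' +
          (X * A).posFalse * Psd.dpow M false 1).op) := rfl

/-- The quadratic tensor at a shifted point: the `s²` term is the value at `(D⁻¹, D)`, which
vanishes, and the `s` term is the linear tensor. -/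
theorem P2_shift (hA : IsCosetPoint r A) (hX : IsCotangent X) (s : ℂ) :
    P2 (A + s • (Dpow (-1), Dpow 1)) X = P2 A X + s • P1 A X := by
  have h := P2_op (hA.fst + s • Psd.dpow M true (-1)) hX.fst (hA.snd + s • Psd.dpow M false 1)
    hX.snd
  refine h.trans (Eq.trans ?_ (congrArg₂ HAdd.hAdd (P2_op hA.fst hX.fst hA.snd hX.snd)
    (congrArg (s • ·) (P1_op hA.fst hX.fst hA.snd hX.snd))).symm)
  have h1 := P2_dpow_fst hX.adj_fst hX.adj_snd hX.1.2
  have h2 := P2_dpow_snd hX.adj_fst hX.adj_snd fun n hn => hX.snd_apply hn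
  rw [Prod.smul_mk, Prod.mk_add_mk, ← map_smul, ← map_smul, ← map_add, ← map_add]
  refine Prod.ext (congrArg Psd.op ?_) (congrArg Psd.op ?_)
  · simp only [mul_add, add_mul, map_add, map_smul, smul_mul_assoc, mul_smul_comm]
    linear_combination (norm := module) (s * s) • h1
  · simp only [mul_add, add_mul, map_add, map_smul, smul_mul_assoc, mul_smul_comm]
    linear_combination (norm := module) (s * s) • h2

/-- The linear combinations of the two tensors in terms of the quadratic one. -/
theorem combination_eq (hA : IsCosetPoint r A) (hX : IsCotangent X) (x y : ℂ) :
    (x • P1 + y • P2 : Op M × Op M → Op M × Op M → Op M × Op M) A X =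
      x • P2 (A + (1 : ℂ) • (Dpow (-1), Dpow 1)) X + (y - x) • P2 A X := by
  change x • P1 A X + y • P2 A X = _
  rw [P2_shift hA hX]
  module

end Shift

/-! ### Dependence on the coordinates -/

section Dependence

variable {M : CoordManifold} {b : Bool}

/-- The differential polynomials `g` whose derivatives `∂g/∂v_k^{(s)}` have degree at least
`e - s` for all `s`. -/
noncomputable def depGE (M : CoordManifold) (k : Coord) (e : ℤ) : Submodule ℂ (DiffPoly M) where
  carrier := {g | ∀ s : ℕ, jetDeriv k s g ∈ degGE M (e - s)}
  zero_mem' s := by rw [map_zero]; exact Submodule.zero_mem _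
  add_mem' hf hg s := by rw [map_add]; exact Submodule.add_mem _ (hf s) (hg s)
  smul_mem' c f hf s := by rw [map_smul]; exact Submodule.smul_mem _ c (hf s)

variable {k : Coord} {e : ℤ}

theorem degGE_le_depGE : degGE M e ≤ depGE M k e := fun _ hg s => jetDeriv_mem_degGE hg k s

theorem depGE_antitone {e' : ℤ} (h : e ≤ e') : depGE M k e' ≤ depGE M k e :=
  fun _ hg s => degGE_le (by omega) (hg s)

theorem depGE_mono {e' : ℤ} {g : DiffPoly M} (hg : g ∈ depGE M k e') (h : e ≤ e') :
    g ∈ depGE M k e := depGE_antitone h hg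

theorem mem_depGE_of_nonpos (he : e ≤ 0) (g : DiffPoly M) : g ∈ depGE M k e :=
  fun _ => mem_degGE_of_nonpos (by omega) _

theorem mul_mem_depGE_degGE {f g : DiffPoly M} {e₁ e₂ l₁ l₂ : ℤ} (hf : f ∈ depGE M k e₁)
    (hf' : f ∈ degGE M l₁) (hg : g ∈ depGE M k e₂) (hg' : g ∈ degGE M l₂) (h1 : e ≤ e₁ + l₂)
    (h2 : e ≤ l₁ + e₂) : f * g ∈ depGE M k e := fun s => by
  rw [jetDeriv_mul]
  exact Submodule.add_mem _ (degGE_le (by omega) (mul_mem_degGE (hf s) hg'))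
    (degGE_le (by omega) (mul_mem_degGE hf' (hg s)))

theorem mul_mem_depGE {f g : DiffPoly M} (hf : f ∈ depGE M k e) (hg : g ∈ depGE M k e) :
    f * g ∈ depGE M k e :=
  mul_mem_depGE_degGE hf (mem_degGE_of_nonpos le_rfl _) hg (mem_degGE_of_nonpos le_rfl _)
    (by simp) (by simp)

theorem D_mem_depGE {g : DiffPoly M} (hg : g ∈ depGE M k e) : D g ∈ depGE M k (e + 1) := by
  intro s
  cases s with
  | zero =>
    rw [jetDeriv_zero_D]
    exact degGE_le (by push_cast; omega) (D_mem_degGE (hg 0))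
  | succ s =>
    rw [jetDeriv_succ_D]
    exact Submodule.add_mem _ (degGE_le (by push_cast; omega) (D_mem_degGE (hg (s + 1))))
      (degGE_le (by push_cast; omega) (hg s))

theorem D_pow_mem_depGE {g : DiffPoly M} (hg : g ∈ depGE M k e) (r : ℕ) :
    (D ^ r) g ∈ depGE M k (e + r) := by
  induction r with
  | zero => simpa using hg
  | succ r ih =>
    rw [pow_succ', Module.End.mul_apply]
    exact depGE_mono (D_mem_depGE ih) (by push_cast; omega)

theorem D_pow_mem_depGE' {g : DiffPoly M} (hg : g ∈ depGE M k e) (r : ℕ) :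
    (D ^ r) g ∈ depGE M k e := depGE_mono (D_pow_mem_depGE hg r) (by omega)

theorem zsmul_mem_depGE {g : DiffPoly M} (hg : g ∈ depGE M k e) (z : ℤ) : z • g ∈ depGE M k e :=
  (depGE M k e).toAddSubgroup.zsmul_mem hg z

theorem varDeriv_mem_degGE {g : DiffPoly M} (hg : g ∈ depGE M k e) :
    varDeriv k g ∈ degGE M e :=
  (hasFSum_varDeriv k g).mem le_rfl fun s => degGE_le (by omega) (neg_D_pow_mem (hg s) s)

theorem adj_mem_depGE {a : Op M} (ha : ∀ n, a n ∈ depGE M k e) (n : ℤ) :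
    adj a n ∈ depGE M k e :=
  (hasFSum_adj a n).mem degGE_le_depGE fun r => zsmul_mem_depGE (D_pow_mem_depGE' (ha _) r) _

theorem mul_apply_mem_depGE {a c : Op M} (ha : a ∈ Reg M b) (hc : c ∈ Reg M b) {n : ℤ}
    (h : ∀ (p : ℤ) (r : ℕ), a p * (D ^ r) (c (n - p + r)) ∈ depGE M k e) :
    (a ⋆ c) n ∈ depGE M k e :=
  (hasFSum_mul ha hc n).mem degGE_le_depGE fun p => zsmul_mem_depGE (h p.1 p.2) _

/-- The product of operators all of whose coefficients have weak dependence on a coordinate. -/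
theorem mul_mem_depGE_of_forall {a c : Op M} (ha : a ∈ Reg M b) (hc : c ∈ Reg M b)
    (ha' : ∀ n, a n ∈ depGE M k e) (hc' : ∀ n, c n ∈ depGE M k e) (n : ℤ) :
    (a ⋆ c) n ∈ depGE M k e :=
  mul_apply_mem_depGE ha hc fun p r => mul_mem_depGE (ha' p) (D_pow_mem_depGE' (hc' _) r)

/-- The differential polynomials which, in every degree, depend on finitely many coordinates. -/
noncomputable def Adm (M : CoordManifold) : Submodule ℂ (DiffPoly M) where
  carrier := {g | ∀ K : ℤ, ∃ S : Finset Coord, ∀ k, k ∉ S → g ∈ depGE M k K}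
  zero_mem' _ := ⟨∅, fun _ _ => Submodule.zero_mem _⟩
  add_mem' := by
    classical
    intro f g hf hg K
    obtain ⟨S, hS⟩ := hf K
    obtain ⟨T, hT⟩ := hg K
    refine ⟨S ∪ T, fun k hk => ?_⟩
    rw [Finset.mem_union, not_or] at hk
    exact Submodule.add_mem _ (hS k hk.1) (hT k hk.2)
  smul_mem' c f hf K := by
    obtain ⟨S, hS⟩ := hf K
    exact ⟨S, fun k hk => Submodule.smul_mem _ c (hS k hk)⟩

theorem mul_mem_Adm {f g : DiffPoly M} (hf : f ∈ Adm M) (hg : g ∈ Adm M) : f * g ∈ Adm M := by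
  classical
  intro K
  obtain ⟨S, hS⟩ := hf K
  obtain ⟨T, hT⟩ := hg K
  refine ⟨S ∪ T, fun k hk => ?_⟩
  rw [Finset.mem_union, not_or] at hk
  exact mul_mem_depGE (hS k hk.1) (hT k hk.2)

theorem D_pow_mem_Adm {g : DiffPoly M} (hg : g ∈ Adm M) (r : ℕ) : (D ^ r) g ∈ Adm M := fun K => by
  obtain ⟨S, hS⟩ := hg K
  exact ⟨S, fun k hk => D_pow_mem_depGE' (hS k hk) r⟩

theorem D_mem_Adm {g : DiffPoly M} (hg : g ∈ Adm M) : D g ∈ Adm M := by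
  simpa using D_pow_mem_Adm hg 1

theorem zsmul_mem_Adm {g : DiffPoly M} (hg : g ∈ Adm M) (z : ℤ) : z • g ∈ Adm M :=
  (Adm M).toAddSubgroup.zsmul_mem hg z

theorem HasFSum.mem_Adm {ι : Type*} {t : ι → DiffPoly M} {x : DiffPoly M}
    (hx : HasFSum (degGE M) t x) (h : ∀ j, t j ∈ Adm M) : x ∈ Adm M := by
  classical
  intro K
  obtain ⟨T, hT⟩ := (hx K).exists
  obtain ⟨S, hS⟩ := (Adm M).sum_mem (t := T) (fun j _ => h j) K
  refine ⟨S, fun k hk => ?_⟩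
  have := Submodule.add_mem _ (degGE_le_depGE hT) (hS k hk)
  rwa [sub_add_cancel] at this

theorem one_mem_depGE (k : Coord) (e : ℤ) : (1 : DiffPoly M) ∈ depGE M k e := fun s => by
  rw [jetDeriv_one]
  exact Submodule.zero_mem _

theorem one_mem_Adm : (1 : DiffPoly M) ∈ Adm M := fun _ => ⟨∅, fun _ _ => one_mem_depGE _ _⟩

theorem mul_apply_mem_Adm {a c : Op M} (ha : a ∈ Reg M b) (hc : c ∈ Reg M b)
    (ha' : ∀ n, a n ∈ Adm M) (hc' : ∀ n, c n ∈ Adm M) (n : ℤ) : (a ⋆ c) n ∈ Adm M :=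
  (hasFSum_mul ha hc n).mem_Adm fun _ =>
    zsmul_mem_Adm (mul_mem_Adm (ha' _) (D_pow_mem_Adm (hc' _) _)) _

theorem adj_apply_mem_Adm {a : Op M} (ha : ∀ n, a n ∈ Adm M) (n : ℤ) : adj a n ∈ Adm M :=
  (hasFSum_adj a n).mem_Adm fun _ => zsmul_mem_Adm (D_pow_mem_Adm (ha _) _) _

end Dependence

/-! ### Evolutionary vector fields -/

section Evolution

variable {M : CoordManifold} {b : Bool} (w : Coord → DiffPoly M)

/-- The action `∑ D^s(w_k) ∂/∂v_k^{(s)}` of the evolutionary vector field with the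
characteristic `w`. -/
noncomputable def evol (g : DiffPoly M) : DiffPoly M :=
  fsum fun p : Coord × ℕ => (D ^ p.2) (w p.1) * jetDeriv p.1 p.2 g

theorem evol_mem_degGE {K : ℤ} {g : DiffPoly M} (hg : g ∈ degGE M K) : evol w g ∈ degGE M K :=
  fsum_mem_degGE fun p => degGE_le (L := p.2 + (K - p.2)) (by omega)
    (mul_mem_degGE (D_pow_mem_degGE' (w p.1) p.2) (jetDeriv_mem_degGE hg p.1 p.2))

variable {w} {f g : DiffPoly M}

/-- Sums over all jet coordinates of an admissible `g` converge: modulo degree `K`, only finitely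
many coordinates and finitely many orders of derivatives contribute. -/
theorem tendsZero_of_mem_Adm (hg : g ∈ Adm M) {t : Coord × ℕ → DiffPoly M}
    (h1 : ∀ K k, g ∈ depGE M k K → ∀ s, t (k, s) ∈ degGE M K)
    (h2 : ∀ k (s : ℕ), t (k, s) ∈ degGE M s) :
    TendsZero (degGE M) t := by
  intro K
  obtain ⟨S, hS⟩ := hg K
  refine (S ×ˢ Finset.range K.toNat).finite_toSet.subset fun p hp => ?_
  rw [Finset.mem_coe, Finset.mem_product, Finset.mem_range]
  constructor
  · by_contra hk
    exact hp (h1 K _ (hS _ hk) _)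
  · by_contra hs
    exact hp (degGE_le (by omega) (h2 _ _))

theorem hasFSum_evol (w : Coord → DiffPoly M) (hg : g ∈ Adm M) :
    HasFSum (degGE M) (fun p : Coord × ℕ => (D ^ p.2) (w p.1) * jetDeriv p.1 p.2 g) (evol w g) :=
  hasFSum_fsum (tendsZero_of_mem_Adm hg
    (fun _ k h s => degGE_le (by omega) (mul_mem_degGE (D_pow_mem_degGE' (w k) s) (h s)))
    fun k s => mul_mem_degGE_left (D_pow_mem_degGE' (w k) s) _)

theorem evol_eq (hg : g ∈ Adm M) {x : DiffPoly M} (h : HasFSum (degGE M)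
    (fun p : Coord × ℕ => (D ^ p.2) (w p.1) * jetDeriv p.1 p.2 g) x) : evol w g = x :=
  (hasFSum_evol w hg).eq h

theorem evol_add (hf : f ∈ Adm M) (hg : g ∈ Adm M) : evol w (f + g) = evol w f + evol w g :=
  evol_eq (Submodule.add_mem _ hf hg) (by
    simpa only [map_add, mul_add] using (hasFSum_evol w hf).add (hasFSum_evol w hg))

theorem evol_smul (hg : g ∈ Adm M) (c : ℂ) : evol w (c • g) = c • evol w g :=
  evol_eq (Submodule.smul_mem _ c hg) (by
    simpa only [map_smul, mul_smul_comm] using (hasFSum_evol w hg).smul c)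

theorem evol_zero : evol w 0 = 0 :=
  evol_eq (Submodule.zero_mem _) (by simpa only [map_zero, mul_zero] using hasFSum_zero)

theorem evol_neg (hg : g ∈ Adm M) : evol w (-g) = -evol w g := by
  simpa using evol_smul (w := w) hg (-1)

theorem evol_sub (hf : f ∈ Adm M) (hg : g ∈ Adm M) : evol w (f - g) = evol w f - evol w g := by
  rw [sub_eq_add_neg, evol_add hf (Submodule.neg_mem _ hg), evol_neg hg, sub_eq_add_neg]

theorem evol_zsmul (hg : g ∈ Adm M) (z : ℤ) : evol w (z • g) = z • evol w g := by
  rw [← Int.cast_smul_eq_zsmul ℂ, evol_smul hg, Int.cast_smul_eq_zsmul]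

theorem evol_sum {ι : Type*} {t : ι → DiffPoly M} (T : Finset ι) (h : ∀ j, t j ∈ Adm M) :
    evol w (∑ j ∈ T, t j) = ∑ j ∈ T, evol w (t j) := by
  classical
  induction T using Finset.induction_on with
  | empty => simpa using evol_zero
  | insert j T hj ih =>
    rw [Finset.sum_insert hj, Finset.sum_insert hj,
      evol_add (h j) (Submodule.sum_mem _ fun i _ => h i), ih]

theorem evol_mul (hf : f ∈ Adm M) (hg : g ∈ Adm M) :
    evol w (f * g) = evol w f * g + f * evol w g :=
  evol_eq (mul_mem_Adm hf hg) (by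
    have h := ((hasFSum_evol w hf).mul_right g).add ((hasFSum_evol w hg).mul_left f)
    refine cast (congrArg₂ _ (funext fun p => ?_) rfl) h
    rw [jetDeriv_mul]
    ring)

/-- Evolutionary vector fields commute with `D`. -/
theorem evol_D (hg : g ∈ Adm M) : evol w (D g) = D (evol w g) := by
  have h1 : HasFSum (degGE M)
      (fun p : Coord × ℕ => D ((D ^ p.2) (w p.1) * jetDeriv p.1 p.2 g)) (D (evol w g)) := by
    simpa only [pow_one] using (hasFSum_evol w hg).D_pow 1
  have h2 := hasFSum_evol w (D_mem_Adm hg)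
  let t : Coord × ℕ → DiffPoly M := fun p =>
    (D ^ p.2) (w p.1) * (jetDeriv p.1 p.2 (D g) - D (jetDeriv p.1 p.2 g))
  have h3 : HasFSum (degGE M) t (evol w (D g) -
      fsum fun p : Coord × ℕ => (D ^ p.2) (w p.1) * D (jetDeriv p.1 p.2 g)) := by
    have h := hasFSum_fsum (t := fun p : Coord × ℕ => (D ^ p.2) (w p.1) * D (jetDeriv p.1 p.2 g))
      (tendsZero_of_mem_Adm hg (fun _ k h s => degGE_le (by omega)
        (mul_mem_degGE (D_pow_mem_degGE' (w k) s) (D_mem_degGE (h s))))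
        fun k s => mul_mem_degGE_left (D_pow_mem_degGE' (w k) s) _)
    refine cast (congrArg₂ _ (funext fun p => ?_) rfl) (h2.sub h)
    exact (mul_sub _ _ _).symm
  have h4 := h3.comp_injective (fun p : Coord × ℕ => (p.1, p.2 + 1))
    (fun p q h => by
      obtain ⟨h1, h2⟩ := Prod.mk.injEq _ _ _ _ ▸ h
      exact Prod.ext h1 (by omega))
    (by
      rintro ⟨k, s⟩ h
      cases s with
      | zero => simp only [t, jetDeriv_zero_D, sub_self, mul_zero]
      | succ s => exact absurd ⟨(k, s), rfl⟩ h)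
  have h5 := h4.add (hasFSum_fsum (t := fun p : Coord × ℕ =>
      (D ^ p.2) (w p.1) * D (jetDeriv p.1 p.2 g))
      (tendsZero_of_mem_Adm hg (fun _ k h s => degGE_le (by omega)
        (mul_mem_degGE (D_pow_mem_degGE' (w k) s) (D_mem_degGE (h s))))
        fun k s => mul_mem_degGE_left (D_pow_mem_degGE' (w k) s) _))
  rw [sub_add_cancel] at h5
  refine h5.eq (cast (congrArg₂ _ (funext fun p => ?_) rfl) h1)
  simp only [t]
  rw [D_mul, jetDeriv_succ_D, add_sub_cancel_left, pow_succ', Module.End.mul_apply]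

theorem evol_D_pow (hg : g ∈ Adm M) (r : ℕ) : evol w ((D ^ r) g) = (D ^ r) (evol w g) := by
  induction r with
  | zero => simp
  | succ r ih =>
    rw [pow_succ', Module.End.mul_apply, evol_D (D_pow_mem_Adm hg r), ih, Module.End.mul_apply]

theorem HasFSum.evol {ι : Type*} {t : ι → DiffPoly M} {x : DiffPoly M}
    (hx : HasFSum (degGE M) t x) (h : ∀ j, t j ∈ Adm M) :
    HasFSum (degGE M) (fun j => evol w (t j)) (evol w x) := by
  intro K
  filter_upwards [hx K] with T hT
  rw [← evol_sum T h, ← evol_sub (hx.mem_Adm h) (Submodule.sum_mem _ fun i _ => h i)]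
  exact evol_mem_degGE w hT

theorem evol_one : evol w (1 : DiffPoly M) = 0 :=
  evol_eq one_mem_Adm (by simpa only [jetDeriv_one, mul_zero] using hasFSum_zero)

/-- The action of an evolutionary vector field on the coefficients of operators. -/
noncomputable def Psd.evol (w : Coord → DiffPoly M) (x : Psd M b) : Psd M b :=
  Psd.mk (fun n => BKP.evol w (x.op n)) fun K => by
    obtain ⟨N, hN⟩ := x.mem K
    exact ⟨N, fun i hi => evol_mem_degGE w (hN i hi)⟩

theorem Psd.evol_apply (w : Coord → DiffPoly M) (x : Psd M b) (n : ℤ) :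
    (x.evol w).op n = BKP.evol w (x.op n) := rfl

/-- The operators with admissible coefficients. -/
noncomputable def Psd.admissible (M : CoordManifold) (b : Bool) : Submodule ℂ (Psd M b) where
  carrier := {x | ∀ n, x.op n ∈ Adm M}
  zero_mem' n := by rw [map_zero]; exact Submodule.zero_mem _
  add_mem' hx hy n := by rw [map_add]; exact Submodule.add_mem _ (hx n) (hy n)
  smul_mem' c x hx n := by rw [map_smul]; exact Submodule.smul_mem _ c (hx n)

variable {x y : Psd M b}

theorem Psd.mul_mem_admissible (hx : x ∈ Psd.admissible M b) (hy : y ∈ Psd.admissible M b) :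
    x * y ∈ Psd.admissible M b := mul_apply_mem_Adm x.mem y.mem hx hy

theorem Psd.adj_mem_admissible (hx : x ∈ Psd.admissible M b) : x.adj ∈ Psd.admissible M b :=
  adj_apply_mem_Adm hx

theorem Psd.negTrue_mem_admissible (hx : x ∈ Psd.admissible M b) :
    x.negTrue ∈ Psd.admissible M true := fun n => by
  change neg x.op n ∈ _
  by_cases h : n < 0
  · rw [neg_apply h]; exact hx n
  · rw [neg_apply_of_nonneg (by omega)]; exact Submodule.zero_mem _

theorem Psd.posFalse_mem_admissible (hx : x ∈ Psd.admissible M b) :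
    x.posFalse ∈ Psd.admissible M false := fun n => by
  change pos x.op n ∈ _
  by_cases h : 0 ≤ n
  · rw [pos_apply h]; exact hx n
  · rw [pos_apply_of_neg (by omega)]; exact Submodule.zero_mem _

theorem Psd.evol_add (hx : x ∈ Psd.admissible M b) (hy : y ∈ Psd.admissible M b) :
    (x + y).evol w = x.evol w + y.evol w := Psd.ext (funext fun n => BKP.evol_add (hx n) (hy n))

theorem Psd.evol_sub (hx : x ∈ Psd.admissible M b) (hy : y ∈ Psd.admissible M b) :
    (x - y).evol w = x.evol w - y.evol w := Psd.ext (funext fun n => BKP.evol_sub (hx n) (hy n))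

theorem Psd.evol_smul (hx : x ∈ Psd.admissible M b) (c : ℂ) :
    (c • x).evol w = c • x.evol w := Psd.ext (funext fun n => BKP.evol_smul (hx n) c)

theorem Psd.evol_mul (hx : x ∈ Psd.admissible M b) (hy : y ∈ Psd.admissible M b) :
    (x * y).evol w = x.evol w * y + x * y.evol w := by
  refine Psd.ext (funext fun n => ?_)
  have h := (hasFSum_mul x.mem y.mem n).evol (w := w) fun p =>
    zsmul_mem_Adm (mul_mem_Adm (hx p.1) (D_pow_mem_Adm (hy _) p.2)) _
  refine h.eq ?_
  have h1 := (hasFSum_mul (x.evol w).mem y.mem n).add (hasFSum_mul x.mem (y.evol w).mem n)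
  refine cast (congrArg₂ _ (funext fun p => ?_) rfl) h1
  rw [evol_zsmul (mul_mem_Adm (hx p.1) (D_pow_mem_Adm (hy _) p.2)),
    BKP.evol_mul (hx p.1) (D_pow_mem_Adm (hy _) p.2), evol_D_pow (hy _), zsmul_add]
  rfl

theorem Psd.evol_adj (hx : x ∈ Psd.admissible M b) : x.adj.evol w = (x.evol w).adj := by
  refine Psd.ext (funext fun n => ?_)
  have h := (hasFSum_adj x.op n).evol (w := w) fun r =>
    zsmul_mem_Adm (D_pow_mem_Adm (hx _) r) _
  refine h.eq ?_
  refine cast (congrArg₂ _ (funext fun r => ?_) rfl) (hasFSum_adj (x.evol w).op n)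
  rw [evol_zsmul (D_pow_mem_Adm (hx _) r), evol_D_pow (hx _)]
  rfl

theorem Psd.evol_negTrue (x : Psd M b) : x.negTrue.evol w = (x.evol w).negTrue := by
  refine Psd.ext (funext fun n => ?_)
  change BKP.evol w (neg x.op n) = neg (x.evol w).op n
  by_cases h : n < 0
  · rw [neg_apply h, neg_apply h]; rfl
  · rw [neg_apply_of_nonneg (by omega), neg_apply_of_nonneg (by omega), evol_zero]

theorem Psd.evol_posFalse (x : Psd M b) : x.posFalse.evol w = (x.evol w).posFalse := by
  refine Psd.ext (funext fun n => ?_)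
  change BKP.evol w (pos x.op n) = pos (x.evol w).op n
  by_cases h : 0 ≤ n
  · rw [pos_apply h, pos_apply h]; rfl
  · rw [pos_apply_of_neg (by omega), pos_apply_of_neg (by omega), evol_zero]

end Evolution

/-! ### Variational gradients -/

section Gradient

variable {M : CoordManifold} {b : Bool} {f g : DiffPoly M}

theorem preGrad_two_mul (f : DiffPoly M) (i : ℕ) :
    preGrad f (2 * (i : ℤ)) = varDeriv (Sum.inl i) f := by
  rw [preGrad, LinearMap.pi_apply, if_pos ⟨by omega, even_two_mul _⟩,
    show (2 * (i : ℤ)).toNat / 2 = i by omega]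

theorem preGrad_of_neg (f : DiffPoly M) {n : ℤ} (hn : n < 0) : preGrad f n = 0 := by
  rw [preGrad, LinearMap.pi_apply, if_neg fun h => by omega]
  rfl

theorem preGrad_odd (f : DiffPoly M) {n : ℤ} (hn : Odd n) : preGrad f n = 0 := by
  rw [preGrad, LinearMap.pi_apply, if_neg fun h => Int.not_even_iff_odd.2 hn h.2]
  rfl

theorem preGradHat_two_mul (f : DiffPoly M) (i : ℕ) :
    preGradHat f (-2 * (i : ℤ)) = varDeriv (Sum.inr i) f := by
  rw [preGradHat, LinearMap.pi_apply, if_pos ⟨by omega, ⟨-i, by ring⟩⟩,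
    show (-(-2 * (i : ℤ))).toNat / 2 = i by omega]

theorem preGradHat_of_pos (f : DiffPoly M) {n : ℤ} (hn : 0 < n) : preGradHat f n = 0 := by
  rw [preGradHat, LinearMap.pi_apply, if_neg fun h => by omega]
  rfl

theorem preGradHat_odd (f : DiffPoly M) {n : ℤ} (hn : Odd n) : preGradHat f n = 0 := by
  rw [preGradHat, LinearMap.pi_apply, if_neg fun h => Int.not_even_iff_odd.2 hn h.2]
  rfl

theorem grad_fst (f : DiffPoly M) : (grad f).1 = (2⁻¹ : ℂ) • (preGrad f + adj (preGrad f)) := rfl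

theorem grad_snd (f : DiffPoly M) :
    (grad f).2 = (2⁻¹ : ℂ) • (preGradHat f + adj (preGradHat f)) := rfl

/-- A property of the coefficients of `preGrad f`, from the variational derivatives. -/
theorem preGrad_induction (f : DiffPoly M) {p : ℤ → DiffPoly M → Prop} (h0 : ∀ n, p n 0)
    (h : ∀ i : ℕ, p (2 * i) (varDeriv (Sum.inl i) f)) (n : ℤ) : p n (preGrad f n) := by
  rcases lt_or_ge n 0 with hn | hn
  · rw [preGrad_of_neg f hn]; exact h0 n
  · rcases Int.even_or_odd' n with ⟨m, rfl | rfl⟩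
    · lift m to ℕ using by omega
      rw [preGrad_two_mul]; exact h m
    · rw [preGrad_odd f ⟨m, rfl⟩]; exact h0 _

/-- A property of the coefficients of `preGradHat f`, from the variational derivatives. -/
theorem preGradHat_induction (f : DiffPoly M) {p : ℤ → DiffPoly M → Prop} (h0 : ∀ n, p n 0)
    (h : ∀ i : ℕ, p (-2 * i) (varDeriv (Sum.inr i) f)) (n : ℤ) : p n (preGradHat f n) := by
  rcases lt_or_ge 0 n with hn | hn
  · rw [preGradHat_of_pos f hn]; exact h0 n
  · rcases Int.even_or_odd' n with ⟨m, rfl | rfl⟩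
    · obtain ⟨k, rfl⟩ : ∃ k : ℕ, m = -k := ⟨(-m).toNat, by omega⟩
      rw [show 2 * -(k : ℤ) = -2 * k by ring, preGradHat_two_mul]; exact h k
    · rw [preGradHat_odd f ⟨m, rfl⟩]; exact h0 _

theorem neg_preGrad (f : DiffPoly M) : neg (preGrad f) = 0 :=
  neg_eq_zero_iff.2 fun _ hn => preGrad_of_neg f hn

theorem preGradHat_mem_Reg (f : DiffPoly M) : preGradHat f ∈ Reg M true := fun K =>
  ⟨0, fun i hi => by
    rw [orient_true] at hi
    rw [preGradHat_of_pos f hi]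
    exact Submodule.zero_mem _⟩

theorem adj_grad_fst (f : DiffPoly M) : adj (grad f).1 = (grad f).1 := by
  rw [grad_fst, map_smul, map_add, adj_adj_Reg (mem_Reg_of_neg (neg_preGrad f)), add_comm]

theorem adj_grad_snd (f : DiffPoly M) : adj (grad f).2 = (grad f).2 := by
  rw [grad_snd, map_smul, map_add, adj_adj_Reg (preGradHat_mem_Reg f), add_comm]

theorem grad_eq_of_integral_eq (h : integral (M := M) f = integral (M := M) g) :
    grad (M := M) f = grad (M := M) g := by
  have h0 : integral (M := M) (f - g) = 0 :=
    integral_eq_zero_iff.2 ((Submodule.Quotient.eq (trivialDensities M)).1 h)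
  have h1 : preGrad (f - g) = 0 := funext (preGrad_induction (f - g) (p := fun n x => x = 0)
    (fun _ => rfl) fun i => varDeriv_eq_zero h0 _)
  have h2 : preGradHat (f - g) = 0 := funext (preGradHat_induction (f - g) (p := fun n x => x = 0)
    (fun _ => rfl) fun i => varDeriv_eq_zero h0 _)
  refine sub_eq_zero.1 (((grad (M := M)).map_sub f g).symm.trans ?_)
  exact Prod.ext (by rw [grad_fst, h1, map_zero, add_zero, smul_zero]; rfl)
    (by rw [grad_snd, h2, map_zero, add_zero, smul_zero]; rfl)

/-- The densities of the local functionals in `ℱ_0`. -/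
noncomputable def densities (M : CoordManifold) : Submodule ℂ (DiffPoly M) :=
  ((Dminus M).prod (Dplus M)).comap grad

theorem mem_densities : f ∈ densities M ↔ (grad f).1 ∈ Dminus M ∧ (grad f).2 ∈ Dplus M := Iff.rfl

theorem two_smul_grad_fst (f : DiffPoly M) (n : ℤ) :
    preGrad f n + adj (preGrad f) n = (2 : ℂ) • (grad f).1 n := by
  rw [grad_fst, Pi.smul_apply, smul_smul, mul_inv_cancel₀ two_ne_zero, one_smul, Pi.add_apply]

theorem two_smul_grad_snd (f : DiffPoly M) (n : ℤ) :
    preGradHat f n + adj (preGradHat f) n = (2 : ℂ) • (grad f).2 n := by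
  rw [grad_snd, Pi.smul_apply, smul_smul, mul_inv_cancel₀ two_ne_zero, one_smul, Pi.add_apply]

/-- The even coefficients of `preGrad f` are recovered from the gradient, and determine it. -/
theorem preGrad_mem_Dminus (hf : f ∈ densities M) : preGrad f ∈ Dminus M := by
  obtain ⟨N, hN⟩ := (mem_densities.1 hf).1
  refine ⟨N, fun n hn => eq_zero_of_mem_degGE _ fun K => ?_⟩
  have := mem_of_parity (a := preGrad f) (N := fun n => if N < n then ⊥ else ⊤)
    (fun n g hg => by
      split_ifs with h
      · rw [if_pos (by omega), Submodule.mem_bot] at hg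
        rw [hg, map_zero]; exact Submodule.zero_mem _
      · trivial)
    (fun n => by
      rcases Int.even_or_odd n with h | h
      · right
        rw [Int.negOnePow_even n h, Units.val_one, one_zsmul, two_smul_grad_fst]
        split_ifs with h'
        · rw [hN n h', smul_zero]; exact Submodule.zero_mem _
        · trivial
      · left
        rw [preGrad_odd f h]; exact Submodule.zero_mem _) n K
  rwa [if_pos hn, bot_sup_eq] at this

theorem preGradHat_mem_Dplus (hf : f ∈ densities M) : preGradHat f ∈ Dplus M := by
  obtain ⟨d, hd⟩ := mem_Dplus.1 (mem_densities.1 hf).2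
  refine mem_Dplus.2 ⟨d, fun n => ?_⟩
  have := mem_of_parity (a := preGradHat f) (N := fun n => degGE M (d - n))
    (fun n g hg => degGE_le (by omega) (D_mem_degGE hg))
    (fun n => by
      rcases Int.even_or_odd n with h | h
      · right
        rw [Int.negOnePow_even n h, Units.val_one, one_zsmul, two_smul_grad_snd]
        exact Submodule.smul_mem _ _ (hd n)
      · left
        rw [preGradHat_odd f h]; exact Submodule.zero_mem _) n (d - n)
  rwa [sup_idem] at this

/-- The condition `δF/δA ∈ 𝒟⁻` means that only finitely many of the `δF/δv_{-i}` are nonzero. -/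
theorem exists_varDeriv_inl_eq_zero (hf : f ∈ densities M) :
    ∃ N : ℕ, ∀ i, N ≤ i → varDeriv (Sum.inl i) f = 0 := by
  obtain ⟨N, hN⟩ := preGrad_mem_Dminus hf
  exact ⟨N.toNat + 1, fun i hi => by rw [← preGrad_two_mul, hN _ (by omega)]⟩

/-- The condition `δF/δÂ ∈ 𝒟⁺` means that the degree of `δF/δv̂_i` is at least `2i`
up to a constant. -/
theorem exists_varDeriv_inr_mem (hf : f ∈ densities M) :
    ∃ d : ℤ, d ≤ 0 ∧ ∀ i : ℕ, varDeriv (Sum.inr i) f ∈ degGE M (2 * i + d) := by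
  obtain ⟨d, hd⟩ := mem_Dplus.1 (preGradHat_mem_Dplus hf)
  exact ⟨min d 0, min_le_right _ _, fun i => by
    rw [← preGradHat_two_mul]; exact degGE_le (by omega) (hd _)⟩

/-- The converse of `exists_varDeriv_inl_eq_zero` and `exists_varDeriv_inr_mem`. -/
theorem mem_densities_of_varDeriv {N : ℕ} (hN : ∀ i, N ≤ i → varDeriv (Sum.inl i) f = 0) {d : ℤ}
    (hd : ∀ i : ℕ, varDeriv (Sum.inr i) f ∈ degGE M (2 * i + d)) : f ∈ densities M := by
  have h1 : preGrad f ∈ Dminus M := ⟨2 * N, preGrad_induction f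
    (p := fun n x => 2 * (N : ℤ) < n → x = 0)
    (fun _ _ => rfl) fun i hi => hN i (by omega)⟩
  have h2 : preGradHat f ∈ Dplus M := mem_Dplus.2 ⟨d, preGradHat_induction f
    (p := fun n x => x ∈ degGE M (d - n)) (fun _ => Submodule.zero_mem _)
    fun i => degGE_le (by omega) (hd i)⟩
  exact mem_densities.2 ⟨Submodule.smul_mem _ _ (Submodule.add_mem _ h1 (adj_mem_Dminus h1)),
    Submodule.smul_mem _ _ (Submodule.add_mem _ h2 (adj_mem_Dplus h2))⟩

theorem isCotangent_grad (hf : f ∈ densities M) : IsCotangent (grad f) := by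
  refine isCotangent_iff.2 ⟨⟨hf.1, adj_grad_fst f, ?_⟩, hf.2, adj_grad_snd f, fun n hn => ?_⟩
  · rw [grad_fst, neg_eq, map_smul, map_add, ← neg_eq, ← neg_eq, neg_preGrad,
      neg_adj_eq_zero (neg_preGrad f), add_zero, smul_zero]
  · have : adj (preGradHat f) n = 0 :=
      adj_eq (cast (congrArg₂ _ (funext fun r => by
        rw [preGradHat_of_pos f (by omega), map_zero, zsmul_zero]) rfl)
        (hasFSum_zero (W := degGE M) (ι := ℕ)))
    rw [grad_snd, Pi.smul_apply, Pi.add_apply, preGradHat_of_pos f hn, this, add_zero, smul_zero]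

/-- In every degree, only finitely many variational derivatives contribute. -/
theorem exists_finset_varDeriv_mem (hf : f ∈ densities M) (K : ℤ) :
    ∃ S : Finset Coord, ∀ k, k ∉ S → varDeriv k f ∈ degGE M K := by
  obtain ⟨N, hN⟩ := exists_varDeriv_inl_eq_zero hf
  obtain ⟨d, -, hd⟩ := exists_varDeriv_inr_mem hf
  refine ⟨(Finset.range N).disjSum (Finset.range (K - d).toNat), fun k hk => ?_⟩
  rcases k with i | i
  · rw [Finset.inl_mem_disjSum, Finset.mem_range] at hk
    rw [hN i (by omega)]; exact Submodule.zero_mem _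
  · rw [Finset.inr_mem_disjSum, Finset.mem_range] at hk
    exact degGE_le (by omega) (hd i)

/-- The symmetry of the second variation bounds the dependence of the variational derivatives on
the coordinates. -/
theorem varDeriv_mem_depGE {m : Coord} {e : ℤ} (h : varDeriv m f ∈ degGE M e) (k : Coord) :
    varDeriv k f ∈ depGE M m e := fun s => by
  rw [← frechet_apply, ← adj_frechet_varDeriv]
  exact adj_mem_degGE (frechet_mem_degGE h k) s

theorem varDeriv_mem_Adm (hf : f ∈ densities M) (k : Coord) : varDeriv k f ∈ Adm M := fun K => by
  obtain ⟨S, hS⟩ := exists_finset_varDeriv_mem hf K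
  exact ⟨S, fun m hm => varDeriv_mem_depGE (hS m hm) k⟩

theorem preGrad_mem_depGE {m : Coord} {e : ℤ} (h : varDeriv m f ∈ degGE M e) (n : ℤ) :
    preGrad f n ∈ depGE M m e :=
  preGrad_induction f (p := fun _ x => x ∈ depGE M m e) (fun _ => Submodule.zero_mem _)
    (fun _ => varDeriv_mem_depGE h _) n

theorem preGradHat_mem_depGE {m : Coord} {e : ℤ} (h : varDeriv m f ∈ degGE M e) (n : ℤ) :
    preGradHat f n ∈ depGE M m e :=
  preGradHat_induction f (p := fun _ x => x ∈ depGE M m e) (fun _ => Submodule.zero_mem _)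
    (fun _ => varDeriv_mem_depGE h _) n

theorem grad_fst_mem_depGE {m : Coord} {e : ℤ} (h : varDeriv m f ∈ degGE M e) (n : ℤ) :
    (grad f).1 n ∈ depGE M m e :=
  Submodule.smul_mem _ _ (Submodule.add_mem _ (preGrad_mem_depGE h n)
    (adj_mem_depGE (preGrad_mem_depGE h) n))

theorem grad_snd_mem_depGE {m : Coord} {e : ℤ} (h : varDeriv m f ∈ degGE M e) (n : ℤ) :
    (grad f).2 n ∈ depGE M m e :=
  Submodule.smul_mem _ _ (Submodule.add_mem _ (preGradHat_mem_depGE h n)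
    (adj_mem_depGE (preGradHat_mem_depGE h) n))

theorem grad_fst_mem_Adm (hf : f ∈ densities M) (n : ℤ) : (grad f).1 n ∈ Adm M := fun K => by
  obtain ⟨S, hS⟩ := exists_finset_varDeriv_mem hf K
  exact ⟨S, fun m hm => grad_fst_mem_depGE (hS m hm) n⟩

theorem grad_snd_mem_Adm (hf : f ∈ densities M) (n : ℤ) : (grad f).2 n ∈ Adm M := fun K => by
  obtain ⟨S, hS⟩ := exists_finset_varDeriv_mem hf K
  exact ⟨S, fun m hm => grad_snd_mem_depGE (hS m hm) n⟩

end Gradient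

/-! ### The pairing in coordinates -/

section Pairing

variable {M : CoordManifold} {b : Bool}

/-- The components of a tangent vector along the coordinates. -/
def components (V : Op M × Op M) : Coord → DiffPoly M
  | Sum.inl i => V.1 (-2 * (i : ℤ) - 1)
  | Sum.inr i => V.2 (2 * (i : ℤ) - 1)

/-- The product of operators, row by row. -/
theorem hasFSum_mul_rows {a c : Op M} (ha : a ∈ Reg M b) (hc : c ∈ Reg M b) (n : ℤ) :
    HasFSum (degGE M) (fun i : ℤ => a i * (Dpow i ⋆ c) n) ((a ⋆ c) n) := by
  refine (hasFSum_mul ha hc n).prod fun i => ?_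
  have h := ((hasFSum_mul (Dpow_mem_Reg i) hc n).comp_injective (fun r : ℕ => (i, r))
    (Prod.mk_right_injective i) (by
      rintro ⟨j, r⟩ hj
      have : j ≠ i := fun h => hj ⟨r, by rw [h]⟩
      simp only [Dpow]
      rw [Pi.single_eq_of_ne this, zero_mul, zsmul_zero])).mul_left (a i)
  refine cast (congrArg₂ _ (funext fun r => ?_) rfl) h
  simp only [Dpow, Pi.single_eq_same, one_mul, mul_smul_comm]

/-- The residue of `D^i ⋆ z` has no contributions of derivatives of `z`, because `res` changes sign
under the adjoint, which turns `D^i ⋆ z` into `-(z ⋆ D^i)`. -/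
theorem res_Dpow_mul {z : Op M} (hz : z ∈ Reg M b) (hz' : adj z = -z) {i : ℤ} (hi : Even i) :
    (Dpow i ⋆ z) (-1) = z (-1 - i) := by
  have h1 : adj (Dpow i ⋆ z) = -(z ⋆ Dpow i) := by
    rw [adj_mul_Reg (b := b) (Dpow_mem_Reg i) hz, hz', adj_Dpow, Int.negOnePow_even i hi,
      Units.val_one, one_zsmul, neg_mul_Reg hz (Dpow_mem_Reg i)]
  have h2 := res_adj (Dpow i ⋆ z)
  rw [h1] at h2
  rw [← mul_Dpow_apply z i]
  exact (neg_injective h2).symm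

/-- The residue of the product of an operator with vanishing odd coefficients and of a
skew-symmetric operator. -/
theorem hasFSum_res_mul {u z : Op M} (hu : u ∈ Reg M b) (hu' : ∀ n, Odd n → u n = 0)
    (hz : z ∈ Reg M b) (hz' : adj z = -z) :
    HasFSum (degGE M) (fun i : ℤ => u i * z (-1 - i)) (res (u ⋆ z)) := by
  refine cast (congrArg₂ _ (funext fun i => ?_) rfl) (hasFSum_mul_rows hu hz (-1))
  rcases Int.even_or_odd i with h | h
  · rw [res_Dpow_mul hz hz' h]
  · rw [hu' i h, zero_mul, zero_mul]

/-- Half of the sum of `u` and of its adjoint pairs with a skew-symmetric operator as `u` does. -/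
theorem Psd.tr_half_mul {u z : Psd M b} (hz : z.adj = -z) :
    (((2⁻¹ : ℂ) • (u + u.adj)) * z).tr = (u * z).tr := by
  have h := Psd.tr_eq_neg_tr_adj (u.adj * z)
  rw [Psd.adj_mul, Psd.adj_adj, hz, neg_mul, Psd.tr_neg, neg_neg, Psd.tr_mul_comm z] at h
  rw [smul_mul_assoc, Psd.tr_smul, add_mul, Psd.tr_add, h, ← two_smul ℂ, smul_smul,
    inv_mul_cancel₀ two_ne_zero, one_smul]

/-- The pairing of a symmetrized covector and of a tangent vector is the sum of the products of
their components. -/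
theorem exists_hasFSum_pairing {u : Op M} {u' : Op M} (hu : u ∈ Reg M true)
    (hu' : u' ∈ Reg M false) (h1 : ∀ n, Odd n ∨ n < 0 → u n = 0)
    (h2 : ∀ n, Odd n ∨ 0 < n → u' n = 0) {Z : Psd M true} {Z' : Psd M false} (hZ : Z.adj = -Z)
    (hZ' : Z'.adj = -Z') {q : Coord → DiffPoly M}
    (hq1 : ∀ i : ℕ, q (Sum.inl i) = u (2 * (i : ℤ)))
    (hq2 : ∀ i : ℕ, q (Sum.inr i) = u' (-2 * (i : ℤ))) :
    ∃ x, HasFSum (degGE M) (fun k => q k * components (Z.op, Z'.op) k) x ∧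
      integral x = pairing ((2⁻¹ : ℂ) • (u + adj u), (2⁻¹ : ℂ) • (u' + adj u')) (Z.op, Z'.op) := by
  have e1 := (hasFSum_res_mul hu (fun n hn => h1 n (Or.inl hn)) Z.mem
    (congrArg Psd.op hZ)).comp_injective (fun i : ℕ => 2 * (i : ℤ)) (fun i j h => by
      simp only at h; omega) (fun n hn => by
      have : u n = 0 := h1 n (by
        by_contra hcon
        rw [not_or, Int.not_odd_iff_even] at hcon
        obtain ⟨⟨m, rfl⟩, h⟩ := hcon
        exact hn ⟨m.toNat, by simp only; omega⟩)
      rw [this, zero_mul])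
  have e2 := (hasFSum_res_mul hu' (fun n hn => h2 n (Or.inl hn)) Z'.mem
    (congrArg Psd.op hZ')).comp_injective (fun i : ℕ => -2 * (i : ℤ)) (fun i j h => by
      simp only at h; omega) (fun n hn => by
      have : u' n = 0 := h2 n (by
        by_contra hcon
        rw [not_or, Int.not_odd_iff_even] at hcon
        obtain ⟨⟨m, rfl⟩, h⟩ := hcon
        exact hn ⟨(-m).toNat, by simp only; omega⟩)
      rw [this, zero_mul])
  refine ⟨_, HasFSum.sum_type (t := fun k => q k * components (Z.op, Z'.op) k)
    (cast (congrArg₂ _ (funext fun i => ?_) rfl) e1)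
    (cast (congrArg₂ _ (funext fun i => ?_) rfl) e2), ?_⟩
  · rw [hq1]
    exact congrArg (u (2 * (i : ℤ)) * ·) (congrArg Z.op (by ring))
  · rw [hq2]
    exact congrArg (u' (-2 * (i : ℤ)) * ·) (congrArg Z'.op (by ring))
  · refine ((integral (M := M)).map_add _ _).trans (congrArg₂ _ ?_ ?_)
    · exact (Psd.tr_half_mul (u := Psd.mk u hu) hZ).symm
    · exact (Psd.tr_half_mul (u := Psd.mk u' hu') hZ').symm

/-- The first variation: the derivative of `∫ h dx` along a tangent vector. -/
theorem integral_evol {h : DiffPoly M} (hh : h ∈ densities M) (hA : h ∈ Adm M) {Z : Psd M true}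
    {Z' : Psd M false} (hZ : Z.adj = -Z) (hZ' : Z'.adj = -Z') :
    integral (evol (components (Z.op, Z'.op)) h) = pairing (grad h) (Z.op, Z'.op) := by
  set w := components (Z.op, Z'.op) with hw
  obtain ⟨x, hx, hx'⟩ := exists_hasFSum_pairing (Dminus_le (preGrad_mem_Dminus hh))
    (Dplus_le (preGradHat_mem_Dplus hh))
    (fun n hn => hn.elim (preGrad_odd h) (preGrad_of_neg h))
    (fun n hn => hn.elim (preGradHat_odd h) (preGradHat_of_pos h)) hZ hZ'
    (q := fun k => varDeriv k h) (fun i => (preGrad_two_mul h i).symm)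
    (fun i => (preGradHat_two_mul h i).symm)
  refine Eq.trans ?_ hx'
  have hz : TendsZero (degGE M) (fun p : Coord × ℕ =>
      w p.1 * ((-D (M := M)) ^ p.2) (jetDeriv p.1 p.2 h)) :=
    tendsZero_of_mem_Adm hA
      (fun _ k hk s => mul_mem_degGE_right (degGE_le (by omega) (neg_D_pow_mem (hk s) s)) _)
      fun k s => mul_mem_degGE_right (neg_D_pow_mem' _ s) _
  have h1 := hasFSum_fsum hz
  have h2 := h1.prod fun k => (hasFSum_varDeriv k h).mul_left (w k)
  have e : fsum (fun p : Coord × ℕ => w p.1 * ((-D (M := M)) ^ p.2) (jetDeriv p.1 p.2 h)) = x :=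
    h2.eq (by simpa only [mul_comm] using hx)
  rw [e] at h1
  exact integral_eq_of_sub_mem (((hasFSum_evol w hA).sub h1).mem_range_D
    fun p => D_pow_mul_sub_mem _ _ _)

end Pairing

/-! ### The generic point as a function of the coordinates -/

section GenericPoint

variable {M : CoordManifold} {b : Bool} {ρ : Smooth M} {A : Op M × Op M}

theorem jetDeriv_C_zero (k : Coord) (φ : Smooth M) :
    jetDeriv k 0 (MvPowerSeries.C φ : DiffPoly M) = MvPowerSeries.C (pd k φ) := by
  classical
  refine ext_coeffL fun m => ?_
  rw [coeffL_jetDeriv_zero]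
  change pd k (MvPowerSeries.coeff m (MvPowerSeries.C φ)) =
    MvPowerSeries.coeff m (MvPowerSeries.C (pd k φ))
  rw [MvPowerSeries.coeff_C, MvPowerSeries.coeff_C]
  split_ifs
  · rfl
  · rw [map_zero]

theorem jetDeriv_C_succ (k : Coord) (s : ℕ) (φ : Smooth M) :
    jetDeriv k (s + 1) (MvPowerSeries.C φ : DiffPoly M) = 0 := by
  classical
  refine ext_coeffL fun m => ?_
  rw [coeffL_jetDeriv_succ]
  change (m (k, s) + 1) • MvPowerSeries.coeff (m + Finsupp.single (k, s) 1) (MvPowerSeries.C φ) = 0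
  rw [MvPowerSeries.coeff_C, if_neg, smul_zero]
  intro h
  have := DFunLike.congr_fun h (k, s)
  simp at this

theorem C_mem_depGE {k : Coord} {φ : Smooth M} (h : pd k φ = 0) (e : ℤ) :
    (MvPowerSeries.C φ : DiffPoly M) ∈ depGE M k e := fun s => by
  cases s with
  | zero => rw [jetDeriv_C_zero, h, map_zero]; exact Submodule.zero_mem _
  | succ s => rw [jetDeriv_C_succ]; exact Submodule.zero_mem _

theorem C_mem_Adm {k : Coord} {φ : Smooth M} (h : ∀ l, l ≠ k → pd l φ = 0) :
    (MvPowerSeries.C φ : DiffPoly M) ∈ Adm M := fun K =>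
  ⟨{k}, fun l hl => C_mem_depGE (h l (by simpa using hl)) K⟩

theorem evol_C {k : Coord} {φ : Smooth M} (h : ∀ l, l ≠ k → pd l φ = 0) (w : Coord → DiffPoly M) :
    evol w (MvPowerSeries.C φ) = w k * MvPowerSeries.C (pd k φ) := by
  refine evol_eq (C_mem_Adm h) ?_
  have := hasFSum_single (W := degGE M)
    (fun p : Coord × ℕ => (D ^ p.2) (w p.1) * jetDeriv p.1 p.2 (MvPowerSeries.C φ)) (k, 0) (by
      rintro ⟨l, s⟩ hl
      cases s with
      | zero =>
        simp only
        rw [jetDeriv_C_zero, h l fun e => hl (by rw [e]), map_zero, mul_zero]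
      | succ s =>
        simp only
        rw [jetDeriv_C_succ, mul_zero])
  simpa only [jetDeriv_C_zero, pow_zero, Module.End.one_apply] using this

theorem pd_coord_of_ne {k l : Coord} (h : l ≠ k) : pd l (coord k : Smooth M) = 0 := by
  rw [pd_coord, if_neg h]

theorem jet_mem_depGE {k l : Coord} (h : l ≠ k) (e : ℤ) : (jet k 0 : DiffPoly M) ∈ depGE M l e :=
  C_mem_depGE (pd_coord_of_ne h) e

theorem evol_jet (k : Coord) (w : Coord → DiffPoly M) : evol w (jet k 0) = w k := by
  rw [jet, evol_C (fun l hl => pd_coord_of_ne hl), pd_coord, if_pos rfl, map_one, mul_one]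

theorem Dpow_apply_mem_depGE (k : Coord) (e j n : ℤ) : (Dpow j : Op M) n ∈ depGE M k e := by
  by_cases h : n = j
  · rw [h, Dpow, Pi.single_eq_same]; exact one_mem_depGE _ _
  · rw [Dpow, Pi.single_eq_of_ne h]; exact Submodule.zero_mem _

theorem Dpow_apply_mem_Adm (j n : ℤ) : (Dpow j : Op M) n ∈ Adm M := fun _ =>
  ⟨∅, fun _ _ => Dpow_apply_mem_depGE _ _ _ _⟩

theorem evol_Dpow_apply (w : Coord → DiffPoly M) (j n : ℤ) : evol w ((Dpow j : Op M) n) = 0 := by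
  by_cases h : n = j
  · rw [h, Dpow, Pi.single_eq_same]; exact evol_one
  · rw [Dpow, Pi.single_eq_of_ne h]; exact evol_zero

theorem ofFun_apply_mem {N : Submodule ℂ (DiffPoly M)} {f : DiffPoly M} (hf : f ∈ N) (n : ℤ) :
    (ofFun f : Op M) n ∈ N := by
  by_cases h : n = 0
  · rw [h, ofFun, Pi.single_eq_same]; exact hf
  · rw [ofFun, Pi.single_eq_of_ne h]; exact Submodule.zero_mem _

theorem fDg_apply_mem_depGE {k : Coord} {e : ℤ} {f g : DiffPoly M} (hf : f ∈ depGE M k e)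
    (hg : g ∈ depGE M k e) (n : ℤ) : (ofFun f ⋆ Dpow (-1) ⋆ ofFun g) n ∈ depGE M k e :=
  mul_mem_depGE_of_forall (b := true) (mul_mem_Reg (ofFun_mem_Reg _) (Dpow_mem_Reg _))
    (ofFun_mem_Reg _)
    (mul_mem_depGE_of_forall (b := true) (ofFun_mem_Reg _) (Dpow_mem_Reg _)
      (ofFun_apply_mem hf) (Dpow_apply_mem_depGE _ _ _)) (ofFun_apply_mem hg) n

/-- The odd coefficients of the first component of the generic point. -/
theorem IsGenericPoint.fst_odd (hA : IsGenericPoint ρ A) {n : ℤ} (hn : Odd n) :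
    (0 ≤ n ∧ A.1 n = (Dpow 1 : Op M) n) ∨
      ∃ i : ℕ, n = -2 * (i : ℤ) - 1 ∧ A.1 n = jet (Sum.inl i) 0 := by
  rcases lt_or_ge n 0 with h | h
  · obtain ⟨m, rfl⟩ := hn
    obtain ⟨i, rfl⟩ : ∃ i : ℕ, m = -i - 1 := ⟨(-m - 1).toNat, by omega⟩
    refine Or.inr ⟨i, by ring, ?_⟩
    rw [← hA.2.1 i]
    exact congrArg A.1 (by ring)
  · exact Or.inl ⟨h, hA.1.fst_apply h⟩

/-- The odd coefficients of the second component of the generic point. -/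
theorem IsGenericPoint.snd_odd (hA : IsGenericPoint ρ A) {n : ℤ} (hn : Odd n) :
    (n < 0 ∧ A.2 n = (ofFun (MvPowerSeries.C ρ) ⋆ Dpow (-1) ⋆ ofFun (MvPowerSeries.C ρ)) n) ∨
      ∃ i : ℕ, 1 ≤ i ∧ n = 2 * (i : ℤ) - 1 ∧ A.2 n = jet (Sum.inr i) 0 := by
  rcases lt_or_ge n 0 with h | h
  · exact Or.inl ⟨h, hA.1.snd_apply h⟩
  · obtain ⟨m, rfl⟩ := hn
    obtain ⟨i, rfl⟩ : ∃ i : ℕ, m = i - 1 := ⟨(m + 1).toNat, by omega⟩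
    have e : 2 * ((i : ℤ) - 1) + 1 = 2 * (i : ℤ) - 1 := by ring
    exact Or.inr ⟨i, by omega, e, by rw [e, hA.2.2 i (by omega)]⟩

theorem IsGenericPoint.fst_mem_depGE_inr (hA : IsGenericPoint ρ A) (i : ℕ) (e n : ℤ) :
    A.1 n ∈ depGE M (Sum.inr i) e := by
  refine mem_of_skew hA.1.skew_fst (N := fun _ => depGE M (Sum.inr i) e)
    (fun _ f hf => depGE_mono (D_mem_depGE hf) (by omega)) (fun _ => ⟨e, degGE_le_depGE⟩)
    (fun n hn => ?_) n
  rcases hA.fst_odd hn with ⟨-, h⟩ | ⟨j, -, h⟩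
  · rw [h]; exact Dpow_apply_mem_depGE _ _ _ _
  · rw [h]; exact jet_mem_depGE Sum.inr_ne_inl _

/-- The coordinate `v_{-j}` only enters the coefficients of `A` of order at most `-2j - 1`. -/
theorem IsGenericPoint.fst_mem_depGE_inl (hA : IsGenericPoint ρ A) (j : ℕ) (e : ℤ) {n : ℤ}
    (hn : -2 * (j : ℤ) ≤ n) : A.1 n ∈ depGE M (Sum.inl j) e := by
  have := mem_of_skew hA.1.skew_fst
    (N := fun n => if -2 * (j : ℤ) ≤ n then depGE M (Sum.inl j) e else ⊤)
    (fun n f hf => by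
      split_ifs with h
      · rw [if_pos (by omega)] at hf
        exact depGE_mono (D_mem_depGE hf) (by omega)
      · trivial)
    (fun n => ⟨e, by
      split_ifs
      · exact degGE_le_depGE
      · exact le_top⟩)
    (fun n hn => by
      split_ifs with h
      · rcases hA.fst_odd hn with ⟨-, h'⟩ | ⟨i, hi, h'⟩
        · rw [h']; exact Dpow_apply_mem_depGE _ _ _ _
        · rw [h']
          refine jet_mem_depGE (fun e => ?_) _
          rw [Sum.inl.injEq] at e
          omega
      · trivial) n
  rwa [if_pos hn] at this

theorem IsGenericPoint.snd_mem_depGE_inl (hA : IsGenericPoint ρ A)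
    (hρ : ρ * ρ = coord (Sum.inr 0)) (j : ℕ) (e n : ℤ) : A.2 n ∈ depGE M (Sum.inl j) e := by
  refine mem_of_skew hA.1.skew_snd (N := fun _ => depGE M (Sum.inl j) e)
    (fun _ f hf => depGE_mono (D_mem_depGE hf) (by omega)) (fun _ => ⟨e, degGE_le_depGE⟩)
    (fun n hn => ?_) n
  rcases hA.snd_odd hn with ⟨-, h⟩ | ⟨i, -, -, h⟩
  · have := C_mem_depGE (M := M) (pd_rho hρ (k := Sum.inl j) Sum.inl_ne_inr) e
    rw [h]
    exact fDg_apply_mem_depGE this this _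
  · rw [h]; exact jet_mem_depGE Sum.inl_ne_inr _

/-- The coordinate `v̂_i` only enters the coefficient of `D^(2i-1)`, and the coefficients of the
lower powers of `D` through its derivatives. -/
theorem IsGenericPoint.snd_mem_depGE_inr (hA : IsGenericPoint ρ A)
    (hρ : ρ * ρ = coord (Sum.inr 0)) (i : ℕ) (n : ℤ) :
    A.2 n ∈ depGE M (Sum.inr i) (2 * i - 1 - max n 0) := by
  rcases Nat.eq_zero_or_pos i with rfl | hi
  · exact mem_depGE_of_nonpos (by omega) _
  refine mem_of_skew hA.1.skew_snd (N := fun n => depGE M (Sum.inr i) (2 * i - 1 - max n 0))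
    (fun _ f hf => depGE_mono (D_mem_depGE hf) (by omega)) (fun _ => ⟨_, degGE_le_depGE⟩)
    (fun n hn => ?_) n
  rcases hA.snd_odd hn with ⟨hn, h⟩ | ⟨j, -, hj, h⟩
  · have := C_mem_depGE (M := M) (pd_rho hρ (k := Sum.inr i) (by
      rw [Ne, Sum.inr.injEq]; omega)) (2 * i - 1 - max n 0)
    rw [h]
    exact fDg_apply_mem_depGE this this _
  · rw [h]
    by_cases e : i = j
    · subst e
      exact mem_depGE_of_nonpos (by omega) _
    · exact jet_mem_depGE (by rwa [Ne, Sum.inr.injEq]) _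

theorem IsGenericPoint.fst_mem_Adm (hA : IsGenericPoint ρ A) (n : ℤ) : A.1 n ∈ Adm M := fun K => by
  refine ⟨(Finset.range (-n).toNat).disjSum ∅, fun k hk => ?_⟩
  rcases k with j | i
  · rw [Finset.inl_mem_disjSum, Finset.mem_range] at hk
    exact hA.fst_mem_depGE_inl j K (by omega)
  · exact hA.fst_mem_depGE_inr i K n

theorem IsGenericPoint.snd_mem_Adm (hA : IsGenericPoint ρ A) (hρ : ρ * ρ = coord (Sum.inr 0))
    (n : ℤ) : A.2 n ∈ Adm M := fun K => by
  refine ⟨Finset.disjSum ∅ (Finset.range (K + 1 + max n 0).toNat), fun k hk => ?_⟩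
  rcases k with j | i
  · exact hA.snd_mem_depGE_inl hρ j K n
  · rw [Finset.inr_mem_disjSum, Finset.mem_range] at hk
    exact depGE_mono (hA.snd_mem_depGE_inr hρ i n) (by omega)

theorem Psd.evol_skew {x : Psd M b} (hx : x ∈ Psd.admissible M b) (h : x.adj = -x)
    {w : Coord → DiffPoly M} : (x.evol w).adj = -x.evol w := by
  rw [← Psd.evol_adj hx, h]
  exact Psd.ext (funext fun n => evol_neg (hx n))

/-- The evolution of the first component of the generic point along a tangent vector. -/
theorem IsGenericPoint.evol_fst (hA : IsGenericPoint ρ A) {V : Op M × Op M}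
    (hV : IsTangent (MvPowerSeries.C ρ) V) (n : ℤ) : evol (components V) (A.1 n) = V.1 n := by
  obtain ⟨⟨-, h2, h3⟩, -⟩ := isTangent_iff.1 hV
  have hAd : hA.1.fst ∈ Psd.admissible M true := hA.fst_mem_Adm
  have hs : adj (hA.1.fst.evol (components V)).op = -(hA.1.fst.evol (components V)).op := by
    exact congrArg Psd.op (Psd.evol_skew hAd hA.1.adj_fst)
  have key : (hA.1.fst.evol (components V)).op - V.1 = 0 := by
    refine eq_zero_of_skew (by rw [map_sub, hs, h2, neg_sub_neg, neg_sub]) fun n hn => ?_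
    rw [Pi.sub_apply, Psd.evol_apply, sub_eq_zero]
    change evol _ (A.1 n) = _
    rcases hA.fst_odd hn with ⟨hn, h⟩ | ⟨i, rfl, h⟩
    · rw [h, evol_Dpow_apply, pos_eq_zero_iff.1 h3 n hn]
    · rw [h, evol_jet]
      rfl
  exact sub_eq_zero.1 (congrFun key n)

theorem Psd.fn_mem_admissible {f : DiffPoly M} (hf : f ∈ Adm M) :
    Psd.fn b f ∈ Psd.admissible M b := ofFun_apply_mem hf

theorem Psd.dpow_mem_admissible (j : ℤ) : Psd.dpow M b j ∈ Psd.admissible M b :=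
  Dpow_apply_mem_Adm j

theorem Psd.evol_fn (w : Coord → DiffPoly M) (f : DiffPoly M) :
    (Psd.fn b f).evol w = Psd.fn b (BKP.evol w f) := by
  refine Psd.ext (funext fun n => ?_)
  change BKP.evol w ((ofFun f : Op M) n) = (ofFun (BKP.evol w f) : Op M) n
  by_cases h : n = 0
  · rw [h, ofFun, ofFun, Pi.single_eq_same, Pi.single_eq_same]
  · rw [ofFun, ofFun, Pi.single_eq_of_ne h, Pi.single_eq_of_ne h, evol_zero]

theorem Psd.evol_dpow (w : Coord → DiffPoly M) (j : ℤ) : (Psd.dpow M b j).evol w = 0 :=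
  Psd.ext (funext fun n => evol_Dpow_apply w j n)

/-- The evolution of the second component of the generic point along a tangent vector. -/
theorem IsGenericPoint.evol_snd (hA : IsGenericPoint ρ A) (hρ : ρ * ρ = coord (Sum.inr 0))
    {V : Op M × Op M} (hV : IsTangent (MvPowerSeries.C ρ) V) (n : ℤ) :
    evol (components V) (A.2 n) = V.2 n := by
  obtain ⟨-, -, h5, g, h6⟩ := isTangent_iff.1 hV
  have hAd : hA.1.snd ∈ Psd.admissible M false := hA.snd_mem_Adm hρ
  have hr : ∀ l, l ≠ Sum.inr 0 → pd l ρ = 0 := fun l hl => pd_rho hρ hl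
  -- The coordinate `v̂_0` is the square of `ρ`, so that `ρ` evolves by `g`.
  have hg : evol (components V) (MvPowerSeries.C ρ) = g := by
    have e := h6 (-1) (by omega)
    rw [Pi.add_apply, fDg_apply_neg_one, fDg_apply_neg_one] at e
    have e' : components V (Sum.inr 0) = V.2 (-1) := rfl
    have e'' := two_mul_rho_mul_pd hρ (Sum.inr 0)
    rw [if_pos rfl] at e''
    rw [evol_C hr, e', e]
    calc _ = g * MvPowerSeries.C (2 * ρ * pd (Sum.inr 0) ρ) := by
            rw [map_mul, map_mul, map_ofNat]; ring
      _ = g := by rw [e'', map_one, mul_one]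
  have hρA := Psd.fn_mem_admissible (b := false) (C_mem_Adm hr)
  have hneg : (Psd.fn false (MvPowerSeries.C ρ) * Psd.dpow M false (-1) *
      Psd.fn false (MvPowerSeries.C ρ)).evol (components V) =
      Psd.fn false (MvPowerSeries.C ρ) * Psd.dpow M false (-1) * Psd.fn false g +
        Psd.fn false g * Psd.dpow M false (-1) * Psd.fn false (MvPowerSeries.C ρ) := by
    rw [Psd.evol_mul (Psd.mul_mem_admissible hρA (Psd.dpow_mem_admissible _)) hρA,
      Psd.evol_mul hρA (Psd.dpow_mem_admissible _), Psd.evol_fn, Psd.evol_dpow, hg, mul_zero,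
      add_zero, add_comm]
  have hs : adj (hA.1.snd.evol (components V)).op = -(hA.1.snd.evol (components V)).op := by
    exact congrArg Psd.op (Psd.evol_skew hAd hA.1.adj_snd)
  have key : (hA.1.snd.evol (components V)).op - V.2 = 0 := by
    refine eq_zero_of_skew (by rw [map_sub, hs, h5, neg_sub_neg, neg_sub]) fun n hn => ?_
    rw [Pi.sub_apply, Psd.evol_apply, sub_eq_zero]
    change evol _ (A.2 n) = _
    rcases hA.snd_odd hn with ⟨hn, h⟩ | ⟨i, -, rfl, h⟩
    · rw [h, h6 n hn]
      exact congrFun (congrArg Psd.op hneg) n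
    · rw [h, evol_jet]
      rfl
  exact sub_eq_zero.1 (congrFun key n)

end GenericPoint

/-! ### The second variation -/

section Hessian

variable {M : CoordManifold} {b : Bool} {f : DiffPoly M}

/-- The coefficient of order zero of `frechet k g ⋆ q` is the Fréchet derivative of `g` in the
direction of `q`. -/
theorem hasFSum_frechet_mul_ofFun (k : Coord) (g q : DiffPoly M) :
    HasFSum (degGE M) (fun s : ℕ => (D ^ s) q * jetDeriv k s g) ((frechet k g ⋆ ofFun q) 0) := by
  have h := (hasFSum_mul (frechet_mem_Reg k g) (ofFun_mem_Reg q) 0).comp_injective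
    (fun s : ℕ => ((s : ℤ), s)) (fun s t h => (Prod.mk.injEq _ _ _ _ ▸ h).2) (by
      rintro ⟨i, r⟩ h
      have : i ≠ r := fun e => h ⟨r, by rw [e]⟩
      simp only [ofFun]
      rw [Pi.single_eq_of_ne (by omega), map_zero, mul_zero, zsmul_zero])
  refine cast (congrArg₂ _ (funext fun s => ?_) rfl) h
  simp only [frechet_apply, ofFun, zero_sub, neg_add_cancel, Pi.single_eq_same]
  rw [Ring.choose_natCast, Nat.choose_self, Nat.cast_one, one_zsmul, mul_comm]

/-- The adjoint with respect to `∫ pq dx`. -/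
theorem mul_adj_sub_mem {a : Op M} (ha : a ∈ Reg M b) (p q : DiffPoly M) :
    p * (a ⋆ ofFun q) 0 - q * (adj a ⋆ ofFun p) 0 ∈ LinearMap.range (D (M := M)) := by
  set x : Psd M b := Psd.fn b p * (Psd.mk a ha * Psd.fn b q) with hx
  have e1 : p * (a ⋆ ofFun q) 0 = x.op 0 := (ofFun_mul_apply p _ 0).symm
  have e2 : q * (adj a ⋆ ofFun p) 0 = x.adj.op 0 := by
    rw [hx, Psd.adj_mul, Psd.adj_mul, Psd.adj_fn, Psd.adj_fn, mul_assoc]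
    exact (ofFun_mul_apply q _ 0).symm
  have h0 := hasFSum_single (W := degGE M) (fun r : ℕ => if r = 0 then x.op 0 else 0) 0
    fun r hr => if_neg hr
  rw [if_pos rfl] at h0
  rw [e1, e2]
  refine (h0.sub (hasFSum_adj x.op 0)).mem_range_D fun r => ?_
  cases r with
  | zero => simp
  | succ r =>
    rw [if_neg (Nat.succ_ne_zero r), zero_sub, pow_succ', Module.End.mul_apply, ← map_zsmul]
    exact Submodule.neg_mem _ (LinearMap.mem_range_self _ _)

/-- The second variation of a local functional is symmetric. -/
theorem hessian_sub_mem (hf : f ∈ densities M) {v w : Coord → DiffPoly M} {x y : DiffPoly M}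
    (hx : HasFSum (degGE M) (fun k => evol w (varDeriv k f) * v k) x)
    (hy : HasFSum (degGE M) (fun k => evol v (varDeriv k f) * w k) y) :
    x - y ∈ LinearMap.range (D (M := M)) := by
  have key : ∀ {v w : Coord → DiffPoly M} {x : DiffPoly M},
      HasFSum (degGE M) (fun k => evol w (varDeriv k f) * v k) x →
      HasFSum (degGE M) (fun p : Coord × Coord =>
        v p.1 * (frechet p.2 (varDeriv p.1 f) ⋆ ofFun (w p.2)) 0) x := by
    intro v w x hx
    have hz : TendsZero (degGE M) (fun p : Coord × Coord =>
        v p.1 * (frechet p.2 (varDeriv p.1 f) ⋆ ofFun (w p.2)) 0) := by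
      intro K
      obtain ⟨S, hS⟩ := exists_finset_varDeriv_mem hf K
      refine (S ×ˢ S).finite_toSet.subset fun p hp => ?_
      rw [Finset.mem_coe, Finset.mem_product]
      have h1 : varDeriv p.1 f ∉ depGE M p.2 K := fun hcon => hp (mul_mem_degGE_right
        ((hasFSum_frechet_mul_ofFun _ _ _).mem le_rfl fun s => degGE_le (by omega)
          (mul_mem_degGE (D_pow_mem_degGE' (w p.2) s) (hcon s))) _)
      constructor
      · by_contra hk
        exact h1 (degGE_le_depGE (hS _ hk))
      · by_contra hk
        exact h1 (varDeriv_mem_depGE (hS _ hk) _)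
    have h1 := hasFSum_fsum hz
    have h2 := h1.prod fun k => (((hasFSum_evol w (varDeriv_mem_Adm hf k)).prod
      fun m => hasFSum_frechet_mul_ofFun m _ (w m)).mul_left (v k))
    have e := h2.eq (by simpa only [mul_comm] using hx)
    rwa [e] at h1
  refine ((key hx).sub ((key hy).equiv (Equiv.prodComm Coord Coord))).mem_range_D fun p => ?_
  have e := adj_frechet_varDeriv p.1 p.2 f
  have h := mul_adj_sub_mem (frechet_mem_Reg p.2 (varDeriv p.1 f)) (v p.1) (w p.2)
  rw [e] at h
  exact h

end Hessian

/-! ### The density of the bracket -/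

section Density

variable {M : CoordManifold} {b : Bool} {k : Coord} {e : ℤ}

/-- The density of `⟨X, P_2(Y)⟩` at the point `A`. -/
noncomputable def bracketDensity (A X Y : Psd M true) (A' X' Y' : Psd M false) : DiffPoly M :=
  (2 : ℂ) • (res (X * A * kk (Y * A) (A' * Y')).op + res (A' * X' * hh (Y * A) (A' * Y')).op)

theorem integral_bracketDensity {A X Y : Psd M true} {A' X' Y' : Psd M false} (hA : A.adj = -A)
    (hA' : A'.adj = -A') (hX : X.adj = X) (hX' : X'.adj = X') (hY : Y.adj = Y)
    (hY' : Y'.adj = Y') :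
    integral (M := M) (bracketDensity A X Y A' X' Y') =
      pairing (X.op, X'.op) (P2 (A.op, A'.op) (Y.op, Y'.op)) := by
  rw [pairing_P2 hA hA' hX hX' hY hY', bracketDensity]
  refine ((integral (M := M)).map_smul _ _).trans (congrArg _ ?_)
  exact (integral (M := M)).map_add _ _

theorem neg_apply_mem {N : Submodule ℂ (DiffPoly M)} {a : Op M} {n : ℤ} (h : n < 0 → a n ∈ N) :
    neg a n ∈ N := by
  by_cases hn : n < 0
  · rw [neg_apply hn]; exact h hn
  · rw [neg_apply_of_nonneg (by omega)]; exact Submodule.zero_mem _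

theorem pos_apply_mem {N : Submodule ℂ (DiffPoly M)} {a : Op M} {n : ℤ} (h : 0 ≤ n → a n ∈ N) :
    pos a n ∈ N := by
  by_cases hn : 0 ≤ n
  · rw [pos_apply hn]; exact h hn
  · rw [pos_apply_of_neg (by omega)]; exact Submodule.zero_mem _

theorem mul_apply_mem_depGE_of_le {a c : Op M} (ha : a ∈ Reg M b) (hc : c ∈ Reg M b) {N L : ℤ}
    (haN : ∀ n, N < n → a n = 0) (ha' : ∀ n, a n ∈ depGE M k e)
    (hc' : ∀ n, L ≤ n → c n ∈ depGE M k e) {n : ℤ} (hn : N + L ≤ n) :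
    (a ⋆ c) n ∈ depGE M k e :=
  mul_apply_mem_depGE ha hc fun p r => by
    rcases lt_or_ge N p with h | h
    · rw [haN p h, zero_mul]; exact Submodule.zero_mem _
    · exact mul_mem_depGE (ha' p) (D_pow_mem_depGE' (hc' _ (by omega)) r)

/-- A coordinate which only enters the coefficients of low order of `A` does not enter the density
of the bracket. -/
theorem bracketDensity_mem_depGE_of_low {A X Y : Psd M true} {A' X' Y' : Psd M false} {N L : ℤ}
    (hL : 2 * N + L ≤ -2) (hL' : N + L ≤ 0)
    (hX : ∀ n, N < n → X.op n = 0) (hY : ∀ n, N < n → Y.op n = 0) (hA : ∀ n, 1 < n → A.op n = 0)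
    (dX : ∀ n, X.op n ∈ depGE M k e) (dY : ∀ n, Y.op n ∈ depGE M k e)
    (dA : ∀ n, L ≤ n → A.op n ∈ depGE M k e) (dX' : ∀ n, X'.op n ∈ depGE M k e)
    (dY' : ∀ n, Y'.op n ∈ depGE M k e) (dA' : ∀ n, A'.op n ∈ depGE M k e) :
    bracketDensity A X Y A' X' Y' ∈ depGE M k e := by
  have hXA : ∀ n, N + L ≤ n → (X * A).op n ∈ depGE M k e := fun n hn =>
    mul_apply_mem_depGE_of_le X.mem A.mem hX dX dA hn
  have hYA : ∀ n, N + L ≤ n → (Y * A).op n ∈ depGE M k e := fun n hn =>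
    mul_apply_mem_depGE_of_le Y.mem A.mem hY dY dA hn
  have hXN : ∀ n, N + 1 < n → (X * A).op n = 0 := fun n hn => mul_apply_eq_zero hX hA hn
  have hAX' : ∀ n, (A' * X').op n ∈ depGE M k e := mul_mem_depGE_of_forall A'.mem X'.mem dA' dX'
  have hAY' : ∀ n, (A' * Y').op n ∈ depGE M k e := mul_mem_depGE_of_forall A'.mem Y'.mem dA' dY'
  have hk : ∀ n, N + L ≤ n → (kk (Y * A) (A' * Y')).op n ∈ depGE M k e := fun n hn =>
    Submodule.sub_mem _ (neg_apply_mem fun _ => hYA n hn) (neg_apply_mem fun _ => hAY' n)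
  have hh : ∀ n, (hh (Y * A) (A' * Y')).op n ∈ depGE M k e := fun n =>
    Submodule.sub_mem _ (pos_apply_mem fun h => hYA n (by omega)) (pos_apply_mem fun _ => hAY' n)
  refine Submodule.smul_mem _ _ (Submodule.add_mem _ ?_
    (mul_mem_depGE_of_forall (A' * X').mem (BKP.hh _ _).mem hAX' hh (-1)))
  refine mul_apply_mem_depGE (X * A).mem (kk _ _).mem fun p r => ?_
  rcases lt_or_ge (N + 1) p with h | h
  · rw [hXN p h, zero_mul]; exact Submodule.zero_mem _
  · rcases lt_or_ge (-1 - p + r) 0 with h' | h'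
    · exact mul_mem_depGE (hXA p (by omega)) (D_pow_mem_depGE' (hk _ (by omega)) r)
    · rw [pos_eq_zero_iff.1 (kk_mem _ _) _ h', map_zero, mul_zero]
      exact Submodule.zero_mem _

/-- The operators with a bounded dependence on a coordinate, which is stronger for the coefficients
of low order. -/
def HasDepGE (k : Coord) (e l : ℤ) (a : Op M) : Prop :=
  ∀ n, a n ∈ depGE M k (e - max n 0) ∧ a n ∈ degGE M (l - n)

/-- The bounds on the degree `l - n` of the coefficients are what compensates for the loss of
`max n 0` in a product. -/
theorem HasDepGE.mul {a c : Op M} (ha : a ∈ Reg M b) (hc : c ∈ Reg M b) {d l : ℤ} (hl : l ≤ 0)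
    (h : HasDepGE k d l a) (h' : HasDepGE k d l c) : HasDepGE k (d + l) (l + l) (a ⋆ c) := by
  refine fun n => ⟨mul_apply_mem_depGE ha hc fun p r => ?_,
    mul_apply_mem_degGE (fun i => (h i).2) (fun i => (h' i).2) n⟩
  have e1 := D_pow_mem_depGE (h' (n - p + r)).1 r
  have e2 := D_pow_mem_degGE (h' (n - p + r)).2 r
  have e3 : a p ∈ degGE M (max (l - p) 0) := by
    rcases max_choice (l - p) 0 with h' | h' <;> rw [h']
    · exact (h p).2
    · exact mem_degGE_of_nonpos le_rfl _
  have e4 : (D ^ r) (c (n - p + r)) ∈ degGE M (max (l - (n - p + r) + r) 0) := by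
    rcases max_choice (l - (n - p + r) + r) 0 with h' | h' <;> rw [h']
    · exact e2
    · exact mem_degGE_of_nonpos le_rfl _
  exact mul_mem_depGE_degGE (h p).1 e3 e1 e4 (by omega) (by omega)

theorem HasDepGE.neg_apply_mem {a : Op M} {d l : ℤ} (h : HasDepGE k d l a) (n : ℤ) :
    neg a n ∈ depGE M k d :=
  BKP.neg_apply_mem fun hn => by
    have := (h n).1
    rwa [max_eq_right hn.le, sub_zero] at this

theorem HasDepGE.pos {a : Op M} {d l : ℤ} (h : HasDepGE k d l a) : HasDepGE k d l (BKP.pos a) :=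
  fun n => ⟨pos_apply_mem fun _ => (h n).1, pos_apply_mem fun _ => (h n).2⟩

theorem HasDepGE.sub {a c : Op M} {d l : ℤ} (h : HasDepGE k d l a) (h' : HasDepGE k d l c) :
    HasDepGE k d l (a - c) :=
  fun n => ⟨Submodule.sub_mem _ (h n).1 (h' n).1, Submodule.sub_mem _ (h n).2 (h' n).2⟩

theorem HasDepGE.mono {a : Op M} {d l d' l' : ℤ} (h : HasDepGE k d l a) (hd : d' ≤ d)
    (hl : l' ≤ l) : HasDepGE k d' l' a :=
  fun n => ⟨depGE_mono (h n).1 (by omega), degGE_le (by omega) (h n).2⟩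

/-- The positive part of an operator with weak dependence on a coordinate. -/
theorem hasDepGE_pos {a : Op M} {d l : ℤ} (hl : l ≤ 0) (h : ∀ n, a n ∈ depGE M k d) :
    HasDepGE k d l (BKP.pos a) := fun n =>
  ⟨pos_apply_mem fun _ => depGE_mono (h n) (by omega),
    pos_apply_mem fun _ => mem_degGE_of_nonpos (by omega) _⟩

/-- The dependence of the bracket on a coordinate is as weak as the one of its arguments, up to a
shift which does not depend on the coordinate. This keeps the growth of `δF/δv̂_i` in `i`. -/
theorem bracketDensity_mem_depGE {A X Y : Psd M true} {A' X' Y' : Psd M false} {d l : ℤ}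
    (hl : l ≤ 0) (dX : ∀ n, X.op n ∈ depGE M k d) (dY : ∀ n, Y.op n ∈ depGE M k d)
    (dA : ∀ n, A.op n ∈ depGE M k d) (dX' : HasDepGE k d l X'.op) (dY' : HasDepGE k d l Y'.op)
    (dA' : HasDepGE k d l A'.op) :
    bracketDensity A X Y A' X' Y' ∈ depGE M k (d + 3 * l) := by
  have hXA : ∀ n, (X * A).op n ∈ depGE M k d := mul_mem_depGE_of_forall X.mem A.mem dX dA
  have hYA : ∀ n, (Y * A).op n ∈ depGE M k d := mul_mem_depGE_of_forall Y.mem A.mem dY dA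
  have hAX' : HasDepGE k (d + l) (l + l) (A' * X').op := dA'.mul A'.mem X'.mem hl dX'
  have hAY' : HasDepGE k (d + l) (l + l) (A' * Y').op := dA'.mul A'.mem Y'.mem hl dY'
  have hk : ∀ n, (kk (Y * A) (A' * Y')).op n ∈ depGE M k (d + l) := fun n =>
    Submodule.sub_mem _ (neg_apply_mem fun _ => depGE_mono (hYA n) (by omega))
      (hAY'.neg_apply_mem n)
  have hh : HasDepGE k (d + l) (l + l) (hh (Y * A) (A' * Y')).op :=
    ((hasDepGE_pos (by omega) hYA).mono (by omega) le_rfl).sub hAY'.pos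
  refine Submodule.smul_mem _ _ (Submodule.add_mem _ (depGE_mono
    (mul_mem_depGE_of_forall (X * A).mem (kk _ _).mem
      (fun n => depGE_mono (hXA n) (by omega)) hk (-1)) (by omega)) ?_)
  exact depGE_mono ((hAX'.mul (A' * X').mem (BKP.hh _ _).mem (by omega) hh) (-1)).1 (by omega)

theorem kk_mem_admissible {a : Psd M true} {c : Psd M false} (ha : a ∈ Psd.admissible M true)
    (hc : c ∈ Psd.admissible M false) : kk a c ∈ Psd.admissible M true :=
  Submodule.sub_mem _ (Psd.negTrue_mem_admissible ha) (Psd.negTrue_mem_admissible hc)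

theorem hh_mem_admissible {a : Psd M true} {c : Psd M false} (ha : a ∈ Psd.admissible M true)
    (hc : c ∈ Psd.admissible M false) : hh a c ∈ Psd.admissible M false :=
  Submodule.sub_mem _ (Psd.posFalse_mem_admissible ha) (Psd.posFalse_mem_admissible hc)

theorem evol_kk {a : Psd M true} {c : Psd M false} (ha : a ∈ Psd.admissible M true)
    (hc : c ∈ Psd.admissible M false) (w : Coord → DiffPoly M) :
    (kk a c).evol w = kk (a.evol w) (c.evol w) := by
  rw [kk, Psd.evol_sub (Psd.negTrue_mem_admissible ha) (Psd.negTrue_mem_admissible hc),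
    Psd.evol_negTrue, Psd.evol_negTrue, kk]

theorem evol_hh {a : Psd M true} {c : Psd M false} (ha : a ∈ Psd.admissible M true)
    (hc : c ∈ Psd.admissible M false) (w : Coord → DiffPoly M) :
    (hh a c).evol w = hh (a.evol w) (c.evol w) := by
  rw [hh, Psd.evol_sub (Psd.posFalse_mem_admissible ha) (Psd.posFalse_mem_admissible hc),
    Psd.evol_posFalse, Psd.evol_posFalse, hh]

variable {A X Y : Psd M true} {A' X' Y' : Psd M false}

theorem bracketDensity_mem_Adm (hA : A ∈ Psd.admissible M true) (hX : X ∈ Psd.admissible M true)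
    (hY : Y ∈ Psd.admissible M true) (hA' : A' ∈ Psd.admissible M false)
    (hX' : X' ∈ Psd.admissible M false) (hY' : Y' ∈ Psd.admissible M false) :
    bracketDensity A X Y A' X' Y' ∈ Adm M := by
  have h1 := Psd.mul_mem_admissible hY hA
  have h2 := Psd.mul_mem_admissible hA' hY'
  exact Submodule.smul_mem _ _ (Submodule.add_mem _
    (Psd.mul_mem_admissible (Psd.mul_mem_admissible hX hA) (kk_mem_admissible h1 h2) (-1))
    (Psd.mul_mem_admissible (Psd.mul_mem_admissible hA' hX') (hh_mem_admissible h1 h2) (-1)))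

/-- The derivative of the bracket along an evolutionary vector field. -/
theorem integral_evol_bracketDensity (hA : A ∈ Psd.admissible M true)
    (hX : X ∈ Psd.admissible M true) (hY : Y ∈ Psd.admissible M true)
    (hA' : A' ∈ Psd.admissible M false) (hX' : X' ∈ Psd.admissible M false)
    (hY' : Y' ∈ Psd.admissible M false) (w : Coord → DiffPoly M) :
    integral (M := M) (evol w (bracketDensity A X Y A' X' Y')) = (2 : ℂ) •
      (omega ((X * A).evol w) ((A' * X').evol w) (Y * A) (A' * Y') +
        omega (X * A) (A' * X') ((Y * A).evol w) ((A' * Y').evol w)) := by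
  have h1 := Psd.mul_mem_admissible hX hA
  have h2 := Psd.mul_mem_admissible hA' hX'
  have h3 := Psd.mul_mem_admissible hY hA
  have h4 := Psd.mul_mem_admissible hA' hY'
  have h5 := kk_mem_admissible h3 h4
  have h6 := hh_mem_admissible h3 h4
  have e1 : evol w (res (X * A * kk (Y * A) (A' * Y')).op) =
      res ((X * A).evol w * kk (Y * A) (A' * Y')).op +
        res (X * A * kk ((Y * A).evol w) ((A' * Y').evol w)).op := by
    rw [← evol_kk h3 h4]
    exact congrFun (congrArg Psd.op (Psd.evol_mul h1 h5)) (-1)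
  have e2 : evol w (res (A' * X' * hh (Y * A) (A' * Y')).op) =
      res ((A' * X').evol w * hh (Y * A) (A' * Y')).op +
        res (A' * X' * hh ((Y * A).evol w) ((A' * Y').evol w)).op := by
    rw [← evol_hh h3 h4]
    exact congrFun (congrArg Psd.op (Psd.evol_mul h2 h6)) (-1)
  have m1 : res (X * A * kk (Y * A) (A' * Y')).op ∈ Adm M := Psd.mul_mem_admissible h1 h5 (-1)
  have m2 : res (A' * X' * hh (Y * A) (A' * Y')).op ∈ Adm M := Psd.mul_mem_admissible h2 h6 (-1)
  rw [bracketDensity, evol_smul (Submodule.add_mem _ m1 m2), evol_add m1 m2, e1, e2]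
  refine ((integral (M := M)).map_smul _ _).trans (congrArg _ ?_)
  refine ((integral (M := M)).map_add _ _).trans (Eq.trans (congrArg₂ _
    ((integral (M := M)).map_add _ _) ((integral (M := M)).map_add _ _)) ?_)
  exact add_add_add_comm _ _ _ _

end Density

/-! ### The brackets of the quadratic tensor at the shifted points -/

section Bracket

variable {M : CoordManifold} {ρ : Smooth M} {A : Op M × Op M}

/-- The point `A` of the coset, shifted by `s(D⁻¹, D)`. -/
noncomputable def shiftedPoint (A : Op M × Op M) (s : ℂ) : Op M × Op M :=
  A + s • ((Dpow (-1), Dpow 1) : Op M × Op M)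

theorem IsGenericPoint.shifted (hA : IsGenericPoint ρ A) (s : ℂ) :
    IsCosetPoint (MvPowerSeries.C ρ) (shiftedPoint A s) := hA.1.shift s

theorem IsGenericPoint.fst_mem_admissible (hA : IsGenericPoint ρ A) (s : ℂ) :
    (hA.shifted s).fst ∈ Psd.admissible M true := fun n =>
  Submodule.add_mem _ (hA.fst_mem_Adm n) (Submodule.smul_mem _ s (Dpow_apply_mem_Adm (-1) n))

theorem IsGenericPoint.snd_mem_admissible (hA : IsGenericPoint ρ A)
    (hρ : ρ * ρ = coord (Sum.inr 0)) (s : ℂ) : (hA.shifted s).snd ∈ Psd.admissible M false :=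
  fun n => Submodule.add_mem _ (hA.snd_mem_Adm hρ n)
    (Submodule.smul_mem _ s (Dpow_apply_mem_Adm 1 n))

theorem IsGenericPoint.evol_shifted_fst (hA : IsGenericPoint ρ A) (s : ℂ) {Z : Psd M true}
    {Z' : Psd M false} (hZ : IsTangent (MvPowerSeries.C ρ) (Z.op, Z'.op)) :
    (hA.shifted s).fst.evol (components (Z.op, Z'.op)) = Z := by
  refine Psd.ext (funext fun n => ?_)
  change evol _ (A.1 n + s • (Dpow (-1) : Op M) n) = _
  rw [evol_add (hA.fst_mem_Adm n) (Submodule.smul_mem _ s (Dpow_apply_mem_Adm (-1) n)),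
    evol_smul (Dpow_apply_mem_Adm (-1) n), evol_Dpow_apply, smul_zero, add_zero, hA.evol_fst hZ]

theorem IsGenericPoint.evol_shifted_snd (hA : IsGenericPoint ρ A)
    (hρ : ρ * ρ = coord (Sum.inr 0)) (s : ℂ) {Z : Psd M true}
    {Z' : Psd M false} (hZ : IsTangent (MvPowerSeries.C ρ) (Z.op, Z'.op)) :
    (hA.shifted s).snd.evol (components (Z.op, Z'.op)) = Z' := by
  refine Psd.ext (funext fun n => ?_)
  change evol _ (A.2 n + s • (Dpow 1 : Op M) n) = _
  rw [evol_add (hA.snd_mem_Adm hρ n) (Submodule.smul_mem _ s (Dpow_apply_mem_Adm 1 n)),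
    evol_smul (Dpow_apply_mem_Adm 1 n), evol_Dpow_apply, smul_zero, add_zero, hA.evol_snd hρ hZ]

/-- The first component of the gradient, in the algebra of operators of the first kind. -/
noncomputable def gradFst (f : densities M) : Psd M true := (isCotangent_grad f.2).fst

/-- The second component of the gradient, in the algebra of operators of the second kind. -/
noncomputable def gradSnd (f : densities M) : Psd M false := (isCotangent_grad f.2).snd

theorem gradFst_mem_admissible (f : densities M) : gradFst f ∈ Psd.admissible M true :=
  grad_fst_mem_Adm f.2

theorem gradSnd_mem_admissible (f : densities M) : gradSnd f ∈ Psd.admissible M false :=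
  grad_snd_mem_Adm f.2

theorem adj_gradFst (f : densities M) : (gradFst f).adj = gradFst f := Psd.ext (adj_grad_fst f.1)

theorem adj_gradSnd (f : densities M) : (gradSnd f).adj = gradSnd f := Psd.ext (adj_grad_snd f.1)

/-- The density of the bracket of two local functionals at the shifted generic point. -/
noncomputable def IsGenericPoint.density (hA : IsGenericPoint ρ A) (s : ℂ) (f g : densities M) :
    DiffPoly M :=
  bracketDensity (hA.shifted s).fst (gradFst f) (gradFst g) (hA.shifted s).snd (gradSnd f)
    (gradSnd g)

theorem IsGenericPoint.integral_density (hA : IsGenericPoint ρ A) (s : ℂ) (f g : densities M) :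
    integral (M := M) (hA.density s f g) =
      pairing (grad f.1) (P2 (shiftedPoint A s) (grad g.1)) :=
  integral_bracketDensity (hA.shifted s).adj_fst (hA.shifted s).adj_snd (adj_gradFst f)
    (adj_gradSnd f) (adj_gradFst g) (adj_gradSnd g)

theorem IsGenericPoint.density_mem_Adm (hA : IsGenericPoint ρ A) (hρ : ρ * ρ = coord (Sum.inr 0))
    (s : ℂ) (f g : densities M) : hA.density s f g ∈ Adm M :=
  bracketDensity_mem_Adm (hA.fst_mem_admissible s) (gradFst_mem_admissible f)
    (gradFst_mem_admissible g) (hA.snd_mem_admissible hρ s) (gradSnd_mem_admissible f)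
    (gradSnd_mem_admissible g)

/-- The local functionals in `ℱ_0` are closed under the bracket. -/
theorem IsGenericPoint.density_mem (hA : IsGenericPoint ρ A) (hρ : ρ * ρ = coord (Sum.inr 0))
    (s : ℂ) (f g : densities M) : hA.density s f g ∈ densities M := by
  have hD : ∀ (k : Coord) (e : ℤ) (j n : ℤ), s • (Dpow j : Op M) n ∈ depGE M k e := fun k e j n =>
    Submodule.smul_mem _ s (Dpow_apply_mem_depGE k e j n)
  obtain ⟨N₁, h1⟩ := (mem_densities.1 f.2).1
  obtain ⟨N₂, h2⟩ := (mem_densities.1 g.2).1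
  obtain ⟨N₃, h3⟩ := exists_varDeriv_inl_eq_zero f.2
  obtain ⟨N₄, h4⟩ := exists_varDeriv_inl_eq_zero g.2
  obtain ⟨d₁, hd1, h5⟩ := exists_varDeriv_inr_mem f.2
  obtain ⟨d₂, hd2, h6⟩ := exists_varDeriv_inr_mem g.2
  obtain ⟨l₁, h7⟩ := mem_Dplus.1 (mem_densities.1 f.2).2
  obtain ⟨l₂, h8⟩ := mem_Dplus.1 (mem_densities.1 g.2).2
  obtain ⟨l₃, h9⟩ := mem_Dplus.1 (hA.shifted s).snd_mem
  refine mem_densities_of_varDeriv (N := N₁.toNat + N₂.toNat + N₃ + N₄ + 1)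
    (d := min (min d₁ d₂) (-1) + 3 * min (min l₁ l₂) (min l₃ 0)) (fun j hj => ?_) fun i => ?_
  · refine eq_zero_of_mem_degGE _ fun e => varDeriv_mem_degGE ?_
    have e1 : varDeriv (Sum.inl j) f.1 ∈ degGE M e := by
      rw [h3 j (by omega)]; exact Submodule.zero_mem _
    have e2 : varDeriv (Sum.inl j) g.1 ∈ degGE M e := by
      rw [h4 j (by omega)]; exact Submodule.zero_mem _
    refine bracketDensity_mem_depGE_of_low (N := N₁.toNat + N₂.toNat) (L := -2 * j) (by omega)
      (by omega) (fun n hn => h1 n (by omega)) (fun n hn => h2 n (by omega)) (fun n hn => ?_)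
      (grad_fst_mem_depGE e1) (grad_fst_mem_depGE e2) (fun n hn => ?_)
      (grad_snd_mem_depGE e1) (grad_snd_mem_depGE e2) fun n => ?_
    · exact ((hA.shifted s).fst_apply (by omega)).trans (Pi.single_eq_of_ne (by omega) _)
    · exact Submodule.add_mem _ (hA.fst_mem_depGE_inl j e hn) (hD _ _ _ _)
    · exact Submodule.add_mem _ (hA.snd_mem_depGE_inl hρ j e n) (hD _ _ _ _)
  · refine varDeriv_mem_degGE ?_
    rw [← add_assoc]
    refine bracketDensity_mem_depGE (by omega)
      (fun n => depGE_mono (grad_fst_mem_depGE (h5 i) n) (by omega))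
      (fun n => depGE_mono (grad_fst_mem_depGE (h6 i) n) (by omega))
      (fun n => Submodule.add_mem _ (hA.fst_mem_depGE_inr i _ n) (hD _ _ _ _))
      (fun n => ⟨depGE_mono (grad_snd_mem_depGE (h5 i) n) (by omega),
        degGE_le (by omega) (h7 n)⟩)
      (fun n => ⟨depGE_mono (grad_snd_mem_depGE (h6 i) n) (by omega),
        degGE_le (by omega) (h8 n)⟩)
      (fun n => ⟨Submodule.add_mem _ (depGE_mono (hA.snd_mem_depGE_inr hρ i n) (by omega))
        (hD _ _ _ _), degGE_le (by omega) (h9 n)⟩)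

/-- The symmetry of the second variation, in terms of the operators. -/
theorem hessian_symm (f : densities M) {Z W : Psd M true} {Z' W' : Psd M false} (hZ : Z.adj = -Z)
    (hZ' : Z'.adj = -Z') (hW : W.adj = -W) (hW' : W'.adj = -W') :
    ((gradFst f).evol (components (Z.op, Z'.op)) * W).tr +
        ((gradSnd f).evol (components (Z.op, Z'.op)) * W').tr =
      ((gradFst f).evol (components (W.op, W'.op)) * Z).tr +
        ((gradSnd f).evol (components (W.op, W'.op)) * Z').tr := by
  let u : Psd M true := Psd.mk (preGrad f.1) (Dminus_le (preGrad_mem_Dminus f.2))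
  let u' : Psd M false := Psd.mk (preGradHat f.1) (Dplus_le (preGradHat_mem_Dplus f.2))
  have hu : u ∈ Psd.admissible M true := preGrad_induction f.1 (p := fun _ x => x ∈ Adm M)
    (fun _ => Submodule.zero_mem _) fun i => varDeriv_mem_Adm f.2 _
  have hu' : u' ∈ Psd.admissible M false := preGradHat_induction f.1 (p := fun _ x => x ∈ Adm M)
    (fun _ => Submodule.zero_mem _) fun i => varDeriv_mem_Adm f.2 _
  have e1 : ∀ w, (gradFst f).evol w = (2⁻¹ : ℂ) • (u.evol w + (u.evol w).adj) := fun w => by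
    rw [← Psd.evol_adj hu, ← Psd.evol_add hu (Psd.adj_mem_admissible hu),
      ← Psd.evol_smul (Submodule.add_mem _ hu (Psd.adj_mem_admissible hu))]
    rfl
  have e2 : ∀ w, (gradSnd f).evol w = (2⁻¹ : ℂ) • (u'.evol w + (u'.evol w).adj) := fun w => by
    rw [← Psd.evol_adj hu', ← Psd.evol_add hu' (Psd.adj_mem_admissible hu'),
      ← Psd.evol_smul (Submodule.add_mem _ hu' (Psd.adj_mem_admissible hu'))]
    rfl
  have key : ∀ {V : Psd M true} {V' : Psd M false} (w : Coord → DiffPoly M), V.adj = -V →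
      V'.adj = -V' → ∃ x, HasFSum (degGE M)
        (fun k => evol w (varDeriv k f.1) * components (V.op, V'.op) k) x ∧
        integral (M := M) x = ((gradFst f).evol w * V).tr + ((gradSnd f).evol w * V').tr := by
    intro V V' w hV hV'
    obtain ⟨x, h1, h2⟩ := exists_hasFSum_pairing (u.evol w).mem (u'.evol w).mem
      (fun n hn => by
        rw [Psd.evol_apply]
        exact (congrArg _ (hn.elim (preGrad_odd f.1) (preGrad_of_neg f.1))).trans evol_zero)
      (fun n hn => by
        rw [Psd.evol_apply]
        exact (congrArg _ (hn.elim (preGradHat_odd f.1) (preGradHat_of_pos f.1))).trans evol_zero)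
      hV hV' (q := fun k => evol w (varDeriv k f.1))
      (fun i => congrArg (evol w) (preGrad_two_mul f.1 i).symm)
      (fun i => congrArg (evol w) (preGradHat_two_mul f.1 i).symm)
    refine ⟨x, h1, h2.trans ?_⟩
    rw [e1, e2]
    rfl
  obtain ⟨x, hx, hx'⟩ := key (components (Z.op, Z'.op)) hW hW'
  obtain ⟨y, hy, hy'⟩ := key (components (W.op, W'.op)) hZ hZ'
  rw [← hx', ← hy']
  exact integral_eq_of_sub_mem (hessian_sub_mem f.2 hx hy)

/-- The Jacobi identity for the quadratic tensor at the shifted generic point. -/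
theorem IsGenericPoint.jacobi (hA : IsGenericPoint ρ A) (hρ : ρ * ρ = coord (Sum.inr 0)) (s : ℂ)
    {ι : Type*} (f : ι → densities M) (i j l : ι) :
    integral (M := M) (hA.density s (f l) ⟨_, hA.density_mem hρ s (f i) (f j)⟩) +
      integral (M := M) (hA.density s (f i) ⟨_, hA.density_mem hρ s (f j) (f l)⟩) +
      integral (M := M) (hA.density s (f j) ⟨_, hA.density_mem hρ s (f l) (f i)⟩) = 0 := by
  set a := (hA.shifted s).fst with ha
  set a' := (hA.shifted s).snd with ha'
  have ha1 : a.adj = -a := (hA.shifted s).adj_fst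
  have ha1' : a'.adj = -a' := (hA.shifted s).adj_snd
  have ha2 : a ∈ Psd.admissible M true := hA.fst_mem_admissible s
  have ha2' : a' ∈ Psd.admissible M false := hA.snd_mem_admissible hρ s
  let X : ι → Psd M true := fun i => gradFst (f i)
  let X' : ι → Psd M false := fun i => gradSnd (f i)
  let Z : ι → Psd M true := fun i => vecK a (kOp a a' X X' i)
  let Z' : ι → Psd M false := fun i => vecH a' (hOp a a' X X' i)
  have hP : ∀ i, P2 (shiftedPoint A s) (grad (f i).1) = ((Z i).op, (Z' i).op) := fun i =>
    P2_eq' (hA.shifted s) (isCotangent_grad (f i).2)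
  have hT : ∀ i, IsTangent (MvPowerSeries.C ρ) ((Z i).op, (Z' i).op) := fun i => by
    rw [← hP i]
    exact P2_isTangent (hA.shifted s) (isCotangent_grad (f i).2)
  have hZ : ∀ i, (Z i).adj = -Z i := fun i => vecK_adj ha1
  have hZ' : ∀ i, (Z' i).adj = -Z' i := fun i => vecH_adj ha1'
  let w : ι → Coord → DiffPoly M := fun i => components ((Z i).op, (Z' i).op)
  have hX : ∀ i, X i ∈ Psd.admissible M true := fun i => gradFst_mem_admissible _
  have hX' : ∀ i, X' i ∈ Psd.admissible M false := fun i => gradSnd_mem_admissible _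
  have key := cyclic_variation (A := a) (A' := a') (X := X) (X' := X') ha1 ha1'
    (fun i => adj_gradFst _) (fun i => adj_gradSnd _)
    (Y := fun i j => (X i).evol (w j)) (Y' := fun i j => (X' i).evol (w j))
    (fun i j => by rw [← Psd.evol_adj (hX i)]; exact congrArg _ (adj_gradFst _))
    (fun i j => by rw [← Psd.evol_adj (hX' i)]; exact congrArg _ (adj_gradSnd _))
    (fun i j l => hessian_symm (f i) (hZ j) (hZ' j) (hZ l) (hZ' l))
    (da := fun i j => (X i * a).evol (w j)) (dc := fun i j => (a' * X' i).evol (w j))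
    (fun i j => by
      rw [Psd.evol_mul (hX i) ha2, hA.evol_shifted_fst s (hT j)])
    (fun i j => by
      rw [Psd.evol_mul ha2' (hX' i), hA.evol_shifted_snd hρ s (hT j)])
    (dO := fun i j l => omega ((X i * a).evol (w l)) ((a' * X' i).evol (w l))
        (X j * a) (a' * X' j) +
      omega (X i * a) (a' * X' i) ((X j * a).evol (w l)) ((a' * X' j).evol (w l)))
    (fun i j l => rfl) i j l
  have step : ∀ i j l, integral (M := M)
      (hA.density s (f l) ⟨_, hA.density_mem hρ s (f i) (f j)⟩) = (-2 : ℂ) •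
        (omega ((X i * a).evol (w l)) ((a' * X' i).evol (w l)) (X j * a) (a' * X' j) +
          omega (X i * a) (a' * X' i) ((X j * a).evol (w l)) ((a' * X' j).evol (w l))) := by
    intro i j l
    rw [hA.integral_density, P2_skew (hA.shifted s) (isCotangent_grad (f l).2)
      (isCotangent_grad (hA.density_mem hρ s (f i) (f j))), hP l,
      ← integral_evol (hA.density_mem hρ s (f i) (f j)) (hA.density_mem_Adm hρ s (f i) (f j))
        (hZ l) (hZ' l), neg_smul]
    exact congrArg Neg.neg (integral_evol_bracketDensity ha2 (hX i) (hX j) ha2' (hX' i) (hX' j) _)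
  rw [step i j l, step j l i, step l i j, ← smul_add, ← smul_add, key, smul_zero]

end Bracket

/-! ### Linear combinations of the tensors -/

section Final

variable {M : CoordManifold} {ρ : Smooth M} {r : DiffPoly M} {A X Y V W : Op M × Op M}

theorem pairing_add_right (hX : IsCotangent X) (hV : IsTangent r V) (hW : IsTangent r W) :
    pairing X (V + W) = pairing X V + pairing X W := by
  obtain ⟨⟨h1, -, -⟩, h2, -⟩ := isTangent_iff.1 hV
  obtain ⟨⟨k1, -, -⟩, k2, -⟩ := isTangent_iff.1 hW
  let v : Psd M true := Psd.mk V.1 (Dminus_le h1)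
  let v' : Psd M false := Psd.mk V.2 (Dplus_le h2)
  let z : Psd M true := Psd.mk W.1 (Dminus_le k1)
  let z' : Psd M false := Psd.mk W.2 (Dplus_le k2)
  change (hX.fst * (v + z)).tr + (hX.snd * (v' + z')).tr =
    (hX.fst * v).tr + (hX.snd * v').tr + ((hX.fst * z).tr + (hX.snd * z').tr)
  rw [mul_add, mul_add, Psd.tr_add, Psd.tr_add]
  exact add_add_add_comm _ _ _ _

theorem pairing_smul_right (hX : IsCotangent X) (hV : IsTangent r V) (c : ℂ) :
    pairing X (c • V) = c • pairing X V := by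
  obtain ⟨⟨h1, -, -⟩, h2, -⟩ := isTangent_iff.1 hV
  let v : Psd M true := Psd.mk V.1 (Dminus_le h1)
  let v' : Psd M false := Psd.mk V.2 (Dplus_le h2)
  change (hX.fst * (c • v)).tr + (hX.snd * (c • v')).tr =
    c • ((hX.fst * v).tr + (hX.snd * v').tr)
  rw [mul_smul_comm, mul_smul_comm, Psd.tr_smul, Psd.tr_smul, smul_add]

theorem shiftedPoint_zero : shiftedPoint A 0 = A := by rw [shiftedPoint, zero_smul, add_zero]

theorem P2_shiftedPoint_neg_one (hA : IsCosetPoint r A) (hX : IsCotangent X) :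
    P2 (shiftedPoint A (-1)) X = (2 : ℂ) • P2 A X - P2 (shiftedPoint A 1) X := by
  rw [shiftedPoint, shiftedPoint, P2_shift hA hX, P2_shift hA hX]
  module

theorem combination_eq_shiftedPoint (hA : IsCosetPoint r A) (hX : IsCotangent X) (x y : ℂ) :
    (x • P1 + y • P2 : Op M × Op M → Op M × Op M → Op M × Op M) A X =
      x • P2 (shiftedPoint A 1) X + (y - x) • P2 A X := combination_eq hA hX x y

theorem pairing_combination (hA : IsCosetPoint r A) (hX : IsCotangent X) (hY : IsCotangent Y)
    (x y : ℂ) :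
    pairing X ((x • P1 + y • P2 : Op M × Op M → Op M × Op M → Op M × Op M) A Y) =
      x • pairing X (P2 (shiftedPoint A 1) Y) + (y - x) • pairing X (P2 A Y) := by
  have h1 := P2_isTangent (hA.shift 1) hY
  have h0 := P2_isTangent hA hY
  rw [combination_eq_shiftedPoint hA hY]
  refine (pairing_add_right hX (h1.smul x) (h0.smul _)).trans (congrArg₂ _ ?_ ?_)
  · exact pairing_smul_right hX h1 x
  · exact pairing_smul_right hX h0 _

/-- A density of a local functional in `ℱ_0`. -/
noncomputable def densityOf (F : F0 M) : densities M := ⟨F.2.choose, F.2.choose_spec.1⟩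

theorem integral_densityOf (F : F0 M) : integral (M := M) (densityOf F).1 = F.1 :=
  F.2.choose_spec.2

theorem grad_densityOf {F : F0 M} {f : DiffPoly M} (h : integral (M := M) f = F.1) :
    grad (M := M) (densityOf F).1 = grad (M := M) f :=
  grad_eq_of_integral_eq ((integral_densityOf F).trans h.symm)

theorem grad_densityOf_add (F G : F0 M) :
    grad (M := M) (densityOf (F + G)).1 =
      grad (M := M) (densityOf F).1 + grad (M := M) (densityOf G).1 :=
  (grad_densityOf (((integral (M := M)).map_add _ _).trans
    (congrArg₂ _ (integral_densityOf F) (integral_densityOf G)))).trans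
    ((grad (M := M)).map_add _ _)

theorem grad_densityOf_smul (c : ℂ) (F : F0 M) :
    grad (M := M) (densityOf (c • F)).1 = c • grad (M := M) (densityOf F).1 :=
  (grad_densityOf (((integral (M := M)).map_smul _ _).trans
    (congrArg _ (integral_densityOf F)))).trans ((grad (M := M)).map_smul _ _)

variable (hA : IsGenericPoint ρ A) (hρ : ρ * ρ = coord (Sum.inr 0))

/-- The bracket given by the quadratic tensor at the shifted generic point. -/
noncomputable def IsGenericPoint.bracketFun (s : ℂ) (F G : F0 M) : F0 M :=
  ⟨integral (M := M) (hA.density s (densityOf F) (densityOf G)), _, hA.density_mem hρ s _ _, rfl⟩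

theorem IsGenericPoint.coe_bracketFun (s : ℂ) (F G : F0 M) : (hA.bracketFun hρ s F G).1 =
    pairing (grad (densityOf F).1) (P2 (shiftedPoint A s) (grad (densityOf G).1)) :=
  hA.integral_density s _ _

theorem IsGenericPoint.bracketFun_skew (s : ℂ) (F G : F0 M) :
    hA.bracketFun hρ s F G = -hA.bracketFun hρ s G F := by
  refine Subtype.ext ((hA.coe_bracketFun hρ s F G).trans (Eq.trans ?_
    (congrArg Neg.neg (hA.coe_bracketFun hρ s G F)).symm))
  exact P2_skew (hA.shifted s) (isCotangent_grad (densityOf F).2) (isCotangent_grad (densityOf G).2)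

theorem IsGenericPoint.bracketFun_add (s : ℂ) (F G H : F0 M) :
    hA.bracketFun hρ s F (G + H) = hA.bracketFun hρ s F G + hA.bracketFun hρ s F H := by
  refine Subtype.ext ((hA.coe_bracketFun hρ s F (G + H)).trans (Eq.trans ?_
    (congrArg₂ HAdd.hAdd (hA.coe_bracketFun hρ s F G) (hA.coe_bracketFun hρ s F H)).symm))
  have h := isCotangent_grad (M := M) (densityOf G).2
  have h' := isCotangent_grad (M := M) (densityOf H).2
  rw [grad_densityOf_add, P2_add (hA.shifted s) h h']
  exact pairing_add_right (isCotangent_grad (densityOf F).2) (P2_isTangent (hA.shifted s) h)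
    (P2_isTangent (hA.shifted s) h')

theorem IsGenericPoint.bracketFun_smul (s c : ℂ) (F G : F0 M) :
    hA.bracketFun hρ s F (c • G) = c • hA.bracketFun hρ s F G := by
  refine Subtype.ext ((hA.coe_bracketFun hρ s F (c • G)).trans (Eq.trans ?_
    (congrArg (c • ·) (hA.coe_bracketFun hρ s F G)).symm))
  have h := isCotangent_grad (M := M) (densityOf G).2
  rw [grad_densityOf_smul, P2_smul (hA.shifted s) h]
  exact pairing_smul_right (isCotangent_grad (densityOf F).2) (P2_isTangent (hA.shifted s) h) c

/-- The bracket given by the quadratic tensor at the shifted generic point, as a bilinear map. -/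
noncomputable def IsGenericPoint.bracket (s : ℂ) : F0 M →ₗ[ℂ] F0 M →ₗ[ℂ] F0 M :=
  LinearMap.mk₂ ℂ (hA.bracketFun hρ s)
    (fun F G H => by
      rw [hA.bracketFun_skew, hA.bracketFun_add, neg_add, ← hA.bracketFun_skew,
        ← hA.bracketFun_skew])
    (fun c F G => by
      rw [hA.bracketFun_skew, hA.bracketFun_smul, hA.bracketFun_skew hρ s F G, smul_neg])
    (hA.bracketFun_add hρ s) (fun c F G => hA.bracketFun_smul hρ s c F G)

theorem IsGenericPoint.coe_bracket (s : ℂ) (F G : F0 M) : (hA.bracket hρ s F G).1 =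
    pairing (grad (densityOf F).1) (P2 (shiftedPoint A s) (grad (densityOf G).1)) :=
  hA.coe_bracketFun hρ s F G

theorem IsGenericPoint.bracket_self (s : ℂ) (F : F0 M) : hA.bracket hρ s F F = 0 := by
  have h : hA.bracket hρ s F F = -hA.bracket hρ s F F := hA.bracketFun_skew hρ s F F
  rw [eq_neg_iff_add_eq_zero, ← two_smul ℂ] at h
  exact (smul_eq_zero.1 h).resolve_left two_ne_zero

theorem IsGenericPoint.bracket_jacobi (s : ℂ) (F G H : F0 M) :
    hA.bracket hρ s F (hA.bracket hρ s G H) + hA.bracket hρ s G (hA.bracket hρ s H F) +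
      hA.bracket hρ s H (hA.bracket hρ s F G) = 0 := by
  have e : ∀ F G H : F0 M, (hA.bracket hρ s F (hA.bracket hρ s G H)).1 =
      integral (M := M) (hA.density s (densityOf F)
        ⟨_, hA.density_mem hρ s (densityOf G) (densityOf H)⟩) := fun F G H => by
    rw [hA.coe_bracket, hA.integral_density]
    have := grad_densityOf (F := hA.bracket hρ s G H)
      (f := hA.density s (densityOf G) (densityOf H)) rfl
    rw [this]
  refine Subtype.ext (Eq.trans ?_ (hA.jacobi hρ s densityOf G H F))
  rw [← e, ← e, ← e]
  rfl

/-- As the tensor is affine in the shift, so is the bracket. -/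
theorem IsGenericPoint.bracket_neg_one (F G : F0 M) :
    hA.bracket hρ (-1) F G = (2 : ℂ) • hA.bracket hρ 0 F G - hA.bracket hρ 1 F G := by
  refine Subtype.ext ?_
  have hF := isCotangent_grad (M := M) (densityOf F).2
  have hG := isCotangent_grad (M := M) (densityOf G).2
  refine (hA.coe_bracket hρ _ F G).trans (Eq.trans ?_ (congrArg₂ (fun x y => (2 : ℂ) • x - y)
    (hA.coe_bracket hρ 0 F G) (hA.coe_bracket hρ 1 F G)).symm)
  have h0 := P2_isTangent hA.1 hG
  have h1 := P2_isTangent (hA.shifted 1) hG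
  rw [P2_shiftedPoint_neg_one hA.1 hG, shiftedPoint_zero, sub_eq_add_neg, ← neg_one_smul ℂ,
    pairing_add_right hF (h0.smul 2) (h1.smul (-1)), pairing_smul_right hF h0,
    pairing_smul_right hF h1, neg_one_smul, sub_eq_add_neg]

/-- The Jacobi identities of three brackets on an affine line imply the one of all the brackets
in the span of the line. -/
theorem jacobi_combination {E : Type*} [AddCommGroup E] [Module ℂ E] {B₀ B₁ : E →ₗ[ℂ] E →ₗ[ℂ] E}
    {F G H : E} (h0 : B₀ F (B₀ G H) + B₀ G (B₀ H F) + B₀ H (B₀ F G) = 0)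
    (h1 : B₁ F (B₁ G H) + B₁ G (B₁ H F) + B₁ H (B₁ F G) = 0) {B : E →ₗ[ℂ] E →ₗ[ℂ] E}
    (hB : ∀ F G, B F G = (2 : ℂ) • B₀ F G - B₁ F G)
    (h2 : B F (B G H) + B G (B H F) + B H (B F G) = 0) (x z : ℂ) {C : E →ₗ[ℂ] E →ₗ[ℂ] E}
    (hC : ∀ F G, C F G = x • B₁ F G + z • B₀ F G) :
    C F (C G H) + C G (C H F) + C H (C F G) = 0 := by
  simp only [hB, hC, map_add, map_sub, map_smul] at h2 ⊢
  linear_combination (norm := module) (x ^ 2 + x * z / 2) • h1 + (z ^ 2 + 2 * x * z) • h0 -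
    (x * z / 2) • h2

theorem exists_combination {E : Type*} [AddCommGroup E] [Module ℂ E] (B₀ B₁ : E →ₗ[ℂ] E →ₗ[ℂ] E)
    (x z : ℂ) : ∃ C : E →ₗ[ℂ] E →ₗ[ℂ] E, ∀ F G, C F G = x • B₁ F G + z • B₀ F G :=
  ⟨x • B₁ + z • B₀, fun _ _ => rfl⟩

/-- The bracket of `x P1 + y P2` is the combination of the brackets of `P2` at the generic point
and at its shift by `1`, with the coefficients `y - x` and `x`. -/
theorem definesPoissonBracket_combination (hρ : ρ * ρ = coord (Sum.inr 0)) (x y : ℂ) :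
    DefinesPoissonBracket (M := M) ρ (x • P1 + y • P2) := by
  intro A hA
  obtain ⟨C, hC⟩ := exists_combination (hA.bracket hρ 0) (hA.bracket hρ 1) x (y - x)
  refine ⟨C, fun f g F G hf hg => ?_, fun F => ?_, fun F G H => ?_⟩
  · have hF := isCotangent_grad (M := M) (densityOf F).2
    have hG := isCotangent_grad (M := M) (densityOf G).2
    have e0 := hA.coe_bracket hρ 0 F G
    rw [shiftedPoint_zero] at e0
    rw [← grad_densityOf hf, ← grad_densityOf hg, pairing_combination hA.1 hF hG, hC,
      Submodule.coe_add, Submodule.coe_smul, Submodule.coe_smul, hA.coe_bracket hρ 1 F G, e0]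
  · rw [hC, hA.bracket_self, hA.bracket_self, smul_zero, smul_zero, add_zero]
  · exact jacobi_combination (hA.bracket_jacobi hρ 0 F G H) (hA.bracket_jacobi hρ 1 F G H)
      (hA.bracket_neg_one hρ) (hA.bracket_jacobi hρ (-1) F G H) x (y - x) hC

theorem isPoissonTensor_combination (hρ : ρ * ρ = coord (Sum.inr 0)) (x y : ℂ) :
    IsPoissonTensor (M := M) ρ (x • P1 + y • P2) where
  isTangent r A X hA hX := by
    rw [combination_eq_shiftedPoint hA hX]
    exact ((P2_isTangent (hA.shift 1) hX).smul x).add ((P2_isTangent hA hX).smul (y - x))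
  map_add r A X Y hA hX hY := by
    rw [combination_eq_shiftedPoint hA hX, combination_eq_shiftedPoint hA hY,
      combination_eq_shiftedPoint hA (hX.add hY), shiftedPoint, P2_add (hA.shift 1) hX hY,
      P2_add hA hX hY]
    module
  map_smul r A c X hA hX := by
    rw [combination_eq_shiftedPoint hA hX, combination_eq_shiftedPoint hA (hX.smul c),
      shiftedPoint, P2_smul (hA.shift 1) hX, P2_smul hA hX]
    module
  skew r A X Y hA hX hY := by
    rw [pairing_combination hA hX hY, pairing_combination hA hY hX, shiftedPoint,
      P2_skew (hA.shift 1) hX hY, P2_skew hA hX hY]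
    module
  bracket := definesPoissonBracket_combination hρ x y

end Final

end BKP

theorem mainTheorem2 (M : BKP.CoordManifold) (ρ : BKP.Smooth M)
    (hρ : ρ * ρ = BKP.coord (Sum.inr 0)) :
    (∃! A, BKP.IsGenericPoint ρ A) ∧
    BKP.IsPoissonTensor ρ (BKP.P1 (M := M)) ∧
    BKP.IsPoissonTensor ρ (BKP.P2 (M := M)) ∧
    BKP.Compatible ρ (BKP.P1 (M := M)) BKP.P2 ∧
    ∀ (r : BKP.DiffPoly M) (A X : BKP.Op M × BKP.Op M) (s : ℂ),
      BKP.IsCosetPoint r A → BKP.IsCotangent X →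
      BKP.IsCosetPoint r (A + s • (BKP.Dpow (-1), BKP.Dpow 1)) ∧
      BKP.P2 (A + s • (BKP.Dpow (-1), BKP.Dpow 1)) X = BKP.P2 A X + s • BKP.P1 A X := by
  refine ⟨BKP.existsUnique_isGenericPoint ρ, ?_, ?_, BKP.isPoissonTensor_combination hρ,
    fun r A X s hA hX => ⟨hA.shift s, BKP.P2_shift hA hX s⟩⟩
  · have h := BKP.isPoissonTensor_combination hρ 1 0
    rwa [one_smul, zero_smul, add_zero] at h
  · have h := BKP.isPoissonTensor_combination hρ 0 1
    rwa [one_smul, zero_smul, zero_add] at h
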